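/- Work over $\mathbb{C}$; "stack" means stack in groupoids on the category of affine $\mathbb{C}$-schemes with the étale topology, "algebraic stack" means Artin stack in the sense of Laumon–Moret-Bailly (stack with representable, separated, quasi-compact diagonal and a smooth surjective presentation), and "representable" means representable by algebraic spaces. Let $\mathscr{W}''$ be the category fibred in groupoids whose objects over an affine $\mathbb{C}$-scheme $U$ are the finite (possibly empty) sequences $(L_1,\lambda_1)\dots(L_r,\lambda_r)$, where $L_i$ is a line bundle on $U$ and $\lambda_i$ is a section of $L_i$ which is not invertible, i.e. vanishes in at least one point of $U$; isomorphisms of two sequences of the same length are sequences of isomorphisms $L_i\cong L_i'$ mapping $\lambda_i$ to $\lambda_i'$ (there are none between sequences of different lengths). The pull-back of a sequence along $\varphi:V\to U$ is the sequence of those $(\varphi^*L_i,\varphi^*\lambda_i)$, in order, for which $\varphi^*\lambda_i$ is not invertible. Let $\mathscr{W}'$ be the prestack with the same objects whose sets of isomorphisms are the global sections of the Zariski sheafifications of the presheaves of isomorphisms in $\mathscr{W}''$, and let $\mathscr{W}$ be the stack associated to $\mathscr{W}'$. For $l\ge 0$ let $\mathscr{W}_l$ be the stack obtained in the same way from the sequences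 of length $r\le l$. Let $[\mathbb{A}^1/\mathbb{G}_m]^l$ be the stack of $l$-tuples $((L_1,\lambda_1),\dots,(L_l,\lambda_l))$ of line bundles with arbitrary sections. (1) For every $l\ge 0$ let $[\mathbb{A}^1/\mathbb{G}_m]^l\to\mathscr{W}_l$ be the morphism induced by sending $((L_1,\lambda_1),\dots,(L_l,\lambda_l))$ over $U$ to $(L_{i_1},\lambda_{i_1})\dots(L_{i_r},\lambda_{i_r})$, where $i_1<\dots<i_r$ are the indices $j$ for which $\lambda_j$ is not invertible. It is a representable, surjective, étale morphism of stacks. (2) For every $l\ge 0$, $\mathscr{W}_l$ is a smooth algebraic stack of finite type over $\mathbb{C}$, of dimension $0$ (non-empty, and of dimension $0$ at every point). (3) $\mathscr{W}$ is a smooth algebraic stack over $\mathbb{C}$ of dimension $0$ (non-empty, and of dimension $0$ at every point). The inclusions $\mathscr{W}_l\to\mathscr{W}_m$ (for $l\le m$) and $\mathscr{W}_l\to\mathscr{W}$ are representable by open immersions, and $\mathscr{W}$ is the union of the open substacks $\mathscr{W}_l$: for every affine $U$ and every object $\xi$ of $\mathscr{W}$ over $U$, each point of $U$ lies in the image of some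 $V\to U$ for which $\xi|_V$ is isomorphic to an object of some $\mathscr{W}_l$. -/

import Mathlib

open CategoryTheory Opposite Limits AlgebraicGeometry

noncomputable section

namespace ModStack

/-! ## Affine complex schemes and their topologies -/

/-- The category of affine `ℂ`-schemes, as the opposite of the category of `ℂ`-algebras. -/
abbrev Aff : Type 1 := (CommAlgCat.{0} (CommRingCat.of ℂ))ᵒᵖ

/-- The category of `ℂ`-schemes. -/
abbrev Sch : Type 1 := Over (Spec (CommRingCat.of ℂ))

/-- The functor `Spec`, from affine `ℂ`-schemes to `ℂ`-schemes. -/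
abbrev spec : Aff ⥤ Sch := algSpec (CommRingCat.of ℂ)

/-- The ring homomorphism `𝒪(U) → 𝒪(V)` belonging to a morphism `V ⟶ U`. -/
def ringMap {V U : Aff} (f : V ⟶ U) : U.unop →+* V.unop := f.unop.hom.toRingHom

/-- The map on points belonging to a morphism of affine schemes. -/
def ptMap {V U : Aff} (f : V ⟶ U) : PrimeSpectrum V.unop → PrimeSpectrum U.unop :=
  PrimeSpectrum.comap (ringMap f)

lemma ringMap_id (U : Aff) : ringMap (𝟙 U) = RingHom.id _ := rfl

lemma ringMap_comp {W V U : Aff} (g : W ⟶ V) (f : V ⟶ U) :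
    ringMap (g ≫ f) = (ringMap g).comp (ringMap f) := rfl

lemma ptMap_id {U : Aff} (x : PrimeSpectrum U.unop) : ptMap (𝟙 U) x = x := rfl

lemma ptMap_comp {W V U : Aff} (g : W ⟶ V) (f : V ⟶ U) (x : PrimeSpectrum W.unop) :
    ptMap (g ≫ f) x = ptMap f (ptMap g x) := rfl

lemma exists_prime_tensor {A B A' : Type} [CommRing A] [CommRing B] [CommRing A'] [Algebra A B]
    [Algebra A A'] (p' : PrimeSpectrum A') (q : PrimeSpectrum B)
    (h : PrimeSpectrum.comap (algebraMap A A') p' = PrimeSpectrum.comap (algebraMap A B) q) :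
    ∃ r : PrimeSpectrum (TensorProduct A A' B),
      PrimeSpectrum.comap (algebraMap A' (TensorProduct A A' B)) r = p' := by
  obtain ⟨z, hz, -⟩ := Scheme.Pullback.exists_preimage_pullback
    (f := Spec.map (CommRingCat.ofHom (algebraMap A A')))
    (g := Spec.map (CommRingCat.ofHom (algebraMap A B))) p' q h
  refine ⟨(pullbackSpecIso A A' B).hom z, ?_⟩
  rw [← hz, ← pullbackSpecIso_hom_fst A A' B]
  rfl

/-- The topology on affine `ℂ`-schemes generated by a class `K` of morphisms: a sieve on `U` is
covering when every point of `U` lies in the image of a member of the sieve that belongs to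
`K`. -/
def topologyOf (K : ∀ {A B : Type} [CommRing A] [CommRing B], (A →+* B) → Prop)
    (hid : RingHom.ContainsIdentities @K) (hcomp : RingHom.StableUnderComposition @K)
    (hbc : RingHom.IsStableUnderBaseChange @K) : GrothendieckTopology Aff where
  sieves U := {S | ∀ x : PrimeSpectrum U.unop, ∃ (V : Aff) (f : V ⟶ U),
    S f ∧ K (ringMap f) ∧ x ∈ Set.range (ptMap f)}
  top_mem' U x := ⟨U, 𝟙 U, trivial, hid _, x, rfl⟩
  pullback_stable' := by
    intro U U' S g hS x'
    obtain ⟨V, f, hSf, hK, q, hq⟩ := hS (ptMap g x')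
    let _ : Algebra U.unop V.unop := (ringMap f).toAlgebra
    let _ : Algebra U.unop U'.unop := (ringMap g).toAlgebra
    obtain ⟨r, hr⟩ := exists_prime_tensor (A := U.unop) (B := V.unop) (A' := U'.unop) x' q hq.symm
    let _ : Algebra (CommRingCat.of ℂ) (TensorProduct U.unop U'.unop V.unop) :=
      ((algebraMap U'.unop (TensorProduct U.unop U'.unop V.unop)).comp
        (algebraMap (CommRingCat.of ℂ) U'.unop)).toAlgebra
    have hVU : ∀ c : CommRingCat.of ℂ, algebraMap U.unop V.unop
        (algebraMap (CommRingCat.of ℂ) U.unop c) = algebraMap (CommRingCat.of ℂ) V.unop c :=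
      fun c => f.unop.hom.commutes c
    have hUU : ∀ c : CommRingCat.of ℂ, algebraMap U.unop U'.unop
        (algebraMap (CommRingCat.of ℂ) U.unop c) = algebraMap (CommRingCat.of ℂ) U'.unop c :=
      fun c => g.unop.hom.commutes c
    let a : U'.unop →ₐ[CommRingCat.of ℂ] TensorProduct U.unop U'.unop V.unop :=
      { (algebraMap U'.unop (TensorProduct U.unop U'.unop V.unop)) with commutes' := fun _ => rfl }
    let b : V.unop →ₐ[CommRingCat.of ℂ] TensorProduct U.unop U'.unop V.unop :=
      { (Algebra.TensorProduct.includeRight :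
          V.unop →ₐ[U.unop] TensorProduct U.unop U'.unop V.unop).toRingHom with
        commutes' := fun c => by
          have h1 := (Algebra.TensorProduct.includeRight :
            V.unop →ₐ[U.unop] TensorProduct U.unop U'.unop V.unop).commutes
              (algebraMap (CommRingCat.of ℂ) U.unop c)
          rw [hVU] at h1
          refine h1.trans ?_
          change algebraMap U.unop (TensorProduct U.unop U'.unop V.unop) _ =
            algebraMap U'.unop (TensorProduct U.unop U'.unop V.unop)
              (algebraMap (CommRingCat.of ℂ) U'.unop c)
          rw [← hUU]
          exact IsScalarTower.algebraMap_apply U.unop U'.unop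
            (TensorProduct U.unop U'.unop V.unop) _ }
    let T : Aff := op (CommAlgCat.of (CommRingCat.of ℂ) (TensorProduct U.unop U'.unop V.unop))
    let a' : T ⟶ U' := (CommAlgCat.ofHom a).op
    let b' : T ⟶ V := (CommAlgCat.ofHom b).op
    refine ⟨T, a', ?_, ?_, r, hr⟩
    · have hab : a' ≫ g = b' ≫ f := by
        apply Quiver.Hom.unop_inj
        apply CommAlgCat.hom_ext
        apply AlgHom.ext
        intro u
        exact ((Algebra.TensorProduct.includeRight :
            V.unop →ₐ[U.unop] TensorProduct U.unop U'.unop V.unop).commutes u).symm ▸ rfl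
      change S (a' ≫ g)
      rw [hab]
      exact S.downward_closed hSf b'
    · exact hbc.tensorProduct U'.unop (R := U.unop) (S := V.unop) hK
  transitive' := by
    intro U S hS R hR x
    obtain ⟨V, f, hSf, hK, q, rfl⟩ := hS x
    obtain ⟨W, g, hRg, hK', r, rfl⟩ := hR hSf q
    exact ⟨W, g ≫ f, hRg, hcomp _ _ hK hK', r, rfl⟩

/-- The Zariski topology on affine `ℂ`-schemes. -/
def zariski : GrothendieckTopology Aff :=
  topologyOf RingHom.IsStandardOpenImmersion RingHom.IsStandardOpenImmersion.containsIdentities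
    RingHom.IsStandardOpenImmersion.stableUnderComposition
    RingHom.IsStandardOpenImmersion.isStableUnderBaseChange

/-- The étale topology on affine `ℂ`-schemes. -/
def etale : GrothendieckTopology Aff :=
  topologyOf RingHom.Etale RingHom.Etale.containsIdentities
    RingHom.Etale.stableUnderComposition RingHom.Etale.isStableUnderBaseChange

/-! ## Categories over a site, stacks, and the two steps of stackification -/

section General

universe v u v₁ u₁ v₂ u₂ v₃ u₃

variable {C : Type u} [Category.{v} C] (J : GrothendieckTopology C)
  {E : Type u₁} [Category.{v₁} E] (p : E ⥤ C)

/-- `p : E ⥤ C` is a category fibred in groupoids: pull-backs exist, and every morphism of `E` is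
cartesian. -/
structure IsFibredInGroupoids : Prop where
  exists_lift : ∀ (x : E) {V : C} (f : V ⟶ p.obj x), ∃ (y : E) (a : y ⟶ x), p.IsHomLift f a
  existsUnique_fac : ∀ {x y z : E} (a : y ⟶ x) (b : z ⟶ x) (g : p.obj z ⟶ p.obj y),
    g ≫ p.map a = p.map b → ∃! c : z ⟶ y, p.map c = g ∧ c ≫ a = b

/-- A morphism `x ⟶ y` defined only locally on the source: a base morphism `f`, a covering sieve of
`p x`, and, compatibly with further pull-back, a morphism `z ⟶ y` for every pull-back `z ⟶ x` of
`x` along a member of the sieve. In other words (for `E` fibred in groupoids), a compatible family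
of sections of the presheaf `Isom(x, f^* y)` over a covering of `p x`. -/
structure LocalHom (x y : E) where
  base : p.obj x ⟶ p.obj y
  sieve : Sieve (p.obj x)
  mem : sieve ∈ J (p.obj x)
  map : ∀ {z : E} (a : z ⟶ x), sieve (p.map a) → (z ⟶ y)
  map_base : ∀ {z : E} (a : z ⟶ x) (h : sieve (p.map a)), p.map (map a h) = p.map a ≫ base
  map_comp : ∀ {w z : E} (b : w ⟶ z) (a : z ⟶ x) (h : sieve (p.map a))
    (h' : sieve (p.map (b ≫ a))), map (b ≫ a) h' = b ≫ map a h

/-- Two local morphisms are identified when they agree on a common refinement. -/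
def LocalHom.Rel {x y : E} (φ ψ : LocalHom J p x y) : Prop :=
  φ.base = ψ.base ∧ ∃ Q ∈ J (p.obj x), ∀ {z : E} (a : z ⟶ x), Q (p.map a) →
    ∃ (h : φ.sieve (p.map a)) (h' : ψ.sieve (p.map a)), φ.map a h = ψ.map a h'

lemma LocalHom.rel_equivalence (x y : E) : Equivalence (LocalHom.Rel J p (x := x) (y := y)) where
  refl φ := ⟨rfl, φ.sieve, φ.mem, fun _ h => ⟨h, h, rfl⟩⟩
  symm := by
    rintro φ ψ ⟨h, Q, hQ, H⟩
    refine ⟨h.symm, Q, hQ, fun a ha => ?_⟩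
    obtain ⟨h₁, h₂, e⟩ := H a ha
    exact ⟨h₂, h₁, e.symm⟩
  trans := by
    rintro φ ψ χ ⟨h, Q, hQ, H⟩ ⟨h', Q', hQ', H'⟩
    refine ⟨h.trans h', Q ⊓ Q', J.intersection_covering hQ hQ', fun a ha => ?_⟩
    obtain ⟨h₁, h₂, e⟩ := H a ha.1
    obtain ⟨h₃, h₄, e'⟩ := H' a ha.2
    exact ⟨h₁, h₄, e.trans e'⟩

instance LocalHom.setoid (x y : E) : Setoid (LocalHom J p x y) :=
  ⟨LocalHom.Rel J p, LocalHom.rel_equivalence J p x y⟩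

/-- A global morphism, as a local one. -/
def LocalHom.of {x y : E} (a : x ⟶ y) : LocalHom J p x y where
  base := p.map a
  sieve := ⊤
  mem := J.top_mem _
  map b _ := b ≫ a
  map_base b _ := p.map_comp b a
  map_comp b c _ _ := Category.assoc b c a

variable {J p} in
/-- Composition of local morphisms. -/
def LocalHom.comp {x y z : E} (φ : LocalHom J p x y) (ψ : LocalHom J p y z) :
    LocalHom J p x z where
  base := φ.base ≫ ψ.base
  sieve := φ.sieve ⊓ ψ.sieve.pullback φ.base
  mem := J.intersection_covering φ.mem (J.pullback_stable _ ψ.mem)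
  map a h := ψ.map (φ.map a h.1) (by rw [φ.map_base]; exact h.2)
  map_base a h := by rw [ψ.map_base, φ.map_base, Category.assoc]
  map_comp b a h h' := by
    rw [← ψ.map_comp b (φ.map a h.1) _
      (by rw [← φ.map_comp b a h.1 h'.1, φ.map_base]; exact h'.2)]
    congr 1
    exact φ.map_comp b a h.1 h'.1

/-- The category over `C` with the same objects as `E`, in which a morphism `x ⟶ y` over `f` is a
class of local morphisms. When the presheaves `Isom(x, f^* y)` are separated for `J`, the morphisms
`x ⟶ y` over `f` are the global sections of the sheaf associated to `Isom(x, f^* y)`. -/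
@[ext]
structure IsomSheafified {C : Type u} [Category.{v} C] {E : Type u₁} [Category.{v₁} E]
    (J : GrothendieckTopology C) (p : E ⥤ C) where
  obj : E

variable {J p} in
lemma LocalHom.comp_rel {x y z : E} {φ φ' : LocalHom J p x y} {ψ ψ' : LocalHom J p y z}
    (h : LocalHom.Rel J p φ φ') (k : LocalHom.Rel J p ψ ψ') :
    LocalHom.Rel J p (φ.comp ψ) (φ'.comp ψ') := by
  obtain ⟨hb, Q, hQ, H⟩ := h
  obtain ⟨kb, R, hR, K⟩ := k
  refine ⟨by simp only [LocalHom.comp, hb, kb], Q ⊓ R.pullback φ.base,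
    J.intersection_covering hQ (J.pullback_stable _ hR), fun a ha => ?_⟩
  obtain ⟨h₁, h₂, e⟩ := H a ha.1
  have ha2 : R (p.map (φ.map a h₁)) := by rw [φ.map_base]; exact ha.2
  obtain ⟨k₁, k₂, e'⟩ := K (φ.map a h₁) ha2
  have h₁' : (φ.comp ψ).sieve (p.map a) := ⟨h₁, by
    have := k₁; rw [φ.map_base] at this; exact this⟩
  have h₂' : (φ'.comp ψ').sieve (p.map a) := ⟨h₂, by
    have := k₂; rw [φ.map_base, hb] at this; exact this⟩
  refine ⟨h₁', h₂', ?_⟩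
  change ψ.map (φ.map a h₁) _ = ψ'.map (φ'.map a h₂) _
  rw [e']
  congr 1

instance : Category (IsomSheafified J p) where
  Hom x y := Quotient (LocalHom.setoid J p x.obj y.obj)
  id x := Quotient.mk _ (LocalHom.of J p (𝟙 x.obj))
  comp φ ψ := Quotient.map₂ LocalHom.comp
    (fun _ _ h _ _ k => LocalHom.comp_rel h k) φ ψ
  id_comp φ := by
    induction φ using Quotient.inductionOn with
    | _ φ =>
      refine Quotient.sound ⟨by simp [LocalHom.comp, LocalHom.of], φ.sieve, φ.mem, fun a h => ?_⟩
      refine ⟨⟨trivial, by simpa [LocalHom.of] using h⟩, h, ?_⟩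
      simp [LocalHom.comp, LocalHom.of]
  comp_id φ := by
    induction φ using Quotient.inductionOn with
    | _ φ =>
      refine Quotient.sound ⟨by simp [LocalHom.comp, LocalHom.of], φ.sieve, φ.mem, fun a h => ?_⟩
      refine ⟨⟨h, trivial⟩, h, ?_⟩
      simp [LocalHom.comp, LocalHom.of]
  assoc φ ψ χ := by
    induction φ using Quotient.inductionOn with
    | _ φ =>
    induction ψ using Quotient.inductionOn with
    | _ ψ =>
    induction χ using Quotient.inductionOn with
    | _ χ =>
      refine Quotient.sound ⟨by simp [LocalHom.comp], ((φ.comp ψ).comp χ).sieve,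
        ((φ.comp ψ).comp χ).mem, fun a h => ?_⟩
      refine ⟨h, ⟨h.1.1, h.1.2, ?_⟩, rfl⟩
      have := h.2
      simpa [LocalHom.comp] using this

/-- The projection to the base. -/
def IsomSheafified.proj : IsomSheafified J p ⥤ C where
  obj x := p.obj x.obj
  map {x y} φ := Quotient.lift (s := LocalHom.setoid J p x.obj y.obj) LocalHom.base
    (fun _ _ h => And.left h) φ
  map_id x := p.map_id x.obj
  map_comp φ ψ := by
    induction φ using Quotient.inductionOn with
    | _ φ =>
    induction ψ using Quotient.inductionOn with
    | _ ψ => rfl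

/-- The tautological functor. -/
def IsomSheafified.unit : E ⥤ IsomSheafified J p where
  obj x := ⟨x⟩
  map a := Quotient.mk _ (LocalHom.of J p a)
  map_id _ := rfl
  map_comp a b := by
    refine Quotient.sound ⟨p.map_comp a b, ⊤, J.top_mem _, fun c _ => ⟨trivial, ⟨trivial, trivial⟩, ?_⟩⟩
    simp [LocalHom.comp, LocalHom.of]

/-- A descent datum for `p : E ⥤ C` on an object `U` of `C`: a covering `(U_i ⟶ U)_i`, an object
`obj i` of `E` over each `U_i`, and compatible isomorphisms between the pull-backs of the objects
`obj i` and `obj j` to `U_i ×_U U_j`. The latter are expressed without choosing pull-backs: if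
`u : z ⟶ obj i` exhibits `z` as the pull-back of `obj i` along `T ⟶ U_i`, and `b : T ⟶ U_j` is
another morphism with the same composite to `U`, then `glue u j b` exhibits `z` as the pull-back of
`obj j` along `b`; `glue_glue` is the cocycle condition. -/
structure DescentDatum where
  U : C
  I : Type
  obj : I → E
  map : ∀ i, p.obj (obj i) ⟶ U
  cover : Sieve.ofArrows _ map ∈ J U
  glue : ∀ {z : E} {i : I} (u : z ⟶ obj i) (j : I) (b : p.obj z ⟶ p.obj (obj j)),
    b ≫ map j = p.map u ≫ map i → (z ⟶ obj j)
  glue_base : ∀ {z : E} {i : I} (u : z ⟶ obj i) (j b w), p.map (glue u j b w) = b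
  glue_self : ∀ {z : E} {i : I} (u : z ⟶ obj i) (w), glue u i (p.map u) w = u
  glue_glue : ∀ {z : E} {i : I} (u : z ⟶ obj i) (j b w k c w' w''),
    glue (glue u j b w) k c w' = glue u k c w''
  comp_glue : ∀ {z' z : E} {i : I} (v : z' ⟶ z) (u : z ⟶ obj i) (j b w w'),
    glue (v ≫ u) j (p.map v ≫ b) w' = v ≫ glue u j b w

/-- `p : E ⥤ C` is a stack for the topology `J`: it is fibred in groupoids, the presheaves of
isomorphisms are sheaves, and every descent datum is effective. -/
structure IsStack : Prop where
  fibred : IsFibredInGroupoids p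
  glueHom : ∀ {x y : E} (φ : LocalHom J p x y), ∃! c : x ⟶ y, p.map c = φ.base ∧
    ∀ {z : E} (a : z ⟶ x) (h : φ.sieve (p.map a)), a ≫ c = φ.map a h
  effective : ∀ D : DescentDatum J p, ∃ (x : E) (e : p.obj x ≅ D.U) (c : ∀ i, D.obj i ⟶ x),
    (∀ i, p.map (c i) ≫ e.hom = D.map i) ∧
    ∀ {z : E} {i : D.I} (u : z ⟶ D.obj i) (j b w), D.glue u j b w ≫ c j = u ≫ c i

namespace DescentDatum

variable {J p}

/-- A representative of a morphism of descent data over `base : D.U ⟶ D'.U`, defined on a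
covering sieve of `D.U`: compatible isomorphisms between the pull-backs of `D.obj i` and
`D'.obj j` to (the part lying over the sieve of) `U_i ×_{D'.U} U'_j`, which commute with the gluing
isomorphisms of `D` and of `D'`. -/
structure PreHom (D D' : DescentDatum J p) where
  base : D.U ⟶ D'.U
  sieve : Sieve D.U
  mem : sieve ∈ J D.U
  map : ∀ {z : E} {i : D.I} (u : z ⟶ D.obj i) (j : D'.I) (b : p.obj z ⟶ p.obj (D'.obj j)),
    b ≫ D'.map j = p.map u ≫ D.map i ≫ base → sieve (p.map u ≫ D.map i) → (z ⟶ D'.obj j)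
  map_base : ∀ {z : E} {i : D.I} (u : z ⟶ D.obj i) (j b w h), p.map (map u j b w h) = b
  comp_map : ∀ {z' z : E} {i : D.I} (v : z' ⟶ z) (u : z ⟶ D.obj i) (j b w h w' h'),
    map (v ≫ u) j (p.map v ≫ b) w' h' = v ≫ map u j b w h
  glue_map : ∀ {z : E} {i : D.I} (u : z ⟶ D.obj i) (i' c w₀ j b w h w' h'),
    map (D.glue u i' c w₀) j b w' h' = map u j b w h
  map_glue : ∀ {z : E} {i : D.I} (u : z ⟶ D.obj i) (j b w h j' c w₀ w'),
    D'.glue (map u j b w h) j' c w₀ = map u j' c w' h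

/-- Two representatives are identified when they agree on a common refinement. -/
def PreHom.Rel {D D' : DescentDatum J p} (φ ψ : PreHom D D') : Prop :=
  φ.base = ψ.base ∧ ∃ Q ∈ J D.U, ∀ {z : E} {i : D.I} (u : z ⟶ D.obj i), Q (p.map u ≫ D.map i) →
    ∃ (h : φ.sieve (p.map u ≫ D.map i)) (h' : ψ.sieve (p.map u ≫ D.map i)), ∀ j b w w',
      φ.map u j b w h = ψ.map u j b w' h'

lemma PreHom.rel_equivalence (D D' : DescentDatum J p) :
    Equivalence (PreHom.Rel (D := D) (D' := D')) where
  refl φ := ⟨rfl, φ.sieve, φ.mem, fun _ h => ⟨h, h, fun _ _ _ _ => rfl⟩⟩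
  symm := by
    rintro φ ψ ⟨h, Q, hQ, H⟩
    refine ⟨h.symm, Q, hQ, fun a ha => ?_⟩
    obtain ⟨h₁, h₂, e⟩ := H a ha
    exact ⟨h₂, h₁, fun j b w w' => (e j b w' w).symm⟩
  trans := by
    rintro φ ψ χ ⟨h, Q, hQ, H⟩ ⟨h', Q', hQ', H'⟩
    refine ⟨h.trans h', Q ⊓ Q', J.intersection_covering hQ hQ', fun a ha => ?_⟩
    obtain ⟨h₁, h₂, e⟩ := H a ha.1
    obtain ⟨h₃, h₄, e'⟩ := H' a ha.2
    exact ⟨h₁, h₄, fun j b w w' => (e j b w (h ▸ w)).trans (e' j b _ w')⟩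

instance PreHom.setoid (D D' : DescentDatum J p) : Setoid (PreHom D D') :=
  ⟨PreHom.Rel, PreHom.rel_equivalence D D'⟩

/-- The identity of a descent datum. -/
def PreHom.id (D : DescentDatum J p) : PreHom D D where
  base := 𝟙 D.U
  sieve := ⊤
  mem := J.top_mem _
  map u j b w _ := D.glue u j b (by simpa using w)
  map_base u j b w _ := D.glue_base u j b _
  comp_map v u j b w _ w' _ := D.comp_glue v u j b _ _
  glue_map u i' c w₀ j b w _ w' _ := D.glue_glue u i' c w₀ j b _ _
  map_glue u j b w _ j' c w₀ w' := D.glue_glue u j b _ j' c _ _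

section comp

variable {D₁ D₂ D₃ D₄ : DescentDatum J p}

lemma aux_assoc {V W X Y U' U'' T : C} {c : V ⟶ W} {m : W ⟶ U'} {a : V ⟶ X} {d : X ⟶ Y}
    {f : Y ⟶ U'} (hs : c ≫ m = a ≫ d ≫ f) (t : T ⟶ V) (g : U' ⟶ U'') :
    t ≫ a ≫ d ≫ f ≫ g = t ≫ c ≫ m ≫ g := by
  rw [← Category.assoc c, hs]
  simp only [Category.assoc]

lemma exists_mid (D : DescentDatum J p) {V : C} (f : V ⟶ D.U) (h : Sieve.ofArrows _ D.map f) :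
    ∃ (k : D.I) (c : V ⟶ p.obj (D.obj k)), c ≫ D.map k = f := by
  rw [Sieve.mem_ofArrows_iff] at h
  obtain ⟨k, c, rfl⟩ := h
  exact ⟨k, c, rfl⟩

lemma PreHom.map_mid (φ : PreHom D₁ D₂) (ψ : PreHom D₂ D₃) {z : E} {i : D₁.I} (u : z ⟶ D₁.obj i)
    (h) (j b) (k c w₁ w₂ h₂) (k' c' w₁' w₂' h₂') :
    ψ.map (φ.map u k c w₁ h) j b w₂ h₂ = ψ.map (φ.map u k' c' w₁' h) j b w₂' h₂' := by
  have w₀ : c' ≫ D₂.map k' = p.map (φ.map u k c w₁ h) ≫ D₂.map k := by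
    rw [φ.map_base, w₁, w₁']
  have e := φ.map_glue u k c w₁ h k' c' w₀ w₁'
  have h₃ : ψ.sieve (p.map (D₂.glue (φ.map u k c w₁ h) k' c' w₀) ≫ D₂.map k') := by
    rw [e]; exact h₂'
  have w₃ : b ≫ D₃.map j =
      p.map (D₂.glue (φ.map u k c w₁ h) k' c' w₀) ≫ D₂.map k' ≫ ψ.base := by
    rw [e]; exact w₂'
  rw [← ψ.glue_map (φ.map u k c w₁ h) k' c' w₀ j b w₂ h₂ w₃ h₃]
  congr 1

/-- Composition of representatives. -/
def PreHom.comp (φ : PreHom D₁ D₂) (ψ : PreHom D₂ D₃) : PreHom D₁ D₃ where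
  base := φ.base ≫ ψ.base
  sieve := φ.sieve ⊓ (Sieve.ofArrows _ D₂.map ⊓ ψ.sieve).pullback φ.base
  mem := J.intersection_covering φ.mem
    (J.pullback_stable _ (J.intersection_covering D₂.cover ψ.mem))
  map {z i} u j b w h :=
    have h₂ : Sieve.ofArrows _ D₂.map (p.map u ≫ D₁.map i ≫ φ.base) := by
      simpa using h.2.1
    have H := D₂.exists_mid _ h₂
    ψ.map (φ.map u H.choose H.choose_spec.choose H.choose_spec.choose_spec h.1) j b
      (by rw [φ.map_base, ← Category.assoc, H.choose_spec.choose_spec]; simpa using w)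
      (by rw [φ.map_base, H.choose_spec.choose_spec]; simpa using h.2.2)
  map_base u j b w h := ψ.map_base _ _ _ _ _
  comp_map {z' z i} v u j b w h w' h' := by
    have h₂ : Sieve.ofArrows _ D₂.map (p.map u ≫ D₁.map i ≫ φ.base) := by
      simpa using h.2.1
    have H := D₂.exists_mid _ h₂
    have hs := H.choose_spec.choose_spec
    have w₁ : (p.map v ≫ H.choose_spec.choose) ≫ D₂.map H.choose =
        p.map (v ≫ u) ≫ D₁.map i ≫ φ.base := by
      rw [Category.assoc, hs, p.map_comp, Category.assoc]
    have e := φ.comp_map v u H.choose H.choose_spec.choose hs h.1 w₁ h'.1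
    dsimp only
    rw [← ψ.comp_map v _ j b _ _
      (by rw [p.map_comp, φ.map_base, Category.assoc, Category.assoc, w]; exact aux_assoc hs _ _)
      (by rw [p.map_comp, φ.map_base, Category.assoc, hs]; simpa using h'.2.2)]
    simp only [← e]
    exact PreHom.map_mid _ _ _ _ _ _ _ _ _ _ _ _ _ _ _ _
  glue_map {z i} u i' c w₀ j b w h w' h' := by
    dsimp only
    have h₂ : Sieve.ofArrows _ D₂.map (p.map u ≫ D₁.map i ≫ φ.base) := by
      simpa using h.2.1
    have H := D₂.exists_mid _ h₂
    have hs := H.choose_spec.choose_spec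
    have e := φ.glue_map u i' c w₀ H.choose H.choose_spec.choose hs h.1
      (by rw [hs, D₁.glue_base, ← Category.assoc, ← Category.assoc, w₀]) h'.1
    simp only [← e]
    exact PreHom.map_mid _ _ _ _ _ _ _ _ _ _ _ _ _ _ _ _
  map_glue u j b w h j' c w₀ w' := ψ.map_glue _ _ _ _ _ _ _ _ _

lemma PreHom.comp_map_eq (φ : PreHom D₁ D₂) (ψ : PreHom D₂ D₃) {z : E} {i : D₁.I}
    (u : z ⟶ D₁.obj i) (j b w h k c w₁ h₁ w₂ h₂) :
    (φ.comp ψ).map u j b w h = ψ.map (φ.map u k c w₁ h₁) j b w₂ h₂ :=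
  PreHom.map_mid _ _ _ _ _ _ _ _ _ _ _ _ _ _ _ _

lemma PreHom.comp_rel {φ φ' : PreHom D₁ D₂} {ψ ψ' : PreHom D₂ D₃}
    (h : PreHom.Rel φ φ') (k : PreHom.Rel ψ ψ') : PreHom.Rel (φ.comp ψ) (φ'.comp ψ') := by
  obtain ⟨hb, R, hR, H⟩ := h
  obtain ⟨kb, S, hS, K⟩ := k
  refine ⟨by simp only [PreHom.comp, hb, kb],
    R ⊓ (Sieve.ofArrows _ D₂.map ⊓ S).pullback φ.base,
    J.intersection_covering hR
      (J.pullback_stable _ (J.intersection_covering D₂.cover hS)), fun {z i} u hu => ?_⟩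
  obtain ⟨i₁, i₂, e⟩ := H u hu.1
  have hm : Sieve.ofArrows _ D₂.map (p.map u ≫ D₁.map i ≫ φ.base) := by
    simpa using hu.2.1
  obtain ⟨k, c, hc⟩ := D₂.exists_mid _ hm
  have hc' : c ≫ D₂.map k = p.map u ≫ D₁.map i ≫ φ'.base := by rw [hc, hb]
  have hS' : S (p.map (φ.map u k c hc i₁) ≫ D₂.map k) := by
    rw [φ.map_base, hc]; simpa using hu.2.2
  obtain ⟨j₁, j₂, e'⟩ := K _ hS'
  have a₁ : (φ.comp ψ).sieve (p.map u ≫ D₁.map i) := by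
    refine ⟨i₁, hu.2.1, ?_⟩
    rw [φ.map_base, hc] at j₁
    simpa using j₁
  have a₂ : (φ'.comp ψ').sieve (p.map u ≫ D₁.map i) := by
    rw [φ.map_base, hc, hb] at j₂
    have := hu.2.1
    rw [hb] at this
    exact ⟨i₂, this, by simpa using j₂⟩
  refine ⟨a₁, a₂, fun j b w w' => ?_⟩
  have w₂ : b ≫ D₃.map j = p.map (φ.map u k c hc i₁) ≫ D₂.map k ≫ ψ.base := by
    rw [φ.map_base, ← Category.assoc, hc, w]
    simp [PreHom.comp]
  have w₂' : b ≫ D₃.map j = p.map (φ'.map u k c hc' i₂) ≫ D₂.map k ≫ ψ'.base := by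
    rw [φ'.map_base, ← Category.assoc, hc', w']
    simp [PreHom.comp]
  have j₂' : ψ'.sieve (p.map (φ'.map u k c hc' i₂) ≫ D₂.map k) := by
    rw [φ'.map_base]
    rw [φ.map_base] at j₂
    exact j₂
  rw [PreHom.comp_map_eq φ ψ u j b w a₁ k c hc i₁ w₂ j₁,
    PreHom.comp_map_eq φ' ψ' u j b w' a₂ k c hc' i₂ w₂' j₂', e' j b w₂ (by rw [w₂, kb])]
  simp only [e k c hc hc']

end comp

/-- The category of descent data for `p : E ⥤ C` with respect to `J`. If `p` is a prestack, this
category over `C` is the stack associated to it. -/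
instance : Category (DescentDatum J p) where
  Hom D D' := Quotient (PreHom.setoid D D')
  id D := Quotient.mk _ (PreHom.id D)
  comp φ ψ := Quotient.map₂ PreHom.comp (fun _ _ h _ _ k => PreHom.comp_rel h k) φ ψ
  id_comp {D D'} φ := by
    induction φ using Quotient.inductionOn with
    | _ φ =>
      refine Quotient.sound ⟨by simp [PreHom.comp, PreHom.id], ((PreHom.id D).comp φ).sieve ⊓ φ.sieve,
        J.intersection_covering ((PreHom.id D).comp φ).mem φ.mem,
        fun {z i} u h => ⟨h.1, h.2, fun j b w w' => ?_⟩⟩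
      have wid : p.map u ≫ D.map i = p.map u ≫ D.map i ≫ (PreHom.id D).base :=
        (congrArg _ (Category.comp_id _)).symm
      have e : (PreHom.id D).map u i (p.map u) wid trivial = u := D.glue_self u rfl
      rw [PreHom.comp_map_eq (PreHom.id D) φ u j b w h.1 i (p.map u) wid trivial
        (by rw [e]; exact w') (by rw [e]; exact h.2)]
      congr 1
  comp_id {D D'} φ := by
    induction φ using Quotient.inductionOn with
    | _ φ =>
      refine Quotient.sound ⟨by simp [PreHom.comp, PreHom.id],
        (φ.comp (PreHom.id D')).sieve ⊓ φ.sieve,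
        J.intersection_covering (φ.comp (PreHom.id D')).mem φ.mem,
        fun {z i} u h => ⟨h.1, h.2, fun j b w w' => ?_⟩⟩
      rw [PreHom.comp_map_eq φ (PreHom.id D') u j b w h.1 j b w' h.2
        (by rw [φ.map_base]; simp [PreHom.id]) trivial]
      exact φ.map_glue u j b w' h.2 j b _ w'
  assoc {D₁ D₂ D₃ D₄} φ ψ χ := by
    induction φ using Quotient.inductionOn with
    | _ φ =>
    induction ψ using Quotient.inductionOn with
    | _ ψ =>
    induction χ using Quotient.inductionOn with
    | _ χ =>
      refine Quotient.sound ⟨by simp [PreHom.comp], ((φ.comp ψ).comp χ).sieve ⊓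
        (φ.comp (ψ.comp χ)).sieve, J.intersection_covering ((φ.comp ψ).comp χ).mem
          (φ.comp (ψ.comp χ)).mem, fun {z i} u h => ⟨h.1, h.2, fun j b w w' => ?_⟩⟩
      have hm : Sieve.ofArrows _ D₂.map (p.map u ≫ D₁.map i ≫ φ.base) := by
        simpa using h.1.1.2.1
      obtain ⟨k, c, hc⟩ := D₂.exists_mid _ hm
      have hn : Sieve.ofArrows _ D₃.map (p.map u ≫ D₁.map i ≫ φ.base ≫ ψ.base) := by
        simpa [PreHom.comp] using h.1.2.1
      obtain ⟨l, d, hd⟩ := D₃.exists_mid _ hn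
      have s₁ : φ.sieve (p.map u ≫ D₁.map i) := h.1.1.1
      have s₂ : ψ.sieve (p.map (φ.map u k c hc s₁) ≫ D₂.map k) := by
        rw [φ.map_base, hc]; simpa using h.1.1.2.2
      have t₂ : d ≫ D₃.map l = p.map (φ.map u k c hc s₁) ≫ D₂.map k ≫ ψ.base := by
        rw [φ.map_base, ← Category.assoc c, hc, hd]; simp
      have s₃ : χ.sieve (p.map (ψ.map (φ.map u k c hc s₁) l d t₂ s₂) ≫ D₃.map l) := by
        rw [ψ.map_base, hd]; simpa [PreHom.comp] using h.1.2.2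
      have t₃ : b ≫ D₄.map j =
          p.map (ψ.map (φ.map u k c hc s₁) l d t₂ s₂) ≫ D₃.map l ≫ χ.base := by
        rw [ψ.map_base, ← Category.assoc d, hd, w]; simp [PreHom.comp]
      have e₁ := PreHom.comp_map_eq φ ψ u l d (by rw [hd]; rfl) h.1.1 k c hc s₁ t₂ s₂
      have f₃ : b ≫ D₄.map j = p.map ((φ.comp ψ).map u l d (by rw [hd]; rfl) h.1.1) ≫
          D₃.map l ≫ χ.base := by rw [e₁]; exact t₃
      have g₃ : χ.sieve (p.map ((φ.comp ψ).map u l d (by rw [hd]; rfl) h.1.1) ≫ D₃.map l) := by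
        rw [e₁]; exact s₃
      have f₄ : b ≫ D₄.map j = p.map (φ.map u k c hc s₁) ≫ D₂.map k ≫ (ψ.comp χ).base := by
        rw [φ.map_base, ← Category.assoc c, hc, w']; simp [PreHom.comp]
      have g₄ : (ψ.comp χ).sieve (p.map (φ.map u k c hc s₁) ≫ D₂.map k) := by
        rw [φ.map_base, hc]; simpa using h.2.2.2
      rw [PreHom.comp_map_eq (φ.comp ψ) χ u j b w h.1 l d (by rw [hd]; rfl) h.1.1 f₃ g₃,
        PreHom.comp_map_eq φ (ψ.comp χ) u j b w' h.2 k c hc s₁ f₄ g₄,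
        PreHom.comp_map_eq ψ χ _ j b f₄ g₄ l d t₂ s₂ t₃ s₃]
      congr 1

/-- The projection of the category of descent data to the base. -/
def proj (J : GrothendieckTopology C) (p : E ⥤ C) : DescentDatum J p ⥤ C where
  obj D := D.U
  map {D D'} φ := Quotient.lift (s := PreHom.setoid D D') PreHom.base
    (fun _ _ h => And.left h) φ
  map_id _ := rfl
  map_comp φ ψ := by
    induction φ using Quotient.inductionOn with
    | _ φ =>
    induction ψ using Quotient.inductionOn with
    | _ ψ => rfl

/-- An object of `E`, as a descent datum with respect to the identity covering. -/
def ofObj (J : GrothendieckTopology C) (p : E ⥤ C) (x : E) : DescentDatum J p where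
  U := p.obj x
  I := PUnit
  obj _ := x
  map _ := 𝟙 _
  cover := by
    refine J.superset_covering ?_ (J.top_mem _)
    intro V f _
    exact (Sieve.mem_ofArrows_iff _ _ _).2 ⟨PUnit.unit, f, by simp⟩
  glue u _ _ _ := u
  glue_base u _ b w := by simpa using w.symm
  glue_self _ _ := rfl
  glue_glue _ _ _ _ _ _ _ _ := rfl
  comp_glue _ _ _ _ _ _ := rfl

/-- The tautological functor. -/
def unit (J : GrothendieckTopology C) (p : E ⥤ C) : E ⥤ DescentDatum J p where
  obj x := ofObj J p x
  map {x y} a := Quotient.mk (PreHom.setoid (ofObj J p x) (ofObj J p y))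
    { base := p.map a
      sieve := ⊤
      mem := J.top_mem _
      map := fun {z} {i} (u : z ⟶ x) _ _ _ _ => u ≫ a
      map_base := fun {z} {i} (u : z ⟶ x) _ b w _ => by
        refine (p.map_comp u a).trans ?_
        exact ((Category.comp_id b).symm.trans (w.trans (congrArg _ (Category.id_comp _)))).symm
      comp_map := fun _ _ _ _ _ _ _ _ => Category.assoc _ _ _
      glue_map := fun _ _ _ _ _ _ _ _ _ _ => rfl
      map_glue := fun _ _ _ _ _ _ _ _ _ => rfl }
  map_id x := by
    refine Quotient.sound ⟨p.map_id x, ⊤, J.top_mem _, fun u _ => ⟨trivial, trivial, ?_⟩⟩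
    intro j b w w'
    exact Category.comp_id _
  map_comp {x y z} a b := by
    refine Quotient.sound ⟨p.map_comp a b, ⊤, J.top_mem _, fun u _ => ⟨trivial, ?_, ?_⟩⟩
    · refine ⟨trivial, ?_, trivial⟩
      exact (Sieve.mem_ofArrows_iff _ _ _).2 ⟨PUnit.unit, _, (Category.comp_id _).symm⟩
    · intro j b w w'
      exact (Category.assoc _ _ _).symm

end DescentDatum

end General

/-! ## Algebraic spaces -/

/-- Presheaves of sets on affine `ℂ`-schemes. -/
abbrev PSpace := Affᵒᵖ ⥤ Type 1

/-- The functor of points of a `ℂ`-scheme, `T ↦ Hom_ℂ(T, Z)`. -/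
def pts : Sch ⥤ PSpace :=
  yoneda ⋙ (Functor.whiskeringLeft Affᵒᵖ Schᵒᵖ (Type 0)).obj spec.op ⋙
    (Functor.whiskeringRight Affᵒᵖ (Type 0) (Type 1)).obj uliftFunctor.{1}

/-- `π : F ⟶ G` is schematic with property `Q`: for every affine scheme `T` and every
`T ⟶ G`, the fibre product `F ×_G T` is a scheme, and its projection to `T` has the property `Q`. -/
def SchematicWith (Q : MorphismProperty Scheme.{0}) {F G : PSpace} (π : F ⟶ G) : Prop :=
  ∀ (T : Aff) (t : pts.obj (spec.obj T) ⟶ G), ∃ (P : Sch) (a : P ⟶ spec.obj T)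
    (b : pts.obj P ⟶ F), IsPullback b (pts.map a) π t ∧ Q a.left

/-- Étale and surjective morphisms of schemes. -/
def etaleSurjective : MorphismProperty Scheme.{0} := fun _ _ f => Etale f ∧ Surjective f

/-- Smooth and surjective morphisms of schemes. -/
def smoothSurjective : MorphismProperty Scheme.{0} := fun _ _ f => Smooth f ∧ Surjective f

/-- An algebraic space over `ℂ`: an étale sheaf, with schematic and quasi-compact diagonal, which
admits an étale surjective morphism from a scheme. -/
structure IsAlgebraicSpace (X : PSpace) : Prop where
  isSheaf : Presieve.IsSheaf etale X
  diagonal : SchematicWith @QuasiCompact (diag X)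
  atlas : ∃ (Z : Sch) (π : pts.obj Z ⟶ X), SchematicWith etaleSurjective π

/-- There is an étale surjective morphism from a scheme `Z` to `X` such that the composite morphism
of schemes `Z ⟶ S` has the property `Q`. For an algebraic space `X` over an affine scheme `S`,
and a property `Q` which is local for the étale topology on the source, this says that `X ⟶ S` has
the property `Q`; for `Q` quasi-compactness, it says that `X ⟶ S` is quasi-compact. -/
def HasAtlasWith (Q : MorphismProperty Scheme.{0}) {X : PSpace} {S : Sch}
    (f : X ⟶ pts.obj S) : Prop :=
  ∃ (Z : Sch) (π : pts.obj Z ⟶ X) (g : Z ⟶ S),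
    SchematicWith etaleSurjective π ∧ π ≫ f = pts.map g ∧ Q g.left

/-- `f : X ⟶ S` is separated: the diagonal `X ⟶ X ×_S X` is a closed immersion. -/
def IsSeparatedOver {X : PSpace} {S : Sch} (f : X ⟶ pts.obj S) : Prop :=
  SchematicWith @IsClosedImmersion (pullback.diagonal f)

/-- `f` is (isomorphic to) an open immersion of schemes. -/
def IsOpenImm {X : PSpace} {S : Sch} (f : X ⟶ pts.obj S) : Prop :=
  ∃ (P : Sch) (a : P ⟶ S) (i : pts.obj P ≅ X), i.hom ≫ f = pts.map a ∧ IsOpenImmersion a.left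

/-! ## Stacks over affine schemes: representability and algebraicity -/

section Stacks

universe v₁ u₁ v₂ u₂ v₃ u₃

variable {X : Type u₁} [Category.{v₁} X] {Y : Type u₂} [Category.{v₂} Y]
  {Z : Type u₃} [Category.{v₃} Z]

/-- A category `q : Y ⥤ Aff`, with a functor `r` over `Aff` from `Y` to the affine scheme `S`, is
represented by the presheaf `F` with `f : F ⟶ S`: there is an equivalence over `S` between `Y` and
the category of pairs of an affine scheme `T` and an element of `F(T)`. -/
structure Represents (q : Y ⥤ Aff) {S : Aff} (r : q ⟶ (Functor.const Y).obj S) (F : PSpace)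
    (f : F ⟶ pts.obj (spec.obj S)) where
  pt : ∀ y, F.obj (op (q.obj y))
  pt_map : ∀ {y y'} (g : y ⟶ y'), F.map (q.map g).op (pt y') = pt y
  pt_base : ∀ y, f.app _ (pt y) = ULift.up (spec.map (r.app y))
  fullyFaithful : ∀ {y y'} (k : q.obj y ⟶ q.obj y'), F.map k.op (pt y') = pt y →
    ∃! g : y ⟶ y', q.map g = k
  essSurj : ∀ {T : Aff} (x : F.obj (op T)), ∃ (y : Y) (i : T ≅ q.obj y),
    F.map i.hom.op (pt y) = x

/-- A 1-morphism between categories over `Aff`. -/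
structure Mor (p : X ⥤ Aff) (q : Y ⥤ Aff) where
  functor : X ⥤ Y
  iso : functor ⋙ q ≅ p

/-- Composition of 1-morphisms. -/
def Mor.comp {p : X ⥤ Aff} {q : Y ⥤ Aff} {r : Z ⥤ Aff} (F : Mor p q) (G : Mor q r) :
    Mor p r where
  functor := F.functor ⋙ G.functor
  iso := Functor.associator _ _ _ ≪≫ Functor.isoWhiskerLeft F.functor G.iso ≪≫ F.iso

variable {p : X ⥤ Aff} {q : Y ⥤ Aff}

/-- The projection to `Aff` of the fibre product `X ×_Y S` of a morphism `F : X ⥤ Y` with the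
morphism from the affine scheme `S = q(ξ)` given by the object `ξ` of `Y`. The objects of this
fibre product are the pairs of an object `x` of `X` and a morphism `F(x) ⟶ ξ`. -/
def Mor.fibreProj (F : Mor p q) (ξ : Y) : CostructuredArrow F.functor ξ ⥤ Aff :=
  CostructuredArrow.proj F.functor ξ ⋙ p

/-- The projection `X ×_Y S ⟶ S`. -/
def Mor.fibreBase (F : Mor p q) (ξ : Y) :
    F.fibreProj ξ ⟶ (Functor.const _).obj (q.obj ξ) where
  app t := F.iso.inv.app t.left ≫ q.map t.hom
  naturality t t' k := by
    have h : p.map k.left ≫ F.iso.inv.app t'.left =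
        F.iso.inv.app t.left ≫ q.map (F.functor.map k.left) := F.iso.inv.naturality k.left
    have w : q.map (F.functor.map k.left) ≫ q.map t'.hom = q.map t.hom := by
      rw [← q.map_comp, CostructuredArrow.w k]
    refine Eq.trans ?_ (Category.comp_id _).symm
    refine (Category.assoc _ _ _).symm.trans ((congrArg (· ≫ q.map t'.hom) h).trans ?_)
    exact (Category.assoc _ _ _).trans (congrArg _ w)

/-- `F : X ⟶ Y` is representable, with property `Q`: for every affine scheme `S` and every object
`ξ` of `Y` over `S`, the fibre product `X ×_Y S` is represented by an algebraic space, and its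
projection to `S` has the property `Q`. -/
def Mor.RepresentableWith (F : Mor p q)
    (Q : ∀ ⦃R : PSpace⦄ ⦃S : Sch⦄, (R ⟶ pts.obj S) → Prop) : Prop :=
  ∀ ξ : Y, ∃ (R : PSpace) (f : R ⟶ pts.obj (spec.obj (q.obj ξ))), IsAlgebraicSpace R ∧
    Nonempty (Represents (F.fibreProj ξ) (F.fibreBase ξ) R f) ∧ Q f

/-- Given objects `ξ`, `η` of `Y` and a morphism `e : q(ξ) ⟶ q(η)`, an object of the category over
`Aff` belonging to the sheaf `Isom(ξ, e^* η)` on `q(ξ)`: an object `z` which is a pull-back both of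
`ξ` and of `e^* η` along the same morphism. -/
structure IsomObj (q : Y ⥤ Aff) (ξ η : Y) (e : q.obj ξ ⟶ q.obj η) where
  z : Y
  fst : z ⟶ ξ
  snd : z ⟶ η
  w : q.map fst ≫ e = q.map snd

/-- A morphism between such objects. -/
@[ext]
structure IsomObj.Hom {q : Y ⥤ Aff} {ξ η : Y} {e : q.obj ξ ⟶ q.obj η} (a b : IsomObj q ξ η e) where
  hom : a.z ⟶ b.z
  fst : hom ≫ b.fst = a.fst
  snd : hom ≫ b.snd = a.snd

instance (q : Y ⥤ Aff) (ξ η : Y) (e : q.obj ξ ⟶ q.obj η) : Category (IsomObj q ξ η e) where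
  Hom := IsomObj.Hom
  id a := ⟨𝟙 a.z, Category.id_comp _, Category.id_comp _⟩
  comp f g := ⟨f.hom ≫ g.hom, by rw [Category.assoc, g.fst, f.fst],
    by rw [Category.assoc, g.snd, f.snd]⟩
  id_comp f := IsomObj.Hom.ext (Category.id_comp _)
  comp_id f := IsomObj.Hom.ext (Category.comp_id _)
  assoc f g h := IsomObj.Hom.ext (Category.assoc _ _ _)

/-- The projection of `Isom(ξ, e^* η)` to affine schemes. -/
def isomProj (q : Y ⥤ Aff) (ξ η : Y) (e : q.obj ξ ⟶ q.obj η) : IsomObj q ξ η e ⥤ Aff where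
  obj a := q.obj a.z
  map f := q.map (IsomObj.Hom.hom f)
  map_id a := q.map_id a.z
  map_comp _ _ := q.map_comp _ _

/-- The projection of `Isom(ξ, e^* η)` to `q(ξ)`. -/
def isomBase (q : Y ⥤ Aff) (ξ η : Y) (e : q.obj ξ ⟶ q.obj η) :
    isomProj q ξ η e ⟶ (Functor.const _).obj (q.obj ξ) where
  app a := q.map a.fst
  naturality a b f := by
    refine Eq.trans ?_ (Category.comp_id _).symm
    exact (q.map_comp _ _).symm.trans (congrArg q.map (IsomObj.Hom.fst f))

/-- A `ℂ`-scheme, as a category over affine schemes. -/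
abbrev schemeProj (V : Sch) : CostructuredArrow spec V ⥤ Aff := CostructuredArrow.proj spec V

/-- A morphism of `ℂ`-schemes, as a 1-morphism. -/
def schemeMor {V V' : Sch} (j : V ⟶ V') : Mor (schemeProj V) (schemeProj V') where
  functor := CostructuredArrow.map j
  iso := Iso.refl _

/-- A presentation of `Y` by the scheme `V`: a representable, smooth and surjective morphism
`V ⟶ Y`. -/
def IsPresentation {V : Sch} (G : Mor (schemeProj V) q) : Prop :=
  G.RepresentableWith fun _ _ f => HasAtlasWith smoothSurjective f

variable (q)

/-- `q : Y ⥤ Aff` is an algebraic stack (over `ℂ`): it is a stack for the étale topology, its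
diagonal is representable, separated and quasi-compact, and it has a presentation by a scheme. -/
structure IsAlgebraicStack : Prop where
  isStack : IsStack etale q
  diagonal : ∀ (ξ η : Y) (e : q.obj ξ ⟶ q.obj η),
    ∃ (R : PSpace) (f : R ⟶ pts.obj (spec.obj (q.obj ξ))), IsAlgebraicSpace R ∧
      Nonempty (Represents (isomProj q ξ η e) (isomBase q ξ η e) R f) ∧
      IsSeparatedOver f ∧ HasAtlasWith @QuasiCompact f
  presentation : ∃ (V : Sch) (G : Mor (schemeProj V) q), IsPresentation G

/-- The algebraic stack `q` is smooth over `ℂ`: it has a presentation by a smooth `ℂ`-scheme. -/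
def IsSmoothStack : Prop :=
  ∃ (V : Sch) (G : Mor (schemeProj V) q), IsPresentation G ∧ Smooth V.hom

/-- The algebraic stack `q` is of finite type over `ℂ`: it has a presentation by a `ℂ`-scheme of
finite type. -/
def IsFiniteTypeStack : Prop :=
  ∃ (V : Sch) (G : Mor (schemeProj V) q), IsPresentation G ∧ LocallyOfFiniteType V.hom ∧
    QuasiCompact V.hom

/-- The dimension of a scheme at a point: the infimum of the Krull dimensions of the open
neighbourhoods. -/
def dimAt (V : Scheme.{0}) (v : V) : WithBot ℕ∞ :=
  ⨅ O : {O : V.Opens // v ∈ O}, topologicalKrullDim O.1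

/-- An open subscheme of a `ℂ`-scheme, as a `ℂ`-scheme. -/
def openSub (V : Sch) (O : V.left.Opens) : Sch := Over.mk (O.ι ≫ V.hom)

/-- The inclusion of an open subscheme. -/
def openIncl (V : Sch) (O : V.left.Opens) : openSub V O ⟶ V := Over.homMk O.ι

/-- The algebraic stack `q` is non-empty and has dimension `d` at each of its points: for a
presentation `G : V ⟶ Y` by a non-empty scheme which is locally of finite type, and every point `v`
of `V`, the dimension of `V` at `v` minus the relative dimension of `G` at `v` is `d`. -/
def HasDimension (d : ℤ) : Prop :=
  ∃ (V : Sch) (G : Mor (schemeProj V) q), IsPresentation G ∧ LocallyOfFiniteType V.hom ∧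
    Nonempty V.left ∧ ∀ v : V.left, ∃ (O : V.left.Opens) (m n : ℕ), v ∈ O ∧
      dimAt V.left v = m ∧
      ((schemeMor (openIncl V O)).comp G).RepresentableWith
        (fun _ _ f => HasAtlasWith (@SmoothOfRelativeDimension n) f) ∧
      (m : ℤ) - n = d

end Stacks

/-! ## Line bundles with a section, `[𝔸¹/𝔾_m]^l`, and the categories `W''`, `W'`, `W` -/

/-- An invertible `A`-module together with an element, i.e. a line bundle with a section on
`Spec A`. -/
structure LineSec (A : Type) [CommRing A] where
  L : Type
  [grp : AddCommGroup L]
  [mod : Module A L]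
  [inv : Module.Invertible A L]
  sec : L

attribute [instance] LineSec.grp LineSec.mod LineSec.inv

/-- The section vanishes at the point `x`. -/
def LineSec.VanishesAt {A : Type} [CommRing A] (P : LineSec A) (x : PrimeSpectrum A) : Prop :=
  P.sec ∈ x.asIdeal • (⊤ : Submodule A P.L)

/-- The section is not invertible: it vanishes in at least one point. -/
def LineSec.NonInvertible {A : Type} [CommRing A] (P : LineSec A) : Prop :=
  ∃ x, P.VanishesAt x

/-- `θ : L → M` exhibits `(M, μ)` as the pull-back of `(L, λ)` along `f : A → B`: it is
`f`-semilinear, maps `λ` to `μ`, and induces an isomorphism `B ⊗_A L ≅ M`. As both sides are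
invertible `B`-modules, the latter just means that the image of `θ` generates `M`. -/
structure IsPullbackMap {A B : Type} [CommRing A] [CommRing B] (f : A →+* B) (P : LineSec A)
    (Q : LineSec B) (θ : P.L →+ Q.L) : Prop where
  smul : ∀ (a : A) (x : P.L), θ (a • x) = f a • θ x
  span : Submodule.span B (Set.range θ) = ⊤
  sec : θ P.sec = Q.sec

lemma IsPullbackMap.id {A : Type} [CommRing A] (P : LineSec A) :
    IsPullbackMap (RingHom.id A) P P (AddMonoidHom.id P.L) where
  smul _ _ := rfl
  span := by
    rw [show Set.range (AddMonoidHom.id P.L) = Set.univ from Set.range_id, Submodule.span_univ]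
  sec := rfl

lemma IsPullbackMap.comp {A B C : Type} [CommRing A] [CommRing B] [CommRing C] {f : A →+* B}
    {g : B →+* C} {P : LineSec A} {Q : LineSec B} {R : LineSec C} {θ : P.L →+ Q.L}
    {η : Q.L →+ R.L} (h : IsPullbackMap f P Q θ) (k : IsPullbackMap g Q R η) :
    IsPullbackMap (g.comp f) P R (η.comp θ) where
  smul a x := by simp [h.smul, k.smul]
  span := by
    rw [eq_top_iff, ← k.span, Submodule.span_le]
    rintro _ ⟨y, rfl⟩
    have hy : y ∈ Submodule.span B (Set.range θ) := h.span ▸ Submodule.mem_top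
    induction hy using Submodule.span_induction with
    | mem y hy =>
      obtain ⟨x, rfl⟩ := hy
      exact Submodule.subset_span ⟨x, rfl⟩
    | zero => simp
    | add y z _ _ hy hz =>
      rw [map_add]
      exact Submodule.add_mem _ hy hz
    | smul b y _ hy =>
      rw [k.smul]
      exact Submodule.smul_mem _ _ hy
  sec := by simp [h.sec, k.sec]

lemma mem_of_smul_le {A : Type} [CommRing A] (P : LineSec A) (I : Ideal A) (t : A)
    (h : ∀ y : P.L, t • y ∈ I • (⊤ : Submodule A P.L)) : t ∈ I := by
  obtain ⟨w, hw⟩ := (Module.Invertible.bijective (R := A) (M := P.L)).2 1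
  have key : ∀ w, t * contractLeft A P.L w ∈ I := by
    intro w
    induction w with
    | zero => simp
    | add a b ha hb => rw [map_add, mul_add]; exact I.add_mem ha hb
    | tmul φ y =>
      rw [contractLeft_apply, ← smul_eq_mul, ← map_smul]
      have aux : ∀ m ∈ I • (⊤ : Submodule A P.L), φ m ∈ I := by
        intro m hm
        induction hm using Submodule.smul_induction_on' with
        | smul r hr n _ => rw [map_smul]; exact I.mul_mem_right _ hr
        | add a _ b _ ha hb => rw [map_add]; exact I.add_mem ha hb
      exact aux _ (h y)
  simpa [hw] using key w

lemma mem_smul_top_of_dual {A : Type} [CommRing A] (P : LineSec A) (I : Ideal A) (m : P.L)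
    (h : ∀ φ : Module.Dual A P.L, φ m ∈ I) : m ∈ I • (⊤ : Submodule A P.L) := by
  obtain ⟨w, hw⟩ := (Module.Invertible.bijective (R := A) (M := P.L)).2 1
  have key : ∀ w, contractLeft A P.L w • m ∈ I • (⊤ : Submodule A P.L) := by
    intro w
    induction w with
    | zero => simp
    | add a b ha hb => rw [map_add, add_smul]; exact Submodule.add_mem _ ha hb
    | tmul φ y =>
      have e : φ y • m = φ m • y := by
        have := congrArg (TensorProduct.lid A P.L ∘ (φ.rTensor P.L))
          (Module.Invertible.tmul_comm (R := A) (m₁ := y) (m₂ := m))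
        simpa using this
      rw [contractLeft_apply, e]
      exact Submodule.smul_mem_smul (h φ) Submodule.mem_top
  simpa [hw] using key w

/-- A pulled back section vanishes at `x` exactly if the original one vanishes at the image of
`x`. -/
lemma IsPullbackMap.vanishesAt_iff {A B : Type} [CommRing A] [CommRing B] {f : A →+* B}
    {P : LineSec A} {Q : LineSec B} {θ : P.L →+ Q.L} (h : IsPullbackMap f P Q θ)
    (x : PrimeSpectrum B) : Q.VanishesAt x ↔ P.VanishesAt (PrimeSpectrum.comap f x) := by
  constructor
  · intro hQ
    by_contra hP
    obtain ⟨φ, hφ⟩ : ∃ φ : Module.Dual A P.L, φ P.sec ∉ (PrimeSpectrum.comap f x).asIdeal := by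
      by_contra! H
      exact hP (mem_smul_top_of_dual P _ _ H)
    refine hφ (mem_of_smul_le Q x.asIdeal (f (φ P.sec)) fun y => ?_)
    have hy : y ∈ Submodule.span B (Set.range θ) := h.span ▸ Submodule.mem_top
    induction hy using Submodule.span_induction with
    | mem y hy =>
      obtain ⟨l, rfl⟩ := hy
      have e : φ P.sec • l = φ l • P.sec := by
        have := congrArg (TensorProduct.lid A P.L ∘ (φ.rTensor P.L))
          (Module.Invertible.tmul_comm (R := A) (m₁ := P.sec) (m₂ := l))
        simpa using this
      rw [← h.smul, e, h.smul, h.sec]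
      exact Submodule.smul_mem _ _ hQ
    | zero => simp
    | add y z _ _ hy hz =>
      rw [smul_add]
      exact Submodule.add_mem _ hy hz
    | smul b y _ hy =>
      rw [smul_comm]
      exact Submodule.smul_mem _ _ hy
  · intro hP
    have key : ∀ m ∈ (PrimeSpectrum.comap f x).asIdeal • (⊤ : Submodule A P.L),
        θ m ∈ x.asIdeal • (⊤ : Submodule B Q.L) := by
      intro m hm
      induction hm using Submodule.smul_induction_on' with
      | smul r hr n _ => rw [h.smul]; exact Submodule.smul_mem_smul hr Submodule.mem_top
      | add a _ b _ ha hb => rw [map_add]; exact Submodule.add_mem _ ha hb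
    have := key _ hP
    rwa [h.sec] at this

/-- The objects of `[𝔸¹/𝔾_m]^l` over an affine scheme: `l`-tuples of line bundles with a section.
-/
structure A1GmPow (l : ℕ) where
  base : Aff
  pair : Fin l → LineSec base.unop

/-- A morphism over `base : V ⟶ U`: isomorphisms between the given `l`-tuple on `V` and the
pull-back of the given `l`-tuple on `U`, written as semilinear maps. -/
@[ext]
structure A1GmPow.Hom {l : ℕ} (X Y : A1GmPow l) where
  base : X.base ⟶ Y.base
  map : ∀ i, (Y.pair i).L →+ (X.pair i).L
  isPullback : ∀ i, IsPullbackMap (ringMap base) (Y.pair i) (X.pair i) (map i)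

instance (l : ℕ) : Category (A1GmPow l) where
  Hom := A1GmPow.Hom
  id X := ⟨𝟙 _, fun _ => AddMonoidHom.id _, fun _ => IsPullbackMap.id _⟩
  comp φ ψ := ⟨φ.base ≫ ψ.base, fun i => (φ.map i).comp (ψ.map i),
    fun i => (ψ.isPullback i).comp (φ.isPullback i)⟩

/-- The projection of `[𝔸¹/𝔾_m]^l` to affine schemes. -/
def A1GmPow.proj (l : ℕ) : A1GmPow l ⥤ Aff where
  obj X := X.base
  map φ := A1GmPow.Hom.base φ

/-- The objects of `W''`: an affine scheme with a finite, possibly empty, sequence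
`(L_1, λ_1) … (L_r, λ_r)` of line bundles with non-invertible sections. The sequence is indexed by
a finite totally ordered set (which has a unique ordered bijection with `{1, …, r}`). -/
structure WPP where
  base : Aff
  ι : Type
  [ord : LinearOrder ι]
  [fin : Finite ι]
  pair : ι → LineSec base.unop
  nonInv : ∀ i, (pair i).NonInvertible

attribute [instance] WPP.ord WPP.fin

/-- The length `r` of the sequence. -/
def WPP.length (X : WPP) : ℕ := Nat.card X.ι

/-- A morphism over `base : V ⟶ U`: an isomorphism between the sequence on `V` and the pull-back of
the sequence on `U`. The latter is the subsequence of those members whose pull-back to `V` is not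
invertible. To every index `j` of the sequence on `V` belong an index of the sequence on `U` and an
isomorphism, written as a semilinear map. -/
@[ext]
structure WPP.Hom (X Y : WPP) where
  base : X.base ⟶ Y.base
  map : ∀ j : X.ι, Σ i : Y.ι, ((Y.pair i).L →+ (X.pair j).L)
  strictMono : StrictMono fun j => (map j).1
  mem_range : ∀ i : Y.ι, (∃ j, (map j).1 = i) ↔ ∃ x, (Y.pair i).VanishesAt (ptMap base x)
  isPullback : ∀ j, IsPullbackMap (ringMap base) (Y.pair (map j).1) (X.pair j) (map j).2

instance : Category WPP where
  Hom := WPP.Hom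
  id X :=
    { base := 𝟙 _
      map := fun j => ⟨j, AddMonoidHom.id _⟩
      strictMono := strictMono_id
      mem_range := fun i => ⟨fun _ => X.nonInv i, fun _ => ⟨i, rfl⟩⟩
      isPullback := fun _ => IsPullbackMap.id _ }
  comp {X Y Z} φ ψ :=
    { base := φ.base ≫ ψ.base
      map := fun j => ⟨(ψ.map (φ.map j).1).1, (φ.map j).2.comp (ψ.map (φ.map j).1).2⟩
      strictMono := fun _ _ h => ψ.strictMono (φ.strictMono h)
      mem_range := fun i => by
        constructor
        · rintro ⟨j, rfl⟩
          obtain ⟨x, hx⟩ := X.nonInv j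
          refine ⟨x, ?_⟩
          rw [ptMap_comp]
          exact ((ψ.isPullback _).vanishesAt_iff _).1 (((φ.isPullback j).vanishesAt_iff x).1 hx)
        · rintro ⟨x, hx⟩
          rw [ptMap_comp] at hx
          obtain ⟨k, rfl⟩ := (ψ.mem_range i).2 ⟨_, hx⟩
          obtain ⟨j, rfl⟩ := (φ.mem_range k).2 ⟨x, ((ψ.isPullback k).vanishesAt_iff _).2 hx⟩
          exact ⟨j, rfl⟩
      isPullback := fun j => (ψ.isPullback _).comp (φ.isPullback j) }

/-- The projection of `W''` to affine schemes. -/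
def WPP.proj : WPP ⥤ Aff where
  obj X := X.base
  map φ := WPP.Hom.base φ

/-- `W'`: the objects are those of `W''`, the morphisms are the sections of the Zariski
sheafifications of the presheaves of isomorphisms of `W''`. (These presheaves are separated, since
an isomorphism of line bundles respecting given sections is determined where these are
invertible.) -/
abbrev WP : Type 1 := IsomSheafified zariski WPP.proj

/-- The projection of `W'` to affine schemes. -/
abbrev WP.proj : WP ⥤ Aff := IsomSheafified.proj zariski WPP.proj

/-- `W`: the stack associated to the prestack `W'`, for the étale topology. An object is a covering
of `U`, with objects of `W'` on it, and a descent datum. -/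
abbrev W : Type 1 := DescentDatum etale WP.proj

/-- The projection of `W` to affine schemes. -/
abbrev W.proj : W ⥤ Aff := DescentDatum.proj etale WP.proj

/-- The descent data formed from sequences of length at most `l`. -/
def lengthLE (l : ℕ) : ObjectProperty W := fun D => ∀ i, (D.obj i).obj.length ≤ l

/-- `W_l`: the stack built like `W`, out of sequences of length at most `l`. -/
abbrev Wl (l : ℕ) : Type 1 := (lengthLE l).FullSubcategory

/-- The projection of `W_l` to affine schemes. -/
abbrev Wl.proj (l : ℕ) : Wl l ⥤ Aff := (lengthLE l).ι ⋙ W.proj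

/-- The functor `[𝔸¹/𝔾_m]^l ⥤ W''` which keeps the non-invertible members of an `l`-tuple, in
order. -/
def keepNonInvertible (l : ℕ) : A1GmPow l ⥤ WPP where
  obj X :=
    { base := X.base
      ι := {i : Fin l // (X.pair i).NonInvertible}
      pair := fun i => X.pair i.1
      nonInv := fun i => i.2 }
  map {X Y} φ :=
    { base := A1GmPow.Hom.base φ
      map := fun j => ⟨⟨j.1, j.2.imp' _ fun x hx =>
        ((A1GmPow.Hom.isPullback φ j.1).vanishesAt_iff x).1 hx⟩, A1GmPow.Hom.map φ j.1⟩
      strictMono := fun _ _ h => h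
      mem_range := fun i => by
        constructor
        · rintro ⟨j, rfl⟩
          obtain ⟨x, hx⟩ := j.2
          exact ⟨x, ((A1GmPow.Hom.isPullback φ j.1).vanishesAt_iff x).1 hx⟩
        · rintro ⟨x, hx⟩
          exact ⟨⟨i.1, x, ((A1GmPow.Hom.isPullback φ i.1).vanishesAt_iff x).2 hx⟩, rfl⟩
      isPullback := fun j => A1GmPow.Hom.isPullback φ j.1 }

lemma keepNonInvertible_length (l : ℕ) (X : A1GmPow l) :
    ((keepNonInvertible l).obj X).length ≤ l := by
  refine (Nat.card_le_card_of_injective Subtype.val Subtype.val_injective).trans ?_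
  simp

/-- The functor `[𝔸¹/𝔾_m]^l ⥤ W'' ⥤ W' ⥤ W`, with values in `W_l`. -/
def toWlFunctor (l : ℕ) : A1GmPow l ⥤ Wl l :=
  (lengthLE l).lift (keepNonInvertible l ⋙ IsomSheafified.unit zariski WPP.proj ⋙
    DescentDatum.unit etale WP.proj) fun X _ => keepNonInvertible_length l X

/-- The morphism `[𝔸¹/𝔾_m]^l ⟶ W_l`. -/
def toWl (l : ℕ) : Mor (A1GmPow.proj l) (Wl.proj l) := ⟨toWlFunctor l, Iso.refl _⟩

/-- The inclusion of `W_l` in `W_m`, for `l ≤ m`. -/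
def Wl.incl {l m : ℕ} (h : l ≤ m) : Mor (Wl.proj l) (Wl.proj m) :=
  ⟨ObjectProperty.ιOfLE fun _ hD i => (hD i).trans h, Iso.refl _⟩

/-- The inclusion of `W_l` in `W`. -/
def Wl.inclW (l : ℕ) : Mor (Wl.proj l) W.proj := ⟨(lengthLE l).ι, Iso.refl _⟩

end ModStack

end

open CategoryTheory Opposite Limits AlgebraicGeometry

noncomputable section

namespace ModStack
open Category
local notation "Pt" U:max => PrimeSpectrum (unop U)
local notation "ran" f:max => Set.range (ptMap f)

section DescentTheory

universe v u v₁ u₁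

variable {C : Type u} [Category.{v} C] {J : GrothendieckTopology C}
  {E : Type u₁} [Category.{v₁} E] {p : E ⥤ C}

namespace IsFibredInGroupoids

lemma lift (hp : IsFibredInGroupoids p) (x : E) {V : C} (f : V ⟶ p.obj x) :
    ∃ (y : E) (e : p.obj y ≅ V) (a : y ⟶ x), p.map a = e.hom ≫ f := by
  obtain ⟨y, a, h⟩ := hp.exists_lift x f
  obtain rfl := IsHomLift.domain_eq p f a
  refine ⟨y, Iso.refl _, a, ?_⟩
  have := IsHomLift.fac p f a
  simp at this
  simp [this]

lemma fac (hp : IsFibredInGroupoids p) {x y z : E} (a : y ⟶ x) (b : z ⟶ x)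
    (g : p.obj z ⟶ p.obj y) (h : g ≫ p.map a = p.map b) : ∃ c : z ⟶ y, p.map c = g ∧ c ≫ a = b :=
  (hp.existsUnique_fac a b g h).exists

lemma cancel (hp : IsFibredInGroupoids p) {x y z : E} {c c' : z ⟶ y} (a : y ⟶ x)
    (h : p.map c = p.map c') (h' : c ≫ a = c' ≫ a) : c = c' := by
  refine (hp.existsUnique_fac a (c ≫ a) (p.map c) (p.map_comp _ _).symm).unique
    ⟨rfl, rfl⟩ ⟨h.symm, h'.symm⟩

lemma isIso (hp : IsFibredInGroupoids p) {x y : E} (a : y ⟶ x) [IsIso (p.map a)] : IsIso a := by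
  obtain ⟨c, hc, hc'⟩ := hp.fac a (𝟙 x) (inv (p.map a)) (by simp)
  refine ⟨c, hp.cancel a ?_ ?_, hc'⟩
  · simp [hc]
  · simp [hc']

end IsFibredInGroupoids

/-- The presheaves of isomorphisms of the category fibred in groupoids `p` are sheaves. -/
structure IsPrestack (J : GrothendieckTopology C) (p : E ⥤ C) : Prop where
  fibred : IsFibredInGroupoids p
  glueHom : ∀ {x y : E} (φ : LocalHom J p x y), ∃! c : x ⟶ y, p.map c = φ.base ∧
    ∀ {z : E} (a : z ⟶ x) (h : φ.sieve (p.map a)), a ≫ c = φ.map a h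

lemma IsStack.isPrestack (h : IsStack J p) : IsPrestack J p := ⟨h.fibred, h.glueHom⟩

lemma IsPrestack.hom_ext (hp : IsPrestack J p) {x y : E} {m m' : x ⟶ y} (h : p.map m = p.map m')
    (Q : Sieve (p.obj x)) (hQ : Q ∈ J (p.obj x))
    (H : ∀ {z : E} (a : z ⟶ x), Q (p.map a) → a ≫ m = a ≫ m') : m = m' := by
  let φ : LocalHom J p x y :=
    { base := p.map m
      sieve := Q
      mem := hQ
      map := fun a _ => a ≫ m
      map_base := fun a _ => p.map_comp _ _
      map_comp := fun b a _ _ => assoc _ _ _ }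
  exact (hp.glueHom φ).unique ⟨rfl, fun _ _ => rfl⟩ ⟨h.symm, fun a ha => (H a ha).symm⟩

namespace DescentDatum

/-- A representative of the tautological morphism from a member of a descent datum. -/
def canPre (D : DescentDatum J p) (i : D.I) : PreHom ((unit J p).obj (D.obj i)) D where
  base := D.map i
  sieve := ⊤
  mem := J.top_mem _
  map {z _} (u : z ⟶ D.obj i) j b w _ := D.glue u j b
    (w.trans ((p.map u) ≫= (id_comp (D.map i))))
  map_base _ _ _ _ _ := D.glue_base _ _ _ _
  comp_map _ _ _ _ _ _ _ _ := D.comp_glue _ _ _ _ _ _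
  glue_map _ _ _ _ _ _ _ _ _ _ := rfl
  map_glue _ _ _ _ _ _ _ _ _ := D.glue_glue _ _ _ _ _ _ _ _

/-- The morphism with a given representative. -/
def PreHom.mk' {D D' : DescentDatum J p} (φ : PreHom D D') : D ⟶ D' :=
  Quotient.mk (PreHom.setoid _ _) φ

lemma exists_rep {D D' : DescentDatum J p} (f : D ⟶ D') : ∃ φ : PreHom D D', φ.mk' = f :=
  Quotient.exists_rep f

lemma glue_congr (D : DescentDatum J p) {z : E} {i : D.I} {u u' : z ⟶ D.obj i} {j : D.I}
    {b b' : p.obj z ⟶ p.obj (D.obj j)} (hu : u = u') (hb : b = b') (w w') :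
    D.glue u j b w = D.glue u' j b' w' := by
  subst hu hb; rfl

lemma PreHom.map_congr {D D' : DescentDatum J p} (φ : PreHom D D') {z : E} {i : D.I}
    {u u' : z ⟶ D.obj i} {j : D'.I} {b b' : p.obj z ⟶ p.obj (D'.obj j)} (hu : u = u')
    (hb : b = b') (w h w' h') : φ.map u j b w h = φ.map u' j b' w' h' := by
  subst hu hb; rfl

/-- The tautological morphism from a member of a descent datum. -/
def can (D : DescentDatum J p) (i : D.I) : (unit J p).obj (D.obj i) ⟶ D :=
  Quotient.mk (PreHom.setoid _ _) (canPre D i)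

/-- The representative of a morphism between objects of `E`. -/
def unitPre {x y : E} (a : x ⟶ y) : PreHom ((unit J p).obj x) ((unit J p).obj y) where
  base := p.map a
  sieve := ⊤
  mem := J.top_mem _
  map := fun {z} {i} (u : z ⟶ x) _ _ _ _ => u ≫ a
  map_base := fun {z} {i} (u : z ⟶ x) _ b w _ => by
    refine (p.map_comp u a).trans ?_
    exact ((comp_id b).symm.trans (w.trans (congrArg _ (id_comp _)))).symm
  comp_map := fun _ _ _ _ _ _ _ _ => assoc _ _ _
  glue_map := fun _ _ _ _ _ _ _ _ _ _ => rfl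
  map_glue := fun _ _ _ _ _ _ _ _ _ => rfl

@[simp] lemma proj_map_can (D : DescentDatum J p) (i : D.I) :
    (proj J p).map (can D i) = D.map i := rfl

@[simp] lemma proj_map_unit {x y : E} (a : x ⟶ y) :
    (proj J p).map ((unit J p).map a) = p.map a := rfl

lemma unitPre_comp_map {D : DescentDatum J p} {x y : E} (m : x ⟶ y)
    (ψ : PreHom ((unit J p).obj y) D) {z : E} {i} (v : z ⟶ x) (j b w h w' h') :
    ((unitPre m).comp ψ).map (i := i) v j b w h =
      ψ.map (i := PUnit.unit) (v ≫ m : z ⟶ y) j b w' h' :=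
  PreHom.comp_map_eq (unitPre m) ψ v j b w h PUnit.unit (p.map (v ≫ m))
    (by
      refine (comp_id _).trans ((p.map_comp _ _).trans ?_)
      exact (p.map v) ≫= (id_comp _).symm) trivial w' h'

lemma canPre_comp_map {D D' : DescentDatum J p} (i₀ : D.I)
    (ψ : PreHom D D') {z : E} {i} (v : z ⟶ D.obj i₀) (j b w h w' h') :
    ((canPre D i₀).comp ψ).map (i := i) v j b w h = ψ.map v j b w' h' := by
  have e : (canPre D i₀).map (i := i) v i₀ (p.map v)
      ((p.map v) ≫= (id_comp _).symm) trivial = v := D.glue_self v rfl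
  rw [PreHom.comp_map_eq (canPre D i₀) ψ v j b w h i₀ (p.map v)
    ((p.map v) ≫= (id_comp _).symm) trivial
    (by rw [e]; exact w') (by rw [e]; exact h')]
  congr 1

lemma mem_ofArrows {I : Type*} {X : C} {Y : I → C} (f : ∀ i, Y i ⟶ X) {Z : C} (i : I)
    (g : Z ⟶ Y i) : Sieve.ofArrows Y f (g ≫ f i) :=
  (Sieve.mem_ofArrows_iff _ _ _).2 ⟨i, g, rfl⟩

lemma eval_eq {D D' : DescentDatum J p} (φ : PreHom D D') {z : E} {i : D.I} (u : z ⟶ D.obj i)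
    (j b w h) :
    (unit J p).map (φ.map u j b w h) ≫ can D' j =
      (unit J p).map u ≫ can D i ≫ φ.mk' := by
  refine Quotient.sound (s := PreHom.setoid _ _)
    (a := (unitPre (φ.map u j b w h)).comp (canPre D' j))
    (b := (unitPre u).comp ((canPre D i).comp φ)) ⟨?_, ?_⟩
  · change p.map _ ≫ D'.map j = p.map u ≫ D.map i ≫ φ.base
    rw [φ.map_base, w]
  · refine ⟨((unitPre (φ.map u j b w h)).comp (canPre D' j)).sieve ⊓
      ((unitPre u).comp ((canPre D i).comp φ)).sieve,
      J.intersection_covering (PreHom.mem _) (PreHom.mem _), ?_⟩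
    rintro t k (v : t ⟶ z) hv
    refine ⟨hv.1, hv.2, fun k b' w₁ w₂ => ?_⟩
    have hs : φ.sieve (p.map (v ≫ u) ≫ D.map i) := by
      simp [*]
    have hb' : b' ≫ D'.map k = p.map (v ≫ u) ≫ D.map i ≫ φ.base := by
      refine w₂.trans ?_
      change p.map v ≫ 𝟙 _ ≫ p.map u ≫ D.map i ≫ φ.base = _
      simp
    have hwb : (p.map v ≫ b) ≫ D'.map j = p.map (v ≫ u) ≫ D.map i ≫ φ.base := by
      rw [assoc, w, p.map_comp, assoc]
    have e := φ.comp_map v u j b w h hwb hs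
    refine (unitPre_comp_map (φ.map u j b w h) (canPre D' j) v k b' w₁ hv.1
      (by
        refine w₁.trans ?_
        change p.map v ≫ 𝟙 _ ≫ p.map (φ.map u j b w h) ≫ D'.map j =
          p.map (v ≫ φ.map u j b w h) ≫ 𝟙 _ ≫ D'.map j
        simp) trivial).trans ?_
    refine Eq.trans ?_ (unitPre_comp_map u ((canPre D i).comp φ) v k b' w₂ hv.2 (by
        refine w₂.trans ?_
        change p.map v ≫ 𝟙 _ ≫ p.map u ≫ D.map i ≫ φ.base =
          p.map (v ≫ u) ≫ 𝟙 _ ≫ D.map i ≫ φ.base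
        simp) (by
        have := hv.2.2.2
        refine (congrArg _ ?_).mp this
        change (p.map v ≫ 𝟙 _) ≫ p.map u = p.map (v ≫ u) ≫ 𝟙 _
        simp)).symm
    refine Eq.trans ?_ (canPre_comp_map i φ (v ≫ u) k b' _ _ hb' hs).symm
    rw [← φ.map_glue (v ≫ u) j (p.map v ≫ b) hwb hs k b' (by rw [φ.map_base, hb', hwb]) hb']
    simp only [e]
    rfl

lemma glue_can (D : DescentDatum J p) {z : E} {i : D.I} (u : z ⟶ D.obj i) (j b w) :
    (unit J p).map (D.glue u j b w) ≫ can D j = (unit J p).map u ≫ can D i := by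
  have := eval_eq (PreHom.id D) u j b (by simpa [PreHom.id] using w) trivial
  refine this.trans ?_
  exact congrArg _ (comp_id (can D i))

lemma unit_can_injective (hp : IsPrestack J p) {D : DescentDatum J p} {z : E} {j : D.I}
    {m m' : z ⟶ D.obj j} (h : p.map m = p.map m')
    (H : (unit J p).map m ≫ can D j = (unit J p).map m' ≫ can D j) : m = m' := by
  obtain ⟨-, Q, hQ, K⟩ := Quotient.exact (s := PreHom.setoid _ _)
    (a := (unitPre m).comp (canPre D j)) (b := (unitPre m').comp (canPre D j)) H
  refine hp.hom_ext h Q hQ fun {w} a ha => ?_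
  obtain ⟨h₁, h₂, e⟩ := K (i := PUnit.unit) (a : w ⟶ z) 
    (show Q (p.map a ≫ 𝟙 _) from (comp_id (p.map a)).symm ▸ ha)
  have w₁ : ∀ n : z ⟶ D.obj j, p.map (a ≫ n) ≫ D.map j =
      p.map a ≫ 𝟙 _ ≫ p.map n ≫ D.map j := fun n => by simp
  have key := e j (p.map (a ≫ m)) (w₁ m) (((by rw [p.map_comp, p.map_comp, h]) =≫ (D.map j)).trans (w₁ m'))
  replace key := (unitPre_comp_map m (canPre D j) a j _ _ _
    ((p.map (a ≫ m)) ≫= (id_comp _).symm) trivial).symm.trans (key.trans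
    (unitPre_comp_map m' (canPre D j) a j _ _ _ (by
      have : p.map (a ≫ m) = p.map (a ≫ m') := by rw [p.map_comp, p.map_comp, h]
      rw [this]
      exact (p.map (a ≫ m')) ≫= (id_comp _).symm) trivial))
  refine (D.glue_self (a ≫ m) rfl).symm.trans (Eq.trans key ?_)
  have : p.map (a ≫ m) = p.map (a ≫ m') := by rw [p.map_comp, p.map_comp, h]
  refine Eq.trans ?_ (D.glue_self (a ≫ m') rfl)
  change D.glue (a ≫ m') j (p.map (a ≫ m)) _ = _
  congr 1

lemma exists_eq_unit_can (hp : IsPrestack J p) {D : DescentDatum J p} {z : E}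
    (n : (unit J p).obj z ⟶ D) (j : D.I) (b : p.obj z ⟶ p.obj (D.obj j))
    (hb : b ≫ D.map j = (proj J p).map n) :
    ∃ m : z ⟶ D.obj j, p.map m = b ∧ (unit J p).map m ≫ can D j = n := by
  induction n using Quotient.inductionOn with
  | _ φ =>
  have hb : b ≫ D.map j = φ.base := hb
  have hw : ∀ {w : E} (a : w ⟶ z), (p.map a ≫ b) ≫ D.map j = p.map a ≫ 𝟙 _ ≫ φ.base := by grind
  have hs : ∀ {w : E} (a : w ⟶ z), φ.sieve (p.map a) → φ.sieve (p.map a ≫ 𝟙 _) := fun a h =>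
    (comp_id (p.map a)).symm ▸ h
  let ψ : LocalHom J p z (D.obj j) :=
    { base := b
      sieve := φ.sieve
      mem := φ.mem
      map := fun {w} a h => φ.map (i := PUnit.unit) (a : w ⟶ z) j (p.map a ≫ b)
        (hw a) (hs a h)
      map_base := fun a h => φ.map_base _ _ _ _ _
      map_comp := fun {t w} c a h h' => by
        have := φ.comp_map (i := PUnit.unit) c (a : w ⟶ z) j (p.map a ≫ b) (hw a) (hs a h)
          (((by simp) =≫ (D.map j)).trans (hw (c ≫ a))) (hs _ h')
        refine Eq.trans ?_ this
        congr 1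
        simp }
  obtain ⟨m, ⟨hm, hm'⟩, -⟩ := hp.glueHom ψ
  refine ⟨m, hm, ?_⟩
  refine Quotient.sound (s := PreHom.setoid _ _) (a := (unitPre m).comp (canPre D j)) (b := φ)
    ⟨(hm =≫ (D.map j)).trans hb, φ.sieve ⊓ ((unitPre m).comp (canPre D j)).sieve,
      J.intersection_covering φ.mem (PreHom.mem _), ?_⟩
  rintro w k (a : w ⟶ z) ha
  refine ⟨ha.2, ha.1, fun l b' w₁ w₂ => ?_⟩
  have ha' : φ.sieve (p.map a) := (comp_id (p.map a)) ▸ ha.1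
  refine (unitPre_comp_map m (canPre D j) a l b' w₁ ha.2 (by
        refine w₁.trans ?_
        change p.map a ≫ 𝟙 _ ≫ p.map m ≫ D.map j = p.map (a ≫ m) ≫ 𝟙 _ ≫ D.map j
        simp) trivial).trans ?_
  have e : a ≫ m = φ.map (i := k) (a : w ⟶ z) j (p.map a ≫ b) (hw a) (hs a ha') :=
    hm' a ha'
  change D.glue (a ≫ m) l b' _ = _
  simp only [e]
  exact φ.map_glue _ _ _ _ _ _ _ _ _

lemma hom_ext (hp : IsPrestack J p) {D D' : DescentDatum J p} {f g : D ⟶ D'}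
    (h : (proj J p).map f = (proj J p).map g) (Q : Sieve D.U) (hQ : Q ∈ J D.U)
    (H : ∀ {z : E} {i : D.I} (u : z ⟶ D.obj i), Q (p.map u ≫ D.map i) →
      (unit J p).map u ≫ can D i ≫ f = (unit J p).map u ≫ can D i ≫ g) : f = g := by
  induction f using Quotient.inductionOn with
  | _ φ =>
  induction g using Quotient.inductionOn with
  | _ ψ =>
  refine Quotient.sound ⟨h, Q ⊓ (φ.sieve ⊓ ψ.sieve), J.intersection_covering hQ
    (J.intersection_covering φ.mem ψ.mem), fun {z i} u hu => ⟨hu.2.1, hu.2.2, fun j b w w' => ?_⟩⟩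
  refine unit_can_injective hp (by rw [φ.map_base, ψ.map_base]) ?_
  rw [eval_eq, eval_eq]
  exact H u hu.1

lemma exists_hom (hp : IsPrestack J p) {D D' : DescentDatum J p} (f : D.U ⟶ D'.U) (Q : Sieve D.U)
    (hQ : Q ∈ J D.U) (hQ' : Q ≤ (Sieve.ofArrows _ D'.map).pullback f)
    (n : ∀ {z : E} {i : D.I} (u : z ⟶ D.obj i), Q (p.map u ≫ D.map i) → ((unit J p).obj z ⟶ D'))
    (n_base : ∀ {z : E} {i : D.I} (u : z ⟶ D.obj i) (h),
      (proj J p).map (n u h) = p.map u ≫ D.map i ≫ f)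
    (n_comp : ∀ {z' z : E} {i : D.I} (v : z' ⟶ z) (u : z ⟶ D.obj i) (h h'),
      n (v ≫ u) h' = (unit J p).map v ≫ n u h)
    (n_glue : ∀ {z : E} {i : D.I} (u : z ⟶ D.obj i) (j b w h h'),
      n (D.glue u j b w) h' = n u h) :
    ∃ F : D ⟶ D', (proj J p).map F = f ∧ ∀ {z : E} {i : D.I} (u : z ⟶ D.obj i) (h),
      (unit J p).map u ≫ can D i ≫ F = n u h := by
  have K : ∀ (z : E) (i : D.I) (u : z ⟶ D.obj i) (j : D'.I) (b : p.obj z ⟶ p.obj (D'.obj j))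
      (_ : b ≫ D'.map j = p.map u ≫ D.map i ≫ f) (h : Q (p.map u ≫ D.map i)),
      ∃ m : z ⟶ D'.obj j, p.map m = b ∧ (unit J p).map m ≫ can D' j = n u h :=
    fun z i u j b w h => exists_eq_unit_can hp (n u h) j b (by rw [n_base, w])
  choose m hm hm' using K
  let φ : PreHom D D' :=
    { base := f
      sieve := Q
      mem := hQ
      map := fun {z i} u j b w h => m z i u j b w h
      map_base := fun u j b w h => hm _ _ u j b w h
      comp_map := fun v u j b w h w' h' => unit_can_injective hp (by simp [hm])
        (by rw [hm', Functor.map_comp, assoc, hm', n_comp v u h h'])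
      glue_map := fun u i' c w₀ j b w h w' h' => unit_can_injective hp (by simp [hm])
        (by rw [hm', hm', n_glue])
      map_glue := fun u j b w h j' c w₀ w' => unit_can_injective hp
        (by rw [glue_base, hm]) (by rw [glue_can, hm', hm']) }
  refine ⟨Quotient.mk _ φ, rfl, fun {z i} u h => ?_⟩
  have h' := hQ' _ h
  obtain ⟨j, b, hb⟩ := D'.exists_mid _ h'
  rw [← hm' z i u j b (by rw [hb, assoc]) h]
  exact (eval_eq φ u j b (by rw [hb, assoc]) h).symm

end DescentDatum

end DescentTheory


section DescentTheory

universe v u v₁ u₁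

variable {C : Type u} [Category.{v} C] {J : GrothendieckTopology C}
  {E : Type u₁} [Category.{v₁} E] {p : E ⥤ C}

namespace DescentDatum

lemma factor_cover (D : DescentDatum J p) {V : C} (f : V ⟶ D.U) :
    (Sieve.ofArrows _ D.map).pullback f ∈ J V := J.pullback_stable f D.cover

lemma comp_right_cancel (hp : IsPrestack J p) {x y z : DescentDatum J p} {c c' : z ⟶ y}
    (a : y ⟶ x) (h : (proj J p).map c = (proj J p).map c') (h' : c ≫ a = c' ≫ a) : c = c' := by
  obtain ⟨α, rfl⟩ := exists_rep a
  let g : z.U ⟶ y.U := (proj J p).map c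
  refine hom_ext hp h ((α.sieve ⊓ Sieve.ofArrows _ y.map ⊓
    (Sieve.ofArrows _ x.map).pullback α.base).pullback g)
    (J.pullback_stable _ (J.intersection_covering (J.intersection_covering α.mem y.cover)
      (J.pullback_stable _ x.cover))) fun {w i} u hu => ?_
  obtain ⟨⟨hu₁, hu₂⟩, hu₃⟩ := hu
  obtain ⟨j, b, hb⟩ := y.exists_mid _ hu₂
  obtain ⟨k, d, hd⟩ := x.exists_mid _ hu₃
  obtain ⟨m, hm, hm'⟩ := exists_eq_unit_can hp ((unit J p).map u ≫ can z i ≫ c) j b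
    (by rw [hb, assoc, Functor.map_comp, Functor.map_comp]; rfl)
  obtain ⟨n, hn, hn'⟩ := exists_eq_unit_can hp ((unit J p).map u ≫ can z i ≫ c') j b (by
    rw [hb, Functor.map_comp, Functor.map_comp, ← h, assoc]; rfl)
  rw [← hm', ← hn']
  have hs : ∀ {m : w ⟶ y.obj j}, p.map m = b → α.sieve (p.map m ≫ y.map j) := fun e => by
    rw [e, hb]; exact hu₁
  have hw : ∀ {m : w ⟶ y.obj j}, p.map m = b →
      d ≫ x.map k = p.map m ≫ y.map j ≫ α.base := fun e => by
    rw [e, hd, ← assoc b, hb]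
  have e : α.map m k d (hw hm) (hs hm) = α.map n k d (hw hn) (hs hn) := by
    refine unit_can_injective hp (by rw [α.map_base, α.map_base]) ?_
    rw [eval_eq, eval_eq, reassoc_of% hm', reassoc_of% hn', h']
  obtain ⟨r, hr, hr'⟩ := hp.fibred.fac m n (𝟙 _) (by rw [hm, hn, id_comp])
  have : r = 𝟙 _ := by
    refine hp.fibred.cancel (α.map m k d (hw hm) (hs hm)) (by rw [hr, p.map_id]) ?_
    rw [id_comp]
    have hrb : p.map r ≫ d = d := by rw [hr, id_comp]
    have := α.comp_map r m k d (hw hm) (hs hm) (by rw [hr', hrb]; exact hw hn)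
      (by rw [hr']; exact hs hn)
    rw [← this, e]
    exact α.map_congr hr' hrb _ _ _ _
  rw [← hr', this, id_comp]

lemma fibred (hp : IsPrestack J p) [HasPullbacks C] : IsFibredInGroupoids (proj J p) where
  exists_lift D V f := by
    let f : V ⟶ D.U := f
    have K : ∀ i, ∃ (y : E) (e : p.obj y ≅ pullback (D.map i) f) (a : y ⟶ D.obj i),
        p.map a = e.hom ≫ pullback.fst _ _ := fun i => hp.fibred.lift _ _
    choose y e a ha using K
    have hw : ∀ {z : E} {i : D.I} (u : z ⟶ y i) (j : D.I) (b : p.obj z ⟶ p.obj (y j)),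
        b ≫ (e j).hom ≫ pullback.snd _ _ = p.map u ≫ (e i).hom ≫ pullback.snd _ _ →
        (b ≫ p.map (a j)) ≫ D.map j = p.map (u ≫ a i) ≫ D.map i := fun {z i} u j b w => by
      rw [p.map_comp, ha, ha]
      simp only [assoc, pullback.condition]
      rw [reassoc_of% w]
    have G : ∀ (z : E) (i : D.I) (u : z ⟶ y i) (j : D.I) (b : p.obj z ⟶ p.obj (y j))
        (w : b ≫ (e j).hom ≫ pullback.snd _ _ = p.map u ≫ (e i).hom ≫ pullback.snd _ _),
        ∃ c : z ⟶ y j, p.map c = b ∧ c ≫ a j = D.glue (u ≫ a i) j (b ≫ p.map (a j)) (hw u j b w) :=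
      fun z i u j b w => hp.fibred.fac _ _ _ (by rw [D.glue_base])
    choose g hg hg' using G
    let D' : DescentDatum J p :=
      { U := V
        I := D.I
        obj := y
        map := fun i => (e i).hom ≫ pullback.snd _ _
        cover := by
          refine J.superset_covering ?_ (D.factor_cover f)
          intro T t ht
          obtain ⟨i, c, hc⟩ := D.exists_mid _ ht
          have := mem_ofArrows (fun i => (e i).hom ≫ pullback.snd (D.map i) f) i
            (pullback.lift c t hc ≫ (e i).inv)
          rw [assoc, e i |>.inv_hom_id_assoc, pullback.lift_snd] at this
          exact this
        glue := fun {z i} u j b w => g z i u j b w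
        glue_base := fun {z i} u j b w => hg z i u j b w
        glue_self := fun {z i} u w => hp.fibred.cancel (a i) (hg _ _ _ _ _ _) (by
          rw [hg']
          refine Eq.trans ?_ (D.glue_self (u ≫ a i) rfl)
          congr 1
          rw [p.map_comp])
        glue_glue := fun {z i} u j b w k c w' w'' => hp.fibred.cancel (a k)
          (by rw [hg, hg]) (by
            refine (hg' _ _ _ _ _ _).trans (Eq.trans ?_ (hg' _ _ _ _ _ _).symm)
            have e := hg' z i u j b w
            refine (D.glue_congr e rfl _ (by
              rw [← e]; exact hw _ _ _ w')).trans (D.glue_glue _ _ _ _ _ _ _ _))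
        comp_glue := fun {z' z i} v u j b w w' => hp.fibred.cancel (a j)
          (by rw [hg, p.map_comp, hg]) (by
            have := hw (v ≫ u) j (p.map v ≫ b) w'
            rw [assoc (p.map v) b, assoc v u] at this
            refine (hg' _ _ _ _ _ _).trans (Eq.trans ?_ (assoc _ _ _).symm)
            refine Eq.trans ?_ (v ≫= (hg' _ _ _ _ _ _)).symm
            refine Eq.trans ?_ (D.comp_glue v _ j _ _ this)
            exact D.glue_congr (assoc _ _ _) (assoc _ _ _) _ _) }
    have hf : ∀ {z : E} {i : D.I} (u : z ⟶ y i) (j : D.I) (b : p.obj z ⟶ p.obj (D.obj j)),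
        b ≫ D.map j = p.map u ≫ ((e i).hom ≫ pullback.snd _ _) ≫ f →
        b ≫ D.map j = p.map (u ≫ a i) ≫ D.map i := fun {z i} u j b w => by
      rw [w, p.map_comp, ha]
      simp only [assoc, pullback.condition]
    let φ : PreHom D' D :=
      { base := f
        sieve := ⊤
        mem := J.top_mem _
        map := fun {z i} u j b w _ => D.glue (u ≫ a i) j b (hf u j b w)
        map_base := fun _ _ _ _ _ => D.glue_base _ _ _ _
        comp_map := fun {z' z i} v u j b w _ w' _ => by
          have := hf (v ≫ u) j _ w'
          rw [assoc v u] at this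
          rw [← D.comp_glue v (u ≫ a i) j b _ this]
          exact D.glue_congr (assoc _ _ _) rfl _ _
        glue_map := fun {z i} u i' c w₀ j b w _ w' _ => by
          refine (D.glue_congr (hg' z i u i' c w₀) rfl _ (by
            have := hf _ j b w'
            rwa [← hg' z i u i' c w₀])).trans ?_
          exact D.glue_glue _ _ _ _ _ _ _ _
        map_glue := fun _ _ _ _ _ _ _ _ _ => D.glue_glue _ _ _ _ _ _ _ _ }
    exact ⟨D', φ.mk', inferInstanceAs ((proj J p).IsHomLift ((proj J p).map φ.mk') _)⟩
  existsUnique_fac {x y z} a b g hg := by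
    refine existsUnique_of_exists_of_unique ?_ fun c c' hc hc' =>
      comp_right_cancel hp a (hc.1.trans hc'.1.symm) (hc.2.trans hc'.2.symm)
    let g : z.U ⟶ y.U := g
    obtain ⟨α, rfl⟩ := exists_rep a
    obtain ⟨β, rfl⟩ := exists_rep b
    have hg : g ≫ α.base = β.base := hg
    let Q : Sieve z.U := β.sieve ⊓ (α.sieve ⊓ Sieve.ofArrows _ y.map).pullback g ⊓
      (Sieve.ofArrows _ x.map).pullback β.base
    have hQ : Q ∈ J z.U := J.intersection_covering (J.intersection_covering β.mem
      (J.pullback_stable _ (J.intersection_covering α.mem y.cover)))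
      (J.pullback_stable _ x.cover)
    have K : ∀ (w : E) (i : z.I) (u : w ⟶ z.obj i) (h : Q (p.map u ≫ z.map i)),
        ∃ n : (unit J p).obj w ⟶ y, (proj J p).map n = p.map u ≫ z.map i ≫ g ∧
          n ≫ α.mk' = (unit J p).map u ≫ can z i ≫ β.mk' := by
      rintro w i u ⟨⟨h₁, h₂, h₃⟩, h₄⟩
      obtain ⟨j, c, hc⟩ := y.exists_mid _ h₃
      obtain ⟨k, d, hd⟩ := x.exists_mid _ h₄
      rw [assoc] at hc hd
      obtain ⟨y', e, t, ht⟩ := hp.fibred.lift (y.obj j) c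
      have hs : α.sieve (p.map t ≫ y.map j) := by
        have := α.sieve.downward_closed h₂ e.hom
        rwa [assoc, ← hc, ← assoc, ← ht] at this
      have hw : (e.hom ≫ d) ≫ x.map k = p.map t ≫ y.map j ≫ α.base := by
        rw [assoc, hd, ht, assoc, ← assoc c, hc, ← hg]
        simp only [assoc]
      obtain ⟨r, hr, hr'⟩ := hp.fibred.fac (α.map t k (e.hom ≫ d) hw hs) (β.map u k d hd h₁) e.inv
        (by rw [α.map_base, β.map_base, e.inv_hom_id_assoc])
      refine ⟨(unit J p).map (r ≫ t) ≫ can y j, ?_, ?_⟩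
      · rw [Functor.map_comp, proj_map_unit, proj_map_can, p.map_comp, hr, ht,
          e.inv_hom_id_assoc]
        exact hc
      · rw [← eval_eq β u k d hd h₁, ← hr', Functor.map_comp, Functor.map_comp, assoc,
          assoc, assoc, eval_eq]
    choose n hn hn' using K
    obtain ⟨F, hF, hF'⟩ := exists_hom hp g Q hQ (fun _ _ h => h.1.2.2)
      (fun {w i} u h => n w i u h) (fun u h => hn _ _ u h)
      (fun v u h h' => comp_right_cancel hp α.mk'
        (by
          refine (hn _ _ (v ≫ u) h').trans (Eq.trans ?_ ((proj J p).map_comp _ _).symm)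
          refine Eq.trans ?_ ((p.map v) ≫= (hn _ _ u h)).symm
          exact ((p.map_comp v u) =≫ (z.map _ ≫ g)).trans (assoc _ _ _))
        (by
          refine (hn' _ _ (v ≫ u) h').trans ?_
          rw [Functor.map_comp, assoc, assoc]
          exact congrArg _ (hn' _ _ u h).symm))
      (fun {w i} u j b e h h' => comp_right_cancel hp α.mk'
        (by rw [hn, hn, glue_base, reassoc_of% e])
        (by
          refine (hn' _ _ _ h').trans (Eq.trans ?_ (hn' _ _ u h).symm)
          rw [← assoc, glue_can, assoc]))
    refine ⟨F, hF, hom_ext hp ?_ Q hQ fun {w i} u h => ?_⟩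
    · rw [Functor.map_comp, hF]
      exact hg
    · rw [← hn' _ _ u h, ← hF' u h, assoc, assoc]

end DescentDatum

end DescentTheory


section DescentTheory

universe v u v₁ u₁

variable {C : Type u} [Category.{v} C] {J : GrothendieckTopology C}
  {E : Type u₁} [Category.{v₁} E] {p : E ⥤ C}

namespace DescentDatum

lemma glueHom (hp : IsPrestack J p) {x y : DescentDatum J p} (φ : LocalHom J (proj J p) x y) :
    ∃! c : x ⟶ y, (proj J p).map c = φ.base ∧
      ∀ {z : DescentDatum J p} (a : z ⟶ x) (h : φ.sieve ((proj J p).map a)),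
        a ≫ c = φ.map a h := by
  refine existsUnique_of_exists_of_unique ?_ ?_
  · let f : x.U ⟶ y.U := φ.base
    let S : Sieve x.U := φ.sieve
    have hS : ∀ {z : E} {i : x.I} (u : z ⟶ x.obj i), S (p.map u ≫ x.map i) →
        φ.sieve ((proj J p).map ((unit J p).map u ≫ can x i)) := fun u h => by
      rw [Functor.map_comp]; exact h
    have hQ : S ⊓ (Sieve.ofArrows _ y.map).pullback f ∈ J x.U :=
      J.intersection_covering φ.mem (J.pullback_stable _ y.cover)
    obtain ⟨F, hF, hF'⟩ := exists_hom hp f _ hQ (fun _ _ h => h.2)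
      (fun u h => φ.map ((unit J p).map u ≫ can x _) (hS u h.1))
      (fun u h => by
        rw [φ.map_base, Functor.map_comp]
        exact assoc _ _ _)
      (fun v u h h' => by
        rw [← φ.map_comp _ _ _ (by
          rw [← assoc, ← Functor.map_comp]; exact hS _ h'.1)]
        congr 1
        rw [Functor.map_comp, assoc])
      (fun u j b w h h' => by
        congr 1
        exact glue_can _ _ _ _ _)
    refine ⟨F, hF, fun {z} a h => ?_⟩
    let b : z.U ⟶ x.U := (proj J p).map a
    refine hom_ext hp ?_ ((S ⊓ (Sieve.ofArrows _ y.map).pullback f ⊓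
      Sieve.ofArrows _ x.map).pullback b) (J.pullback_stable _ (J.intersection_covering hQ x.cover))
      fun {w i} u hu => ?_
    · rw [Functor.map_comp, hF, φ.map_base]
    · obtain ⟨hu₁, hu₂⟩ := hu
      obtain ⟨k, d, hd⟩ := x.exists_mid _ hu₂
      obtain ⟨m, hm, hm'⟩ := exists_eq_unit_can hp ((unit J p).map u ≫ can z i ≫ a) k d (by
        rw [hd, assoc, Functor.map_comp, Functor.map_comp]; rfl)
      have hs : (S ⊓ (Sieve.ofArrows _ y.map).pullback f) (p.map m ≫ x.map k) := by
        rw [hm, hd]; exact hu₁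
      have e₁ := hF' m hs
      rw [← reassoc_of% hm', e₁, ← φ.map_comp (can z i) a h (by
        have := φ.sieve.downward_closed h ((proj J p).map (can z i))
        rwa [← Functor.map_comp] at this), ← φ.map_comp ((unit J p).map u) (can z i ≫ a) _ (by
        rw [← hm']; exact hS _ hs.1)]
      congr 1
  · rintro c c' ⟨h₁, h₂⟩ ⟨h₁', h₂'⟩
    let S : Sieve x.U := φ.sieve
    refine hom_ext hp (h₁.trans h₁'.symm) S φ.mem fun {z i} u hu => ?_
    have hS : φ.sieve ((proj J p).map ((unit J p).map u ≫ can x i)) := by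
      rw [Functor.map_comp]; exact hu
    rw [← assoc, ← assoc, h₂ _ hS, h₂' _ hS]

lemma isPrestack (hp : IsPrestack J p) [HasPullbacks C] : IsPrestack J (proj J p) :=
  ⟨fibred hp, glueHom hp⟩

lemma exists_flatten_glue (hp : IsPrestack J p) (D : DescentDatum J (proj J p)) {z : E}
    {i : Σ i, (D.obj i).I} (u : z ⟶ (D.obj i.1).obj i.2) (j : Σ i, (D.obj i).I)
    (b : p.obj z ⟶ p.obj ((D.obj j.1).obj j.2))
    (w : (b ≫ (D.obj j.1).map j.2) ≫ D.map j.1 =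
      (proj J p).map ((unit J p).map u ≫ can (D.obj i.1) i.2) ≫ D.map i.1) :
    ∃ m : z ⟶ (D.obj j.1).obj j.2, p.map m = b ∧ (unit J p).map m ≫ can (D.obj j.1) j.2 =
      D.glue ((unit J p).map u ≫ can (D.obj i.1) i.2) j.1 (b ≫ (D.obj j.1).map j.2) w :=
  exists_eq_unit_can hp _ _ _ (D.glue_base (z := (unit J p).obj z)
    ((unit J p).map u ≫ can (D.obj i.1) i.2) j.1 (b ≫ (D.obj j.1).map j.2) w).symm

lemma flatten_condition (D : DescentDatum J (proj J p)) {z : E}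
    {i : Σ i, (D.obj i).I} (u : z ⟶ (D.obj i.1).obj i.2) {j : Σ i, (D.obj i).I}
    {b : p.obj z ⟶ p.obj ((D.obj j.1).obj j.2)}
    (w : b ≫ (D.obj j.1).map j.2 ≫ D.map j.1 = p.map u ≫ (D.obj i.1).map i.2 ≫ D.map i.1) :
    (b ≫ (D.obj j.1).map j.2) ≫ D.map j.1 =
      (proj J p).map ((unit J p).map u ≫ can (D.obj i.1) i.2) ≫ D.map i.1 := by
  rw [Functor.map_comp]
  exact (assoc _ _ _).trans (w.trans (assoc _ _ _).symm)

/-- The gluing morphisms of `flatten`. -/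
def flattenGlue (hp : IsPrestack J p) (D : DescentDatum J (proj J p)) {z : E}
    {i : Σ i, (D.obj i).I} (u : z ⟶ (D.obj i.1).obj i.2) (j : Σ i, (D.obj i).I)
    (b : p.obj z ⟶ p.obj ((D.obj j.1).obj j.2))
    (w : b ≫ (D.obj j.1).map j.2 ≫ D.map j.1 = p.map u ≫ (D.obj i.1).map i.2 ≫ D.map i.1) :
    z ⟶ (D.obj j.1).obj j.2 :=
  (exists_flatten_glue hp D u j b (D.flatten_condition u w)).choose

lemma map_flattenGlue (hp : IsPrestack J p) (D : DescentDatum J (proj J p)) {z : E}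
    {i : Σ i, (D.obj i).I} (u : z ⟶ (D.obj i.1).obj i.2) (j b w) :
    p.map (flattenGlue hp D u j b w) = b :=
  (exists_flatten_glue hp D u j b (D.flatten_condition u w)).choose_spec.1

lemma flattenGlue_can (hp : IsPrestack J p) (D : DescentDatum J (proj J p)) {z : E}
    {i : Σ i, (D.obj i).I} (u : z ⟶ (D.obj i.1).obj i.2) (j b w) :
    (unit J p).map (flattenGlue hp D u j b w) ≫ can (D.obj j.1) j.2 =
      D.glue ((unit J p).map u ≫ can (D.obj i.1) i.2) j.1 (b ≫ (D.obj j.1).map j.2)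
        (D.flatten_condition u w) :=
  (exists_flatten_glue hp D u j b (D.flatten_condition u w)).choose_spec.2

/-- A descent datum of descent data, as a descent datum. -/
def flatten (hp : IsPrestack J p) (D : DescentDatum J (proj J p)) : DescentDatum J p where
  U := D.U
  I := Σ i, (D.obj i).I
  obj i := (D.obj i.1).obj i.2
  map i := (D.obj i.1).map i.2 ≫ D.map i.1
  cover := by
    refine J.transitive D.cover _ fun V f hf => ?_
    obtain ⟨i, c, rfl⟩ := (Sieve.mem_ofArrows_iff _ _ _).1 hf
    rw [Sieve.pullback_comp]
    refine J.pullback_stable _ (J.superset_covering ?_ (D.obj i).cover)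
    intro W g hg
    obtain ⟨k, d, rfl⟩ := (Sieve.mem_ofArrows_iff _ _ _).1 hg
    refine (Sieve.mem_ofArrows_iff _ _ _).2 ⟨⟨i, k⟩, d, assoc _ _ _⟩
  glue u j b w := flattenGlue hp D u j b w
  glue_base u j b w := map_flattenGlue hp D u j b w
  glue_self {z i} u w := unit_can_injective hp (map_flattenGlue _ _ _ _ _ _) (by
    rw [flattenGlue_can]
    refine (D.glue_congr rfl ?_ _ rfl).trans (D.glue_self _ rfl)
    rw [Functor.map_comp]; rfl)
  glue_glue {z i} u j b w k c w' w'' := unit_can_injective hp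
    (by rw [map_flattenGlue, map_flattenGlue]) (by
      have e := flattenGlue_can hp D u j b w
      refine (flattenGlue_can _ _ _ _ _ _).trans (Eq.trans ?_ (flattenGlue_can _ _ _ _ _ _).symm)
      refine (D.glue_congr e rfl _ ?_).trans (D.glue_glue _ _ _ _ _ _ _ _)
      rw [← e]
      exact D.flatten_condition _ w')
  comp_glue {z' z i} v u j b w w' := unit_can_injective hp
    (by rw [map_flattenGlue, p.map_comp, map_flattenGlue]) (by
      refine (flattenGlue_can _ _ _ _ _ _).trans (Eq.trans ?_
        ((((Functor.map_comp _ _ _) =≫ (can (D.obj j.1) j.2)).trans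
          (assoc _ _ _)).trans
          (((unit J p).map v) ≫= (flattenGlue_can hp D u j b w))).symm)
      refine (D.glue_congr ?_ ?_ _ ?_).trans (D.comp_glue ((unit J p).map v) _ _ _ _ ?_)
      · rw [Functor.map_comp, assoc]
      · exact assoc _ _ _
      · rw [(proj J p).map_comp ((unit J p).map v), assoc, assoc,
          ← D.flatten_condition u w]
        rfl
      · rw [(proj J p).map_comp ((unit J p).map v), assoc, assoc,
          ← D.flatten_condition u w]
        rfl)

lemma exists_flatten_map (hp : IsPrestack J p) (D : DescentDatum J (proj J p)) (i : D.I) :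
    ∃ c : D.obj i ⟶ flatten hp D, (proj J p).map c = D.map i ∧ ∀ {z : E} {k : (D.obj i).I}
      (u : z ⟶ (D.obj i).obj k), (unit J p).map u ≫ can (D.obj i) k ≫ c =
        (unit J p).map u ≫ can (flatten hp D) ⟨i, k⟩ := by
  obtain ⟨F, hF, hF'⟩ := exists_hom hp (D := D.obj i) (D' := flatten hp D) (D.map i)
    (Sieve.ofArrows _ (D.obj i).map) (D.obj i).cover (by
      intro V f hf
      obtain ⟨k, d, rfl⟩ := (Sieve.mem_ofArrows_iff _ _ _).1 hf
      refine (Sieve.mem_ofArrows_iff _ _ _).2 ⟨⟨i, k⟩, d, assoc _ _ _⟩)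
    (fun {z k} u _ => (unit J p).map u ≫ can (flatten hp D) ⟨i, k⟩)
    (fun u _ => (proj J p).map_comp _ _)
    (fun v u _ _ => (((unit J p).map_comp v u) =≫ (can (flatten hp D) ⟨i, _⟩)).trans (assoc _ _ _))
    (fun {z k} u j b w _ _ => by
      have w' : b ≫ (D.obj i).map j ≫ D.map i = p.map u ≫ (D.obj i).map k ≫ D.map i := by grind
      refine Eq.trans ?_ (glue_can (flatten hp D) (i := ⟨i, k⟩) u ⟨i, j⟩ b w')
      congr 2
      refine unit_can_injective hp (((D.obj i).glue_base _ _ _ _).trans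
        (map_flattenGlue hp D (i := ⟨i, k⟩) u ⟨i, j⟩ b w').symm) ?_
      refine (glue_can _ _ _ _ _).trans (Eq.trans ?_ (flattenGlue_can hp D (i := ⟨i, k⟩) u ⟨i, j⟩ b
        w').symm)
      refine (D.glue_self _ rfl).symm.trans (D.glue_congr rfl ?_ _ _)
      rw [Functor.map_comp]
      exact w.symm)
  exact ⟨F, hF, fun u => hF' u (mem_ofArrows _ _ _)⟩

lemma flatten_map_glue (hp : IsPrestack J p) (D : DescentDatum J (proj J p))
    (c : ∀ i, D.obj i ⟶ flatten hp D) (hc : ∀ i, (proj J p).map (c i) = D.map i)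
    (hc' : ∀ i {z : E} {k : (D.obj i).I} (u : z ⟶ (D.obj i).obj k),
      (unit J p).map u ≫ can (D.obj i) k ≫ c i = (unit J p).map u ≫ can (flatten hp D) ⟨i, k⟩)
    {z : DescentDatum J p} {i : D.I} (u : z ⟶ D.obj i) (j b w) :
    D.glue u j b w ≫ c j = u ≫ c i := by
  let f : z.U ⟶ (D.obj i).U := (proj J p).map u
  let g : z.U ⟶ (D.obj j).U := b
  refine hom_ext hp ?_ ((Sieve.ofArrows _ (D.obj i).map).pullback f ⊓
    (Sieve.ofArrows _ (D.obj j).map).pullback g)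
    (J.intersection_covering (J.pullback_stable _ (D.obj i).cover)
      (J.pullback_stable _ (D.obj j).cover)) fun {t k} v hv => ?_
  · refine ((proj J p).map_comp _ _).trans (Eq.trans ?_ ((proj J p).map_comp _ _).symm)
    rw [glue_base, hc, hc]
    exact w
  · obtain ⟨h₁, h₂⟩ := hv
    obtain ⟨l, d, hd⟩ := (D.obj i).exists_mid _ h₁
    obtain ⟨l', d', hd'⟩ := (D.obj j).exists_mid _ h₂
    have hb : (proj J p).map ((unit J p).map v ≫ can z k ≫ u) = (p.map v ≫ z.map k) ≫ f := by
      rw [Functor.map_comp, Functor.map_comp, assoc]; rfl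
    obtain ⟨m, hm, hm'⟩ := exists_eq_unit_can hp ((unit J p).map v ≫ can z k ≫ u) l d
      (by rw [hd, hb])
    have hw : d' ≫ (D.obj j).map l' ≫ D.map j = p.map m ≫ (D.obj i).map l ≫ D.map i := by
      refine (assoc _ _ _).symm.trans ((hd' =≫ (D.map j)).trans ?_)
      refine Eq.trans ?_ (((hm ▸ hd) =≫ (D.map i)).symm.trans (assoc _ _ _))
      exact (assoc _ _ _).trans ((((p.map v ≫ z.map k)) ≫= w).trans
        (assoc _ _ _).symm)
    have e₁ := flattenGlue_can hp D (i := ⟨i, l⟩) m ⟨j, l'⟩ d' hw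
    have e₂ := glue_can (flatten hp D) (i := ⟨i, l⟩) m ⟨j, l'⟩ d' hw
    have hpv : (p.map v ≫ z.map k) ≫ b = d' ≫ (D.obj j).map l' := hd'.symm
    have e₃ : (unit J p).map v ≫ can z k ≫ D.glue u j b w =
        D.glue ((unit J p).map m ≫ can (D.obj i) l) j (d' ≫ (D.obj j).map l')
          (D.flatten_condition (i := ⟨i, l⟩) (j := ⟨j, l'⟩) m hw) := by
      rw [← assoc]
      refine (D.comp_glue ((unit J p).map v ≫ can z k) u j b w (by
        rw [Functor.map_comp, assoc, w, (proj J p).map_comp _ u,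
          (proj J p).map_comp _ (can z k), assoc ((proj J p).map _ ≫ _)])).symm.trans ?_
      refine D.glue_congr ?_ ?_ _ _
      · rw [hm', assoc]
      · rw [Functor.map_comp]; exact hpv
    rw [← reassoc_of% hm', reassoc_of% e₃, ← reassoc_of% e₁]
    refine (hc' j _).trans (Eq.trans ?_ (hc' i m).symm)
    exact e₂

theorem isStack (hp : IsPrestack J p) [HasPullbacks C] : IsStack J (proj J p) where
  fibred := fibred hp
  glueHom := glueHom hp
  effective D := by
    choose c hc hc' using exists_flatten_map hp D
    refine ⟨flatten hp D, Iso.refl _, c, fun i => ?_, fun u j b w =>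
      flatten_map_glue hp D c hc hc' u j b w⟩
    rw [hc]
    exact comp_id _

end DescentDatum

end DescentTheory


section DescentTheory

universe w v u v₁ u₁ v₂ u₂

variable {C : Type u} [Category.{v} C] {J : GrothendieckTopology C}
  {E : Type u₁} [Category.{v₁} E] {p : E ⥤ C}

namespace DescentDatum

lemma unit_faithful (hp : IsPrestack J p) {x y : E} {m m' : x ⟶ y}
    (h : (unit J p).map m = (unit J p).map m') : m = m' :=
  unit_can_injective hp (D := (unit J p).obj y) (j := PUnit.unit)
    (congrArg (proj J p).map h) (congrArg (· ≫ can _ _) h)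

lemma unit_full (hp : IsPrestack J p) {x y : E} (n : (unit J p).obj x ⟶ (unit J p).obj y) :
    ∃ m : x ⟶ y, (unit J p).map m = n := by
  obtain ⟨m, -, hm⟩ := exists_eq_unit_can hp n PUnit.unit ((proj J p).map n)
    (comp_id _)
  exact ⟨m, (comp_id _).symm.trans hm⟩

end DescentDatum

lemma IsFibredInGroupoids.exists_eq (hp : IsFibredInGroupoids p) (x : E) {V : C}
    (f : V ⟶ p.obj x) : ∃ (y : E) (h : p.obj y = V) (a : y ⟶ x), p.map a = eqToHom h ≫ f := by
  obtain ⟨y, a, h⟩ := hp.exists_lift x f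
  obtain rfl := IsHomLift.domain_eq p f a
  refine ⟨y, rfl, a, ?_⟩
  have := IsHomLift.fac p f a
  simp at this
  simp [this]

lemma IsFibredInGroupoids.mk' (h₁ : ∀ (x : E) {V : C} (f : V ⟶ p.obj x),
      ∃ (y : E) (h : p.obj y = V) (a : y ⟶ x), p.map a = eqToHom h ≫ f)
    (h₂ : ∀ {x y z : E} (a : y ⟶ x) (b : z ⟶ x) (g : p.obj z ⟶ p.obj y),
      g ≫ p.map a = p.map b → ∃! c : z ⟶ y, p.map c = g ∧ c ≫ a = b) : IsFibredInGroupoids p where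
  exists_lift x V f := by
    obtain ⟨y, rfl, a, ha⟩ := h₁ x f
    refine ⟨y, a, ?_⟩
    rw [eqToHom_refl, id_comp] at ha
    rw [← ha]
    infer_instance
  existsUnique_fac := h₂

/-- The canonical descent datum of a covering family of morphisms. -/
def DescentDatum.ofCover (hp : IsFibredInGroupoids p) (x : E) {I : Type} (y : I → E)
    (a : ∀ i, y i ⟶ x) (h : Sieve.ofArrows _ (fun i => p.map (a i)) ∈ J (p.obj x)) :
    DescentDatum J p where
  U := p.obj x
  I := I
  obj := y
  map i := p.map (a i)
  cover := h
  glue {z i} u j b w := (hp.fac (a j) (u ≫ a i) b (by rw [w, p.map_comp])).choose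
  glue_base {z i} u j b w :=
    (hp.fac (a j) (u ≫ a i) b (by rw [w, p.map_comp])).choose_spec.1
  glue_self {z i} u w := by
    have := (hp.fac (a i) (u ≫ a i) (p.map u) (by rw [p.map_comp])).choose_spec
    exact hp.cancel (a i) this.1 this.2
  glue_glue {z i} u j b w k c w' w'' := by
    have h₁ := (hp.fac (a j) (u ≫ a i) b (by rw [w, p.map_comp])).choose_spec
    have h₂ := (hp.fac (a k) (u ≫ a i) c (by rw [w'', p.map_comp])).choose_spec
    have h₃ := (hp.fac (a k) ((hp.fac (a j) (u ≫ a i) b (by rw [w, p.map_comp])).choose ≫ a j) c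
      (w'.trans (p.map_comp _ _).symm)).choose_spec
    exact hp.cancel (a k) (h₃.1.trans h₂.1.symm) (h₃.2.trans (h₁.2.trans h₂.2.symm))
  comp_glue {z' z i} v u j b w w' := by
    have h₁ := (hp.fac (a j) (u ≫ a i) b (by rw [w, p.map_comp])).choose_spec
    have h₂ := (hp.fac (a j) ((v ≫ u) ≫ a i) (p.map v ≫ b)
      (by rw [w', p.map_comp (v ≫ u)])).choose_spec
    refine hp.cancel (a j) (h₂.1.trans ?_) (h₂.2.trans ?_)
    · rw [p.map_comp, h₁.1]
    · rw [assoc, assoc, h₁.2]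

lemma DescentDatum.ofCover_glue_comp (hp : IsFibredInGroupoids p) (x : E) {I : Type} (y : I → E)
    (a : ∀ i, y i ⟶ x) (h : Sieve.ofArrows _ (fun i => p.map (a i)) ∈ J (p.obj x)) {z : E} {i : I}
    (u : z ⟶ y i) (j b w) : (ofCover hp x y a h).glue (i := i) u j b w ≫ a j = u ≫ a i :=
  (hp.fac (a j) (u ≫ a i) b (w.trans (p.map_comp _ _).symm)).choose_spec.2

lemma DescentDatum.exists_of_cover (hp : IsPrestack J p) [HasPullbacks C] (x : DescentDatum J p)
    {I : Type} (y : I → DescentDatum J p) (a : ∀ i, y i ⟶ x)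
    (h : Sieve.ofArrows _ (fun i => (proj J p).map (a i)) ∈ J x.U) :
    ∃ x' : DescentDatum J p, (∃ (e : (proj J p).obj x' = (proj J p).obj x) (H : x' ⟶ x),
      (proj J p).map H = eqToHom e) ∧ ∀ k : x'.I, ∃ i l, x'.obj k = (y i).obj l := by
  let D := ofCover (fibred hp) x y a h
  refine ⟨flatten hp D, ?_, fun k => ⟨k.1, k.2, rfl⟩⟩
  have hb : ∀ (i : I) (k : (y i).I), (proj J p).map (can (y i) k ≫ a i) =
      (y i).map k ≫ D.map i := fun i k => (proj J p).map_comp _ _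
  obtain ⟨F, hF, -⟩ := exists_hom hp (D := flatten hp D) (D' := x) (𝟙 x.U)
    ((Sieve.ofArrows _ x.map).pullback (𝟙 x.U)) (J.pullback_stable _ x.cover) le_rfl
    (fun {z k} u _ => (unit J p).map u ≫ can (y k.1) k.2 ≫ a k.1)
    (fun {z k} u _ => by
      refine ((proj J p).map_comp _ _).trans ?_
      exact (p.map u) ≫= ((hb k.1 k.2).trans (comp_id _).symm))
    (fun v u _ _ => by rw [Functor.map_comp, assoc])
    (fun {z k} u j b w _ _ => by
      have e := flattenGlue_can hp D (i := k) u j b w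
      refine (assoc _ _ _).symm.trans ((e =≫ (a j.1)).trans ?_)
      refine (ofCover_glue_comp (fibred hp) x y a h _ _ _ _).trans (assoc _ _ _))
  exact ⟨rfl, F, hF⟩

section Cover

variable {I : Type w} {y y' : E} {Y : I → E} (a : ∀ i, Y i ⟶ y)

lemma IsPrestack.hom_ext_cover [J.Subcanonical] (hp : IsPrestack J p)
    (hcov : Sieve.ofArrows _ (fun i => p.map (a i)) ∈ J (p.obj y)) {m m' : y ⟶ y'}
    (H : ∀ i, a i ≫ m = a i ≫ m') : m = m' := by
  refine hp.hom_ext ?_ _ hcov fun {z} b hb => ?_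
  · refine ((GrothendieckTopology.Subcanonical.isSheaf_of_isRepresentable
      (yoneda.obj (p.obj y'))).isSheafFor _ hcov).isSeparatedFor.ext fun V f hf => ?_
    obtain ⟨i⟩ := hf
    simpa using congrArg p.map (H i)
  · obtain ⟨i, c, hc⟩ := (Sieve.mem_ofArrows_iff _ _ _).1 hb
    obtain ⟨u, -, rfl⟩ := hp.fibred.fac (a i) b c hc.symm
    rw [assoc, H, assoc]

lemma IsPrestack.exists_glue_cover [J.Subcanonical] (hp : IsPrestack J p)
    (hcov : Sieve.ofArrows _ (fun i => p.map (a i)) ∈ J (p.obj y)) (m : ∀ i, Y i ⟶ y')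
    (H : ∀ {z : E} {i j : I} (u : z ⟶ Y i) (v : z ⟶ Y j), u ≫ a i = v ≫ a j →
      u ≫ m i = v ≫ m j) : ∃ c : y ⟶ y', ∀ i, a i ≫ c = m i := by
  obtain ⟨f, hf, -⟩ := (Presieve.isSheafFor_arrows_iff _ _).1
    ((GrothendieckTopology.Subcanonical.isSheaf_of_isRepresentable
      (yoneda.obj (p.obj y'))).isSheafFor _ hcov) (fun i => p.map (m i)) (by
      intro i j Z gi gj hg
      obtain ⟨z, e, u, hu⟩ := hp.fibred.lift (Y i) gi
      obtain ⟨v, hv, hv'⟩ := hp.fibred.fac (a j) (u ≫ a i) (e.hom ≫ gj) (by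
        rw [p.map_comp, hu, assoc, assoc, hg])
      have := congrArg p.map (H u v hv'.symm)
      rw [p.map_comp, p.map_comp, hu, hv, assoc, assoc, Iso.cancel_iso_hom_left]
        at this
      exact this)
  have K : ∀ (z : E) (b : z ⟶ y) (h : Sieve.ofArrows _ (fun i => p.map (a i)) (p.map b)),
      ∃ (i : I) (u : z ⟶ Y i), u ≫ a i = b := fun z b hb => by
    obtain ⟨i, c, hc⟩ := (Sieve.mem_ofArrows_iff _ _ _).1 hb
    obtain ⟨u, -, h⟩ := hp.fibred.fac (a i) b c hc.symm
    exact ⟨i, u, h⟩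
  choose i u hu using K
  let φ : LocalHom J p y y' :=
    { base := f
      sieve := _
      mem := hcov
      map := fun {z} b h => u z b h ≫ m (i z b h)
      map_base := fun {z} b h => by
        have : p.map (m (i z b h)) = p.map (a _) ≫ f := (hf _).symm
        rw [p.map_comp, this, ← p.map_comp_assoc, hu]
      map_comp := fun {w z} b c h h' => by
        rw [← assoc]
        refine H _ _ ?_
        rw [hu, assoc, hu] }
  obtain ⟨c, ⟨-, hc⟩, -⟩ := hp.glueHom φ
  refine ⟨c, fun j => ?_⟩
  have hj : φ.sieve (p.map (a j)) := Sieve.ofArrows_mk _ _ j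
  rw [hc (a j) hj]
  change u _ _ _ ≫ m _ = _
  rw [← id_comp (m j)]
  refine H _ _ ?_
  rw [hu, id_comp]

end Cover

end DescentTheory


section DescentTheory

universe w v u v₁ u₁ v₂ u₂

variable {C : Type u} [Category.{v} C] {J : GrothendieckTopology C}
  {E : Type u₁} [Category.{v₁} E] {p : E ⥤ C}

section FullSubcategory

variable (R : ObjectProperty E)

theorem IsStack.fullSubcategory (hp : IsStack J p)
    (h₁ : ∀ {x y : E} (_ : y ⟶ x), R x → ∃ (I : Type) (Y : I → E) (b : ∀ i, Y i ⟶ y),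
      (∀ i, R (Y i)) ∧ Sieve.ofArrows _ (fun i => p.map (b i)) ∈ J (p.obj y))
    (h₂ : ∀ (y : E) {I : Type} (Y : I → E) (b : ∀ i, Y i ⟶ y), (∀ i, R (Y i)) →
      Sieve.ofArrows _ (fun i => p.map (b i)) ∈ J (p.obj y) →
      ∃ y', R y' ∧ ∃ (e : p.obj y' = p.obj y) (H : y' ⟶ y), p.map H = eqToHom e) :
    IsStack J (R.ι ⋙ p) := by
  have key : ∀ (x y : E) (_ : y ⟶ x), R x → ∃ y', R y' ∧ ∃ (e : p.obj y' = p.obj y) (H : y' ⟶ y),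
      p.map H = eqToHom e := fun x y a hx => by
    obtain ⟨I, Y, b, hY, hb⟩ := h₁ a hx
    exact h₂ y Y b hY hb
  refine ⟨.mk' (fun x V f => ?_) (fun {x y z} a b g hg => ?_), fun {x y} φ => ?_, fun D => ?_⟩
  · obtain ⟨y, rfl, a, ha⟩ := hp.fibred.exists_eq x.obj f
    obtain ⟨y', hy', e, H, hH⟩ := key _ _ a x.property
    exact ⟨⟨y', hy'⟩, e, R.homMk (H ≫ a), by simp [hH, ha]⟩
  · obtain ⟨c, hc, huc⟩ := hp.fibred.existsUnique_fac a.hom b.hom g hg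
    refine ⟨R.homMk c, ⟨hc.1, by ext1; exact hc.2⟩, fun c' hc' => ?_⟩
    ext1
    exact huc c'.hom ⟨hc'.1, congrArg (·.hom) hc'.2⟩
  · have K : ∀ (z : E) (a : z ⟶ x.obj), ∃ z' : R.FullSubcategory, ∃ s : z'.obj ⟶ z, IsIso s :=
      fun z a => by
        obtain ⟨y', hy', e, H, hH⟩ := key _ _ a x.property
        have : IsIso (p.map H) := by rw [hH]; infer_instance
        exact ⟨⟨y', hy'⟩, H, hp.fibred.isIso H⟩
    choose z' s hs using K
    have hsv : ∀ {z : E} {a : z ⟶ x.obj} {t : E} (r : t ⟶ z), φ.sieve (p.map a) →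
        φ.sieve (p.map (r ≫ a)) := fun r h => by
      rw [p.map_comp]; exact φ.sieve.downward_closed h _
    let m : ∀ (z : E) (a : z ⟶ x.obj), φ.sieve (p.map a) → (z ⟶ y.obj) := fun z a h =>
      inv (s z a) ≫ (φ.map (R.homMk (s z a ≫ a) : z' z a ⟶ x) (hsv _ h)).hom
    have hm : ∀ (z : E) (a : z ⟶ x.obj) (h : φ.sieve (p.map a)) (t : R.FullSubcategory)
        (r : t.obj ⟶ z), r ≫ m z a h = (φ.map (R.homMk (r ≫ a) : t ⟶ x) (hsv _ h)).hom := by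
      intro z a h t r
      have := φ.map_comp (R.homMk (r ≫ inv (s z a)) : t ⟶ z' z a)
        (R.homMk (s z a ≫ a) : z' z a ⟶ x) (hsv _ h)
        (by simpa using hsv r h)
      have := congrArg (·.hom) this
      rw [← assoc r]
      refine Eq.trans this.symm ?_
      congr 2
      ext1
      simp
    let ψ : LocalHom J p x.obj y.obj :=
      { base := φ.base
        sieve := φ.sieve
        mem := φ.mem
        map := fun {z} a h => m z a h
        map_base := fun {z} a h => by
          rw [← cancel_epi (p.map (s z a)), ← p.map_comp, hm z a h]
          refine (φ.map_base _ _).trans ?_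
          simp
        map_comp := fun {t z} b a h h' => by
          refine (cancel_epi (s t (b ≫ a))).1 ((hm _ _ h' _ _).trans (Eq.trans ?_
            (assoc _ _ _)))
          refine Eq.trans ?_ (hm z a h _ _).symm
          congr 2
          ext1
          simp }
    obtain ⟨c, hc, huc⟩ := hp.glueHom ψ
    refine ⟨R.homMk c, ⟨hc.1, fun {z} a h => ?_⟩, fun c' hc' => ?_⟩
    · ext1
      refine (hc.2 a.hom h).trans ?_
      have := hm z.obj a.hom h z (𝟙 _)
      rw [id_comp] at this
      rw [show ψ.map a.hom h = m z.obj a.hom h from rfl, this]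
      congr 2
      ext1
      simp
    · ext1
      refine huc c'.hom ⟨hc'.1, fun {z} a h => ?_⟩
      rw [← cancel_epi (s z a), ← assoc]
      refine Eq.trans ?_ (hm z a h _ _).symm
      exact congrArg (·.hom) (hc'.2 (R.homMk (s z a ≫ a) : z' z a ⟶ x) (hsv _ h))
  · have K : ∀ (i : D.I) (z : E) (a : z ⟶ (D.obj i).obj), ∃ z' : R.FullSubcategory,
        ∃ s : z'.obj ⟶ z, IsIso s := fun i z a => by
      obtain ⟨y', hy', e, H, hH⟩ := key _ _ a (D.obj i).property
      have : IsIso (p.map H) := by rw [hH]; infer_instance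
      exact ⟨⟨y', hy'⟩, H, hp.fibred.isIso H⟩
    choose z' s hs using K
    have hw : ∀ {z t : E} {i : D.I} (u : z ⟶ (D.obj i).obj) (j : D.I)
        (b : p.obj z ⟶ p.obj (D.obj j).obj), b ≫ D.map j = p.map u ≫ D.map i → ∀ r : t ⟶ z,
        (p.map r ≫ b) ≫ D.map j = p.map (r ≫ u) ≫ D.map i := fun u j b w r => by
      rw [assoc, w, p.map_comp, assoc]
    have gc : ∀ {t : R.FullSubcategory} {i j : D.I} {u u' : t ⟶ D.obj i}
        {b b' : p.obj t.obj ⟶ p.obj (D.obj j).obj} (_ : u.hom = u'.hom) (_ : b = b') (w w'),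
        (D.glue u j b w).hom = (D.glue u' j b' w').hom := fun hu hb w w' =>
      congrArg (·.hom) (D.glue_congr (by ext1; exact hu) hb w w')
    let g : ∀ (z : E) (i : D.I) (u : z ⟶ (D.obj i).obj) (j : D.I)
        (b : p.obj z ⟶ p.obj (D.obj j).obj) (_ : b ≫ D.map j = p.map u ≫ D.map i),
        (z ⟶ (D.obj j).obj) := fun z i u j b w =>
      inv (s i z u) ≫ (D.glue (R.homMk (s i z u ≫ u) : z' i z u ⟶ D.obj i) j
        (p.map (s i z u) ≫ b) (hw u j b w _)).hom
    have hg : ∀ (z : E) (i : D.I) (u : z ⟶ (D.obj i).obj) (j : D.I)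
        (b : p.obj z ⟶ p.obj (D.obj j).obj) (w : b ≫ D.map j = p.map u ≫ D.map i)
        (t : R.FullSubcategory) (r : t.obj ⟶ z), r ≫ g z i u j b w =
          (D.glue (R.homMk (r ≫ u) : t ⟶ D.obj i) j (p.map r ≫ b) (hw u j b w r)).hom := by
      intro z i u j b w t r
      have := D.comp_glue (R.homMk (r ≫ inv (s i z u)) : t ⟶ z' i z u)
        (R.homMk (s i z u ≫ u) : z' i z u ⟶ D.obj i) j (p.map (s i z u) ≫ b) (hw u j b w _) (by
          have := hw u j b w r
          simpa using this)
      have := congrArg (·.hom) this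
      rw [← assoc r]
      refine Eq.trans this.symm ?_
      exact gc (by simp) (by simp) _ _
    let D' : DescentDatum J p :=
      { U := D.U
        I := D.I
        obj := fun i => (D.obj i).obj
        map := D.map
        cover := D.cover
        glue := fun {z i} u j b w => g z i u j b w
        glue_base := fun {z i} u j b w => by
          rw [← cancel_epi (p.map (s i z u)), ← p.map_comp, hg z i u j b w]
          exact D.glue_base _ _ _ _
        glue_self := fun {z i} u w => by
          refine (cancel_epi (s i z u)).1 ((hg z i u i _ w _ _).trans ?_)
          have := D.glue_self (R.homMk (s i z u ≫ u) : z' i z u ⟶ D.obj i) rfl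
          refine Eq.trans (gc rfl (by simp) _ rfl) (congrArg (·.hom) this)
        glue_glue := fun {z i} u j b w k c w' w'' => by
          refine (cancel_epi (s i z u)).1 ((hg _ _ _ _ _ w' _ _).trans (Eq.trans ?_
            (hg _ _ _ _ _ w'' _ _).symm))
          refine (gc ?_ rfl _ ?_).trans (congrArg (·.hom)
            (D.glue_glue (R.homMk (s i z u ≫ u) : z' i z u ⟶ D.obj i) j (p.map (s i z u) ≫ b)
              (hw u j b w _) k (p.map (s i z u) ≫ c) ?_ _))
          · exact hg _ _ _ _ _ w _ _
          · rw [D.glue_base]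
            exact (hw u k c w'' _).trans (hw u j b w (s i z u)).symm
          · rw [D.glue_base]
            exact (hw u k c w'' _).trans (hw u j b w (s i z u)).symm
        comp_glue := fun {t z i} v u j b w w' => by
          refine (cancel_epi (s i t (v ≫ u))).1 ((hg _ _ _ _ _ w' _ _).trans (Eq.trans ?_
            (assoc _ _ _)))
          exact (gc (by simp) (by simp) _ _).trans (hg _ _ _ _ _ w _ _).symm }
    obtain ⟨x, e, c, hc, hc'⟩ := hp.effective D'
    have hcov : Sieve.ofArrows _ (fun i => p.map (c i)) ∈ J (p.obj x) := by
      have := J.pullback_stable e.hom D.cover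
      refine J.superset_covering ?_ this
      intro V f hf
      obtain ⟨i, d, hd⟩ := (Sieve.mem_ofArrows_iff _ _ _).1 hf
      refine (Sieve.mem_ofArrows_iff _ _ _).2 ⟨i, d, ?_⟩
      rw [← cancel_mono e.hom, assoc, hc]
      exact hd
    obtain ⟨x', hx', e', H, hH⟩ := h₂ x _ c (fun i => (D.obj i).property) hcov
    have hHi : IsIso (p.map H) := by rw [hH]; infer_instance
    have := hp.fibred.isIso H
    refine ⟨⟨x', hx'⟩, eqToIso e' ≪≫ e, fun i => R.homMk (c i ≫ inv H), fun i => ?_,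
      fun {z i} u j b w => ?_⟩
    · have : p.map (inv H) ≫ eqToHom e' = 𝟙 _ := by rw [← hH, ← p.map_comp]; simp
      change p.map (c i ≫ inv H) ≫ eqToHom e' ≫ e.hom = _
      rw [p.map_comp, assoc, reassoc_of% this, hc]
    · ext1
      have := hc' u.hom j b w
      change (D.glue u j b w).hom ≫ c j ≫ inv H = u.hom ≫ c i ≫ inv H
      rw [← assoc, ← assoc, cancel_mono, ← this]
      have := hg z.obj i u.hom j b w z (𝟙 _)
      rw [id_comp] at this
      change _ = g z.obj i u.hom j b w ≫ c j
      rw [this]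
      exact (gc (by simp) (by simp) w _) =≫ (c j)

end FullSubcategory

theorem DescentDatum.isStack_fullSubcategory (hp : IsPrestack J p) [HasPullbacks C]
    (P : ObjectProperty E) (hP : ∀ x, P x → ∀ {V : C} (f : V ⟶ p.obj x),
      ∃ y, P y ∧ ∃ (e : p.obj y ≅ V) (a : y ⟶ x), p.map a = e.hom ≫ f)
    (R : ObjectProperty (DescentDatum J p)) (hR : ∀ D, R D ↔ ∀ i, P (D.obj i)) :
    IsStack J (R.ι ⋙ proj J p) := by
  refine (isStack hp).fullSubcategory R (fun {x y} a hx => ?_) fun y I Y b hY hb => ?_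
  · have hx := (hR _).1 hx
    let f : y.U ⟶ x.U := (proj J p).map a
    have K : ∀ i : x.I, ∃ z, P z ∧ ∃ (e : p.obj z ≅ pullback (x.map i) f) (a : z ⟶ x.obj i),
        p.map a = e.hom ≫ pullback.fst _ _ := fun i => hP _ (hx i) _
    choose z hz e c hc using K
    have K : ∀ i, ∃ d : (unit J p).obj (z i) ⟶ y, (proj J p).map d = (e i).hom ≫ pullback.snd _ _ ∧
        d ≫ a = (unit J p).map (c i) ≫ can x i := fun i => (fibred hp).fac a _ _ (by
      refine Eq.trans ?_ ((proj J p).map_comp _ _).symm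
      refine (assoc _ _ _).trans ?_
      refine (((e i).hom) ≫= (pullback.condition (f := x.map i) (g := f)).symm).trans ?_
      refine (assoc _ _ _).symm.trans ((hc i).symm =≫ (x.map i)))
    choose d hd _ using K
    refine ⟨x.I, _, d, fun i => (hR _).2 fun _ => hz i, ?_⟩
    refine J.superset_covering ?_ (x.factor_cover f)
    intro T t ht
    obtain ⟨i, s, hs⟩ := x.exists_mid _ ht
    refine (Sieve.mem_ofArrows_iff _ _ _).2 ⟨i, pullback.lift s t hs ≫ (e i).inv, ?_⟩
    rw [hd]
    exact ((assoc _ _ _).trans (((pullback.lift s t hs) ≫= ((e i).inv_hom_id_assoc _)).trans (pullback.lift_snd _ _ _))).symm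
  · obtain ⟨x', H, h⟩ := exists_of_cover hp y Y b hb
    refine ⟨x', (hR _).2 fun k => ?_, H⟩
    obtain ⟨i, l, e⟩ := h k
    rw [e]
    exact (hR _).1 (hY i) l

end DescentTheory


section DescentTheory

universe w v u v₁ u₁ v₂ u₂

variable {C : Type u} [Category.{v} C] {J : GrothendieckTopology C}
  {E : Type u₁} [Category.{v₁} E] {p : E ⥤ C}

lemma hom_ext_of_sieve [J.Subcanonical] {U V : C} {f g : U ⟶ V} {S : Sieve U} (hS : S ∈ J U)
    (h : ∀ {T : C} (t : T ⟶ U), S t → t ≫ f = t ≫ g) : f = g :=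
  ((GrothendieckTopology.Subcanonical.isSheaf_of_isRepresentable
    (yoneda.obj V)) S hS).isSeparatedFor.ext fun _ t ht => h t ht

lemma sieve_of_eq {U T : C} (S : Sieve U) {f g : T ⟶ U} (h : f = g) (hf : S g) : S f := h ▸ hf

lemma IsFibredInGroupoids.lift_sieve (hp : IsFibredInGroupoids p) {x : E} {T : C}
    (t : T ⟶ p.obj x) : ∃ (z : E) (e : p.obj z ≅ T) (a : z ⟶ x), p.map a = e.hom ≫ t := by
  obtain ⟨z, rfl, a, ha⟩ := hp.exists_eq x t
  exact ⟨z, Iso.refl _, a, by simpa using ha⟩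

lemma DescentDatum.cover_of_effective {D : DescentDatum J p} {x : E} (e : p.obj x ≅ D.U)
    (c : ∀ i, D.obj i ⟶ x) (hc : ∀ i, p.map (c i) ≫ e.hom = D.map i) :
    Sieve.ofArrows _ (fun i => p.map (c i)) ∈ J (p.obj x) := by
  refine J.superset_covering ?_ (J.pullback_stable e.hom D.cover)
  intro V f hf
  obtain ⟨i, d, hd⟩ := (Sieve.mem_ofArrows_iff _ _ _).1 hf
  refine (Sieve.mem_ofArrows_iff _ _ _).2 ⟨i, d, ?_⟩
  rw [← cancel_mono e.hom, assoc, hc]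
  exact hd

lemma IsPrestack.exists_glue_effective [J.Subcanonical] {Y : Type u₂} [Category.{v₂} Y]
    {q : Y ⥤ C} {F : E ⥤ Y} (hp : IsFibredInGroupoids (F ⋙ q)) (hq : IsPrestack J q)
    {D : DescentDatum J (F ⋙ q)} {x : E}
    (e : (F ⋙ q).obj x ≅ D.U) (c : ∀ i, D.obj i ⟶ x) (hc : ∀ i, (F ⋙ q).map (c i) ≫ e.hom = D.map i)
    (hc' : ∀ {z : E} {i : D.I} (u : z ⟶ D.obj i) (j b w), D.glue u j b w ≫ c j = u ≫ c i)
    {ξ : Y} (m : ∀ i, F.obj (D.obj i) ⟶ ξ)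
    (hm : ∀ {z : E} {i : D.I} (u : z ⟶ D.obj i) (j b w),
      F.map (D.glue u j b w) ≫ m j = F.map u ≫ m i) :
    ∃ k : F.obj x ⟶ ξ, ∀ i, F.map (c i) ≫ k = m i := by
  have hcov : Sieve.ofArrows _ (fun i => q.map (F.map (c i))) ∈ J (q.obj (F.obj x)) :=
    DescentDatum.cover_of_effective (p := F ⋙ q) e c hc
  refine hq.exists_glue_cover (fun i => F.map (c i)) hcov m
    fun {z i j} u v huv => ?_
  obtain ⟨z', s, a, ha⟩ := hp.lift_sieve (x := D.obj i) (q.map u)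
  obtain ⟨t, ht, hta⟩ := hq.fibred.fac u (F.map a) s.hom ha.symm
  have hti : IsIso (q.map t) := by rw [ht]; infer_instance
  have := hq.fibred.isIso t
  rw [← cancel_epi t, ← assoc, hta]
  have w : q.map (t ≫ v) ≫ D.map j = (F ⋙ q).map a ≫ D.map i := by
    have h1 : q.map (t ≫ v) ≫ q.map (F.map (c j)) = (F ⋙ q).map a ≫ q.map (F.map (c i)) := by
      change _ = q.map (F.map a) ≫ _
      rw [← q.map_comp, ← q.map_comp, assoc, ← huv, ← hta, assoc]
    have := h1 =≫ e.hom
    refine Eq.trans ((q.map (t ≫ v)) ≫= (hc j).symm) (Eq.trans ?_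
      (((F ⋙ q).map a) ≫= (hc i)))
    exact (assoc _ _ _).symm.trans (this.trans (assoc _ _ _))
  have hg := hm a j _ w
  rw [← hg, ← assoc]
  congr 1
  have hj : IsIso (𝟙 (q.obj z)) := inferInstance
  refine hq.fibred.cancel (F.map (c j)) ?_ ?_
  · exact D.glue_base a j _ w
  · rw [assoc, ← huv, ← assoc, hta, ← F.map_comp, ← F.map_comp, hc']

section CostructuredArrow

variable {Y : Type u₂} [Category.{v₂} Y] {q : Y ⥤ C} {F : E ⥤ Y}

theorem IsStack.costructuredArrow [J.Subcanonical] (hp : IsStack J (F ⋙ q)) (hq : IsPrestack J q)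
    (ξ : Y) : IsStack J (CostructuredArrow.proj F ξ ⋙ F ⋙ q) := by
  refine ⟨.mk' (fun t V f => ?_) (fun {t' t t''} a b g hg => ?_), fun {t t'} φ => ?_, fun D => ?_⟩
  · obtain ⟨x, rfl, a, ha⟩ := hp.fibred.exists_eq t.left f
    exact ⟨CostructuredArrow.mk (F.map a ≫ t.hom), rfl, CostructuredArrow.homMk a, ha⟩
  · obtain ⟨c, ⟨hc, hc'⟩, huc⟩ := hp.fibred.existsUnique_fac a.left b.left g hg
    refine ⟨CostructuredArrow.homMk c ?_, ⟨hc, by ext; exact hc'⟩, fun d hd => ?_⟩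
    · rw [← CostructuredArrow.w a, ← CostructuredArrow.w b, ← hc', F.map_comp, assoc]
    · ext
      exact huc d.left ⟨hd.1, congrArg (·.left) hd.2⟩
  · have hsv : ∀ {z : E} (a : z ⟶ t.left), φ.sieve ((F ⋙ q).map a) →
        φ.sieve ((CostructuredArrow.proj F ξ ⋙ F ⋙ q).map (CostructuredArrow.homMk a :
          CostructuredArrow.mk (F.map a ≫ t.hom) ⟶ t)) := fun a h => h
    let ψ : LocalHom J (F ⋙ q) t.left t'.left :=
      { base := φ.base
        sieve := φ.sieve
        mem := φ.mem
        map := fun {z} a h => (φ.map _ (hsv a h)).left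
        map_base := fun {z} a h => φ.map_base _ (hsv a h)
        map_comp := fun {w z} b a h h' => by
          let b' : CostructuredArrow.mk (F.map (b ≫ a) ≫ t.hom) ⟶
            CostructuredArrow.mk (F.map a ≫ t.hom) := CostructuredArrow.homMk b (by simp)
          exact congrArg (·.left) (φ.map_comp b' (CostructuredArrow.homMk a :
            CostructuredArrow.mk (F.map a ≫ t.hom) ⟶ t) (hsv a h) (hsv (b ≫ a) h')) }
    have hψ : ∀ (z : CostructuredArrow F ξ) (a : z ⟶ t) (h : φ.sieve ((F ⋙ q).map a.left)),
        (φ.map a h).left = ψ.map a.left h := by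
      intro z a h
      let b : z ⟶ CostructuredArrow.mk (F.map a.left ≫ t.hom) :=
        CostructuredArrow.homMk (𝟙 _) (by simp)
      have := congrArg (·.left) (φ.map_comp b (CostructuredArrow.homMk a.left :
            CostructuredArrow.mk (F.map a.left ≫ t.hom) ⟶ t) (hsv a.left h)
            (sieve_of_eq (U := q.obj (F.obj t.left)) φ.sieve
              (congrArg (F ⋙ q).map (id_comp a.left)) h))
      refine Eq.trans ?_ (this.trans (id_comp _))
      congr 2
      ext
      simp [b]
    obtain ⟨c, hc, huc⟩ := hp.glueHom ψ
    have w : F.map c ≫ t'.hom = t.hom := by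
      have hl : ∀ {z : E} (a : z ⟶ t.left) (h : φ.sieve ((F ⋙ q).map a)),
          F.map a ≫ F.map c ≫ t'.hom = F.map a ≫ t.hom := by
        intro z a h
        rw [← assoc, ← F.map_comp, hc.2 a h]
        exact CostructuredArrow.w (φ.map _ (hsv a h))
      refine hq.hom_ext (hom_ext_of_sieve (J := J) φ.mem fun {T} f hf => ?_) φ.sieve φ.mem
        fun {z} b hb => ?_
      · obtain ⟨z, rfl, a, ha⟩ := hp.fibred.exists_eq t.left f
        rw [eqToHom_refl, id_comp] at ha
        have := congrArg q.map (hl a (sieve_of_eq (U := q.obj (F.obj t.left)) φ.sieve ha hf))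
        rw [q.map_comp, q.map_comp (F.map a)] at this
        rw [← ha]
        exact this
      · obtain ⟨z', s, a, ha⟩ := hp.fibred.lift_sieve (x := t.left) (q.map b)
        obtain ⟨r, hr, hra⟩ := hq.fibred.fac b (F.map a) s.hom ha.symm
        have hti : IsIso (q.map r) := by rw [hr]; infer_instance
        have := hq.fibred.isIso r
        rw [← cancel_epi r, ← assoc, ← assoc r, hra]
        exact hl a (sieve_of_eq (U := q.obj (F.obj t.left)) φ.sieve ha
          (φ.sieve.downward_closed hb _))
    refine ⟨CostructuredArrow.homMk c w, ⟨hc.1, fun {z} a h => ?_⟩, fun d hd => ?_⟩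
    · ext
      exact (hc.2 a.left h).trans (hψ z a h).symm
    · ext
      refine huc d.left ⟨hd.1, fun {z} a h => ?_⟩
      exact congrArg (·.left) (hd.2 (CostructuredArrow.homMk a :
        CostructuredArrow.mk (F.map a ≫ t.hom) ⟶ t) (hsv a h))
  · let k : ∀ {z : E} {i : D.I} (u : z ⟶ (D.obj i).left),
        (CostructuredArrow.mk (F.map u ≫ (D.obj i).hom) ⟶ D.obj i) :=
      fun u => CostructuredArrow.homMk u
    have gc : ∀ {z z' : CostructuredArrow F ξ} {i j : D.I} (s : z ⟶ z') (u : z ⟶ D.obj i)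
        (u' : z' ⟶ D.obj i) {b : q.obj (F.obj z.left) ⟶ q.obj (F.obj (D.obj j).left)}
        {b' : q.obj (F.obj z'.left) ⟶ q.obj (F.obj (D.obj j).left)} (_ : s ≫ u' = u)
        (_ : q.map (F.map s.left) ≫ b' = b) (w w'),
        (D.glue u j b w).left = s.left ≫ (D.glue u' j b' w').left := by
      rintro z z' i j s u u' b b' rfl rfl w w'
      exact congrArg (·.left) (D.comp_glue s u' j b' w' w)
    have gc' : ∀ {z : CostructuredArrow F ξ} {i j : D.I} (u : z ⟶ D.obj i) {b} (w w'),
        (D.glue u j b w).left = (D.glue (k u.left) j b w').left := by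
      intro z i j u b w w'
      refine (gc (z' := CostructuredArrow.mk (F.map u.left ≫ (D.obj i).hom))
        (CostructuredArrow.homMk (𝟙 z.left) (by simp)) u (k u.left) (b' := b) ?_ ?_ w w').trans ?_
      · ext; simp [k]
      · exact (((F ⋙ q).map_id z.left) =≫ b).trans (id_comp _)
      · exact id_comp _
    let D' : DescentDatum J (F ⋙ q) :=
      { U := D.U
        I := D.I
        obj := fun i => (D.obj i).left
        map := D.map
        cover := D.cover
        glue := fun {z i} u j b w => (D.glue (k u) j b w).left
        glue_base := fun {z i} u j b w => D.glue_base (k u) j b w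
        glue_self := fun {z i} u w => congrArg (·.left) (D.glue_self (k u) w)
        glue_glue := fun {z i} u j b w l c w' w'' => by
          refine (gc' (D.glue (k u) j b w) ?_ ?_).symm.trans
            (congrArg (·.left) (D.glue_glue (k u) j b w l c ?_ w''))
          all_goals exact w'
        comp_glue := fun {t z i} v u j b w w' => by
          refine gc (z := CostructuredArrow.mk (F.map (v ≫ u) ≫ (D.obj i).hom))
            (z' := CostructuredArrow.mk (F.map u ≫ (D.obj i).hom))
            (CostructuredArrow.homMk v (by simp)) (k (v ≫ u)) (k u) (by ext; simp [k]) rfl _ _ }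
    obtain ⟨x, e, c, hc, hc'⟩ := hp.effective D'
    obtain ⟨h, hh⟩ := IsPrestack.exists_glue_effective hp.fibred hq e c hc hc'
      (fun i => (D.obj i).hom) (fun {z i} u j b w => CostructuredArrow.w (D.glue (k u) j b w))
    refine ⟨CostructuredArrow.mk h, e, fun i => CostructuredArrow.homMk (c i) (hh i), hc,
      fun {z i} u j b w => ?_⟩
    ext
    refine Eq.trans ((gc' u w w) =≫ (c j)) (hc' u.left j b w)

end CostructuredArrow

end DescentTheory


section IsomStack

universe v₁ u₁

variable {J : GrothendieckTopology Aff} {Y : Type u₁} [Category.{v₁} Y] {q : Y ⥤ Aff}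

namespace IsomObj

variable {ξ η : Y} {e : q.obj ξ ⟶ q.obj η}

/-- The restriction of an isomorphism. -/
def restrict (t : IsomObj q ξ η e) {z : Y} (a : z ⟶ t.z) : IsomObj q ξ η e :=
  ⟨z, a ≫ t.fst, a ≫ t.snd, by rw [q.map_comp, assoc, t.w, q.map_comp]⟩

/-- The restriction of an isomorphism, as a morphism. -/
def restrictHom (t : IsomObj q ξ η e) {z : Y} (a : z ⟶ t.z) : t.restrict a ⟶ t := ⟨a, rfl, rfl⟩

theorem isStack [J.Subcanonical] (hq : IsStack J q) : IsStack J (isomProj q ξ η e) := by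
  refine ⟨.mk' (fun t V f => ?_) (fun {t' t t''} a b g hg => ?_), fun {t t'} φ => ?_, fun D => ?_⟩
  · obtain ⟨x, rfl, a, ha⟩ := hq.fibred.exists_eq t.z f
    exact ⟨t.restrict a, rfl, t.restrictHom a, ha⟩
  · obtain ⟨c, ⟨hc, hc'⟩, huc⟩ := hq.fibred.existsUnique_fac a.hom b.hom g hg
    refine ⟨⟨c, ?_, ?_⟩, ⟨hc, IsomObj.Hom.ext hc'⟩, fun d hd => ?_⟩
    · rw [← a.fst, ← b.fst, ← hc', assoc]
    · rw [← a.snd, ← b.snd, ← hc', assoc]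
    · exact IsomObj.Hom.ext (huc d.hom ⟨hd.1, congrArg IsomObj.Hom.hom hd.2⟩)
  · have hsv : ∀ {z : Y} (a : z ⟶ t.z), φ.sieve (q.map a) →
        φ.sieve ((isomProj q ξ η e).map (t.restrictHom a)) := fun a h => h
    let ψ : LocalHom J q t.z t'.z :=
      { base := φ.base
        sieve := φ.sieve
        mem := φ.mem
        map := fun {z} a h => (φ.map _ (hsv a h)).hom
        map_base := fun {z} a h => φ.map_base _ (hsv a h)
        map_comp := fun {w z} b a h h' => by
          let b' : t.restrict (b ≫ a) ⟶ t.restrict a :=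
            ⟨b, (assoc _ _ _).symm, (assoc _ _ _).symm⟩
          exact congrArg IsomObj.Hom.hom (φ.map_comp b' (t.restrictHom a) (hsv a h)
            (hsv (b ≫ a) h')) }
    have hψ : ∀ (z : IsomObj q ξ η e) (a : z ⟶ t) (h : φ.sieve (q.map a.hom)),
        (φ.map a h).hom = ψ.map a.hom h := by
      intro z a h
      let b : z ⟶ t.restrict a.hom :=
        ⟨𝟙 _, (id_comp _).trans a.fst, (id_comp _).trans a.snd⟩
      have hb : b ≫ t.restrictHom a.hom = a := IsomObj.Hom.ext (id_comp _)
      have := congrArg IsomObj.Hom.hom (φ.map_comp b (t.restrictHom a.hom) (hsv a.hom h)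
            (sieve_of_eq (U := q.obj t.z) φ.sieve
              (congrArg q.map (id_comp a.hom)) h))
      refine Eq.trans ?_ (this.trans (id_comp _))
      congr 2
      exact hb.symm
    obtain ⟨c, hc, huc⟩ := hq.glueHom ψ
    have hl : ∀ {ζ : Y} (h : t.z ⟶ ζ) (h' : t'.z ⟶ ζ) (_ : ∀ {z : Y} (a : z ⟶ t.z)
        (ha : φ.sieve (q.map a)), (ψ.map a ha) ≫ h' = a ≫ h), c ≫ h' = h := by
      intro ζ h h' H
      refine hq.isPrestack.hom_ext (hom_ext_of_sieve (J := J) φ.mem fun {T} f hf => ?_) φ.sieve φ.mem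
        fun {z} b hb => ?_
      · obtain ⟨z, rfl, a, ha⟩ := hq.fibred.exists_eq t.z f
        rw [eqToHom_refl, id_comp] at ha
        have ha' := sieve_of_eq (U := q.obj t.z) φ.sieve ha hf
        have := congrArg q.map (H a ha')
        rw [← hc.2 a ha', assoc, q.map_comp, q.map_comp a h] at this
        rw [← ha]
        exact this
      · rw [← assoc, hc.2 b hb]
        exact H b hb
    refine ⟨⟨c, hl _ _ fun a ha => (φ.map _ (hsv a ha)).fst,
      hl _ _ fun a ha => (φ.map _ (hsv a ha)).snd⟩, ⟨hc.1, fun {z} a h => ?_⟩, fun d hd => ?_⟩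
    · exact IsomObj.Hom.ext ((hc.2 a.hom h).trans (hψ z a h).symm)
    · refine IsomObj.Hom.ext (huc d.hom ⟨hd.1, fun {z} a h => ?_⟩)
      exact congrArg IsomObj.Hom.hom (hd.2 (t.restrictHom a) (hsv a h))
  · let k : ∀ {z : Y} {i : D.I} (u : z ⟶ (D.obj i).z), ((D.obj i).restrict u ⟶ D.obj i) :=
      fun {z i} u => (D.obj i).restrictHom u
    have gc : ∀ {z z' : IsomObj q ξ η e} {i j : D.I} (s : z ⟶ z') (u : z ⟶ D.obj i)
        (u' : z' ⟶ D.obj i) {b : q.obj z.z ⟶ q.obj (D.obj j).z}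
        {b' : q.obj z'.z ⟶ q.obj (D.obj j).z} (_ : s ≫ u' = u)
        (_ : q.map s.hom ≫ b' = b) (w w'),
        (D.glue u j b w).hom = s.hom ≫ (D.glue u' j b' w').hom := by
      rintro z z' i j s u u' b b' rfl rfl w w'
      exact congrArg IsomObj.Hom.hom (D.comp_glue s u' j b' w' w)
    have gc' : ∀ {z : IsomObj q ξ η e} {i j : D.I} (u : z ⟶ D.obj i) {b} (w w'),
        (D.glue u j b w).hom = (D.glue (k u.hom) j b w').hom := by
      intro z i j u b w w'
      refine (gc (z' := (D.obj i).restrict u.hom)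
        (⟨𝟙 _, (id_comp _).trans u.fst, (id_comp _).trans u.snd⟩ :
          IsomObj.Hom z ((D.obj i).restrict u.hom)) u (k u.hom) (b' := b) ?_ ?_ w w').trans ?_
      · exact IsomObj.Hom.ext (id_comp _)
      · exact ((q.map_id z.z) =≫ b).trans (id_comp _)
      · exact id_comp _
    let D' : DescentDatum J q :=
      { U := D.U
        I := D.I
        obj := fun i => (D.obj i).z
        map := D.map
        cover := D.cover
        glue := fun {z i} u j b w => (D.glue (k u) j b w).hom
        glue_base := fun {z i} u j b w => D.glue_base (k u) j b w
        glue_self := fun {z i} u w => congrArg IsomObj.Hom.hom (D.glue_self (k u) w)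
        glue_glue := fun {z i} u j b w l c w' w'' => by
          refine (gc' (D.glue (k u) j b w) ?_ ?_).symm.trans
            (congrArg IsomObj.Hom.hom (D.glue_glue (k u) j b w l c ?_ w''))
          all_goals exact w'
        comp_glue := fun {t z i} v u j b w w' => by
          refine gc (z := (D.obj i).restrict (v ≫ u)) (z' := (D.obj i).restrict u)
            ⟨v, (assoc _ _ _).symm, (assoc _ _ _).symm⟩
            (k (v ≫ u)) (k u) (IsomObj.Hom.ext rfl) rfl _ _ }
    obtain ⟨x, s, c, hc, hc'⟩ := hq.effective D'
    obtain ⟨h, hh⟩ := IsPrestack.exists_glue_effective (F := 𝟭 Y) hq.fibred hq.isPrestack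
      (D := D') s c hc hc' (fun i => (D.obj i).fst) (fun {z i} u j b w => (D.glue (k u) j b w).fst)
    obtain ⟨h', hh'⟩ := IsPrestack.exists_glue_effective (F := 𝟭 Y) hq.fibred hq.isPrestack
      (D := D') s c hc hc' (fun i => (D.obj i).snd) (fun {z i} u j b w => (D.glue (k u) j b w).snd)
    have hw : q.map h ≫ e = q.map h' := by
      refine hom_ext_of_sieve (J := J) (DescentDatum.cover_of_effective (D := D') s c hc)
        fun {T} f hf => ?_
      obtain ⟨i, d, rfl⟩ := (Sieve.mem_ofArrows_iff _ _ _).1 hf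
      have h1 : q.map (c i) ≫ q.map h = q.map (D.obj i).fst :=
        (q.map_comp _ _).symm.trans (congrArg q.map (hh i))
      have h2 : q.map (c i) ≫ q.map h' = q.map (D.obj i).snd :=
        (q.map_comp _ _).symm.trans (congrArg q.map (hh' i))
      have h3 : q.map (c i) ≫ q.map h ≫ e = q.map (c i) ≫ q.map h' := by
        rw [← assoc, h1, h2, (D.obj i).w]
      exact (assoc _ _ _).trans ((d ≫= h3).trans (assoc _ _ _).symm)
    refine ⟨⟨x, h, h', hw⟩, s, fun i => ⟨c i, hh i, hh' i⟩, hc, fun {z i} u j b w => ?_⟩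
    exact IsomObj.Hom.ext (Eq.trans ((gc' u w w) =≫ (c j)) (hc' u.hom j b w))

end IsomObj

end IsomStack


/-! ### Affine schemes -/

instance : HasPullbacks Aff := hasPullbacks_opposite

/-- The morphism of affine schemes is étale. -/
def IsEt {V U : Aff} (f : V ⟶ U) : Prop := (ringMap f).Etale

lemma isEt_id (U : Aff) : IsEt (𝟙 U) := RingHom.Etale.containsIdentities _

lemma IsEt.comp {W V U : Aff} {g : W ⟶ V} {f : V ⟶ U} (hg : IsEt g) (hf : IsEt f) :
    IsEt (g ≫ f) := RingHom.Etale.stableUnderComposition _ _ hf hg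

lemma spec_map_left {V U : Aff} (f : V ⟶ U) :
    (spec.map f).left = Spec.map (CommRingCat.ofHom (ringMap f)) := rfl

lemma isEt_iff {V U : Aff} (f : V ⟶ U) : IsEt f ↔ Etale (spec.map f).left := by
  exact (HasRingHomProperty.Spec_iff (P := @Etale) (φ := CommRingCat.ofHom (ringMap f))).symm

instance : spec.Full := algSpec.instFull

instance : spec.Faithful := algSpec.instFaithful

instance : PreservesLimitsOfSize.{0, 0} spec := preservesLimitsOfSize_algSpec

lemma spec_map_comp_left {W V U : Aff} (g : W ⟶ V) (f : V ⟶ U) :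
    (spec.map (g ≫ f)).left = (spec.map g).left ≫ (spec.map f).left :=
  congrArg (·.left) (spec.map_comp g f)

lemma isPullback_spec {P X Y S : Aff} {a : P ⟶ X} {b : P ⟶ Y} {f : X ⟶ S} {g : Y ⟶ S}
    (h : IsPullback a b f g) :
    IsPullback (spec.map a).left (spec.map b).left (spec.map f).left (spec.map g).left :=
  (h.map spec).map (Over.forget _)

lemma IsEt.of_isPullback {P X Y S : Aff} {a : P ⟶ X} {b : P ⟶ Y} {f : X ⟶ S} {g : Y ⟶ S}
    (h : IsPullback a b f g) (hg : IsEt g) : IsEt a :=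
  (isEt_iff _).2 (MorphismProperty.of_isPullback (isPullback_spec h).flip ((isEt_iff _).1 hg))

lemma exists_point {P X Y S : Aff} {a : P ⟶ X} {b : P ⟶ Y} {f : X ⟶ S} {g : Y ⟶ S}
    (h : IsPullback a b f g) (x : PrimeSpectrum X.unop) (y : PrimeSpectrum Y.unop)
    (e : ptMap f x = ptMap g y) : ∃ z, ptMap a z = x ∧ ptMap b z = y := by
  have h' := isPullback_spec h
  obtain ⟨z, hx, hy⟩ := Scheme.Pullback.exists_preimage_pullback (f := (spec.map f).left)
    (g := (spec.map g).left) x y e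
  refine ⟨h'.isoPullback.inv z, ?_, ?_⟩
  · have := congrArg (fun k => k.base z) h'.isoPullback_inv_fst
    exact Eq.trans this hx
  · have := congrArg (fun k => k.base z) h'.isoPullback_inv_snd
    exact Eq.trans this hy

lemma IsEt.exists_square {V U T : Aff} {f : V ⟶ U} (hf : IsEt f) (g : T ⟶ U)
    (t : PrimeSpectrum T.unop) (v : PrimeSpectrum V.unop) (h : ptMap g t = ptMap f v) :
    ∃ (W : Aff) (a : W ⟶ T) (b : W ⟶ V) (w : PrimeSpectrum W.unop),
      IsEt a ∧ a ≫ g = b ≫ f ∧ ptMap a w = t ∧ ptMap b w = v := by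
  have hp := IsPullback.of_hasPullback g f
  obtain ⟨w, h1, h2⟩ := exists_point hp t v h
  exact ⟨_, pullback.fst g f, pullback.snd g f, w, hf.of_isPullback hp, hp.w, h1, h2⟩

lemma isEt_of_isIso {V U : Aff} (f : V ⟶ U) [IsIso f] : IsEt f := by
  have : IsIso (spec.map f).left := inferInstanceAs (IsIso ((Over.forget _).map (spec.map f)))
  exact (isEt_iff f).2 inferInstance

lemma ptMap_surjective_of_isIso {V U : Aff} (f : V ⟶ U) [IsIso f] :
    Function.Surjective (ptMap f) := fun x => ⟨ptMap (inv f) x, by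
      rw [← ptMap_comp, IsIso.inv_hom_id, ptMap_id]⟩

lemma IsEt.isOpenMap {V U : Aff} {f : V ⟶ U} (hf : IsEt f) : IsOpenMap (ptMap f) := by
  have := (isEt_iff f).1 hf
  have h : IsOpenMap (spec.map f).left.base := by
    have : Etale (Spec.map (CommRingCat.ofHom (ringMap f))) := this
    exact (Spec.map (CommRingCat.ofHom (ringMap f))).isOpenMap
  exact h

lemma mem_etale {U : Aff} {S : Sieve U} : S ∈ etale U ↔ ∀ x : PrimeSpectrum U.unop,
    ∃ (V : Aff) (f : V ⟶ U), S f ∧ IsEt f ∧ x ∈ Set.range (ptMap f) := Iff.rfl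

lemma mem_zariski {U : Aff} {S : Sieve U} : S ∈ zariski U ↔ ∀ x : PrimeSpectrum U.unop,
    ∃ (V : Aff) (f : V ⟶ U), S f ∧ (ringMap f).IsStandardOpenImmersion ∧
      x ∈ Set.range (ptMap f) := Iff.rfl

/-! ### The functor of points of a scheme is an étale sheaf -/

instance (V : Aff) : IsAffine (spec.obj V).left :=
  inferInstanceAs (IsAffine (Spec (CommRingCat.of V.unop)))

lemma exists_spec_over {X : Scheme.{0}} (V : Aff) [IsAffine X] (f : X ⟶ (spec.obj V).left) :
    ∃ (T : Aff) (i : (spec.obj T).left ≅ X) (g : T ⟶ V), i.hom ≫ f = (spec.map g).left := by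
  let Y : Sch := Over.mk (f ≫ (spec.obj V).hom)
  let φ : V.unop →+* Γ(X, ⊤) := (Scheme.ΓSpecIso (CommRingCat.of V.unop)).inv.hom |> fun ψ =>
    (f.appTop.hom).comp ψ
  let _ : Algebra (CommRingCat.of ℂ) Γ(X, ⊤) :=
    (φ.comp (algebraMap (CommRingCat.of ℂ) V.unop)).toAlgebra
  let T : Aff := op (CommAlgCat.of (CommRingCat.of ℂ) Γ(X, ⊤))
  let g : T ⟶ V := (CommAlgCat.ofHom { φ with commutes' := fun _ => rfl }).op
  refine ⟨T, X.isoSpec.symm, g, ?_⟩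
  have hg : (spec.map g).left = Spec.map f.appTop ≫
    Spec.map (Scheme.ΓSpecIso (CommRingCat.of V.unop)).inv := (Spec.map_comp _ _)
  rw [hg]
  refine (Iso.inv_comp_eq _).2 ?_
  have h := Scheme.isoSpec_hom_naturality f
  have h2 : (spec.obj V).left.isoSpec.hom = Spec.map (Scheme.ΓSpecIso (CommRingCat.of V.unop)).hom :=
    Scheme.isoSpec_Spec_hom _
  rw [h2] at h
  have h3 : Spec.map (Scheme.ΓSpecIso (CommRingCat.of V.unop)).hom ≫
    Spec.map (Scheme.ΓSpecIso (CommRingCat.of V.unop)).inv = 𝟙 _ := by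
    rw [← Spec.map_comp, Iso.inv_hom_id, Spec.map_id]
  refine Eq.trans ?_ (assoc _ _ _)
  refine Eq.trans ?_ (h.symm =≫ (Spec.map (Scheme.ΓSpecIso (CommRingCat.of V.unop)).inv))
  exact ((assoc _ _ _).trans ((f ≫= h3).trans (comp_id _))).symm

lemma pts_isSheaf (X : Sch) : Presieve.IsSheaf etale (pts.obj X) := by
  intro U S hS s hs
  choose V f hSf hf v hv using mem_etale.1 hS
  let g : ∀ x, (spec.obj (V x)).left ⟶ X.left := fun x => (s (f x) (hSf x)).down.left
  have hcov : Presieve.ofArrows _ (fun x => (spec.map (f x)).left) ∈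
      Scheme.fppfPrecoverage (spec.obj U).left := by
    rw [Scheme.fppfPrecoverage, Scheme.ofArrows_mem_precoverage_iff]
    refine ⟨fun x => ⟨x, v x, hv x⟩, fun x => ?_⟩
    have := (isEt_iff _).1 (hf x)
    exact ⟨inferInstance, inferInstance⟩
  have hcov' := Precoverage.generate_mem_toGrothendieck hcov
  have hsh := (GrothendieckTopology.Subcanonical.isSheaf_of_isRepresentable
    (J := Scheme.fppfTopology) (yoneda.obj X.left)).isSheafFor _ hcov'
  have hcomp : ∀ {T : Aff} {x y} (a : T ⟶ V x) (b : T ⟶ V y), a ≫ f x = b ≫ f y →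
      (spec.map a).left ≫ g x = (spec.map b).left ≫ g y := fun a b h =>
    congrArg (fun k => k.down.left) (hs a b (hSf _) (hSf _) h)
  obtain ⟨c, hc, huc⟩ := (Presieve.isSheafFor_arrows_iff _ _).1 hsh g (by
    intro x y Z a b hab
    refine Z.affineCover.hom_ext _ _ fun i => ?_
    obtain ⟨T, j, a', ha'⟩ := exists_spec_over (V x) (Z.affineCover.f i ≫ a)
    obtain ⟨T', j', b', hb'⟩ := exists_spec_over (V y) (Z.affineCover.f i ≫ b)
    have hab' : (j.hom ≫ Z.affineCover.f i ≫ a) ≫ (spec.map (f x)).left =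
        (j.hom ≫ Z.affineCover.f i ≫ b) ≫ (spec.map (f y)).left := by
      simp only [assoc]
      exact congrArg (fun k => j.hom ≫ Z.affineCover.f i ≫ k) hab
    have hov : (j.hom ≫ Z.affineCover.f i ≫ b) ≫ (spec.obj (V y)).hom = (spec.obj T).hom := by
      rw [← Over.w (spec.map (f y)), ← assoc, ← hab', assoc, Over.w, ha', Over.w]
    let b'' : spec.obj T ⟶ spec.obj (V y) := Over.homMk _ hov
    obtain ⟨b₁, hb₁⟩ := spec.map_surjective b''
    have hb₂ : (spec.map b₁).left = j.hom ≫ Z.affineCover.f i ≫ b := by rw [hb₁]; rfl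
    have := hcomp a' b₁ (by
      apply spec.map_injective
      ext1
      rw [spec.map_comp, spec.map_comp, Over.comp_left, Over.comp_left, hb₂, ← ha']
      exact hab')
    rw [← ha', hb₂] at this
    simp only [assoc, Iso.cancel_iso_hom_left] at this
    exact this)
  have hext : ∀ {T : Aff} (t : T ⟶ U) {d d' : (spec.obj T).left ⟶ X.left},
      (∀ {T' : Aff} (t' : T' ⟶ T) (x) (k : T' ⟶ V x), t' ≫ t = k ≫ f x →
        (spec.map t').left ≫ d = (spec.map t').left ≫ d') → d = d' := by
    intro T t d d' H
    have hcov₂ : Presieve.ofArrows _ (fun x => (spec.map (pullback.fst t (f x))).left) ∈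
        Scheme.fppfPrecoverage (spec.obj T).left := by
      rw [Scheme.fppfPrecoverage, Scheme.ofArrows_mem_precoverage_iff]
      refine ⟨fun y => ?_, fun x => ?_⟩
      · obtain ⟨w, hw, -⟩ := exists_point (IsPullback.of_hasPullback t (f (ptMap t y))) y
          (v _) (hv _).symm
        exact ⟨_, w, hw⟩
      · have := (isEt_iff _).1 ((hf x).of_isPullback (IsPullback.of_hasPullback t (f x)))
        exact ⟨inferInstance, inferInstance⟩
    refine ((GrothendieckTopology.Subcanonical.isSheaf_of_isRepresentable
      (J := Scheme.fppfTopology) (yoneda.obj X.left)).isSheafFor _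
        (Precoverage.generate_mem_toGrothendieck hcov₂)).isSeparatedFor.ext ?_
    rintro _ _ ⟨x⟩
    exact H _ x _ pullback.condition
  have hover : c ≫ X.hom = (spec.obj U).hom := by
    have hcov'' := (GrothendieckTopology.Subcanonical.isSheaf_of_isRepresentable
      (J := Scheme.fppfTopology) (yoneda.obj (Spec (CommRingCat.of ℂ)))).isSheafFor _ hcov'
    refine hcov''.isSeparatedFor.ext ?_
    rintro _ _ ⟨x⟩
    have h1 : (spec.map (f x)).left ≫ c = g x := hc x
    have h2 : g x ≫ X.hom = _ := Over.w (s (f x) (hSf x)).down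
    have h3 : (spec.map (f x)).left ≫ (spec.obj U).hom = _ := Over.w (spec.map (f x))
    exact (assoc _ _ _).symm.trans ((congrArg (· ≫ X.hom) h1).trans (h2.trans h3.symm))
  refine ⟨ULift.up (Over.homMk c hover), fun T t ht => ?_, fun d hd => ?_⟩
  · apply ULift.ext
    apply Over.OverMorphism.ext
    refine hext t fun {T'} t' x k h => ?_
    have h1 : (spec.map k).left ≫ g x = (spec.map t').left ≫ (s t ht).down.left :=
      congrArg (fun k => k.down.left) (hs k t' (hSf _) ht h.symm)
    refine Eq.trans ?_ h1
    have h2 : (spec.map (f x)).left ≫ c = g x := hc x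
    rw [← h2, ← assoc, ← spec_map_comp_left, ← h, spec_map_comp_left, assoc]
    rfl
  · apply ULift.ext
    apply Over.OverMorphism.ext
    exact huc _ fun x => congrArg (fun k => k.down.left) (hd (f x) (hSf x))

instance : etale.Subcanonical := by
  refine GrothendieckTopology.Subcanonical.of_isSheaf_yoneda_obj _ fun U => ?_
  let e : yoneda.obj U ⋙ uliftFunctor.{1} ≅ pts.obj (spec.obj U) := NatIso.ofComponents
    (fun T => (Equiv.ulift.trans
      ((Functor.FullyFaithful.ofFullyFaithful spec).homEquiv.trans Equiv.ulift.symm)).toIso)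
    (fun {T T'} f => by
      ext a
      exact congrArg ULift.up (spec.map_comp f.unop a.down))
  exact (Presieve.isSheaf_comp_uliftFunctor_iff (P := yoneda.obj U) etale).1
    (Presieve.isSheaf_iso etale e.symm (pts_isSheaf (spec.obj U)))


section EtaleLocal

universe v₁ u₁ w

lemma exists_section {G : Affᵒᵖ ⥤ Type w} (hG : Presieve.IsSheaf etale G) {U : Aff}
    (Pr : ∀ {V : Aff} (_ : V ⟶ U), G.obj (op V) → Prop)
    (stab : ∀ {V W : Aff} (g : W ⟶ V) (f : V ⟶ U) (s : G.obj (op V)), Pr f s →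
      Pr (g ≫ f) (G.map g.op s))
    (uniq : ∀ {V : Aff} (f : V ⟶ U) (s s' : G.obj (op V)), Pr f s → Pr f s' → s = s')
    (loc : ∀ x : PrimeSpectrum U.unop, ∃ (V : Aff) (f : V ⟶ U), IsEt f ∧
      x ∈ Set.range (ptMap f) ∧ ∃ s, Pr f s) :
    ∃ s : G.obj (op U), ∀ {V : Aff} (f : V ⟶ U) (s' : G.obj (op V)), Pr f s' →
      G.map f.op s = s' := by
  let S : Sieve U :=
    { arrows := fun V f => ∃ s, Pr f s
      downward_closed := by
        rintro V W f ⟨s, hs⟩ g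
        exact ⟨_, stab g f s hs⟩ }
  have hS : S ∈ etale U := fun x => by
    obtain ⟨V, f, hf, hx, hs⟩ := loc x
    exact ⟨V, f, hs, hf, hx⟩
  obtain ⟨t, ht, -⟩ := hG S hS (fun V f hf => hf.choose) (by
    intro V₁ V₂ Z g₁ g₂ f₁ f₂ h₁ h₂ e
    refine uniq (g₁ ≫ f₁) _ _ (stab _ _ _ h₁.choose_spec) ?_
    have := stab g₂ f₂ _ h₂.choose_spec
    rw [← e] at this
    exact this)
  refine ⟨t, fun {V} f s' h => (ht f ⟨s', h⟩).trans ?_⟩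
  grind

lemma section_ext {G : Affᵒᵖ ⥤ Type w} (hG : Presieve.IsSheaf etale G) {U : Aff}
    {s s' : G.obj (op U)} (h : ∀ x : PrimeSpectrum U.unop, ∃ (V : Aff) (f : V ⟶ U), IsEt f ∧
      x ∈ Set.range (ptMap f) ∧ G.map f.op s = G.map f.op s') : s = s' := by
  let S : Sieve U :=
    { arrows := fun V f => G.map f.op s = G.map f.op s'
      downward_closed := by
        intro V W f hs g
        rw [op_comp, Functor.map_comp]
        exact congrArg (G.map g.op) hs }
  have hS : S ∈ etale U := fun x => by
    obtain ⟨V, f, hf, hx, hs⟩ := h x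
    exact ⟨V, f, hs, hf, hx⟩
  exact (hG S hS).isSeparatedFor.ext fun V f hf => hf

variable {Y : Type u₁} [Category.{v₁} Y] {q : Y ⥤ Aff}

lemma exists_nbhd (hq : IsFibredInGroupoids q) (y : Y) {V : Aff} (f : V ⟶ q.obj y) (hf : IsEt f)
    {x : PrimeSpectrum (q.obj y).unop} (hx : x ∈ Set.range (ptMap f)) :
    ∃ (z : Y) (i : q.obj z ≅ V) (e : z ⟶ y), q.map e = i.hom ≫ f ∧ IsEt (q.map e) ∧
      x ∈ Set.range (ptMap (q.map e)) := by
  obtain ⟨z, i, e, he⟩ := hq.lift_sieve f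
  refine ⟨z, i, e, he, ?_, ?_⟩
  · rw [he]; exact (isEt_of_isIso _).comp hf
  · obtain ⟨v, rfl⟩ := hx
    obtain ⟨w, rfl⟩ := ptMap_surjective_of_isIso i.hom v
    exact ⟨w, by rw [he]; rfl⟩

lemma IsPrestack.exists_hom (hq : IsPrestack etale q) {y y' : Y} (f : q.obj y ⟶ q.obj y')
    (Pr : ∀ {z : Y} (_ : z ⟶ y) (_ : z ⟶ y'), Prop)
    (base : ∀ {z : Y} (e : z ⟶ y) (m : z ⟶ y'), Pr e m → q.map m = q.map e ≫ f)
    (stab : ∀ {z w : Y} (k : w ⟶ z) (e : z ⟶ y) (m : z ⟶ y'), Pr e m → Pr (k ≫ e) (k ≫ m))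
    (uniq : ∀ {z : Y} (e : z ⟶ y) (m m' : z ⟶ y'), Pr e m → Pr e m' → m = m')
    (loc : ∀ x : PrimeSpectrum (q.obj y).unop, ∃ (z : Y) (e : z ⟶ y), IsEt (q.map e) ∧
      x ∈ Set.range (ptMap (q.map e)) ∧ ∃ m, Pr e m) :
    ∃ c : y ⟶ y', q.map c = f ∧ ∀ {z : Y} (e : z ⟶ y) (m : z ⟶ y'), Pr e m → e ≫ c = m := by
  let S : Sieve (q.obj y) :=
    { arrows := fun V g => ∃ (z : Y) (e : z ⟶ y) (m : z ⟶ y') (k : V ⟶ q.obj z), Pr e m ∧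
        k ≫ q.map e = g
      downward_closed := by
        rintro V W f ⟨z, e, m, k, h, rfl⟩ g
        exact ⟨z, e, m, g ≫ k, h, assoc _ _ _⟩ }
  have hS : S ∈ etale (q.obj y) := fun x => by
    obtain ⟨z, e, he, hx, m, hm⟩ := loc x
    exact ⟨_, q.map e, ⟨z, e, m, 𝟙 _, hm, id_comp _⟩, he, hx⟩
  have K : ∀ {z : Y} (e : z ⟶ y), S (q.map e) → ∃ m, Pr e m := by
    rintro z e ⟨z', e', m, k, h, hk⟩
    obtain ⟨d, -, hd⟩ := hq.fibred.fac e' e k hk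
    exact ⟨d ≫ m, hd ▸ stab d e' m h⟩
  let φ : LocalHom etale q y y' :=
    { base := f
      sieve := S
      mem := hS
      map := fun {z} e h => (K e h).choose
      map_base := fun {z} e h => base e _ (K e h).choose_spec
      map_comp := fun {w z} b e h h' =>
        uniq _ _ _ (K (b ≫ e) h').choose_spec (stab b e _ (K e h).choose_spec) }
  obtain ⟨c, hc, -⟩ := hq.glueHom φ
  refine ⟨c, hc.1, fun {z} e m hm => ?_⟩
  have he : S (q.map e) := ⟨z, e, m, 𝟙 _, hm, id_comp _⟩
  grind

lemma IsPrestack.hom_ext_local (hq : IsPrestack etale q) {y y' : Y} {m m' : y ⟶ y'}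
    (h : ∀ x : PrimeSpectrum (q.obj y).unop, ∃ (z : Y) (e : z ⟶ y), IsEt (q.map e) ∧
      x ∈ Set.range (ptMap (q.map e)) ∧ e ≫ m = e ≫ m') : m = m' := by
  choose z e he hx h using h
  refine hq.hom_ext_cover (J := etale) e ?_ h
  intro x
  exact ⟨_, q.map (e x), Sieve.ofArrows_mk _ _ x, he x, hx x⟩

end EtaleLocal

section Represent

universe v₁

variable {Y : Type 1} [Category.{v₁} Y] {q : Y ⥤ Aff} (hq : IsFibredInGroupoids q)

/-- Points of `Y` with values in an affine scheme. -/
structure PrePoint (q : Y ⥤ Aff) (T : Aff) where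
  y : Y
  i : T ⟶ q.obj y

include hq in
lemma PrePoint.rel_equivalence (T : Aff) : Equivalence (fun a b : PrePoint q T =>
    ∃ (z : Y) (j : T ⟶ q.obj z) (g : z ⟶ a.y) (g' : z ⟶ b.y),
      j ≫ q.map g = a.i ∧ j ≫ q.map g' = b.i) where
  refl a := ⟨a.y, a.i, 𝟙 _, 𝟙 _, by simp, by simp⟩
  symm := by
    grind
  trans := by
    rintro a b c ⟨z, j, g, g', h, h'⟩ ⟨z₂, j₂, g₂, g₂', h₂, h₂'⟩
    obtain ⟨z₃, e, k, hk⟩ := hq.lift_sieve j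
    obtain ⟨l, hl, hl'⟩ := hq.fac g₂ (k ≫ g') (e.hom ≫ j₂) (by
      rw [assoc, h₂, q.map_comp, hk, assoc, h'])
    refine ⟨z₃, e.inv, k ≫ g, l ≫ g₂', ?_, ?_⟩
    · simp [*]
    · simp [*]

/-- The presheaf of isomorphism classes of objects. -/
def isoClasses : PSpace where
  obj T := Quotient ⟨_, PrePoint.rel_equivalence hq T.unop⟩
  map {T T'} f := TypeCat.ofHom (Quotient.map (fun a => ⟨a.y, f.unop ≫ a.i⟩) (by
    rintro a b ⟨z, j, g, g', h, h'⟩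
    exact ⟨z, f.unop ≫ j, g, g', by simp [h], by simp [h']⟩))
  map_id T := by
    ext x
    obtain ⟨a, rfl⟩ := Quotient.exists_rep x
    refine congrArg (Quotient.mk _) ?_
    simp
  map_comp f g := by
    ext x
    obtain ⟨a, rfl⟩ := Quotient.exists_rep x
    refine congrArg (Quotient.mk _) ?_
    simp

namespace isoClasses

/-- The class of an object, restricted along a morphism. -/
def mk {T : Aff} (y : Y) (i : T ⟶ q.obj y) : (isoClasses hq).obj (op T) := Quotient.mk _ ⟨y, i⟩

lemma map_mk {T T' : Aff} (f : T' ⟶ T) (y : Y) (i : T ⟶ q.obj y) :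
    (isoClasses hq).map f.op (mk hq y i) = mk hq y (f ≫ i) := rfl

lemma mk_eq_iff {w y y' : Y} (a : w ⟶ y) (k : q.obj w ⟶ q.obj y') :
    mk hq y (q.map a) = mk hq y' k ↔ ∃ b : w ⟶ y', q.map b = k := by
  constructor
  · intro h
    obtain ⟨z, j, g, g', h, h'⟩ := Quotient.exact h
    obtain ⟨c, hc, -⟩ := hq.fac g a j h
    exact ⟨c ≫ g', by rw [q.map_comp, hc, h']⟩
  · rintro ⟨b, rfl⟩
    exact Quotient.sound ⟨w, 𝟙 _, a, b, id_comp _, id_comp _⟩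

lemma mk_comp {T : Aff} {w y : Y} (a : w ⟶ y) (k : T ⟶ q.obj w) :
    mk hq y (k ≫ q.map a) = mk hq w k :=
  Quotient.sound ⟨w, k, a, 𝟙 _, rfl, by simp⟩

lemma exists_mk {T : Aff} (x : (isoClasses hq).obj (op T)) :
    ∃ (y : Y) (i : T ≅ q.obj y), x = mk hq y i.hom := by
  obtain ⟨⟨y, i⟩, rfl⟩ := Quotient.exists_rep x
  obtain ⟨z, e, a, ha⟩ := hq.lift_sieve i
  refine ⟨z, e.symm, ?_⟩
  refine Eq.trans ?_ (mk_comp hq a e.inv)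
  rw [ha, e.inv_hom_id_assoc]
  rfl

variable (hs : IsStack etale q)
  (faithful : ∀ {y y' : Y} (g g' : y ⟶ y'), q.map g = q.map g' → g = g')

include faithful in
lemma isSeparated {T : Aff} {s s' : (isoClasses hs.fibred).obj (op T)}
    (h : ∀ x : PrimeSpectrum T.unop, ∃ (V : Aff) (f : V ⟶ T), IsEt f ∧
      x ∈ Set.range (ptMap f) ∧ (isoClasses hs.fibred).map f.op s =
        (isoClasses hs.fibred).map f.op s') : s = s' := by
  obtain ⟨y, i, rfl⟩ := exists_mk _ s
  obtain ⟨y', i', rfl⟩ := exists_mk _ s'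
  obtain ⟨c, hc, -⟩ := hs.isPrestack.exists_hom (i.inv ≫ i'.hom)
    (fun {z} e m => q.map m = q.map e ≫ i.inv ≫ i'.hom) (fun _ _ h => h)
    (fun k e m h => by rw [q.map_comp, q.map_comp, h, assoc])
    (fun e m m' h h' => faithful _ _ (h.trans h'.symm)) (fun x => by
      obtain ⟨V, f, hf, hx, hV⟩ := h (ptMap i.inv x)
      obtain ⟨W, a, b, w, ha, hab, hw, -⟩ := hf.exists_square i.inv x hx.choose hx.choose_spec.symm
      obtain ⟨z, j, e, he, hez, hzx⟩ := exists_nbhd hs.fibred y a ha ⟨w, hw⟩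
      refine ⟨z, e, hez, hzx, ?_⟩
      refine (mk_eq_iff hs.fibred e _).1 ?_
      have := congrArg ((isoClasses hs.fibred).map (j.hom ≫ b).op) hV
      rw [map_mk, map_mk, map_mk, map_mk] at this
      have h2 : (j.hom ≫ b) ≫ f = q.map e ≫ i.inv := by
        rw [he, assoc, assoc, hab]
      rw [← assoc, h2, ← assoc (j.hom ≫ b), h2] at this
      simpa using this)
  have := mk_comp hs.fibred c i.hom
  grind

include faithful in
theorem isSheaf : Presieve.IsSheaf etale (isoClasses hs.fibred) := by
  intro T S hS s hcomp
  have sep : ∀ {T : Aff} {s s' : (isoClasses hs.fibred).obj (op T)}, _ → s = s' :=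
    isSeparated hs faithful
  choose V f hSf hf v hv using mem_etale.1 hS
  choose y e he using fun x => exists_mk hs.fibred (s (f x) (hSf x))
  have hc : ∀ {z : Y} {i j} (u : z ⟶ y i) (b : q.obj z ⟶ q.obj (y j)),
      b ≫ (e j).inv ≫ f j = q.map u ≫ (e i).inv ≫ f i → ∃ m : z ⟶ y j, q.map m = b := by
    intro z i j u b w
    refine (mk_eq_iff hs.fibred u b).1 ?_
    have := hcomp (q.map u ≫ (e i).inv) (b ≫ (e j).inv) (hSf i) (hSf j) (by simpa using w.symm)
    rw [he, he, map_mk, map_mk] at this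
    simpa using this
  choose g hg using @hc
  let D : DescentDatum etale q :=
    { U := T
      I := PrimeSpectrum T.unop
      obj := y
      map := fun x => (e x).inv ≫ f x
      cover := fun x => ⟨_, (e x).inv ≫ f x, Sieve.ofArrows_mk _ _ x,
        (isEt_of_isIso _).comp (hf x), by
          obtain ⟨w, hw⟩ := ptMap_surjective_of_isIso (e x).inv (v x)
          exact ⟨w, by rw [ptMap_comp, hw, hv]⟩⟩
      glue := fun u j b w => g u b w
      glue_base := fun u j b w => hg u b w
      glue_self := fun u w => faithful _ _ (hg _ _ _)
      glue_glue := fun u j b w k c w' w'' => faithful _ _ ((hg _ _ _).trans (hg _ _ _).symm)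
      comp_glue := fun v u j b w w' => faithful _ _ (by rw [q.map_comp, hg, hg]) }
  obtain ⟨x, r, c, hc, -⟩ := hs.effective D
  refine ⟨mk hs.fibred x r.inv, fun T' t ht => sep fun p => ?_, fun s' hs' => sep fun p => ?_⟩
  · obtain ⟨W, a, b, w, ha, hab, hw, -⟩ := (hf (ptMap t p)).exists_square t p (v _) (hv _).symm
    refine ⟨W, a, ha, ⟨w, hw⟩, ?_⟩
    have := hcomp a b ht (hSf _) hab
    rw [this, he, map_mk, map_mk, map_mk, ← assoc, hab]
    have h1 : b ≫ (e (ptMap t p)).hom = b ≫ (e (ptMap t p)).hom := rfl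
    rw [← mk_comp hs.fibred (c (ptMap t p))]
    congr 1
    rw [← cancel_mono r.hom]
    simp only [assoc, Iso.inv_hom_id, comp_id]
    rw [hc]
    simp [D]
  · refine ⟨_, f p, hf p, ⟨v p, hv p⟩, ?_⟩
    rw [hs' _ (hSf p), he, map_mk, ← mk_comp hs.fibred (c p)]
    congr 1
    rw [← cancel_mono r.hom]
    grind

variable {S : Aff} (r : q ⟶ (Functor.const Y).obj S)

/-- The structure morphism of the presheaf of isomorphism classes. -/
def toBase : isoClasses hq ⟶ pts.obj (spec.obj S) where
  app T := TypeCat.ofHom (Quotient.lift (fun a => ULift.up (spec.map (a.i ≫ r.app a.y))) (by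
    rintro a b ⟨z, j, g, g', h, h'⟩
    have n : ∀ {y y' : Y} (g : y ⟶ y'), q.map g ≫ r.app y' = r.app y := fun g =>
      (r.naturality g).trans (comp_id _)
    refine congrArg (fun k => ULift.up (spec.map k)) ?_
    rw [← h, ← h', assoc, assoc, n, n]))
  naturality T T' f := by
    ext x
    obtain ⟨a, rfl⟩ := Quotient.exists_rep x
    exact congrArg ULift.up ((congrArg spec.map (assoc _ _ _)).trans (spec.map_comp _ _))

lemma toBase_mk {T : Aff} (y : Y) (i : T ⟶ q.obj y) :
    (toBase hq r).app _ (mk hq y i) = ULift.up (spec.map (i ≫ r.app y)) := rfl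

/-- The presheaf of isomorphism classes represents `Y` if `Y` has no automorphisms. -/
def represents (faithful : ∀ {y y' : Y} (g g' : y ⟶ y'), q.map g = q.map g' → g = g') :
    Represents q r (isoClasses hq) (toBase hq r) where
  pt y := mk hq y (𝟙 _)
  pt_map {y y'} g := by
    rw [map_mk, comp_id]
    have := mk_comp hq g (𝟙 _)
    rwa [id_comp] at this
  pt_base y := by rw [toBase_mk, id_comp]
  fullyFaithful {y y'} k h := by
    rw [map_mk, comp_id] at h
    obtain ⟨b, hb⟩ := (mk_eq_iff hq (𝟙 y) k).1 (by rw [q.map_id]; exact h.symm)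
    exact ⟨b, hb, fun g hg => faithful _ _ (hg.trans hb.symm)⟩
  essSurj x := by
    obtain ⟨y, i, rfl⟩ := exists_mk hq x
    exact ⟨y, i, by rw [map_mk, comp_id]⟩

end isoClasses

end Represent


section Charts

/-! ### Sections and morphisms of presheaves -/

/-- The morphism from an affine scheme belonging to a section. -/
def secHom {F : PSpace} {T : Aff} (x : F.obj (op T)) : pts.obj (spec.obj T) ⟶ F where
  app W := TypeCat.ofHom fun a => F.map (spec.preimage a.down).op x
  naturality W W' f := by
    ext a
    obtain ⟨a⟩ := a
    obtain ⟨a, rfl⟩ := spec.map_surjective a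
    change F.map (spec.preimage (spec.map f.unop ≫ spec.map a)).op x =
      F.map f (F.map (spec.preimage (spec.map a)).op x)
    simp [*]

lemma secHom_app {F : PSpace} {T W : Aff} (x : F.obj (op T)) (f : W ⟶ T) :
    (secHom x).app (op W) (ULift.up (spec.map f)) = F.map f.op x := by
  change F.map (spec.preimage (spec.map f)).op x = _
  rw [spec.preimage_map]

lemma eq_secHom {F : PSpace} {T : Aff} (t : pts.obj (spec.obj T) ⟶ F) :
    t = secHom (t.app _ (ULift.up (𝟙 _))) := by
  ext W a
  obtain ⟨a⟩ := a
  obtain ⟨a, rfl⟩ := spec.map_surjective a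
  refine Eq.trans ?_ (secHom_app _ a).symm
  refine Eq.trans ?_ (NatTrans.naturality_apply t a.op _)
  rfl

lemma isPullback_of_sections {A B C D : PSpace} {b : A ⟶ B} {a : A ⟶ C} {π : B ⟶ D} {t : C ⟶ D}
    (comm : ∀ (W : Aff) (x : A.obj (op W)), π.app _ (b.app _ x) = t.app _ (a.app _ x))
    (inj : ∀ (W : Aff) (x y : A.obj (op W)), b.app _ x = b.app _ y → a.app _ x = a.app _ y → x = y)
    (surj : ∀ (W : Aff) (x : B.obj (op W)) (y : C.obj (op W)), π.app _ x = t.app _ y →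
      ∃ z, b.app _ z = x ∧ a.app _ z = y) : IsPullback b a π t := by
  refine IsPullback.of_forall_isPullback_app fun W => (Types.isPullback_iff _ _ _ _).2 ⟨?_, ?_, ?_⟩
  · ext x
    exact comm W.unop x
  · exact fun x y h => inj W.unop x y h.1 h.2
  · exact fun x y h => surj W.unop x y h

/-- `P` with its projections `a`, `b` is the fibre product of `π` with the section `x`. -/
structure FibreData {F G : PSpace} (π : F ⟶ G) {T : Aff} (x : G.obj (op T)) {P : Sch}
    (a : P ⟶ spec.obj T) (b : pts.obj P ⟶ F) : Prop where
  comm : ∀ (W : Aff) (l : spec.obj W ⟶ P) (k : W ⟶ T), l ≫ a = spec.map k →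
    π.app _ (b.app (op W) (ULift.up l)) = G.map k.op x
  inj : ∀ (W : Aff) (l l' : spec.obj W ⟶ P), l ≫ a = l' ≫ a →
    b.app (op W) (ULift.up l) = b.app (op W) (ULift.up l') → l = l'
  surj : ∀ (W : Aff) (z : F.obj (op W)) (k : W ⟶ T), π.app _ z = G.map k.op x →
    ∃ l : spec.obj W ⟶ P, l ≫ a = spec.map k ∧ b.app (op W) (ULift.up l) = z

lemma schematicWith_of_sections {Q : MorphismProperty Scheme.{0}} {F G : PSpace} {π : F ⟶ G}
    (h : ∀ (T : Aff) (x : G.obj (op T)), ∃ (P : Sch) (a : P ⟶ spec.obj T) (b : pts.obj P ⟶ F),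
      FibreData π x a b ∧ Q a.left) : SchematicWith Q π := by
  intro T t
  rw [eq_secHom t]
  obtain ⟨P, a, b, ⟨comm, inj, surj⟩, hQ⟩ := h T (t.app _ (ULift.up (𝟙 _)))
  refine ⟨P, a, b, isPullback_of_sections (fun W l => ?_) (fun W l l' h₁ h₂ => ?_)
    (fun W z k hz => ?_), hQ⟩
  · obtain ⟨l⟩ := l
    obtain ⟨k, hk⟩ := spec.map_surjective (l ≫ a)
    rw [comm W l k hk.symm]
    refine (secHom_app _ k).symm.trans (congrArg _ ?_)
    exact congrArg ULift.up hk
  · obtain ⟨l⟩ := l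
    obtain ⟨l'⟩ := l'
    exact congrArg ULift.up (inj W l l' (congrArg ULift.down h₂) h₁)
  · obtain ⟨k⟩ := k
    obtain ⟨k, rfl⟩ := spec.map_surjective k
    obtain ⟨l, hl, hl'⟩ := surj W z k (hz.trans (secHom_app _ k))
    exact ⟨ULift.up l, hl', congrArg ULift.up hl⟩

lemma exists_of_schematicWith {Q : MorphismProperty Scheme.{0}} {F G : PSpace} {π : F ⟶ G}
    (h : SchematicWith Q π) (T : Aff) (x : G.obj (op T)) :
    ∃ (P : Sch) (a : P ⟶ spec.obj T) (b : pts.obj P ⟶ F),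
      FibreData π x a b ∧ Q a.left := by
  obtain ⟨P, a, b, hp, hQ⟩ := h T (secHom x)
  refine ⟨P, a, b, ⟨fun W l k hl => ?_, fun W l l' h₁ h₂ => ?_, fun W z k hz => ?_⟩, hQ⟩
  · have := (Types.isPullback_iff _ _ _ _).1 (hp.map ((evaluation _ _).obj (op W)))
    refine (ConcreteCategory.congr_hom this.1 (ULift.up l : (pts.obj P).obj (op W))).trans ?_
    refine Eq.trans ?_ (secHom_app x k)
    exact congrArg ((secHom x).app (op W)) (congrArg ULift.up hl)
  · have := (Types.isPullback_iff _ _ _ _).1 (hp.map ((evaluation _ _).obj (op W)))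
    exact congrArg ULift.down (this.2.1 (ULift.up l) (ULift.up l') ⟨h₂, congrArg ULift.up h₁⟩)
  · have := (Types.isPullback_iff _ _ _ _).1 (hp.map ((evaluation _ _).obj (op W)))
    obtain ⟨⟨l⟩, hl, hl'⟩ := this.2.2 z (ULift.up (spec.map k)) (hz.trans (secHom_app x k).symm)
    exact ⟨l, congrArg ULift.down hl', hl⟩

/-! ### Open subfunctors -/

/-- The affine scheme belonging to an algebra over the ring of an affine scheme. -/
def affOver (U : Aff) (B : Type) [CommRing B] (f : U.unop →+* B) : Aff :=
  op (@CommAlgCat.of _ _ B _ (f.comp (algebraMap (CommRingCat.of ℂ) U.unop)).toAlgebra)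

/-- The structure morphism of `affOver U B f`. -/
def affOverHom (U : Aff) (B : Type) [CommRing B] (f : U.unop →+* B) : affOver U B f ⟶ U :=
  letI := (f.comp (algebraMap (CommRingCat.of ℂ) U.unop)).toAlgebra
  let φ : U.unop →ₐ[CommRingCat.of ℂ] B := { f with commutes' := fun _ => rfl }
  (CommAlgCat.ofHom φ).op

/-- A morphism to `affOver U B f`. -/
def affOverLift {U : Aff} {B : Type} [CommRing B] {f : U.unop →+* B} {V : Aff} (g : V ⟶ U)
    (h : B →+* V.unop) (e : h.comp f = ringMap g) : V ⟶ affOver U B f :=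
  letI := (f.comp (algebraMap (CommRingCat.of ℂ) U.unop)).toAlgebra
  let φ : B →ₐ[CommRingCat.of ℂ] V.unop := { h with
    commutes' := fun c => (RingHom.congr_fun e (algebraMap (CommRingCat.of ℂ) U.unop c)).trans
      (g.unop.hom.commutes c) }
  (CommAlgCat.ofHom φ).op

lemma ringMap_injective {V U : Aff} {f g : V ⟶ U} (h : ringMap f = ringMap g) : f = g := by
  apply Quiver.Hom.unop_inj
  apply CommAlgCat.hom_ext
  apply AlgHom.ext
  exact RingHom.congr_fun h

lemma affOverLift_comp {U : Aff} {B : Type} [CommRing B] {f : U.unop →+* B} {V : Aff} (g : V ⟶ U)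
    (h : B →+* V.unop) (e : h.comp f = ringMap g) : affOverLift g h e ≫ affOverHom U B f = g :=
  ringMap_injective e

/-- The basic open subscheme where `a` is invertible. -/
def away {U : Aff} (a : U.unop) : Aff := affOver U (Localization.Away a) (algebraMap _ _)

/-- The inclusion of a basic open subscheme. -/
def awayHom {U : Aff} (a : U.unop) : away a ⟶ U := affOverHom U (Localization.Away a) (algebraMap _ _)

lemma awayHom_isStandard {U : Aff} (a : U.unop) : (ringMap (awayHom a)).IsStandardOpenImmersion := by
  have : (algebraMap U.unop (Localization.Away a)).IsStandardOpenImmersion := by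
    rw [RingHom.isStandardOpenImmersion_algebraMap]
    exact ⟨a, inferInstance⟩
  exact this

lemma awayHom_isEt {U : Aff} (a : U.unop) : IsEt (awayHom a) := by
  have : (algebraMap U.unop (Localization.Away a)).Etale := by
    rw [RingHom.etale_algebraMap]
    exact Algebra.Etale.of_isLocalizationAway a
  exact this

lemma range_awayHom {U : Aff} (a : U.unop) :
    ran (awayHom a) = PrimeSpectrum.basicOpen a :=
  PrimeSpectrum.localization_away_comap_range (Localization.Away a) a

lemma exists_lift_away {U V : Aff} {a : U.unop} (f : V ⟶ U) (h : IsUnit (ringMap f a)) :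
    ∃ g : V ⟶ away a, g ≫ awayHom a = f :=
  ⟨affOverLift f (IsLocalization.Away.lift a h) (IsLocalization.Away.lift_comp a h),
    affOverLift_comp _ _ _⟩

lemma isUnit_awayHom {U : Aff} (a : U.unop) : IsUnit (ringMap (awayHom a) a) :=
  IsLocalization.Away.algebraMap_isUnit (S := Localization.Away a) a

lemma exists_opens (U : Aff) (H : ∀ {W : Aff}, (W ⟶ U) → Prop)
    (stab : ∀ {W W' : Aff} (g : W' ⟶ W) (f : W ⟶ U), H f → H (g ≫ f))
    (loc : ∀ {W : Aff} (f : W ⟶ U), (∀ p : PrimeSpectrum W.unop, ∃ (V : Aff) (g : V ⟶ W), IsEt g ∧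
      p ∈ Set.range (ptMap g) ∧ H (g ≫ f)) → H f)
    (opn : ∀ {W : Aff} (f : W ⟶ U), H f → ∀ p : PrimeSpectrum W.unop, ∃ (V : Aff) (v : V ⟶ U),
      IsEt v ∧ ptMap f p ∈ Set.range (ptMap v) ∧ H v) :
    ∃ O : (spec.obj U).left.Opens, ∀ {W : Aff} (f : W ⟶ U),
      H f ↔ ∀ p : PrimeSpectrum W.unop, ptMap f p ∈ O := by
  refine ⟨⟨⋃ v : {v : Σ V : Aff, V ⟶ U // IsEt v.2 ∧ H v.2}, Set.range (ptMap v.1.2),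
    isOpen_iUnion fun v => v.2.1.isOpenMap.isOpen_range⟩, fun {W} f => ⟨fun hf p => ?_, fun h => ?_⟩⟩
  · obtain ⟨V, v, hv, hp, hH⟩ := opn f hf p
    exact Set.mem_iUnion.2 ⟨⟨⟨V, v⟩, hv, hH⟩, hp⟩
  · refine loc f fun p => ?_
    obtain ⟨⟨⟨V, v⟩, hv, hH⟩, q, hq⟩ := Set.mem_iUnion.1 (h p)
    obtain ⟨W', a, b, w, ha, hab, hw, -⟩ := hv.exists_square f p q hq.symm
    grind

instance {X : Sch} (O : X.left.Opens) : IsOpenImmersion (openIncl X O).left :=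
  inferInstanceAs (IsOpenImmersion O.ι)

instance {X Y : Sch} (f : X ⟶ Y) [h : IsOpenImmersion f.left] : Mono f := by
  have : Mono f.left := inferInstance
  exact Over.mono_of_mono_left f

lemma exists_lift_openImmersion {X Y : Sch} (f : X ⟶ Y) [IsOpenImmersion f.left] {Z : Sch}
    (w : Z ⟶ Y) (h : ∀ p : Z.left, w.left p ∈ Set.range f.left) : ∃ l : Z ⟶ X, l ≫ f = w := by
  have h' : Set.range w.left ⊆ Set.range f.left := by rintro _ ⟨p, rfl⟩; exact h p
  refine ⟨Over.homMk (IsOpenImmersion.lift f.left w.left h') ?_, ?_⟩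
  · rw [← Over.w f, IsOpenImmersion.lift_fac_assoc, Over.w]
  · ext1
    exact IsOpenImmersion.lift_fac _ _ _

lemma exists_lift_openSub {X : Sch} (O : X.left.Opens) {Z : Sch} (w : Z ⟶ X)
    (h : ∀ p : Z.left, w.left p ∈ O) : ∃ l : Z ⟶ openSub X O, l ≫ openIncl X O = w :=
  exists_lift_openImmersion (openIncl X O) w fun p => by
    have : Set.range O.ι = (O : Set X.left) := Scheme.Opens.range_ι O
    exact this.symm ▸ h p

lemma exists_nbhd_in_opens {W : Aff} {X : Sch} (w : spec.obj W ⟶ X) (O : X.left.Opens)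
    (p : PrimeSpectrum W.unop) (hp : w.left p ∈ O) : ∃ (V : Aff) (f : V ⟶ W), IsEt f ∧
      (ringMap f).IsStandardOpenImmersion ∧
      p ∈ Set.range (ptMap f) ∧ ∀ v : PrimeSpectrum V.unop, w.left (ptMap f v) ∈ O := by
  have ho : IsOpen (w.left ⁻¹ᵁ O).1 := (w.left ⁻¹ᵁ O).2
  obtain ⟨a, hpa, ha⟩ : ∃ a : W.unop, p ∈ PrimeSpectrum.basicOpen a ∧
      (PrimeSpectrum.basicOpen a : Set (PrimeSpectrum W.unop)) ⊆ (w.left ⁻¹ᵁ O).1 := by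
    obtain ⟨_, ⟨a, rfl⟩, hpa, ha⟩ :=
      PrimeSpectrum.isTopologicalBasis_basic_opens.exists_subset_of_mem_open
        (u := (w.left ⁻¹ᵁ O).1) hp ho
    exact ⟨a, hpa, ha⟩
  refine ⟨away a, awayHom a, awayHom_isEt a, awayHom_isStandard a, range_awayHom a ▸ hpa,
    fun v => ha (range_awayHom a ▸ ⟨v, rfl⟩)⟩

/-! ### Disjoint unions -/

variable {K : Type} (Z : K → Sch)

/-- The disjoint union of a family of `ℂ`-schemes. -/
def cop : Sch := Over.mk (Sigma.desc fun k => (Z k).hom)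

/-- The inclusion of a member in a disjoint union. -/
def copι (k : K) : Z k ⟶ cop Z := Over.homMk (Sigma.ι (fun k => (Z k).left) k) (by simp [cop])

instance (k : K) : IsOpenImmersion (copι Z k).left :=
  inferInstanceAs (IsOpenImmersion (Sigma.ι (fun k => (Z k).left) k))

variable {Z}

/-- A morphism from a disjoint union. -/
def copDesc {S : Sch} (f : ∀ k, Z k ⟶ S) : cop Z ⟶ S :=
  Over.homMk (Sigma.desc fun k => (f k).left) (by
    refine Sigma.hom_ext _ _ fun k => ?_
    simp [cop])

@[simp]
lemma copι_desc {S : Sch} (f : ∀ k, Z k ⟶ S) (k : K) : copι Z k ≫ copDesc f = f k := by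
  ext1
  exact Sigma.ι_desc _ _

lemma cop_cover (x : (cop Z).left) : ∃ k, x ∈ Set.range (copι Z k).left := by
  obtain ⟨y, hy⟩ := (sigmaOpenCover (fun k => (Z k).left)).covers x
  exact ⟨_, y, hy⟩

lemma copι_eq {k k' : K} {x : (Z k).left} {x' : (Z k').left}
    (h : (copι Z k).left x = (copι Z k').left x') : k = k' :=
  congrArg Sigma.fst ((sigmaι_eq_iff (fun k => (Z k).left) k k' x x').1 h)

lemma exists_local_cop {W : Aff} (w : spec.obj W ⟶ cop Z) (p : PrimeSpectrum W.unop) :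
    ∃ (V : Aff) (f : V ⟶ W) (k : K) (l : spec.obj V ⟶ Z k), IsEt f ∧
      p ∈ Set.range (ptMap f) ∧ l ≫ copι Z k = spec.map f ≫ w := by
  obtain ⟨k, hk⟩ := cop_cover (w.left p)
  obtain ⟨V, f, hf, -, hp, hV⟩ := exists_nbhd_in_opens w (copι Z k).left.opensRange p hk
  obtain ⟨l, hl⟩ := exists_lift_openImmersion (copι Z k) (spec.map f ≫ w) hV
  exact ⟨V, f, k, l, hf, hp, hl⟩

lemma copDesc_left_of_local {S : Sch} (f : ∀ k, Z k ⟶ S) (Q : MorphismProperty Scheme.{0})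
    [IsZariskiLocalAtSource Q] (h : ∀ k, Q (f k).left) : Q (copDesc f).left := by
  refine IsZariskiLocalAtSource.of_openCover (sigmaOpenCover (fun k => (Z k).left)) fun k => ?_
  have : (sigmaOpenCover (fun k => (Z k).left)).f k ≫ (copDesc f).left = (f k).left :=
    Sigma.ι_desc _ _
  exact this.symm ▸ h k

variable {G : PSpace} (hG : Presieve.IsSheaf etale G)

include hG in
lemma exists_copSection (β : ∀ k, pts.obj (Z k) ⟶ G) {W : Aff} (w : spec.obj W ⟶ cop Z) :
    ∃! s : G.obj (op W), ∀ (V : Aff) (f : V ⟶ W) (k : K) (l : spec.obj V ⟶ Z k),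
      l ≫ copι Z k = spec.map f ≫ w → G.map f.op s = (β k).app _ (ULift.up l) := by
  obtain ⟨s, hs⟩ := exists_section hG (U := W)
    (fun {V} f s => ∃ (k : K) (l : spec.obj V ⟶ Z k), l ≫ copι Z k = spec.map f ≫ w ∧
      s = (β k).app _ (ULift.up l)) (by
      rintro V V' g f _ ⟨k, l, hl, rfl⟩
      refine ⟨k, spec.map g ≫ l, by rw [assoc, hl, spec.map_comp, assoc], ?_⟩
      exact (NatTrans.naturality_apply (β k) g.op _).symm) (by
      rintro V f _ _ ⟨k, l, hl, rfl⟩ ⟨k', l', hl', rfl⟩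
      refine section_ext hG fun x => ?_
      obtain rfl : k = k' := by
        have h := congrArg (fun a => a.left x) (hl.trans hl'.symm)
        exact copι_eq h
      obtain rfl : l = l' := by
        rw [← cancel_mono (copι Z k), hl, hl']
      exact ⟨V, 𝟙 _, isEt_id V, ⟨x, rfl⟩, rfl⟩) (fun x => by
      obtain ⟨V, f, k, l, hf, hx, hl⟩ := exists_local_cop w x
      exact ⟨V, f, hf, hx, _, k, l, hl, rfl⟩)
  refine ⟨s, fun V f k l hl => hs f _ ⟨k, l, hl, rfl⟩, fun s' hs' => section_ext hG fun x => ?_⟩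
  obtain ⟨V, f, k, l, hf, hx, hl⟩ := exists_local_cop w x
  exact ⟨V, f, hf, hx, (hs' V f k l hl).trans (hs f _ ⟨k, l, hl, rfl⟩).symm⟩

/-- A morphism from the functor of points of a disjoint union to an étale sheaf. -/
def copHom (β : ∀ k, pts.obj (Z k) ⟶ G) : pts.obj (cop Z) ⟶ G where
  app W := TypeCat.ofHom fun w => (exists_copSection hG β w.down).choose
  naturality W W' g := by
    ext w
    obtain ⟨w⟩ := w
    refine (exists_copSection hG β (spec.map g.unop ≫ w)).unique
      (exists_copSection hG β (spec.map g.unop ≫ w)).choose_spec.1 fun V f k l hl => ?_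
    refine Eq.trans ?_ ((exists_copSection hG β w).choose_spec.1 V (f ≫ g.unop) k l (by
      rw [hl, spec.map_comp, assoc]))
    exact ConcreteCategory.congr_hom (G.map_comp g f.op).symm _

lemma copHom_app (β : ∀ k, pts.obj (Z k) ⟶ G) {W V : Aff} (w : spec.obj W ⟶ cop Z) (f : V ⟶ W)
    (k : K) (l : spec.obj V ⟶ Z k) (h : l ≫ copι Z k = spec.map f ≫ w) :
    G.map f.op ((copHom hG β).app (op W) (ULift.up w)) = (β k).app _ (ULift.up l) :=
  (exists_copSection hG β w).choose_spec.1 V f k l h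

lemma copHom_app' (β : ∀ k, pts.obj (Z k) ⟶ G) {V : Aff} (k : K) (l : spec.obj V ⟶ Z k) :
    (copHom hG β).app (op V) (ULift.up (l ≫ copι Z k)) = (β k).app _ (ULift.up l) := by
  have := copHom_app hG β (l ≫ copι Z k) (𝟙 V) k l (by simp)
  simpa using this

section

variable {β : ∀ k, pts.obj (Z k) ⟶ G} {T : Aff} {x : G.obj (op T)} {P : K → Sch}
  {a : ∀ k, P k ⟶ spec.obj T} {b : ∀ k, pts.obj (P k) ⟶ pts.obj (Z k)}

lemma pts_map_op {X : Sch} {W V : Aff} (f : V ⟶ W) (l : spec.obj W ⟶ X) :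
    (pts.obj X).map f.op (ULift.up l) = ULift.up (spec.map f ≫ l) := rfl

/-- The morphism of disjoint unions belonging to a family of morphisms. -/
def copMap (b : ∀ k, pts.obj (P k) ⟶ pts.obj (Z k)) : pts.obj (cop P) ⟶ pts.obj (cop Z) :=
  copHom (pts_isSheaf _) fun k => b k ≫ pts.map (copι Z k)

lemma copMap_ι {W : Aff} (k : K) (l : spec.obj W ⟶ P k) :
    (copMap b).app (op W) (ULift.up (l ≫ copι P k)) =
      ULift.up (((b k).app (op W) (ULift.up l)).down ≫ copι Z k) :=
  copHom_app' _ _ k l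

lemma app_spec_map {X : Sch} {F : PSpace} (b : pts.obj X ⟶ F) {W V : Aff} (f : V ⟶ W)
    (l : spec.obj W ⟶ X) :
    b.app (op V) (ULift.up (spec.map f ≫ l)) = F.map f.op (b.app _ (ULift.up l)) :=
  NatTrans.naturality_apply b f.op (ULift.up l : (pts.obj X).obj (op W))

lemma comp_copι_desc {W : Aff} {k : K} (m : spec.obj W ⟶ P k) :
    (m ≫ copι P k) ≫ copDesc a = m ≫ a k := by rw [assoc, copι_desc]

include hG in
lemma copMap_comm (h : ∀ k, FibreData (β k) x (a k) (b k)) (W : Aff) (l : spec.obj W ⟶ cop P)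
    (k : W ⟶ T) (hl : l ≫ copDesc a = spec.map k) :
    (copHom hG β).app _ ((copMap b).app (op W) (ULift.up l)) = G.map k.op x := by
  refine section_ext hG fun p => ?_
  obtain ⟨V, f, κ, m, hf, hp, hm⟩ := exists_local_cop l p
  refine ⟨V, f, hf, hp, ?_⟩
  have h1 := app_spec_map (copMap b) f l
  rw [← hm, copMap_ι] at h1
  refine (NatTrans.naturality_apply (copHom hG β) f.op _).symm.trans ?_
  refine (congrArg _ h1.symm).trans ((copHom_app' hG β κ _).trans ?_)
  refine ((h κ).comm V m (f ≫ k) ?_).trans (ConcreteCategory.congr_hom (G.map_comp k.op f.op) x)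
  rw [spec.map_comp, ← hl, ← assoc, ← hm, comp_copι_desc]

lemma copMap_inj (h : ∀ k, FibreData (β k) x (a k) (b k)) (W : Aff) (l l' : spec.obj W ⟶ cop P)
    (h₁ : l ≫ copDesc a = l' ≫ copDesc a)
    (h₂ : (copMap b).app (op W) (ULift.up l) = (copMap b).app (op W) (ULift.up l')) : l = l' := by
  refine congrArg ULift.down (section_ext (pts_isSheaf (cop P)) (s := ULift.up l)
    (s' := ULift.up l') fun p => ?_)
  obtain ⟨V, f, κ, m, hf, hp, hm⟩ := exists_local_cop l p
  obtain ⟨v, hv⟩ := hp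
  obtain ⟨V', f', κ', m', hf', ⟨v', hv'⟩, hm'⟩ := exists_local_cop (spec.map f ≫ l') v
  have hm2 : (spec.map f' ≫ m) ≫ copι P κ = spec.map (f' ≫ f) ≫ l := by
    rw [assoc, hm, spec.map_comp, assoc]
  have hm2' : m' ≫ copι P κ' = spec.map (f' ≫ f) ≫ l' := by
    rw [hm', spec.map_comp, assoc]
  have e1 := app_spec_map (copMap b) (f' ≫ f) l
  have e2 := app_spec_map (copMap b) (f' ≫ f) l'
  rw [h₂, ← e2, ← hm2, ← hm2', copMap_ι, copMap_ι] at e1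
  have e1 := congrArg ULift.down e1
  obtain rfl : κ = κ' := copι_eq (congrArg (fun a => a.left v') e1)
  have e1 := (cancel_mono (copι Z κ)).1 e1
  obtain rfl : spec.map f' ≫ m = m' := by
    refine (h κ).inj V' _ _ ?_ (congrArg ULift.up e1)
    have := (spec.map (f' ≫ f)) ≫= h₁
    simp only [← assoc] at this
    rw [← hm2, ← hm2', comp_copι_desc, comp_copι_desc] at this
    exact this
  refine ⟨V', f' ≫ f, hf'.comp hf, ⟨v', by rw [ptMap_comp, hv', hv]⟩, ?_⟩
  rw [pts_map_op, pts_map_op, ← hm2, ← hm2']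

lemma copMap_surj_local (h : ∀ k, FibreData (β k) x (a k) (b k)) (W : Aff)
    (z : spec.obj W ⟶ cop Z) (k : W ⟶ T)
    (hz : (copHom hG β).app _ (ULift.up z) = G.map k.op x) (p : PrimeSpectrum W.unop) :
    ∃ (V : Aff) (f : V ⟶ W) (m : spec.obj V ⟶ cop P), IsEt f ∧ p ∈ Set.range (ptMap f) ∧
      m ≫ copDesc a = spec.map (f ≫ k) ∧
      (copMap b).app (op V) (ULift.up m) = ULift.up (spec.map f ≫ z) := by
  obtain ⟨V, f, κ, m, hf, hp, hm⟩ := exists_local_cop z p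
  obtain ⟨l, hl, hl'⟩ := (h κ).surj V (ULift.up m) (f ≫ k) (by
    refine (copHom_app hG β z f κ m hm).symm.trans ((congrArg (G.map f.op) hz).trans ?_)
    exact ConcreteCategory.congr_hom (G.map_comp k.op f.op).symm x)
  refine ⟨V, f, l ≫ copι P κ, hf, hp, (comp_copι_desc l).trans hl, ?_⟩
  rw [copMap_ι, hl', ← hm]

lemma copMap_surj (h : ∀ k, FibreData (β k) x (a k) (b k)) (W : Aff)
    (z : spec.obj W ⟶ cop Z) (k : W ⟶ T)
    (hz : (copHom hG β).app _ (ULift.up z) = G.map k.op x) :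
    ∃ l : spec.obj W ⟶ cop P, l ≫ copDesc a = spec.map k ∧
      (copMap b).app (op W) (ULift.up l) = ULift.up z := by
  have loc := copMap_surj_local hG h W z k hz
  obtain ⟨⟨l⟩, hl⟩ := exists_section (pts_isSheaf (cop P)) (U := W)
    (fun {V} f l => l.down ≫ copDesc a = spec.map (f ≫ k) ∧
      (copMap b).app (op V) l = ULift.up (spec.map f ≫ z)) (by
      rintro V V' g f ⟨l⟩ ⟨e1, e2⟩
      refine ⟨?_, ?_⟩
      · change (spec.map g ≫ l) ≫ _ = _
        simp [*]
      · rw [pts_map_op, app_spec_map, e2, pts_map_op, spec.map_comp, assoc]) (by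
      rintro V f ⟨l⟩ ⟨l'⟩ ⟨e1, e2⟩ ⟨e1', e2'⟩
      exact congrArg ULift.up (copMap_inj h V l l' (e1.trans e1'.symm) (e2.trans e2'.symm)))
      (fun p => by
      obtain ⟨V, f, m, hf, hp, h1, h2⟩ := loc p
      exact ⟨V, f, hf, hp, ULift.up m, h1, h2⟩)
  refine ⟨l, congrArg ULift.down (section_ext (pts_isSheaf (spec.obj T))
    (s := ULift.up (l ≫ copDesc a)) (s' := ULift.up (spec.map k)) fun p => ?_),
    section_ext (pts_isSheaf (cop Z)) fun p => ?_⟩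
  · obtain ⟨V, f, m, hf, hp, h1, h2⟩ := loc p
    have h3 : spec.map f ≫ l = m := congrArg ULift.down (hl f (ULift.up m) ⟨h1, h2⟩)
    refine ⟨V, f, hf, hp, congrArg ULift.up ?_⟩
    exact (assoc _ _ _).symm.trans ((h3 =≫ (copDesc a)).trans
      (h1.trans (spec.map_comp _ _)))
  · obtain ⟨V, f, m, hf, hp, h1, h2⟩ := loc p
    have h3 : spec.map f ≫ l = m := congrArg ULift.down (hl f (ULift.up m) ⟨h1, h2⟩)
    refine ⟨V, f, hf, hp, (app_spec_map (copMap b) f l).symm.trans ?_⟩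
    rw [h3]
    exact h2

end

theorem schematicWith_copHom (β : ∀ k, pts.obj (Z k) ⟶ G) (Q : MorphismProperty Scheme.{0})
    [IsZariskiLocalAtSource Q] (h : ∀ k, SchematicWith Q (β k))
    (surj : ∀ (T : Aff) (x : G.obj (op T)) (p : PrimeSpectrum T.unop), ∃ (V : Aff) (f : V ⟶ T)
      (k : K) (l : spec.obj V ⟶ Z k), p ∈ Set.range (ptMap f) ∧
        (β k).app _ (ULift.up l) = G.map f.op x) :
    SchematicWith (fun _ _ f => Q f ∧ Surjective f) (copHom hG β) := by
  refine schematicWith_of_sections fun T x => ?_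
  choose P a b hd hQ using fun k => exists_of_schematicWith (h k) T x
  refine ⟨cop P, copDesc a, copMap b, ⟨copMap_comm hG hd, copMap_inj hd,
    fun W z k hz => copMap_surj hG hd W z.down k hz⟩, copDesc_left_of_local a Q hQ, ⟨fun p => ?_⟩⟩
  obtain ⟨V, f, κ, m, ⟨v, rfl⟩, hm⟩ := surj T x p
  obtain ⟨l, hl, -⟩ := (hd κ).surj V (ULift.up m) f hm
  refine ⟨(l ≫ copι P κ).left v, ?_⟩
  exact congrArg (fun k => k.left v) ((comp_copι_desc l).trans hl)

end Charts


section Functions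

/-! ### Functions, and closed subfunctors -/

/-- A morphism over `T`, from a ring homomorphism. -/
def homOver {T V W : Aff} (v : V ⟶ T) (w : W ⟶ T) (h : V.unop →+* W.unop)
    (e : h.comp (ringMap v) = ringMap w) : W ⟶ V :=
  let φ : V.unop →ₐ[CommRingCat.of ℂ] W.unop := { h with
    commutes' := fun c => (congrArg h (v.unop.hom.commutes c).symm).trans
      ((RingHom.congr_fun e (algebraMap (CommRingCat.of ℂ) T.unop c)).trans
        (w.unop.hom.commutes c)) }
  (CommAlgCat.ofHom φ).op

lemma homOver_comp {T V W : Aff} (v : V ⟶ T) (w : W ⟶ T) (h : V.unop →+* W.unop)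
    (e : h.comp (ringMap v) = ringMap w) : homOver v w h e ≫ v = w := ringMap_injective e

/-- The affine line. -/
def line : Aff := op (CommAlgCat.of (CommRingCat.of ℂ) (Polynomial (CommRingCat.of ℂ)))

/-- The morphism to the affine line belonging to a function. -/
def toLine {W : Aff} (a : W.unop) : W ⟶ line := (CommAlgCat.ofHom (Polynomial.aeval a)).op

/-- The coordinate function of the affine line. -/
def coord : line.unop := (Polynomial.X : Polynomial (CommRingCat.of ℂ))

lemma ringMap_toLine {W : Aff} (a : W.unop) : ringMap (toLine a) coord = a :=
  Polynomial.aeval_X a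

lemma line_hom_ext {W : Aff} {f g : W ⟶ line} (h : ringMap f coord = ringMap g coord) : f = g := by
  apply Quiver.Hom.unop_inj
  apply CommAlgCat.hom_ext
  exact Polynomial.algHom_ext h

lemma comp_toLine {W V : Aff} (f : V ⟶ W) (a : W.unop) : f ≫ toLine a = toLine (ringMap f a) :=
  line_hom_ext (by rw [ringMap_toLine, ringMap_comp, RingHom.comp_apply, ringMap_toLine])

lemma function_ext {W : Aff} {a b : W.unop} (h : ∀ p : PrimeSpectrum W.unop, ∃ (V : Aff)
    (f : V ⟶ W), IsEt f ∧ p ∈ Set.range (ptMap f) ∧ ringMap f a = ringMap f b) : a = b := by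
  have : toLine a = toLine b := by
    have := section_ext (pts_isSheaf (spec.obj line)) (U := W)
      (s := ULift.up (spec.map (toLine a))) (s' := ULift.up (spec.map (toLine b))) fun p => by
        obtain ⟨V, f, hf, hp, e⟩ := h p
        refine ⟨V, f, hf, hp, congrArg ULift.up ?_⟩
        change spec.map f ≫ _ = spec.map f ≫ _
        rw [← spec.map_comp, ← spec.map_comp, comp_toLine, comp_toLine, e]
    exact spec.map_injective (congrArg ULift.down this)
  rw [← ringMap_toLine a, this, ringMap_toLine]

lemma exists_function {U : Aff} (Pr : ∀ {V : Aff} (_ : V ⟶ U), V.unop → Prop)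
    (stab : ∀ {V W : Aff} (g : W ⟶ V) (f : V ⟶ U) (s : V.unop), Pr f s →
      Pr (g ≫ f) (ringMap g s))
    (uniq : ∀ {V : Aff} (f : V ⟶ U) (s s' : V.unop), Pr f s → Pr f s' → s = s')
    (loc : ∀ x : PrimeSpectrum U.unop, ∃ (V : Aff) (f : V ⟶ U), IsEt f ∧
      x ∈ Set.range (ptMap f) ∧ ∃ s, Pr f s) :
    ∃ s : U.unop, ∀ {V : Aff} (f : V ⟶ U) (s' : V.unop), Pr f s' → ringMap f s = s' := by
  obtain ⟨⟨s⟩, hs⟩ := exists_section (pts_isSheaf (spec.obj line)) (U := U)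
    (fun {V} f s => Pr f (ringMap (spec.preimage s.down) coord)) (by
      rintro V W g f ⟨s⟩ h
      have := stab g f _ h
      have e : spec.preimage (spec.map g ≫ s) = g ≫ spec.preimage s := by
        apply spec.map_injective; simp
      change Pr _ (ringMap (spec.preimage (spec.map g ≫ s)) coord)
      rw [e]
      exact this) (by
      rintro V f ⟨s⟩ ⟨s'⟩ h h'
      have := line_hom_ext (uniq f _ _ h h')
      refine congrArg ULift.up ?_
      rw [← spec.map_preimage s, ← spec.map_preimage s']
      exact congrArg spec.map this) (fun x => by
      obtain ⟨V, f, hf, hx, s, hs⟩ := loc x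
      refine ⟨V, f, hf, hx, ULift.up (spec.map (toLine s)), ?_⟩
      change Pr f (ringMap (spec.preimage (spec.map (toLine s))) coord)
      rw [spec.preimage_map, ringMap_toLine]
      exact hs)
  refine ⟨ringMap (spec.preimage s) coord, fun {V} f s' h => ?_⟩
  have h1 : spec.map f ≫ s = spec.map (toLine s') := congrArg ULift.down
    (hs f (ULift.up (spec.map (toLine s'))) (by
      change Pr f (ringMap (spec.preimage (spec.map (toLine s'))) coord)
      rw [spec.preimage_map, ringMap_toLine]
      exact h))
  have h2 : f ≫ spec.preimage s = toLine s' := by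
    apply spec.map_injective
    rw [spec.map_comp, spec.map_preimage, h1]
  rw [← RingHom.comp_apply, ← ringMap_comp, h2, ringMap_toLine]

lemma exists_finite_cover {T : Aff} {V : PrimeSpectrum T.unop → Aff} (v : ∀ p, V p ⟶ T)
    (hv : ∀ p, IsEt (v p)) (hp : ∀ p, p ∈ Set.range (ptMap (v p))) :
    ∃ s : Finset (PrimeSpectrum T.unop), ∀ p, ∃ q ∈ s, p ∈ Set.range (ptMap (v q)) := by
  obtain ⟨s, hs⟩ := isCompact_univ.elim_finite_subcover (fun p => Set.range (ptMap (v p)))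
    (fun p => (hv p).isOpenMap.isOpen_range) (fun p _ => Set.mem_iUnion.2 ⟨p, hp p⟩)
  refine ⟨s, fun p => ?_⟩
  obtain ⟨q, hq, h⟩ := Set.mem_iUnion₂.1 (hs (Set.mem_univ p))
  exact ⟨q, hq, h⟩

lemma mem_map_of_flat {A B : Type} [CommRing A] [CommRing B] [Algebra A B] [Module.Flat A B]
    {s : Type} [Fintype s] (C : s → Type) [∀ p, CommRing (C p)] [∀ p, Algebra A (C p)] (b : B)
    (h : ∀ p, b ⊗ₜ[A] (1 : C p) = 0) :
    b ∈ (⨅ p, RingHom.ker (algebraMap A (C p))).map (algebraMap A B) := by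
  classical
  let I := ⨅ p, RingHom.ker (algebraMap A (C p))
  let φ : A →ₗ[A] (∀ p, C p) := Algebra.linearMap A (∀ p, C p)
  have ex : Function.Exact I.subtype φ := by
    intro x
    constructor
    · intro hx
      have : x ∈ I := by
        refine (Submodule.mem_iInf _).2 fun p => ?_
        exact congrFun hx p
      exact ⟨⟨x, this⟩, rfl⟩
    · rintro ⟨⟨x, hx⟩, rfl⟩
      funext p
      exact (Submodule.mem_iInf _).1 hx p
  have ex' := Module.Flat.lTensor_exact B ex
  have hb : LinearMap.lTensor B φ (b ⊗ₜ 1) = 0 := by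
    rw [LinearMap.lTensor_tmul]
    apply (TensorProduct.piRight A A B C).injective
    rw [map_zero]
    funext p
    simpa [φ] using h p
  obtain ⟨w, hw⟩ := (ex' _).1 hb
  have key : ∀ w : TensorProduct A B I, (TensorProduct.rid A B) (LinearMap.lTensor B I.subtype w) ∈
      I.map (algebraMap A B) := by
    intro w
    induction w with
    | zero => simp
    | add x y hx hy => rw [map_add, map_add]; exact Ideal.add_mem _ hx hy
    | tmul x y =>
      simp only [LinearMap.lTensor_tmul, TensorProduct.rid_tmul, Submodule.subtype_apply]
      rw [Algebra.smul_def]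
      exact Ideal.mul_mem_right _ _ (Ideal.mem_map_of_mem _ y.2)
  have := key w
  rw [hw] at this
  simpa using this

open TensorProduct in
theorem exists_ideal (T : Aff) (H : ∀ {W : Aff}, (W ⟶ T) → Prop)
    (stab : ∀ {W W' : Aff} (g : W' ⟶ W) (f : W ⟶ T), H f → H (g ≫ f))
    (loc : ∀ {W : Aff} (f : W ⟶ T), (∀ p : PrimeSpectrum W.unop, ∃ (V : Aff) (g : V ⟶ W), IsEt g ∧
      p ∈ Set.range (ptMap g) ∧ H (g ≫ f)) → H f)
    (cl : ∀ p : PrimeSpectrum T.unop, ∃ (V : Aff) (v : V ⟶ T) (I : Ideal V.unop),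
      IsEt v ∧ p ∈ Set.range (ptMap v) ∧
      ∀ {W : Aff} (w : W ⟶ V), H (w ≫ v) ↔ ∀ a ∈ I, ringMap w a = 0) :
    ∃ I : Ideal T.unop, ∀ {W : Aff} (f : W ⟶ T), H f ↔ ∀ a ∈ I, ringMap f a = 0 := by
  choose V v I hv hp hI using cl
  obtain ⟨s, hs⟩ := exists_finite_cover v hv hp
  let _ : ∀ p, Algebra T.unop (V p).unop := fun p => (ringMap (v p)).toAlgebra
  let C : s → Type := fun p => (V p).unop ⧸ I p
  let J : Ideal T.unop := ⨅ p : s, RingHom.ker (algebraMap T.unop (C p))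
  have hJ : ∀ p ∈ s, ∀ a ∈ J, ringMap (v p) a ∈ I p := fun p hp a ha =>
    Ideal.Quotient.eq_zero_iff_mem.1 ((Submodule.mem_iInf _).1 ha ⟨p, hp⟩)
  have hJ' : ∀ q ∈ s, ∀ b ∈ I q, b ∈ J.map (ringMap (v q)) := by
    intro q hq b hb
    have hfl : Module.Flat T.unop (V q).unop := by
      have : Algebra.Etale T.unop (V q).unop := (RingHom.etale_algebraMap).1 (hv q)
      infer_instance
    refine mem_map_of_flat (A := T.unop) (B := (V q).unop) C b fun p => ?_
    let R := (V q).unop ⊗[T.unop] C p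
    let W := affOver (V q) R (Algebra.TensorProduct.includeLeftRingHom)
    let w : W ⟶ V q := affOverHom _ _ _
    let h : (V p).unop →+* R := (Algebra.TensorProduct.includeRight (R := T.unop) (A := (V q).unop)
      (B := C p)).toRingHom.comp (Ideal.Quotient.mk (I p))
    have e : h.comp (ringMap (v p)) = ringMap (w ≫ v q) := by
      refine RingHom.ext fun c => ?_
      exact ((Algebra.TensorProduct.includeRight (R := T.unop) (A := (V q).unop)
        (B := C p)).commutes c)
    let w' : W ⟶ V p := homOver (v p) (w ≫ v q) h e
    have h1 : H (w' ≫ v p) := (hI p w').2 fun a ha => by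
      have : (Ideal.Quotient.mk (I p) a) = 0 := Ideal.Quotient.eq_zero_iff_mem.2 ha
      change (Algebra.TensorProduct.includeRight (R := T.unop) (A := (V q).unop)
        (B := C p)) (Ideal.Quotient.mk (I p) a) = 0
      rw [this, map_zero]
    exact (hI q w).1 ((congrArg (fun k => H k) (homOver_comp (v p) (w ≫ v q) h e)).mp h1) b hb
  refine ⟨J, fun {W} f => ⟨fun hf a ha => ?_, fun h => loc f fun p => ?_⟩⟩
  · refine function_ext fun p => ?_
    obtain ⟨q, hq, y, hy⟩ := hs (ptMap f p)
    obtain ⟨W', g, b, w, hg, hgb, hw, -⟩ := (hv q).exists_square f p y hy.symm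
    refine ⟨W', g, hg, ⟨w, hw⟩, ?_⟩
    have h1 := (hI q b).1 (hgb ▸ stab g f hf) _ (hJ q hq a ha)
    rw [map_zero, ← RingHom.comp_apply, ← ringMap_comp, hgb]
    exact h1
  · obtain ⟨q, hq, y, hy⟩ := hs (ptMap f p)
    obtain ⟨W', g, b, w, hg, hgb, hw, -⟩ := (hv q).exists_square f p y hy.symm
    refine ⟨W', g, hg, ⟨w, hw⟩, ?_⟩
    rw [hgb]
    refine (hI q b).2 fun a ha => ?_
    have h1 : J.map (ringMap (v q)) ≤ RingHom.ker (ringMap b) := by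
      rw [Ideal.map_le_iff_le_comap]
      intro c hc
      change (ringMap b) (ringMap (v q) c) = 0
      rw [← RingHom.comp_apply, ← ringMap_comp, ← hgb, ringMap_comp, RingHom.comp_apply, h c hc,
        map_zero]
    exact h1 (hJ' q hq a ha)

end Functions


section Atlas

universe v₁

lemma exists_affHom {U Z : Aff} (Pr : ∀ {V : Aff} (_ : V ⟶ U), (V ⟶ Z) → Prop)
    (stab : ∀ {V W : Aff} (g : W ⟶ V) (f : V ⟶ U) (s : V ⟶ Z), Pr f s → Pr (g ≫ f) (g ≫ s))
    (uniq : ∀ {V : Aff} (f : V ⟶ U) (s s' : V ⟶ Z), Pr f s → Pr f s' → s = s')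
    (loc : ∀ x : PrimeSpectrum U.unop, ∃ (V : Aff) (f : V ⟶ U), IsEt f ∧
      x ∈ Set.range (ptMap f) ∧ ∃ s, Pr f s) :
    ∃ s : U ⟶ Z, ∀ {V : Aff} (f : V ⟶ U) (s' : V ⟶ Z), Pr f s' → f ≫ s = s' := by
  obtain ⟨s, hs⟩ := exists_section (GrothendieckTopology.Subcanonical.isSheaf_of_isRepresentable
    (J := etale) (yoneda.obj Z)) (U := U) (fun {V} f s => Pr f s) stab uniq loc
  exact ⟨s, hs⟩

lemma affHom_ext {U Z : Aff} {s s' : U ⟶ Z} (h : ∀ x : PrimeSpectrum U.unop, ∃ (V : Aff)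
    (f : V ⟶ U), IsEt f ∧ x ∈ Set.range (ptMap f) ∧ f ≫ s = f ≫ s') : s = s' :=
  section_ext (GrothendieckTopology.Subcanonical.isSheaf_of_isRepresentable
    (J := etale) (yoneda.obj Z)) h

instance : IsZariskiLocalAtSource @Etale.{0} :=
  HasRingHomProperty.instIsZariskiLocalAtSource (Q := RingHom.Etale)

instance : IsZariskiLocalAtSource @Smooth.{0} :=
  HasRingHomProperty.instIsZariskiLocalAtSource (Q := RingHom.Smooth)

variable {Y : Type 1} [Category.{v₁} Y] (q : Y ⥤ Aff) {S : Aff}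
  (r : q ⟶ (Functor.const Y).obj S) (K : Type)

/-- Charts of a stack without automorphisms over the affine scheme `S`: étale morphisms `U k ⟶ S`
and affine schemes `Z k = q (ζ k)`, which are open in the fibre product of `Y` and `U k`. -/
structure Charts where mkCharts ::
  U : K → Aff
  u : ∀ k, U k ⟶ S
  et : ∀ k, IsEt (u k)
  ζ : K → Y
  zu : ∀ k, q.obj (ζ k) ⟶ U k
  comm : ∀ k, zu k ≫ u k = r.app (ζ k)
  uniq : ∀ {k} {w : Y} (g g' : w ⟶ ζ k), q.map g ≫ zu k = q.map g' ≫ zu k → q.map g = q.map g'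
  opn : ∀ {k} {y : Y} (t : q.obj y ⟶ U k), t ≫ u k = r.app y → ∀ {w : Y} (h : w ⟶ y)
    (g : w ⟶ ζ k), q.map g ≫ zu k = q.map h ≫ t → ∀ p : PrimeSpectrum (q.obj w).unop,
    ∃ (v : Y) (e : v ⟶ y) (g' : v ⟶ ζ k), IsEt (q.map e) ∧
      ptMap (q.map h) p ∈ Set.range (ptMap (q.map e)) ∧ q.map g' ≫ zu k = q.map e ≫ t
  cov : ∀ (y : Y) (p : PrimeSpectrum (q.obj y).unop), ∃ (k : K) (v : Y) (e : v ⟶ y)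
    (_ : v ⟶ ζ k), IsEt (q.map e) ∧ p ∈ Set.range (ptMap (q.map e))

namespace Charts

variable {q r K} (C : Charts q r K) (hs : IsStack etale q)
  (faithful : ∀ {y y' : Y} (g g' : y ⟶ y'), q.map g = q.map g' → g = g')

lemma base_app {y y' : Y} (g : y ⟶ y') : q.map g ≫ r.app y' = r.app y :=
  (r.naturality g).trans (comp_id _)

open isoClasses

lemma uniq' {k : K} {W : Aff} (g g' : W ⟶ q.obj (C.ζ k)) (h : g ≫ C.zu k = g' ≫ C.zu k)
    (h' : mk hs.fibred (C.ζ k) g = mk hs.fibred (C.ζ k) g') : g = g' := by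
  obtain ⟨w, e, a, ha⟩ := hs.fibred.lift_sieve g
  have h2 := congrArg ((isoClasses hs.fibred).map e.hom.op) h'
  rw [map_mk, map_mk, ← ha] at h2
  obtain ⟨b, hb⟩ := (mk_eq_iff hs.fibred a _).1 h2
  have := C.uniq a b (by rw [ha, hb, assoc, assoc, h])
  rw [ha, hb] at this
  exact (cancel_epi e.hom).1 this

/-- The locus where a section comes from a chart. -/
def Locus {k : K} {T P : Aff} (y : Y) (i : T ⟶ q.obj y) (fst : P ⟶ T) (snd : P ⟶ C.U k) {W : Aff}
    (f : W ⟶ P) (g : W ⟶ q.obj (C.ζ k)) : Prop :=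
  g ≫ C.zu k = f ≫ snd ∧ mk hs.fibred (C.ζ k) g = mk hs.fibred y (f ≫ fst ≫ i)

variable {k : K} {T P : Aff} {y : Y} {i : T ≅ q.obj y} {fst : P ⟶ T} {snd : P ⟶ C.U k}

lemma Locus.comp {W W' : Aff} {f : W ⟶ P} {g : W ⟶ q.obj (C.ζ k)}
    (h : C.Locus hs y i.hom fst snd f g) (a : W' ⟶ W) :
    C.Locus hs y i.hom fst snd (a ≫ f) (a ≫ g) := by
  refine ⟨by rw [assoc, h.1, assoc], ?_⟩
  have := congrArg ((isoClasses hs.fibred).map a.op) h.2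
  rw [map_mk, map_mk] at this
  rw [this, assoc]

lemma Locus.unique {W : Aff} {f : W ⟶ P} {g g' : W ⟶ q.obj (C.ζ k)}
    (h : C.Locus hs y i.hom fst snd f g) (h' : C.Locus hs y i.hom fst snd f g') : g = g' :=
  C.uniq' hs g g' (h.1.trans h'.1.symm) (h.2.trans h'.2.symm)

include faithful in
lemma exists_locus_opens (hsq : fst ≫ i.hom ≫ r.app y = snd ≫ C.u k) :
    ∃ O : (spec.obj P).left.Opens, ∀ {W : Aff} (f : W ⟶ P),
      (∃ g, C.Locus hs y i.hom fst snd f g) ↔ ∀ p : PrimeSpectrum W.unop, ptMap f p ∈ O := by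
  refine exists_opens P (fun f => ∃ g, C.Locus hs y i.hom fst snd f g) (fun a f ⟨g, hg⟩ =>
    ⟨_, hg.comp C hs a⟩) (fun {W} f hf => ?_) (fun {W} f ⟨g, hg⟩ p => ?_)
  · obtain ⟨s, hs'⟩ := exists_affHom (U := W) (Z := q.obj (C.ζ k))
      (fun {V} a g => C.Locus hs y i.hom fst snd (a ≫ f) g)
      (fun a b g h => by rw [assoc]; exact h.comp C hs a)
      (fun a g g' h h' => h.unique C hs h') (fun x => hf x)
    refine ⟨s, affHom_ext fun x => ?_, isSeparated hs faithful fun x => ?_⟩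
    · obtain ⟨V, a, ha, hx, g, hg⟩ := hf x
      refine ⟨V, a, ha, hx, ?_⟩
      rw [← assoc, hs' a g hg, hg.1, assoc]
    · obtain ⟨V, a, ha, hx, g, hg⟩ := hf x
      refine ⟨V, a, ha, hx, ?_⟩
      rw [map_mk, hs' a g hg, hg.2, map_mk, assoc]
  · obtain ⟨yP, e, c, hc⟩ := hs.fibred.lift_sieve (x := y) (fst ≫ i.hom)
    obtain ⟨w, j, a, ha⟩ := hs.fibred.lift_sieve g
    obtain ⟨b, hb⟩ := (mk_eq_iff hs.fibred a (j.hom ≫ f ≫ fst ≫ i.hom)).1 (by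
      have := congrArg ((isoClasses hs.fibred).map j.hom.op) hg.2
      rw [map_mk, map_mk] at this
      rw [ha, this])
    obtain ⟨h, hh, -⟩ := hs.fibred.fac c b (j.hom ≫ f ≫ e.inv) (by
      rw [hc, hb]; simp)
    obtain ⟨p', rfl⟩ := ptMap_surjective_of_isIso j.hom p
    obtain ⟨v, ev, g', hev, hp, hg'⟩ := C.opn (y := yP) (e.hom ≫ snd) (by
      rw [assoc, ← hsq, ← base_app c, hc]; simp) h a (by
      rw [ha, hh]; simp [hg.1]) p'
    refine ⟨q.obj v, q.map ev ≫ e.hom, hev.comp (isEt_of_isIso _), ?_, q.map g', ?_, ?_⟩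
    · obtain ⟨x, hx⟩ := hp
      refine ⟨x, ?_⟩
      rw [ptMap_comp, hx, ← ptMap_comp, ← ptMap_comp, hh]
      simp
    · rw [hg']; simp
    · rw [assoc, ← hc, mk_comp]
      refine (mk_eq_iff hs.fibred g' (q.map ev)).2 ⟨ev, rfl⟩ |>.trans ?_
      rfl

include faithful in
lemma schematic_chart (k : K) :
    SchematicWith @Etale (secHom (mk hs.fibred (C.ζ k) (𝟙 _))) := by
  have happ : ∀ {W : Aff} (g : W ⟶ q.obj (C.ζ k)),
      (secHom (mk hs.fibred (C.ζ k) (𝟙 _))).app (op W) (ULift.up (spec.map g)) =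
        mk hs.fibred (C.ζ k) g := fun g => by rw [secHom_app, map_mk, comp_id]
  refine schematicWith_of_sections fun T x => ?_
  obtain ⟨y, i, rfl⟩ := exists_mk _ x
  let fst := pullback.fst (i.hom ≫ r.app y) (C.u k)
  let snd := pullback.snd (i.hom ≫ r.app y) (C.u k)
  have hsq : fst ≫ i.hom ≫ r.app y = snd ≫ C.u k := pullback.condition
  obtain ⟨O, hO⟩ := C.exists_locus_opens hs faithful hsq
  let X := spec.obj (pullback (i.hom ≫ r.app y) (C.u k))
  have hl : ∀ {W : Aff} (l : spec.obj W ⟶ openSub X O),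
      ∃ g, C.Locus hs y i.hom fst snd (spec.preimage (l ≫ openIncl X O)) g := fun {W} l => by
    refine (hO _).2 fun p => ?_
    have h1 : ptMap (spec.preimage (l ≫ openIncl X O)) p = (l ≫ openIncl X O).left p :=
      congrArg (fun k => k.left p) (spec.map_preimage (l ≫ openIncl X O))
    rw [h1]
    exact (l.left p).2
  choose g hg using @hl
  let b : pts.obj (openSub X O) ⟶ pts.obj (spec.obj (q.obj (C.ζ k))) :=
    { app := fun W => TypeCat.ofHom fun l => ULift.up (spec.map (g l.down))
      naturality := fun W W' a => by
        ext l
        refine congrArg ULift.up ((congrArg spec.map ?_).trans (spec.map_comp a.unop (g l.down)))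
        have h1 := hg (spec.map a.unop ≫ l.down)
        have h2 : spec.preimage ((spec.map a.unop ≫ l.down) ≫ openIncl X O) =
            a.unop ≫ spec.preimage (l.down ≫ openIncl X O) := by
          apply spec.map_injective; simp
        rw [h2] at h1
        exact h1.unique C hs ((hg l.down).comp C hs a.unop) }
  have hb : ∀ {W : Aff} (l : spec.obj W ⟶ openSub X O), b.app (op W) (ULift.up l) =
    ULift.up (spec.map (g l)) := fun l => rfl
  have hfst : ∀ {W : Aff} (l : spec.obj W ⟶ openSub X O), l ≫ openIncl X O ≫ spec.map fst =
      spec.map (spec.preimage (l ≫ openIncl X O) ≫ fst) := fun l => by simp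
  refine ⟨openSub X O, openIncl X O ≫ spec.map fst, b, ⟨fun W l t hlt => ?_, fun W l l' h₁ h₂ => ?_,
    fun W z t hz => ?_⟩, ?_⟩
  · rw [hb, happ, (hg l).2, map_mk]
    rw [hfst] at hlt
    have := spec.map_injective hlt
    rw [← this, assoc]
  · rw [hb, hb] at h₂
    have h3 : g l = g l' := spec.map_injective (congrArg ULift.down h₂)
    rw [hfst, hfst] at h₁
    have h4 : spec.preimage (l ≫ openIncl X O) = spec.preimage (l' ≫ openIncl X O) := by
      refine pullback.hom_ext (spec.map_injective h₁) ?_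
      exact (hg l).1.symm.trans ((congrArg (· ≫ C.zu k) h3).trans (hg l').1)
    have h5 := congrArg spec.map h4
    rw [spec.map_preimage, spec.map_preimage] at h5
    exact (cancel_mono _).1 h5
  · obtain ⟨z⟩ := z
    obtain ⟨z, rfl⟩ := spec.map_surjective z
    rw [happ, map_mk] at hz
    let f : W ⟶ pullback (i.hom ≫ r.app y) (C.u k) := pullback.lift t (z ≫ C.zu k) (by
      have := congrArg ((toBase hs.fibred r).app (op W)) hz
      rw [toBase_mk, toBase_mk] at this
      have := spec.map_injective (congrArg ULift.down this)
      rw [assoc, C.comm, this, assoc])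
    have hf1 : f ≫ fst = t := pullback.lift_fst _ _ _
    have hf2 : f ≫ snd = z ≫ C.zu k := pullback.lift_snd _ _ _
    have hfz : C.Locus hs y i.hom fst snd f z := ⟨hf2.symm, by
      rw [hz, ← assoc f, hf1]⟩
    obtain ⟨l, hl⟩ := exists_lift_openSub O (spec.map f) ((hO f).1 ⟨z, hfz⟩)
    have h1 : spec.preimage (l ≫ openIncl X O) = f := by
      apply spec.map_injective
      rw [spec.map_preimage, hl]
    refine ⟨l, by rw [hfst, h1, hf1], ?_⟩
    rw [hb]
    have h2 := hg l
    rw [h1] at h2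
    rw [h2.unique C hs hfz]
  · have h1 : Etale (spec.map fst).left :=
      (isEt_iff _).1 ((C.et k).of_isPullback (IsPullback.of_hasPullback _ _))
    have : Etale ((openIncl X O).left ≫ (spec.map fst).left) := inferInstance
    exact this

include C faithful in
theorem exists_atlas : ∃ π : pts.obj (cop fun k => spec.obj (q.obj (C.ζ k))) ⟶ isoClasses hs.fibred,
    SchematicWith etaleSurjective π ∧ π ≫ toBase hs.fibred r =
      pts.map (copDesc fun k => spec.map (r.app (C.ζ k))) := by
  have hsh := isSheaf hs faithful
  refine ⟨copHom hsh fun k => secHom (mk hs.fibred (C.ζ k) (𝟙 _)),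
    schematicWith_copHom hsh _ @Etale.{0} (C.schematic_chart hs faithful) (fun T x p => ?_), ?_⟩
  · obtain ⟨y, i, rfl⟩ := exists_mk _ x
    obtain ⟨k, v, e, g, he, hp⟩ := C.cov y (ptMap i.hom p)
    refine ⟨q.obj v, q.map e ≫ i.inv, k, spec.map (q.map g), ?_, ?_⟩
    · obtain ⟨x, hx⟩ := hp
      exact ⟨x, by rw [ptMap_comp, hx, ← ptMap_comp, i.hom_inv_id, ptMap_id]⟩
    · rw [secHom_app, map_mk, comp_id, map_mk, assoc, i.inv_hom_id,
        comp_id]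
      exact (mk_eq_iff hs.fibred g (q.map e)).2 ⟨e, rfl⟩
  · ext W l
    obtain ⟨l⟩ := l
    refine section_ext (pts_isSheaf (spec.obj S)) (U := W.unop) fun p => ?_
    obtain ⟨V, f, k, m, hf, hp, hm⟩ := exists_local_cop l p
    obtain ⟨m, rfl⟩ := spec.map_surjective m
    refine ⟨V, f, hf, hp, ?_⟩
    refine (NatTrans.naturality_apply (toBase hs.fibred r) f.op _).symm.trans ?_
    refine (congrArg _ (copHom_app hsh _ l f k _ hm)).trans ?_
    refine (congrArg _ (secHom_app _ m)).trans ?_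
    rw [map_mk, comp_id, toBase_mk]
    refine congrArg ULift.up ?_
    have h1 := comp_copι_desc (a := fun k => spec.map (r.app (C.ζ k))) (spec.map m)
    rw [spec.map_comp]
    refine h1.symm.trans ?_
    rw [hm]
    exact assoc _ _ _

end Charts

end Atlas


section Criterion

universe v₁

/-! ### Equalizers of sections -/

/-- The equalizer of two sections over `T` is a subscheme whose inclusion has the property `Q`. -/
def HasEqualizer (Q : MorphismProperty Scheme.{0}) {F : PSpace} {T : Aff} (s s' : F.obj (op T)) :
    Prop :=
  ∃ (P : Sch) (a : P ⟶ spec.obj T) (_ : Mono a), Q a.left ∧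
    ∀ {W : Aff} (k : W ⟶ T), F.map k.op s = F.map k.op s' ↔
      ∃ l : spec.obj W ⟶ P, l ≫ a = spec.map k

lemma schematicWith_of_equalizer {Q : MorphismProperty Scheme.{0}} {F G : PSpace} (δ : F ⟶ G)
    (p₁ p₂ : G ⟶ F) (h₁ : δ ≫ p₁ = 𝟙 F) (h₂ : δ ≫ p₂ = 𝟙 F)
    (hinj : ∀ {Z : PSpace} (f g : Z ⟶ G), f ≫ p₁ = g ≫ p₁ → f ≫ p₂ = g ≫ p₂ → f = g)
    (h : ∀ {T : Aff} (x : G.obj (op T)), HasEqualizer Q (p₁.app _ x) (p₂.app _ x)) :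
    SchematicWith Q δ := by
  have hsec : ∀ {W : Aff} (x : G.obj (op W)) (p : G ⟶ F), secHom x ≫ p = secHom (p.app _ x) := by
    intro W x p
    rw [eq_secHom (secHom x ≫ p)]
    refine congrArg secHom (congrArg (p.app _) ?_)
    refine (congrArg _ (congrArg ULift.up (spec.map_id W).symm)).trans ((secHom_app x (𝟙 W)).trans ?_)
    simp
  have hext : ∀ {W : Aff} (x y : G.obj (op W)), p₁.app _ x = p₁.app _ y → p₂.app _ x = p₂.app _ y →
      x = y := by
    intro W x y e₁ e₂
    have h := hinj (secHom x) (secHom y) (by rw [hsec, hsec, e₁]) (by rw [hsec, hsec, e₂])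
    have := congrArg (fun t => t.app (op W) (ULift.up (spec.map (𝟙 W)))) h
    dsimp only at this
    rw [secHom_app, secHom_app] at this
    simpa using this
  have k₁ : ∀ {W : Aff} (z : F.obj (op W)), p₁.app _ (δ.app _ z) = z := fun {W} z =>
    ConcreteCategory.congr_hom (congrArg (fun t : F ⟶ F => t.app (op W)) h₁) z
  have k₂ : ∀ {W : Aff} (z : F.obj (op W)), p₂.app _ (δ.app _ z) = z := fun {W} z =>
    ConcreteCategory.congr_hom (congrArg (fun t : F ⟶ F => t.app (op W)) h₂) z
  refine schematicWith_of_sections fun T x => ?_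
  obtain ⟨P, a, ha, hQ, H⟩ := h x
  refine ⟨P, a, pts.map a ≫ secHom (p₁.app _ x), ⟨fun W l k hl => ?_, fun W l l' hl _ => ?_,
    fun W z k hz => ?_⟩, hQ⟩
  · have hb : (pts.map a ≫ secHom (p₁.app _ x)).app (op W) (ULift.up l) =
        F.map k.op (p₁.app _ x) := by
      refine Eq.trans ?_ (secHom_app _ k)
      exact congrArg ((secHom (p₁.app (op T) x)).app (op W)) (congrArg ULift.up hl)
    rw [hb]
    refine hext _ _ ?_ ?_
    · simp [*]
    · rw [k₂, (H k).2 ⟨l, hl⟩]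
      simp [*]
  · exact (cancel_mono a).1 hl
  · have e₁ : z = F.map k.op (p₁.app _ x) := by
      rw [← k₁ z, hz]
      exact NatTrans.naturality_apply p₁ k.op x
    have e₂ : z = F.map k.op (p₂.app _ x) := by
      rw [← k₂ z, hz]
      exact NatTrans.naturality_apply p₂ k.op x
    obtain ⟨l, hl⟩ := (H k).1 (e₁.symm.trans e₂)
    refine ⟨l, hl, ?_⟩
    rw [e₁]
    refine Eq.trans ?_ (secHom_app _ k)
    exact congrArg ((secHom (p₁.app (op T) x)).app (op W)) (congrArg ULift.up hl)

lemma schematicWith_diag {Q : MorphismProperty Scheme.{0}} {F : PSpace}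
    (h : ∀ {T : Aff} (s s' : F.obj (op T)), HasEqualizer Q s s') : SchematicWith Q (diag F) :=
  schematicWith_of_equalizer (diag F) prod.fst prod.snd (prod.lift_fst _ _)
    (prod.lift_snd _ _)
    (fun _ _ h₁ h₂ => Limits.prod.hom_ext h₁ h₂) fun _ => h _ _

lemma schematicWith_diagonal {Q : MorphismProperty Scheme.{0}} {F : PSpace} {S : Sch}
    (f : F ⟶ pts.obj S)
    (h : ∀ {T : Aff} (s s' : F.obj (op T)), f.app _ s = f.app _ s' → HasEqualizer Q s s') :
    SchematicWith Q (pullback.diagonal f) :=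
  schematicWith_of_equalizer (pullback.diagonal f) (pullback.fst f f) (pullback.snd f f) (by simp)
    (by simp) (fun _ _ h₁ h₂ => pullback.hom_ext h₁ h₂) fun {T} x => h _ _
      (ConcreteCategory.congr_hom (congrArg (fun t : pullback f f ⟶ pts.obj S => t.app (op T))
        (pullback.condition (f := f) (g := f))) x)

/-! ### Closed subschemes of affine schemes -/

/-- The closed subscheme belonging to an ideal. -/
def closedAff {T : Aff} (I : Ideal T.unop) : Aff := affOver T (T.unop ⧸ I) (Ideal.Quotient.mk I)

/-- The inclusion of a closed subscheme. -/
def closedHom {T : Aff} (I : Ideal T.unop) : closedAff I ⟶ T := affOverHom T _ _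

instance {T : Aff} (I : Ideal T.unop) : IsClosedImmersion (spec.map (closedHom I)).left := by
  refine IsClosedImmersion.spec_of_surjective (CommRingCat.ofHom (Ideal.Quotient.mk I)) ?_
  exact Ideal.Quotient.mk_surjective

instance {X Y : Sch} (f : X ⟶ Y) [h : IsClosedImmersion f.left] : Mono f := by
  have : Mono f.left := inferInstance
  exact Over.mono_of_mono_left f

lemma exists_lift_closed {T W : Aff} {I : Ideal T.unop} (k : W ⟶ T) :
    (∃ l : W ⟶ closedAff I, l ≫ closedHom I = k) ↔ ∀ a ∈ I, ringMap k a = 0 := by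
  constructor
  · rintro ⟨l, rfl⟩ a ha
    have : Ideal.Quotient.mk I a = 0 := Ideal.Quotient.eq_zero_iff_mem.2 ha
    exact (congrArg (ringMap l) this).trans (map_zero (ringMap l))
  · intro h
    exact ⟨affOverLift k (Ideal.Quotient.lift I (ringMap k) h) (Ideal.Quotient.lift_comp_mk _ _ _),
      affOverLift_comp _ _ _⟩

lemma exists_lift_closed' {T W : Aff} {I : Ideal T.unop} (k : W ⟶ T) :
    (∃ l : spec.obj W ⟶ spec.obj (closedAff I), l ≫ spec.map (closedHom I) = spec.map k) ↔
      ∀ a ∈ I, ringMap k a = 0 := by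
  rw [← exists_lift_closed]
  constructor
  · rintro ⟨l, hl⟩
    refine ⟨spec.preimage l, spec.map_injective ?_⟩
    rw [spec.map_comp, spec.map_preimage, hl]
  · rintro ⟨l, rfl⟩
    exact ⟨spec.map l, (spec.map_comp _ _).symm⟩

lemma hasEqualizer_of_over {Q : MorphismProperty Scheme.{0}} [Q.IsStableUnderComposition]
    (hQ : ∀ {X Y : Scheme.{0}} (f : X ⟶ Y) [IsClosedImmersion f], Q f) {F : PSpace} {S : Aff}
    (f : F ⟶ pts.obj (spec.obj S))
    (h : ∀ {T : Aff} (s s' : F.obj (op T)), f.app _ s = f.app _ s' → HasEqualizer Q s s')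
    {T : Aff} (s s' : F.obj (op T)) : HasEqualizer Q s s' := by
  obtain ⟨t, ht⟩ := spec.map_surjective (f.app _ s).down
  obtain ⟨t', ht'⟩ := spec.map_surjective (f.app _ s').down
  let I : Ideal T.unop := Ideal.span (Set.range fun c => ringMap t c - ringMap t' c)
  have hI : ∀ {W : Aff} (k : W ⟶ T), (∀ a ∈ I, ringMap k a = 0) ↔ k ≫ t = k ≫ t' := by
    intro W k
    constructor
    · intro h
      refine ringMap_injective (RingHom.ext fun c => ?_)
      have := h _ (Ideal.subset_span ⟨c, rfl⟩)
      rw [map_sub, sub_eq_zero] at this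
      exact this
    · intro h
      have : I ≤ RingHom.ker (ringMap k) := by
        refine Ideal.span_le.2 ?_
        rintro _ ⟨c, rfl⟩
        change ringMap k _ = 0
        rw [map_sub, sub_eq_zero]
        exact congrArg (fun m => ringMap m c) h
      exact this
  have hf : ∀ {W : Aff} (k : W ⟶ T), f.app _ (F.map k.op s) = ULift.up (spec.map (k ≫ t)) := by
    intro W k
    refine (NatTrans.naturality_apply f k.op s).trans ?_
    refine congrArg ULift.up ?_
    rw [spec.map_comp, ht]
    rfl
  have hf' : ∀ {W : Aff} (k : W ⟶ T), f.app _ (F.map k.op s') = ULift.up (spec.map (k ≫ t')) := by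
    intro W k
    refine (NatTrans.naturality_apply f k.op s').trans ?_
    refine congrArg ULift.up ?_
    rw [spec.map_comp, ht']
    rfl
  obtain ⟨P, a, ha, hQa, H⟩ := h (F.map (closedHom I).op s) (F.map (closedHom I).op s') (by
    rw [hf, hf', (hI _).1 ((exists_lift_closed _).1 ⟨𝟙 _, id_comp _⟩)])
  refine ⟨P, a ≫ spec.map (closedHom I), inferInstance, Q.comp_mem _ _ hQa (hQ _), fun {W} k => ?_⟩
  constructor
  · intro hk
    have h1 : k ≫ t = k ≫ t' := by grind
    obtain ⟨l, rfl⟩ := (exists_lift_closed (I := I) k).2 ((hI k).2 h1)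
    obtain ⟨m, hm⟩ := (H l).1 (by simpa using hk)
    grind
  · rintro ⟨l, hl⟩
    obtain ⟨m, hm⟩ := spec.map_surjective (l ≫ a)
    have : k = m ≫ closedHom I := by
      grind
    simp [*]

/-! ### Conditions on the presheaves of isomorphisms -/

variable {Y : Type 1} [Category.{v₁} Y] (q : Y ⥤ Aff) {S : Aff} (r : q ⟶ (Functor.const Y).obj S)

/-- The locus where two objects agree is closed. -/
def EqClosed : Prop := ∀ {y₁ y₂ : Y} (i : q.obj y₁ ≅ q.obj y₂), i.hom ≫ r.app y₂ = r.app y₁ →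
  ∀ p : PrimeSpectrum (q.obj y₁).unop, ∃ (v : Y) (e : v ⟶ y₁) (I : Ideal (q.obj v).unop),
    IsEt (q.map e) ∧ p ∈ Set.range (ptMap (q.map e)) ∧ ∀ {w : Y} (h : w ⟶ v),
      (∃ m : w ⟶ y₂, q.map m = q.map (h ≫ e) ≫ i.hom) ↔ ∀ a ∈ I, ringMap (q.map h) a = 0

/-- The locus where two objects agree is locally the locus where a function is invertible. -/
def EqOpen : Prop := ∀ {y₁ y₂ : Y} (i : q.obj y₁ ≅ q.obj y₂), i.hom ≫ r.app y₂ = r.app y₁ →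
  ∀ p : PrimeSpectrum (q.obj y₁).unop, ∃ (v : Y) (e : v ⟶ y₁) (a : (q.obj v).unop),
    IsEt (q.map e) ∧ p ∈ Set.range (ptMap (q.map e)) ∧ ∀ {w : Y} (h : w ⟶ v),
      (∃ m : w ⟶ y₂, q.map m = q.map (h ≫ e) ≫ i.hom) ↔ IsUnit (ringMap (q.map h) a)

variable {q r} (hs : IsStack etale q)
  (faithful : ∀ {y y' : Y} (g g' : y ⟶ y'), q.map g = q.map g' → g = g')

open isoClasses

lemma map_mk_eq_iff {v y₁ y₂ : Y} {T W : Aff} (i₁ : T ≅ q.obj y₁) (i₂ : T ≅ q.obj y₂)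
    (e : v ⟶ y₁) {w : Y} (h : w ⟶ v) (j : q.obj w ≅ W) :
    (isoClasses hs.fibred).map ((j.inv ≫ q.map h) ≫ q.map e ≫ i₁.inv).op
      (mk hs.fibred y₁ i₁.hom) = (isoClasses hs.fibred).map
      ((j.inv ≫ q.map h) ≫ q.map e ≫ i₁.inv).op (mk hs.fibred y₂ i₂.hom) ↔
      ∃ m : w ⟶ y₂, q.map m = q.map (h ≫ e) ≫ (i₁.inv ≫ i₂.hom) := by
  rw [← mk_eq_iff hs.fibred (h ≫ e), map_mk, map_mk]
  have inj : ∀ s s' : (isoClasses hs.fibred).obj (op W), s = s' ↔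
      (isoClasses hs.fibred).map j.hom.op s = (isoClasses hs.fibred).map j.hom.op s' := by
    refine fun s s' => ⟨fun h => by rw [h], fun h => ?_⟩
    have := congrArg ((isoClasses hs.fibred).map j.inv.op) h
    rw [← Functor.map_comp_apply, ← Functor.map_comp_apply, ← op_comp, j.inv_hom_id] at this
    simpa using this
  rw [inj, map_mk, map_mk]
  grind

include faithful in
lemma hasEqualizer_of_eqClosed (h : EqClosed q r) {T : Aff} (s s' : (isoClasses hs.fibred).obj (op T))
    (hss : (toBase hs.fibred r).app _ s = (toBase hs.fibred r).app _ s') :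
    HasEqualizer @IsClosedImmersion s s' := by
  obtain ⟨y₁, i₁, rfl⟩ := exists_mk _ s
  obtain ⟨y₂, i₂, rfl⟩ := exists_mk _ s'
  have hi : (i₁.symm ≪≫ i₂).hom ≫ r.app y₂ = r.app y₁ := by
    rw [toBase_mk, toBase_mk] at hss
    have := spec.map_injective (congrArg ULift.down hss)
    rw [Iso.trans_hom, Iso.symm_hom, assoc, ← this, i₁.inv_hom_id_assoc]
  obtain ⟨I, hI⟩ := exists_ideal T (fun f => (isoClasses hs.fibred).map f.op
      (mk hs.fibred y₁ i₁.hom) = (isoClasses hs.fibred).map f.op (mk hs.fibred y₂ i₂.hom))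
    (fun g f hf => by
      rw [op_comp, Functor.map_comp_apply, Functor.map_comp_apply, hf])
    (fun f hf => isSeparated hs faithful fun p => by
      obtain ⟨V, g, hg, hp, h⟩ := hf p
      refine ⟨V, g, hg, hp, ?_⟩
      rw [← Functor.map_comp_apply, ← Functor.map_comp_apply]
      exact h)
    (fun p => by
      obtain ⟨v, e, I, he, hp, H⟩ := h (i₁.symm ≪≫ i₂) hi (ptMap i₁.hom p)
      refine ⟨q.obj v, q.map e ≫ i₁.inv, I, he.comp (isEt_of_isIso _), ?_, fun {W} w => ?_⟩
      · obtain ⟨x, hx⟩ := hp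
        exact ⟨x, by rw [ptMap_comp, hx, ← ptMap_comp, i₁.hom_inv_id, ptMap_id]⟩
      · obtain ⟨z, j, h, hh⟩ := hs.fibred.lift_sieve w
        obtain rfl : w = j.inv ≫ q.map h := by rw [hh, j.inv_hom_id_assoc]
        refine (map_mk_eq_iff hs i₁ i₂ e h j).trans ((H h).trans ?_)
        refine forall₂_congr fun a _ => ?_
        rw [ringMap_comp, RingHom.comp_apply]
        refine ⟨fun h => by rw [h, map_zero], fun h => ?_⟩
        have := congrArg (ringMap j.hom) h
        rw [← RingHom.comp_apply, ← ringMap_comp, j.hom_inv_id, map_zero] at this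
        exact this)
  exact ⟨_, spec.map (closedHom I), inferInstance, inferInstance, fun {W} k =>
    (hI k).trans (exists_lift_closed' k).symm⟩

include faithful in
lemma hasEqualizer_of_eqOpen (h : EqOpen q r) {T : Aff} (s s' : (isoClasses hs.fibred).obj (op T))
    (hss : (toBase hs.fibred r).app _ s = (toBase hs.fibred r).app _ s') :
    HasEqualizer @QuasiCompact s s' := by
  obtain ⟨y₁, i₁, rfl⟩ := exists_mk _ s
  obtain ⟨y₂, i₂, rfl⟩ := exists_mk _ s'
  have hi : (i₁.symm ≪≫ i₂).hom ≫ r.app y₂ = r.app y₁ := by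
    rw [toBase_mk, toBase_mk] at hss
    have := spec.map_injective (congrArg ULift.down hss)
    rw [Iso.trans_hom, Iso.symm_hom, assoc, ← this, i₁.inv_hom_id_assoc]
  let H : ∀ {W : Aff}, (W ⟶ T) → Prop := fun f => (isoClasses hs.fibred).map f.op
      (mk hs.fibred y₁ i₁.hom) = (isoClasses hs.fibred).map f.op (mk hs.fibred y₂ i₂.hom)
  have stab : ∀ {W W' : Aff} (g : W' ⟶ W) (f : W ⟶ T), H f → H (g ≫ f) := fun g f hf => by
    change _ = _
    rw [op_comp, Functor.map_comp_apply, Functor.map_comp_apply]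
    exact congrArg _ hf
  have loc : ∀ p : PrimeSpectrum T.unop, ∃ (V : Aff) (v : V ⟶ T) (a : V.unop),
      IsEt v ∧ p ∈ Set.range (ptMap v) ∧
      ∀ {W : Aff} (w : W ⟶ V), H (w ≫ v) ↔ IsUnit (ringMap w a) := fun p => by
    obtain ⟨v, e, a, he, hp, H⟩ := h (i₁.symm ≪≫ i₂) hi (ptMap i₁.hom p)
    refine ⟨q.obj v, q.map e ≫ i₁.inv, a, he.comp (isEt_of_isIso _), ?_, fun {W} w => ?_⟩
    · obtain ⟨x, hx⟩ := hp
      exact ⟨x, by rw [ptMap_comp, hx, ← ptMap_comp, i₁.hom_inv_id, ptMap_id]⟩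
    · obtain ⟨z, j, h, hh⟩ := hs.fibred.lift_sieve w
      obtain rfl : w = j.inv ≫ q.map h := by rw [hh, j.inv_hom_id_assoc]
      refine (map_mk_eq_iff hs i₁ i₂ e h j).trans ((H h).trans ?_)
      rw [ringMap_comp, RingHom.comp_apply]
      refine ⟨fun h => h.map _, fun h => ?_⟩
      have := h.map (ringMap j.hom)
      rw [← RingHom.comp_apply, ← ringMap_comp, j.hom_inv_id] at this
      exact this
  choose V v a hv hp hH using loc
  obtain ⟨O, hO⟩ := exists_opens T H stab
    (fun f hf => isSeparated hs faithful fun p => by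
      obtain ⟨V, g, hg, hp, h⟩ := hf p
      refine ⟨V, g, hg, hp, ?_⟩
      rw [← Functor.map_comp_apply, ← Functor.map_comp_apply]
      exact h)
    (fun {W} f hf p => by
      obtain ⟨x, hx⟩ := hp (ptMap f p)
      obtain ⟨W', b, c, w, hb, hbc, hwp, hwx⟩ := (hv (ptMap f p)).exists_square f p x hx.symm
      refine ⟨_, awayHom (a (ptMap f p)) ≫ v _, (awayHom_isEt _).comp (hv _), ?_,
        (hH _ _).2 (isUnit_awayHom _)⟩
      have h1 := (hH _ c).1 (hbc ▸ stab b f hf)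
      have h2 : x ∈ Set.range (ptMap (awayHom (a (ptMap f p)))) := by
        rw [range_awayHom, ← hwx]
        intro h
        exact w.2.ne_top (Ideal.eq_top_of_isUnit_mem _ h h1)
      obtain ⟨x', hx'⟩ := h2
      exact ⟨x', by rw [ptMap_comp, hx', hx]⟩)
  refine ⟨_, openIncl _ O, inferInstance, ?_, fun {W} k => (hO k).trans ⟨fun h =>
    exists_lift_openSub O (spec.map k) h, ?_⟩⟩
  · obtain ⟨s, hs'⟩ := exists_finite_cover v hv hp
    let Os : Set (PrimeSpectrum T.unop) := O.1
    have hc : IsCompact Os := by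
      have : Os = ⋃ x ∈ s, Set.range (ptMap (awayHom (a x) ≫ v x)) := by
        ext p
        simp only [Set.mem_iUnion]
        constructor
        · intro hpO
          obtain ⟨x, hx, y, rfl⟩ := hs' p
          obtain ⟨W, w, hw, t, ht, hWO⟩ : ∃ (W : Aff) (w : W ⟶ V x) (_ : IsEt w) (t : _),
            ptMap w t = y ∧ H (w ≫ v x) := by
            let U' : TopologicalSpace.Opens (PrimeSpectrum (V x).unop) :=
              ⟨ptMap (v x) ⁻¹' Os, O.2.preimage (PrimeSpectrum.continuous_comap _)⟩
            obtain ⟨_, ⟨b, rfl⟩, hb, hbU⟩ := PrimeSpectrum.isTopologicalBasis_basic_opens.exists_subset_of_mem_open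
              (show y ∈ (U' : Set _) from hpO) U'.2
            obtain ⟨t, ht⟩ : y ∈ Set.range (ptMap (awayHom b)) := by
              rw [range_awayHom]; exact hb
            refine ⟨_, awayHom b, awayHom_isEt b, t, ht, (hO _).2 fun p => ?_⟩
            refine show ptMap (awayHom b) p ∈ U' from hbU ?_
            have : ptMap (awayHom b) p ∈ Set.range (ptMap (awayHom b)) := ⟨p, rfl⟩
            rw [range_awayHom] at this
            exact this
          have h1 := (hH x w).1 hWO
          obtain ⟨y', hy'⟩ : y ∈ Set.range (ptMap (awayHom (a x))) := by
            rw [range_awayHom, ← ht]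
            intro h
            exact t.2.ne_top (Ideal.eq_top_of_isUnit_mem _ h h1)
          exact ⟨x, hx, y', by rw [ptMap_comp, hy']⟩
        · rintro ⟨x, hx, y, rfl⟩
          exact (hO _).1 ((hH x _).2 (isUnit_awayHom _)) y
      rw [this]
      refine s.finite_toSet.isCompact_biUnion fun x _ => ?_
      exact isCompact_range (PrimeSpectrum.continuous_comap _)
    have : CompactSpace (spec.obj T).left := inferInstanceAs (CompactSpace (PrimeSpectrum T.unop))
    exact (quasiCompact_iff_compactSpace O.ι).2 (isCompact_iff_compactSpace.1 hc)
  · rintro ⟨l, hl⟩ p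
    have : ptMap k p = (openIncl _ O).left (l.left p) :=
      congrArg (fun m => m.left p) hl.symm
    rw [this]
    exact (l.left p).2

variable {K : Type} (C : Charts q r K)

include C faithful in
theorem hasAtlasWith (Q : MorphismProperty Scheme.{0})
    (hQ : Q (copDesc fun k => spec.map (r.app (C.ζ k))).left) :
    HasAtlasWith Q (toBase hs.fibred r) := by
  obtain ⟨π, hπ, h⟩ := C.exists_atlas hs faithful
  exact ⟨_, π, _, hπ, h, hQ⟩

lemma surjective_copDesc {X : K → Aff} (f : ∀ k, X k ⟶ S)
    (sur : ∀ x : PrimeSpectrum S.unop, ∃ k, x ∈ Set.range (ptMap (f k))) :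
    Surjective (copDesc fun k => spec.map (f k)).left := by
  refine ⟨fun x => ?_⟩
  obtain ⟨k, y, hy⟩ := sur x
  refine ⟨(copι (fun k => spec.obj (X k)) k).left y, ?_⟩
  refine Eq.trans ?_ hy
  exact congrArg (fun m => m.left y) (copι_desc (fun k => spec.map (f k)) k)

lemma quasiCompact_copDesc [Finite K] {X : K → Aff} (f : ∀ k, X k ⟶ S) :
    QuasiCompact (copDesc fun k => spec.map (f k)).left := by
  have : CompactSpace (spec.obj S).left := inferInstanceAs (CompactSpace (PrimeSpectrum S.unop))
  refine (quasiCompact_iff_compactSpace _).2 ⟨?_⟩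
  have h : (Set.univ : Set (cop fun k => spec.obj (X k)).left) =
      ⋃ k, Set.range (copι (fun k => spec.obj (X k)) k).left := by
    ext x
    simpa using cop_cover x
  rw [h]
  refine isCompact_iUnion fun k => ?_
  have : CompactSpace (spec.obj (X k)).left :=
    inferInstanceAs (CompactSpace (PrimeSpectrum (X k).unop))
  exact isCompact_range (copι (fun k => spec.obj (X k)) k).left.continuous

include C faithful in
theorem isAlgebraicSpace (hd : ∀ {T : Aff} (s s' : (isoClasses hs.fibred).obj (op T)),
    (toBase hs.fibred r).app _ s = (toBase hs.fibred r).app _ s' → HasEqualizer @QuasiCompact s s') :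
    IsAlgebraicSpace (isoClasses hs.fibred) where
  isSheaf := isSheaf hs faithful
  diagonal := schematicWith_diag (hasEqualizer_of_over (fun f hf => inferInstanceAs (QuasiCompact f)) (toBase hs.fibred r) hd)
  atlas := by
    obtain ⟨π, hπ, -⟩ := C.exists_atlas hs faithful
    exact ⟨_, π, hπ⟩

lemma HasEqualizer.mono {Q Q' : MorphismProperty Scheme.{0}} (h : Q ≤ Q') {F : PSpace} {T : Aff}
    {s s' : F.obj (op T)} (hQ : HasEqualizer Q s s') : HasEqualizer Q' s s' := by
  obtain ⟨P, a, ha, hQ, H⟩ := hQ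
  exact ⟨P, a, ha, h _ hQ, H⟩

include hs C faithful in
theorem exists_represents_of_eqOpen (hd : EqOpen q r) (Q : MorphismProperty Scheme.{0})
    (hQ : Q (copDesc fun k => spec.map (r.app (C.ζ k))).left) :
    ∃ (R : PSpace) (f : R ⟶ pts.obj (spec.obj S)), IsAlgebraicSpace R ∧
      Nonempty (Represents q r R f) ∧ HasAtlasWith Q f :=
  ⟨_, toBase hs.fibred r, isAlgebraicSpace hs faithful C (hasEqualizer_of_eqOpen hs faithful hd),
    ⟨represents hs.fibred r faithful⟩, hasAtlasWith hs faithful C Q hQ⟩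

include hs C faithful in
theorem exists_represents_of_eqClosed (hd : EqClosed q r) (Q : MorphismProperty Scheme.{0})
    (hQ : Q (copDesc fun k => spec.map (r.app (C.ζ k))).left) :
    ∃ (R : PSpace) (f : R ⟶ pts.obj (spec.obj S)), IsAlgebraicSpace R ∧
      Nonempty (Represents q r R f) ∧ IsSeparatedOver f ∧ HasAtlasWith Q f := by
  have h := fun {T : Aff} => hasEqualizer_of_eqClosed hs faithful hd (T := T)
  exact ⟨_, toBase hs.fibred r, isAlgebraicSpace hs faithful C fun s s' e =>
    (h s s' e).mono fun _ _ f (_ : IsClosedImmersion f) => inferInstanceAs (QuasiCompact f),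
    ⟨represents hs.fibred r faithful⟩, schematicWith_diagonal _ h, hasAtlasWith hs faithful C Q hQ⟩

end Criterion


section Line

/-! ### Line bundles with a section -/

section Algebra

variable {A B C : Type} [CommRing A] [CommRing B] [CommRing C]

lemma IsPullbackMap.ext_semilinear {f : A →+* B} {P : LineSec A} {Q : LineSec B} {θ : P.L →+ Q.L}
    (h : IsPullbackMap f P Q θ) {g : B →+* C} {N : Type} [AddCommGroup N] [Module C N]
    {η η' : Q.L →+ N} (hη : ∀ b y, η (b • y) = g b • η y) (hη' : ∀ b y, η' (b • y) = g b • η' y)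
    (e : η.comp θ = η'.comp θ) : η = η' := by
  ext y
  have hy : y ∈ Submodule.span B (Set.range θ) := h.span ▸ Submodule.mem_top
  induction hy using Submodule.span_induction with
  | mem y hy =>
    obtain ⟨x, rfl⟩ := hy
    exact DFunLike.congr_fun e x
  | zero => simp
  | add y z _ _ hy hz => rw [map_add, map_add, hy, hz]
  | smul b y _ hy => rw [hη, hη', hy]

lemma IsPullbackMap.exists_lift {f : A →+* B} {P : LineSec A} {Q : LineSec B} {θ : P.L →+ Q.L}
    (h : IsPullbackMap f P Q θ) (g : B →+* C) {N : Type} [AddCommGroup N] [Module C N]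
    (θ' : P.L →+ N) (hs : ∀ a x, θ' (a • x) = g (f a) • θ' x) :
    ∃ η : Q.L →+ N, (∀ b y, η (b • y) = g b • η y) ∧ η.comp θ = θ' := by
  let _ : Algebra A B := f.toAlgebra
  let _ : Module A Q.L := Module.compHom _ f
  let _ : Module B N := Module.compHom _ g
  let _ : Module A N := Module.compHom _ (g.comp f)
  have : IsScalarTower A B Q.L := ⟨fun a b y => mul_smul (f a) b y⟩
  have : IsScalarTower A B N := ⟨fun a b y => by
    change g (f a * b) • y = g (f a) • g b • y
    rw [map_mul, mul_smul]⟩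
  let θl : P.L →ₗ[A] Q.L := { θ with map_smul' := h.smul }
  let θl' : P.L →ₗ[A] N := { θ' with map_smul' := hs }
  let F : TensorProduct A B P.L →ₗ[B] Q.L := θl.liftBaseChange B
  have hF : ∀ b x, F (b ⊗ₜ x) = b • θ x := fun b x => LinearMap.liftBaseChange_tmul _ _ _ _
  have hsur : Function.Surjective F := by
    rw [← LinearMap.range_eq_top, eq_top_iff, ← h.span, Submodule.span_le]
    rintro _ ⟨x, rfl⟩
    exact ⟨1 ⊗ₜ x, by rw [hF, one_smul]⟩
  let e := LinearEquiv.ofBijective F (Module.Invertible.bijective_of_surjective hsur)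
  let G : TensorProduct A B P.L →ₗ[B] N := θl'.liftBaseChange B
  refine ⟨(G ∘ₗ e.symm.toLinearMap).toAddMonoidHom, fun b y =>
    (G ∘ₗ e.symm.toLinearMap).map_smul b y, AddMonoidHom.ext fun x => ?_⟩
  have : e.symm (θ x) = 1 ⊗ₜ x := by
    rw [LinearEquiv.symm_apply_eq]
    change _ = F _
    rw [hF, one_smul]
  change G (e.symm (θ x)) = θ' x
  rw [this]
  refine (LinearMap.liftBaseChange_tmul _ _ _ _).trans ?_
  rw [one_smul]
  rfl

lemma IsPullbackMap.exists_fac {f : A →+* B} {P : LineSec A} {Q : LineSec B} {θ : P.L →+ Q.L}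
    (h : IsPullbackMap f P Q θ) (g : B →+* C) {R : LineSec C} {θ' : P.L →+ R.L}
    (h' : IsPullbackMap (g.comp f) P R θ') :
    ∃ η : Q.L →+ R.L, IsPullbackMap g Q R η ∧ η.comp θ = θ' := by
  obtain ⟨η, hη, e⟩ := h.exists_lift g θ' h'.smul
  refine ⟨η, ⟨hη, ?_, ?_⟩, e⟩
  · rw [eq_top_iff, ← h'.span]
    refine Submodule.span_mono ?_
    rintro _ ⟨x, rfl⟩
    exact ⟨θ x, DFunLike.congr_fun e x⟩
  · rw [← h.sec, ← h'.sec]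
    exact DFunLike.congr_fun e _

/-- The pull-back of a line bundle with a section. -/
def LineSec.baseChange (f : A →+* B) (P : LineSec A) : LineSec B :=
  letI := f.toAlgebra
  { L := TensorProduct A B P.L
    sec := 1 ⊗ₜ P.sec }

/-- The pull-back map. -/
def LineSec.baseChangeMap (f : A →+* B) (P : LineSec A) : P.L →+ (P.baseChange f).L :=
  letI := f.toAlgebra
  (TensorProduct.mk A B P.L 1).toAddMonoidHom

lemma LineSec.isPullbackMap_baseChange (f : A →+* B) (P : LineSec A) :
    IsPullbackMap f P (P.baseChange f) (P.baseChangeMap f) where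
  smul a x := by
    let _ := f.toAlgebra
    refine ((TensorProduct.mk A B P.L 1).map_smul a x).trans ?_
    exact (algebraMap_smul B a _).symm
  span := by
    let _ := f.toAlgebra
    rw [eq_top_iff]
    rintro w -
    change TensorProduct A B P.L at w
    induction w with
    | zero => exact Submodule.zero_mem _
    | add x y hx hy => exact Submodule.add_mem _ hx hy
    | tmul b x =>
      have : (b ⊗ₜ[A] x : TensorProduct A B P.L) = b • (1 ⊗ₜ[A] x) := by
        rw [TensorProduct.smul_tmul', smul_eq_mul, mul_one]
      rw [this]
      exact Submodule.smul_mem _ _ (Submodule.subset_span ⟨x, rfl⟩)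
  sec := rfl

/-- The trivial line bundle with the section `a`. -/
def LineSec.triv (a : A) : LineSec A := { L := A, sec := a }

lemma LineSec.isPullbackMap_triv {f : A →+* B} {a : A} {b u : B} (hu : IsUnit u) (e : u * f a = b) :
    IsPullbackMap f (LineSec.triv a) (LineSec.triv b)
      ((AddMonoidHom.mulLeft u).comp f.toAddMonoidHom) where
  smul c x := by
    change A at x
    change u * f (c * x) = f c * (u * f x)
    rw [map_mul]
    ring
  span := by
    have h : u ∈ Submodule.span B (Set.range fun x : A => u * f x) :=
      Submodule.subset_span ⟨1, by simp⟩
    exact Ideal.eq_top_of_isUnit_mem _ h hu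
  sec := e

lemma LineSec.exists_dual_notMem (P : LineSec A) (x : PrimeSpectrum A) :
    ∃ (φ : Module.Dual A P.L) (l : P.L), φ l ∉ x.asIdeal := by
  by_contra! H
  obtain ⟨w, hw⟩ := (Module.Invertible.bijective (R := A) (M := P.L)).2 1
  have key : ∀ w, contractLeft A P.L w ∈ x.asIdeal := by
    intro w
    induction w with
    | zero => simp
    | add a b ha hb => rw [map_add]; exact Ideal.add_mem _ ha hb
    | tmul φ y => exact H φ y
  exact x.2.ne_top ((Ideal.eq_top_iff_one _).2 (hw ▸ key w))

lemma LineSec.smul_comm_dual (P : LineSec A) (φ : Module.Dual A P.L) (l m : P.L) :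
    φ l • m = φ m • l := by
  have := congrArg (TensorProduct.lid A P.L ∘ (φ.rTensor P.L))
    (Module.Invertible.tmul_comm (R := A) (m₁ := l) (m₂ := m))
  simp at this
  exact this

lemma LineSec.isPullbackMap_dual {f : A →+* B} (P : LineSec A) (φ : Module.Dual A P.L) (l : P.L)
    (h : IsUnit (f (φ l))) : IsPullbackMap f P (LineSec.triv (f (φ P.sec)))
      (f.toAddMonoidHom.comp φ.toAddMonoidHom) where
  smul c x := by
    change f (φ (c • x)) = f c * f (φ x)
    simp [*]
  span := by
    have h' : f (φ l) ∈ Submodule.span B (Set.range fun x : P.L => f (φ x)) :=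
      Submodule.subset_span ⟨l, rfl⟩
    exact Ideal.eq_top_of_isUnit_mem _ h' h
  sec := rfl

lemma LineSec.eq_zero_of_dual (P : LineSec A) {l : P.L} (h : ∀ φ : Module.Dual A P.L, φ l = 0) :
    l = 0 :=
  (Module.forall_dual_apply_eq_zero_iff A l).1 h

lemma LineSec.exists_of_dual (P : LineSec A) (F : Module.Dual A (Module.Dual A P.L)) :
    ∃ l : P.L, ∀ φ, φ l = F φ :=
  ⟨(Module.evalEquiv A P.L).symm F, fun φ => by
    simp⟩

lemma LineSec.vanishesAt_triv (a : A) (x : PrimeSpectrum A) :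
    (LineSec.triv a).VanishesAt x ↔ a ∈ x.asIdeal := by
  have : x.asIdeal • (⊤ : Submodule A (LineSec.triv a).L) = x.asIdeal :=
    (Ideal.mul_top x.asIdeal)
  exact iff_of_eq (congrArg (fun I : Ideal A => a ∈ I) this)

lemma LineSec.nonInvertible_triv (a : A) : (LineSec.triv a).NonInvertible ↔ ¬ IsUnit a := by
  constructor
  · rintro ⟨x, hx⟩ h
    exact x.2.ne_top (Ideal.eq_top_of_isUnit_mem _ ((vanishesAt_triv a x).1 hx) h)
  · intro h
    obtain ⟨m, hm, ha⟩ := exists_max_ideal_of_mem_nonunits h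
    exact ⟨⟨m, hm.isPrime⟩, (vanishesAt_triv a _).2 ha⟩

end Algebra

namespace A1GmPow

variable {r : ℕ}

lemma hom_ext {X Y : A1GmPow r} {φ ψ : X ⟶ Y} (h : Hom.base φ = Hom.base ψ)
    (h' : ∀ i, Hom.map φ i = Hom.map ψ i) : φ = ψ := Hom.ext h (funext h')

lemma fac {x y z : A1GmPow r} (a : y ⟶ x) (b : z ⟶ x) (g : z.base ⟶ y.base)
    (h : g ≫ Hom.base a = Hom.base b) : ∃ c : z ⟶ y, Hom.base c = g ∧ c ≫ a = b := by
  choose η hη e using fun i => (Hom.isPullback a i).exists_fac (ringMap g) (R := z.pair i)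
    (θ' := Hom.map b i) (by rw [← ringMap_comp, h]; exact Hom.isPullback b i)
  exact ⟨⟨g, η, hη⟩, rfl, hom_ext h e⟩

lemma fibred : IsFibredInGroupoids (proj r) := by
  refine IsFibredInGroupoids.mk' (fun x V f => ?_) fun {x y z} a b g h => ?_
  · refine ⟨⟨V, fun i => (x.pair i).baseChange (ringMap f)⟩, rfl,
      ⟨f, fun i => _, fun i => (x.pair i).isPullbackMap_baseChange _⟩, ?_⟩
    exact (id_comp _).symm
  · obtain ⟨c, hc, hc'⟩ := fac a b g h
    refine ⟨c, ⟨hc, hc'⟩, fun c' ⟨h1, h2⟩ => hom_ext (h1.trans hc.symm) fun i => ?_⟩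
    have e : Hom.base c' = Hom.base c := h1.trans hc.symm
    refine (Hom.isPullback a i).ext_semilinear (g := ringMap (Hom.base c))
      (by rw [← e]; exact (Hom.isPullback c' i).smul) (Hom.isPullback c i).smul
      (congrArg (Hom.map · i) (h2.trans hc'.symm))

variable {x y : A1GmPow r} {i : Fin r}

lemma exists_extend {z : A1GmPow r} (a : z ⟶ x) (ψ : Module.Dual x.base.unop (x.pair i).L) :
    ∃ η : Module.Dual z.base.unop (z.pair i).L, ∀ l, η (Hom.map a i l) = ringMap (Hom.base a) (ψ l) := by
  obtain ⟨η, hη, e⟩ := (Hom.isPullback a i).exists_lift (RingHom.id _)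
    ((ringMap (Hom.base a)).toAddMonoidHom.comp ψ.toAddMonoidHom) (fun c l => by
      change ringMap (Hom.base a) (ψ (c • l)) = ringMap (Hom.base a) c * ringMap _ (ψ l)
      rw [LinearMap.map_smul, smul_eq_mul, map_mul])
  exact ⟨{ η with map_smul' := hη }, fun l => DFunLike.congr_fun e l⟩

/-- The extension of a functional to a pull-back. -/
def extend {z : A1GmPow r} (a : z ⟶ x) (ψ : Module.Dual x.base.unop (x.pair i).L) :
    Module.Dual z.base.unop (z.pair i).L := (exists_extend a ψ).choose

lemma extend_map {z : A1GmPow r} (a : z ⟶ x) (ψ : Module.Dual x.base.unop (x.pair i).L) (l : (x.pair i).L) :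
    extend a ψ (Hom.map a i l) = ringMap (Hom.base a) (ψ l) := (exists_extend a ψ).choose_spec l

lemma extend_comp {w z : A1GmPow r} (b : w ⟶ z) (a : z ⟶ x) (ψ : Module.Dual x.base.unop (x.pair i).L)
    (m : (z.pair i).L) : extend (b ≫ a) ψ (Hom.map b i m) = ringMap (Hom.base b) (extend a ψ m) := by
  have : (extend (b ≫ a) ψ).toAddMonoidHom.comp (Hom.map b i) =
      (ringMap (Hom.base b)).toAddMonoidHom.comp (extend a ψ).toAddMonoidHom := by
    refine (Hom.isPullback a i).ext_semilinear (g := ringMap (Hom.base b)) (fun c m => ?_)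
      (fun c m => ?_) (AddMonoidHom.ext fun l => ?_)
    · change extend (b ≫ a) ψ (Hom.map b i (c • m)) = _
      rw [(Hom.isPullback b i).smul, LinearMap.map_smul]
      rfl
    · simp [*]
    · change extend (b ≫ a) ψ (Hom.map (b ≫ a) i l) = ringMap _ (extend a ψ (Hom.map a i l))
      rw [extend_map, extend_map]
      rfl
  exact DFunLike.congr_fun this m

lemma eq_zero_of_extend {z : A1GmPow r} (a : z ⟶ x) {m : (z.pair i).L} (h : ∀ ψ, extend a ψ m = 0) : m = 0 := by
  obtain ⟨w, hw⟩ := (Module.Invertible.bijective (R := x.base.unop) (M := (x.pair i).L)).2 1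
  have key : ∀ w, ringMap (Hom.base a) (contractLeft x.base.unop (x.pair i).L w) • m = 0 := by
    intro w
    induction w with
    | zero => rw [map_zero, map_zero, zero_smul]
    | add a b ha hb => rw [map_add, map_add, add_smul, ha, hb, add_zero]
    | tmul φ y =>
      rw [contractLeft_apply, ← extend_map, (z.pair i).smul_comm_dual, h, zero_smul]
  have := key w
  rwa [hw, map_one, one_smul] at this

lemma elem_ext {l l' : (x.pair i).L} (h : ∀ p : PrimeSpectrum x.base.unop, ∃ (z : A1GmPow r) (a : z ⟶ x),
    IsEt (Hom.base a) ∧ p ∈ Set.range (ptMap (Hom.base a)) ∧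
      Hom.map a i l = Hom.map a i l') : l = l' := by
  rw [← sub_eq_zero]
  refine (x.pair i).eq_zero_of_dual fun ψ => function_ext fun p => ?_
  obtain ⟨z, a, ha, hp, e⟩ := h p
  refine ⟨_, Hom.base a, ha, hp, ?_⟩
  rw [← extend_map, map_sub, e, sub_self, map_zero, map_zero]

lemma exists_elem (Pr : ∀ {z : A1GmPow r} (_ : z ⟶ x), (z.pair i).L → Prop)
    (stab : ∀ {w z : A1GmPow r} (b : w ⟶ z) (a : z ⟶ x) (m : (z.pair i).L), Pr a m →
      Pr (b ≫ a) (Hom.map b i m))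
    (uniq : ∀ {z : A1GmPow r} (a : z ⟶ x) (m m' : (z.pair i).L), Pr a m → Pr a m' → m = m')
    (loc : ∀ p : PrimeSpectrum x.base.unop, ∃ (z : A1GmPow r) (a : z ⟶ x), IsEt (Hom.base a) ∧
      p ∈ Set.range (ptMap (Hom.base a)) ∧ ∃ m, Pr a m) :
    ∃ l : (x.pair i).L, ∀ {z : A1GmPow r} (a : z ⟶ x) (m : (z.pair i).L), Pr a m → Hom.map a i l = m := by
  have key : ∀ ψ : Module.Dual x.base.unop (x.pair i).L, ∃ s : x.base.unop, ∀ {z : A1GmPow r} (a : z ⟶ x)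
      (m : (z.pair i).L), Pr a m → ringMap (Hom.base a) s = extend a ψ m := by
    intro ψ
    obtain ⟨s, hs⟩ := exists_function (U := x.base) (fun {V} f s => ∃ (R : Fin r → LineSec V.unop)
        (a : (⟨V, R⟩ : A1GmPow r) ⟶ x) (m : (R i).L), Hom.base a = f ∧ Pr a m ∧ extend a ψ m = s) (by
      rintro V W g _ _ ⟨R, a, m, rfl, hm, rfl⟩
      let b : (⟨W, fun j => (R j).baseChange (ringMap g)⟩ : A1GmPow r) ⟶ ⟨V, R⟩ :=
        ⟨g, fun _ => _, fun j => (R j).isPullbackMap_baseChange _⟩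
      exact ⟨_, b ≫ a, _, rfl, stab b a m hm, extend_comp b a ψ m⟩) (by
      rintro V f _ _ ⟨R, a, m, h, hm, rfl⟩ ⟨R', a', m', h', hm', rfl⟩
      obtain ⟨b, hb, rfl⟩ := fac a a' (𝟙 V) ((id_comp _).trans (h.trans h'.symm))
      rw [uniq _ _ _ hm' (stab b a m hm), extend_comp, hb]
      rfl) (by
      intro p
      obtain ⟨⟨V, R⟩, a, ha, hp, m, hm⟩ := loc p
      exact ⟨V, Hom.base a, ha, hp, _, R, a, m, rfl, hm, rfl⟩)
    exact ⟨s, fun {z} a m hm => hs _ _ ⟨z.pair, a, m, rfl, hm, rfl⟩⟩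
  choose s hs using key
  obtain ⟨l, hl⟩ := (x.pair i).exists_of_dual
    { toFun := s
      map_add' := fun ψ ψ' => function_ext fun p => by
        obtain ⟨z, a, ha, hp, m, hm⟩ := loc p
        refine ⟨_, Hom.base a, ha, hp, ?_⟩
        rw [map_add, hs _ a m hm, hs _ a m hm, hs _ a m hm]
        have : (extend a (ψ + ψ')).toAddMonoidHom =
            (extend a ψ + extend a ψ').toAddMonoidHom := by
          refine (Hom.isPullback a i).ext_semilinear (g := RingHom.id _)
            (extend a (ψ + ψ')).map_smul (extend a ψ + extend a ψ').map_smul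
            (AddMonoidHom.ext fun l => ?_)
          change extend a _ _ = extend a _ _ + extend a _ _
          rw [extend_map, extend_map, extend_map, LinearMap.add_apply, map_add]
        exact DFunLike.congr_fun this m
      map_smul' := fun c ψ => function_ext fun p => by
        obtain ⟨z, a, ha, hp, m, hm⟩ := loc p
        refine ⟨_, Hom.base a, ha, hp, ?_⟩
        rw [smul_eq_mul, map_mul, hs _ a m hm, hs _ a m hm]
        have : (extend a (c • ψ)).toAddMonoidHom =
            (ringMap (Hom.base a) c • extend a ψ).toAddMonoidHom := by
          refine (Hom.isPullback a i).ext_semilinear (g := RingHom.id _)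
            (extend a (c • ψ)).map_smul (ringMap (Hom.base a) c • extend a ψ).map_smul
            (AddMonoidHom.ext fun l => ?_)
          change extend a _ _ = _ * extend a _ _
          rw [extend_map, extend_map, LinearMap.smul_apply, smul_eq_mul, map_mul]
        exact DFunLike.congr_fun this m }
  refine ⟨l, fun {z} a m hm => ?_⟩
  rw [← sub_eq_zero]
  refine eq_zero_of_extend a fun ψ => ?_
  rw [map_sub, extend_map, hl, sub_eq_zero]
  exact hs ψ a m hm

lemma span_eq_top_of_forall {A B : Type} [CommRing A] [CommRing B] {P : LineSec A}
    {Q : LineSec B} (θ : P.L →+ Q.L)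
    (h : ∀ p : PrimeSpectrum B, ∃ (ψ : Module.Dual B Q.L) (l : P.L), ψ (θ l) ∉ p.asIdeal) :
    Submodule.span B (Set.range θ) = ⊤ := by
  let J : Ideal B := Ideal.span (Set.range fun t : Module.Dual B Q.L × P.L => t.1 (θ t.2))
  have hJ : J = ⊤ := by
    by_contra hJ
    obtain ⟨m, hm, hJm⟩ := Ideal.exists_le_maximal J hJ
    obtain ⟨ψ, l, hl⟩ := h ⟨m, hm.isPrime⟩
    exact hl (hJm (Ideal.subset_span ⟨(ψ, l), rfl⟩))
  rw [eq_top_iff]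
  rintro y -
  have key : ∀ b ∈ J, b • y ∈ Submodule.span B (Set.range θ) := by
    intro b hb
    induction hb using Submodule.span_induction with
    | mem b hb =>
      obtain ⟨⟨ψ, l⟩, rfl⟩ := hb
      change ψ (θ l) • y ∈ _
      rw [Q.smul_comm_dual]
      exact Submodule.smul_mem _ _ (Submodule.subset_span ⟨l, rfl⟩)
    | zero => rw [zero_smul]; exact Submodule.zero_mem _
    | add b c _ _ hb hc => rw [add_smul]; exact Submodule.add_mem _ hb hc
    | smul b c _ hc => rw [smul_eq_mul, mul_smul]; exact Submodule.smul_mem _ _ hc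
  simpa using key 1 (hJ ▸ Submodule.mem_top)

lemma exists_dual_map_notMem {y z : A1GmPow r} (a : z ⟶ y) (p : PrimeSpectrum z.base.unop) :
    ∃ (ψ : Module.Dual z.base.unop (z.pair i).L) (l : (y.pair i).L), ψ (Hom.map a i l) ∉ p.asIdeal := by
  obtain ⟨ψ, l, h⟩ := (y.pair i).exists_dual_notMem (ptMap (Hom.base a) p)
  exact ⟨extend a ψ, l, by rw [extend_map]; exact h⟩

theorem isPrestack : IsPrestack etale (proj r) := by
  refine ⟨fibred, fun {x y} φ => ?_⟩
  have hmem := mem_etale.1 φ.mem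
  have loc : ∀ p : PrimeSpectrum x.base.unop, ∃ (z : A1GmPow r) (a : z ⟶ x) (_ : φ.sieve ((proj r).map a)),
      IsEt (Hom.base a) ∧ p ∈ Set.range (ptMap (Hom.base a)) := by
    intro p
    obtain ⟨V, f, hf, he, hp⟩ := hmem p
    exact ⟨⟨V, fun i => (x.pair i).baseChange (ringMap f)⟩, ⟨f, fun i => _, fun i => (x.pair i).isPullbackMap_baseChange _⟩, hf, he, hp⟩
  have key : ∀ i, ∀ l : (y.pair i).L, ∃ m : (x.pair i).L, ∀ {z : A1GmPow r} (a : z ⟶ x) (h : φ.sieve ((proj r).map a)),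
      Hom.map a i m = Hom.map (φ.map a h) i l := by
    intro i l
    obtain ⟨m, hm⟩ := exists_elem (x := x) (i := i) (fun a m => ∃ h : φ.sieve ((proj r).map a),
        m = Hom.map (φ.map a h) i l) (by
      rintro w z b a _ ⟨h, rfl⟩
      have h' : φ.sieve ((proj r).map (b ≫ a)) := by simp [*]
      exact ⟨h', by rw [φ.map_comp b a h h']; rfl⟩) (by
      rintro z a _ _ ⟨h, rfl⟩ ⟨h', rfl⟩
      rfl) (fun p => by
      obtain ⟨z, a, h, ha, hp⟩ := loc p
      exact ⟨z, a, ha, hp, _, h, rfl⟩)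
    exact ⟨m, fun a h => hm a _ ⟨h, rfl⟩⟩
  choose m hm using key
  have hext : ∀ {i} {l l' : (x.pair i).L}, (∀ {z : A1GmPow r} (a : z ⟶ x), φ.sieve ((proj r).map a) →
      Hom.map a i l = Hom.map a i l') → l = l' := by
    intro i l l' h
    refine elem_ext fun p => ?_
    obtain ⟨z, a, ha, he, hp⟩ := loc p
    exact ⟨z, a, he, hp, h a ha⟩
  let β : x.base ⟶ y.base := φ.base
  have hb : ∀ {z : A1GmPow r} (a : z ⟶ x) (h : φ.sieve ((proj r).map a)),
      Hom.base (φ.map a h) = Hom.base a ≫ β := fun a h => φ.map_base a h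
  let θ (i) : (y.pair i).L →+ (x.pair i).L :=
    { toFun := m i
      map_zero' := hext fun a h => by rw [hm i _ a h, map_zero, map_zero]
      map_add' := fun l l' => hext fun a h => by
        rw [map_add, hm i _ a h, hm i _ a h, hm i _ a h, map_add] }
  have hθ (i) : IsPullbackMap (ringMap β) (y.pair i) (x.pair i) (θ i) :=
    { smul := fun c l => hext fun a h => by
        change Hom.map a i (m i (c • l)) = Hom.map a i (ringMap β c • m i l)
        rw [hm i _ a h, (Hom.isPullback a i).smul, hm i _ a h, (Hom.isPullback (φ.map a h) i).smul,
          hb a h]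
        rfl
      span := by
        refine span_eq_top_of_forall (θ i) fun p => ?_
        obtain ⟨z, a, ha, he, t, rfl⟩ := loc p
        by_contra! H
        have h1 : ∀ (ψ : Module.Dual z.base.unop (z.pair i).L) (l : (y.pair i).L),
            ψ (Hom.map (φ.map a ha) i l) ∈ t.asIdeal := by
          intro ψ l
          rw [← hm i l a ha]
          obtain ⟨χ, n, hn⟩ := (x.pair i).exists_dual_notMem (ptMap (Hom.base a) t)
          have h2 : extend a χ (Hom.map a i (m i l)) ∈ t.asIdeal := by
            rw [extend_map]
            exact H χ l
          have h3 : extend a χ (Hom.map a i n) ∉ t.asIdeal := by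
            rw [extend_map]
            exact hn
          have h4 := congrArg ψ ((z.pair i).smul_comm_dual (extend a χ) (Hom.map a i (m i l))
            (Hom.map a i n))
          rw [LinearMap.map_smul, LinearMap.map_smul, smul_eq_mul, smul_eq_mul] at h4
          have h5 : extend a χ (Hom.map a i n) * ψ (Hom.map a i (m i l)) ∈ t.asIdeal := by
            rw [← h4]
            exact Ideal.mul_mem_right _ _ h2
          exact (t.2.mem_or_mem h5).resolve_left h3
        obtain ⟨ψ, l, h⟩ := exists_dual_map_notMem (φ.map a ha) t
        exact h (h1 ψ l)
      sec := hext fun a h => by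
        change Hom.map a i (m i _) = _
        rw [hm i _ a h, (Hom.isPullback (φ.map a h) i).sec, (Hom.isPullback a i).sec] }
  refine ⟨⟨β, θ, hθ⟩, ⟨rfl, fun {z} a h => hom_ext (hb a h).symm fun i =>
    AddMonoidHom.ext fun l => hm i l a h⟩, fun c ⟨hc, hc'⟩ => hom_ext hc fun i =>
    AddMonoidHom.ext fun l => hext fun a h => ?_⟩
  have := congrArg (fun k => Hom.map k i l) (hc' a h)
  exact this.trans (hm i l a h).symm

end A1GmPow

end Line


section Sheafified

universe v₁ u₁

/-! ### The prestack associated to a category fibred in groupoids, for the Zariski topology -/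

variable {E : Type u₁} [Category.{v₁} E] (p : E ⥤ Aff)

/-- Morphisms which agree étale locally are equal. -/
def EtaleSeparated : Prop := ∀ {x y : E} (m m' : x ⟶ y), p.map m = p.map m' →
  (∀ t : PrimeSpectrum (p.obj x).unop, ∃ (z : E) (a : z ⟶ x), IsEt (p.map a) ∧
    t ∈ Set.range (ptMap (p.map a)) ∧ a ≫ m = a ≫ m') → m = m'

/-- The predicate `Pr` determines a morphism étale locally. -/
structure LocallyDetermines {x y : E} (f : p.obj x ⟶ p.obj y)
    (Pr : ∀ {z : E} (_ : z ⟶ x) (_ : z ⟶ y), Prop) : Prop where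
  base : ∀ {z : E} (e : z ⟶ x) (m : z ⟶ y), Pr e m → p.map m = p.map e ≫ f
  stab : ∀ {z w : E} (k : w ⟶ z) (e : z ⟶ x) (m : z ⟶ y), Pr e m → Pr (k ≫ e) (k ≫ m)
  uniq : ∀ {z : E} (e : z ⟶ x) (m m' : z ⟶ y), Pr e m → Pr e m' → m = m'
  loc : ∀ t : PrimeSpectrum (p.obj x).unop, ∃ (z : E) (e : z ⟶ x), IsEt (p.map e) ∧
    t ∈ Set.range (ptMap (p.map e)) ∧ ∃ m, Pr e m

/-- A morphism given étale locally exists Zariski locally. -/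
def ZariskiGluing : Prop := ∀ {x y : E} (f : p.obj x ⟶ p.obj y)
  (Pr : ∀ {z : E} (_ : z ⟶ x) (_ : z ⟶ y), Prop), LocallyDetermines p f Pr →
  ∀ t : PrimeSpectrum (p.obj x).unop, ∃ (z : E) (e : z ⟶ x) (m : z ⟶ y),
    (ringMap (p.map e)).IsStandardOpenImmersion ∧ t ∈ Set.range (ptMap (p.map e)) ∧
    p.map m = p.map e ≫ f ∧ ∀ {w : E} (k : w ⟶ z) (m' : w ⟶ y), Pr (k ≫ e) m' → k ≫ m = m'

lemma isEt_of_isStandard {V U : Aff} {f : V ⟶ U} (h : (ringMap f).IsStandardOpenImmersion) :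
    IsEt f := by
  let _ := (ringMap f).toAlgebra
  obtain ⟨a, ha⟩ := h
  have : Algebra.Etale U.unop V.unop := Algebra.Etale.of_isLocalizationAway a
  exact RingHom.etale_algebraMap.2 this

variable {p}

lemma IsFibredInGroupoids.exists_square (hp : IsFibredInGroupoids p) {x y z : E} {b : y ⟶ x}
    (hb : IsEt (p.map b)) (a : z ⟶ x) {t : PrimeSpectrum (p.obj z).unop}
    (ht : ptMap (p.map a) t ∈ Set.range (ptMap (p.map b))) :
    ∃ (w : E) (c : w ⟶ z) (d : w ⟶ y), IsEt (p.map c) ∧ t ∈ Set.range (ptMap (p.map c)) ∧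
      c ≫ a = d ≫ b := by
  obtain ⟨s, hs⟩ := ht
  obtain ⟨W, g, h, w, hg, hgh, hw, -⟩ := hb.exists_square (p.map a) t s hs.symm
  obtain ⟨w', e, c, hc, hce, hct⟩ := exists_nbhd hp z g hg ⟨w, hw⟩
  obtain ⟨d, -, hd⟩ := hp.fac b (c ≫ a) (e.hom ≫ h) (by
    rw [p.map_comp, hc, assoc, assoc, hgh])
  exact ⟨w', c, d, hce, hct, hd.symm⟩

lemma exists_comp_nbhd {x y z : E} {t : PrimeSpectrum (p.obj x).unop} (a : y ⟶ x)
    (ha : IsEt (p.map a)) {s : PrimeSpectrum (p.obj y).unop} (hs : ptMap (p.map a) s = t) (b : z ⟶ y)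
    (hb : IsEt (p.map b)) (hs' : s ∈ Set.range (ptMap (p.map b))) :
    IsEt (p.map (b ≫ a)) ∧ t ∈ Set.range (ptMap (p.map (b ≫ a))) := by
  obtain ⟨r, rfl⟩ := hs'
  rw [p.map_comp]
  exact ⟨hb.comp ha, r, by rw [ptMap_comp, hs]⟩

namespace IsomSheafified

/-- The tautological functor to the Zariski sheafification of the morphisms. -/
abbrev zun (p : E ⥤ Aff) : E ⥤ IsomSheafified zariski p := unit zariski p

/-- The class of a local morphism. -/
def ofLocal {x y : E} (α : LocalHom zariski p x y) : (zun p).obj x ⟶ (zun p).obj y :=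
  Quotient.mk (LocalHom.setoid zariski p x y) α

lemma zun_comp_ofLocal {x y z : E} (α : LocalHom zariski p x y) (b : z ⟶ x)
    (h : α.sieve (p.map b)) : (zun p).map b ≫ ofLocal α = (zun p).map (α.map b h) := by
  refine Quotient.sound ⟨(α.map_base b h).symm, ⊤, zariski.top_mem _, fun {w} c _ => ?_⟩
  change z ⟶ x at b
  change w ⟶ z at c
  have h0 : α.sieve (p.map c ≫ p.map b) := α.sieve.downward_closed h _
  exact ⟨⟨trivial, h0⟩, trivial, α.map_comp c b h ((p.map_comp c b).symm ▸ h0)⟩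

/-- The morphisms between objects which come from `E`. -/
abbrev ZHom (p : E ⥤ Aff) (x y : E) := (zun p).obj x ⟶ (zun p).obj y

/-- The underlying morphism of affine schemes. -/
def zbase {x y : E} (A : ZHom p x y) : p.obj x ⟶ p.obj y := (proj zariski p).map A

lemma zbase_comp {x y z : E} (A : ZHom p x y) (B : ZHom p y z) :
    zbase (A ≫ B) = zbase A ≫ zbase B := (proj zariski p).map_comp A B

lemma zbase_zun {x y : E} (a : x ⟶ y) : zbase ((zun p).map a) = p.map a := rfl

variable (hp : IsFibredInGroupoids p)

include hp in
lemma exists_local_rep {x y : E} (A : ZHom p x y) (t : PrimeSpectrum (p.obj x).unop) :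
    ∃ (z : E) (b : z ⟶ x) (n : z ⟶ y), IsEt (p.map b) ∧ t ∈ Set.range (ptMap (p.map b)) ∧
      (zun p).map b ≫ A = (zun p).map n := by
  obtain ⟨α, rfl⟩ : ∃ α, ofLocal α = A := Quotient.exists_rep A
  obtain ⟨V, f, hf, hstd, hx⟩ := mem_zariski.1 α.mem t
  obtain ⟨z, e, b, hb, hbe, hbt⟩ := exists_nbhd hp x f (isEt_of_isStandard hstd) hx
  have h : α.sieve (p.map b) := by
    simp [*]
  exact ⟨z, b, α.map b h, hbe, hbt, zun_comp_ofLocal α b h⟩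

variable (sep : EtaleSeparated p)

include hp sep in
lemma zun_injective {x y : E} {m m' : x ⟶ y} (h : (zun p).map m = (zun p).map m') : m = m' := by
  obtain ⟨hb, Q, hQ, H⟩ := Quotient.exact (s := LocalHom.setoid zariski p x y) h
  refine sep m m' hb fun t => ?_
  obtain ⟨V, f, hf, hstd, ht⟩ := mem_zariski.1 hQ t
  obtain ⟨z, e, b, hb, hbe, hbt⟩ := exists_nbhd hp x f (isEt_of_isStandard hstd) ht
  obtain ⟨_, _, h⟩ := H b (by rw [hb]; exact Q.downward_closed hf _)
  exact ⟨z, b, hbe, hbt, h⟩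

include hp sep in
lemma zhom_ext {x y : E} {A A' : ZHom p x y} (h : zbase A = zbase A')
    (H : ∀ t : PrimeSpectrum (p.obj x).unop, ∃ (z : E) (b : z ⟶ x), IsEt (p.map b) ∧
      t ∈ Set.range (ptMap (p.map b)) ∧ (zun p).map b ≫ A = (zun p).map b ≫ A') : A = A' := by
  obtain ⟨α, rfl⟩ : ∃ α, ofLocal α = A := Quotient.exists_rep A
  obtain ⟨α', rfl⟩ : ∃ α, ofLocal α = A' := Quotient.exists_rep A'
  have hα : α.base = α'.base := h
  refine Quotient.sound ⟨hα, α.sieve ⊓ α'.sieve, zariski.intersection_covering α.mem α'.mem,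
    fun {z} a ha => ⟨ha.1, ha.2, sep _ _ (by rw [α.map_base, α'.map_base, hα]) fun t => ?_⟩⟩
  obtain ⟨y, b, hb, ht, e⟩ := H (ptMap (p.map a) t)
  obtain ⟨w, c, d, hc, hct, hcd⟩ := hp.exists_square hb a ht
  refine ⟨w, c, hc, hct, zun_injective hp sep ?_⟩
  rw [Functor.map_comp, Functor.map_comp, ← zun_comp_ofLocal, ← zun_comp_ofLocal, ← assoc,
    ← assoc, ← Functor.map_comp, hcd, Functor.map_comp, assoc, assoc, e]

variable (glue : ZariskiGluing p)

include hp sep glue in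
lemma exists_zhom {x y : E} (f : p.obj x ⟶ p.obj y) (Pr : ∀ {z : E} (_ : z ⟶ x) (_ : z ⟶ y), Prop)
    (hPr : LocallyDetermines p f Pr) : ∃ A : ZHom p x y, zbase A = f ∧
      ∀ {z : E} (e : z ⟶ x) (m : z ⟶ y), Pr e m → (zun p).map e ≫ A = (zun p).map m := by
  let Pr' : ∀ {z : E} (_ : z ⟶ x) (_ : z ⟶ y), Prop := fun {z} e m => p.map m = p.map e ≫ f ∧
    ∀ {w : E} (k : w ⟶ z) (m' : w ⟶ y), Pr (k ≫ e) m' → k ≫ m = m'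
  have stab : ∀ {z w : E} (k : w ⟶ z) (e : z ⟶ x) (m : z ⟶ y), Pr' e m → Pr' (k ≫ e) (k ≫ m) := by
    grind
  have uniq : ∀ {z : E} (e : z ⟶ x) (m m' : z ⟶ y), Pr' e m → Pr' e m' → m = m' := by
    rintro z e m m' ⟨h1, h2⟩ ⟨h1', h2'⟩
    refine sep m m' (h1.trans h1'.symm) fun t => ?_
    obtain ⟨v, b, hb, ht, n, hn⟩ := hPr.loc (ptMap (p.map e) t)
    obtain ⟨w, c, d, hc, hct, hcd⟩ := hp.exists_square hb e ht
    have h3 : Pr (c ≫ e) (d ≫ n) := hcd ▸ hPr.stab d b n hn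
    grind
  let S : Sieve (p.obj x) :=
    { arrows := fun V g => ∃ (z : E) (e : z ⟶ x) (m : z ⟶ y) (k : V ⟶ p.obj z), Pr' e m ∧
        k ≫ p.map e = g
      downward_closed := by
        rintro V W f ⟨z, e, m, k, h, rfl⟩ g
        exact ⟨z, e, m, g ≫ k, h, assoc _ _ _⟩ }
  have hS : S ∈ zariski (p.obj x) := fun t => by
    obtain ⟨z, e, m, he, ht, h⟩ := glue f Pr hPr t
    exact ⟨_, p.map e, ⟨z, e, m, 𝟙 _, h, id_comp _⟩, he, ht⟩
  have K : ∀ {z : E} (e : z ⟶ x), S (p.map e) → ∃ m, Pr' e m := by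
    rintro z e ⟨z', e', m, k, h, hk⟩
    obtain ⟨d, -, hd⟩ := hp.fac e' e k hk
    exact ⟨d ≫ m, hd ▸ stab d e' m h⟩
  let α : LocalHom zariski p x y :=
    { base := f
      sieve := S
      mem := hS
      map := fun e h => (K e h).choose
      map_base := fun e h => (K e h).choose_spec.1
      map_comp := fun b e h h' => uniq _ _ _ (K _ h').choose_spec (stab b _ _ (K e h).choose_spec) }
  refine ⟨ofLocal α, rfl, fun {z} e m hm => zhom_ext hp sep ?_ fun t => ?_⟩
  · exact (zbase_comp _ _).trans (hPr.base e m hm).symm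
  · obtain ⟨V, g, hg, hstd, ht⟩ := mem_zariski.1 hS (ptMap (p.map e) t)
    obtain ⟨v, i, b, hb, hbe, hbt⟩ := exists_nbhd hp x g (isEt_of_isStandard hstd) ht
    obtain ⟨w, c, d, hc, hct, hcd⟩ := hp.exists_square hbe e hbt
    refine ⟨w, c, hc, hct, ?_⟩
    have h1 : S (p.map (c ≫ e)) := by
      simp [*]
    rw [← assoc, ← Functor.map_comp, zun_comp_ofLocal α _ h1, ← Functor.map_comp]
    refine congrArg _ ?_
    have h2 := (K _ h1).choose_spec.2 (𝟙 w) (c ≫ m) (by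
      rw [id_comp]; exact hPr.stab c e m hm)
    rw [id_comp] at h2
    exact h2

include hp sep in
lemma zcancel {x y z : E} (a : ZHom p y x) (m m' : z ⟶ y) (h : p.map m = p.map m')
    (h' : (zun p).map m ≫ a = (zun p).map m' ≫ a) : m = m' := by
  refine sep m m' h fun t => ?_
  obtain ⟨v, e, n, he, ht, hn⟩ := exists_local_rep hp a (ptMap (p.map m) t)
  obtain ⟨w, c, d, hc, hct, hcd⟩ := hp.exists_square he m ht
  obtain ⟨d', hd', hd2⟩ := hp.fac e (c ≫ m') (p.map d) (by
    rw [p.map_comp, ← h, ← p.map_comp, ← p.map_comp, hcd])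
  refine ⟨w, c, hc, hct, ?_⟩
  have h3 : d ≫ n = d' ≫ n := by
    apply zun_injective hp sep
    grind
  rw [hcd, ← hd2, hp.cancel n hd'.symm h3]

include hp sep glue in
lemma zfac {x y z : E} (a : ZHom p y x) (b : ZHom p z x) (g : p.obj z ⟶ p.obj y)
    (hg : g ≫ zbase a = zbase b) : ∃! c : ZHom p z y, zbase c = g ∧ c ≫ a = b := by
  have loc : ∀ t : PrimeSpectrum (p.obj z).unop, ∃ (w : E) (e : w ⟶ z), IsEt (p.map e) ∧
      t ∈ Set.range (ptMap (p.map e)) ∧ ∃ m : w ⟶ y, p.map m = p.map e ≫ g ∧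
        (zun p).map m ≫ a = (zun p).map e ≫ b := by
    intro t
    obtain ⟨z', e, n, he, ⟨t', ht'⟩, hn⟩ := exists_local_rep hp b t
    obtain ⟨y₁, i, s, hs⟩ := hp.lift_sieve (x := y) (p.map e ≫ g)
    obtain ⟨t₁, ht₁⟩ := ptMap_surjective_of_isIso i.hom t'
    obtain ⟨y₂, e', n', he', ht₂, hn'⟩ := exists_local_rep hp ((zun p).map s ≫ a) t₁
    obtain ⟨w, j, k, hk, hke, hkt⟩ := exists_nbhd hp z' (p.map e' ≫ i.hom)
      (he'.comp (isEt_of_isIso _)) (x := t') (by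
        obtain ⟨t₂, rfl⟩ := ht₂
        exact ⟨t₂, ht₁⟩)
    have h1 : p.map e ≫ zbase b = p.map n := (zbase_comp _ _).symm.trans (congrArg zbase hn)
    have h2 : p.map e' ≫ p.map s ≫ zbase a = p.map n' := by
      rw [← zbase_zun n', ← hn', zbase_comp, zbase_comp, zbase_zun, zbase_zun]
    obtain ⟨t, ht, htn⟩ := hp.fac n' (k ≫ n) j.hom (by
      rw [p.map_comp, ← h1, ← h2, hk, hs, ← hg]
      simp only [assoc])
    obtain ⟨h3, h4⟩ := exists_comp_nbhd e he ht' k hke hkt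
    refine ⟨w, k ≫ e, h3, h4, t ≫ e' ≫ s, ?_, ?_⟩
    · grind
    · grind
  obtain ⟨c, hc, hPr⟩ := exists_zhom hp sep glue g
    (fun {w} e m => p.map m = p.map e ≫ g ∧ (zun p).map m ≫ a = (zun p).map e ≫ b)
    ⟨fun e m h => h.1, fun k e m h => ⟨by rw [p.map_comp, p.map_comp, h.1, assoc], by
        rw [Functor.map_comp, Functor.map_comp, assoc, assoc, h.2]⟩,
      fun e m m' h h' => zcancel hp sep a m m' (h.1.trans h'.1.symm) (h.2.trans h'.2.symm), loc⟩
  refine ⟨c, ⟨hc, zhom_ext hp sep ?_ fun t => ?_⟩, fun c' ⟨h1, h2⟩ => zhom_ext hp sep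
    (h1.trans hc.symm) fun t => ?_⟩
  · rw [zbase_comp, hc, hg]
  · obtain ⟨w, e, he, ht, m, hm⟩ := loc t
    grind
  · obtain ⟨w, e, n, he, ⟨t', ht'⟩, hn⟩ := exists_local_rep hp c' t
    refine ⟨w, e, he, ⟨t', ht'⟩, ?_⟩
    rw [hn, hPr e n]
    refine ⟨?_, by rw [← hn, assoc, h2]⟩
    rw [← zbase_zun n, ← hn, zbase_comp, h1]
    rfl

include hp sep glue in
lemma zfibred : IsFibredInGroupoids (proj zariski p) := by
  refine IsFibredInGroupoids.mk' (fun X V f => ?_) fun {X Y Z} a b g hg =>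
    zfac hp sep glue (x := X.obj) (y := Y.obj) (z := Z.obj) a b g hg
  obtain ⟨y, h, a, ha⟩ := hp.exists_eq X.obj f
  exact ⟨(zun p).obj y, h, (zun p).map a, ha⟩

include hp sep glue in
lemma zglue {x y : E} (f : p.obj x ⟶ p.obj y) (S : Sieve (p.obj x)) (hS : S ∈ etale (p.obj x))
    (F : ∀ {z : E} (A : ZHom p z x) (_ : S (zbase A)), ZHom p z y)
    (Fbase : ∀ {z : E} (A : ZHom p z x) (h : S (zbase A)), zbase (F A h) = zbase A ≫ f)
    (Fcomp : ∀ {w z : E} (B : ZHom p w z) (A : ZHom p z x) (h : S (zbase A)) (h'),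
      F (B ≫ A) h' = B ≫ F A h) :
    ∃! c : ZHom p x y, zbase c = f ∧ ∀ {z : E} (A : ZHom p z x) (h : S (zbase A)), A ≫ c = F A h := by
  have Scomp : ∀ {w z : E} (B : ZHom p w z) (A : ZHom p z x), S (zbase A) → S (zbase (B ≫ A)) :=
    fun B A h => by
      rw [zbase_comp]
      exact S.downward_closed h _
  let Pr : ∀ {z : E} (_ : z ⟶ x) (_ : z ⟶ y), Prop := fun {z} e m =>
    ∃ h : S (zbase ((zun p).map e)), F ((zun p).map e) h = (zun p).map m
  have hPr : LocallyDetermines p f Pr := by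
    refine ⟨?_, ?_, ?_, fun t => ?_⟩
    · rintro z e m ⟨h, e'⟩
      rw [← zbase_zun m, ← e', Fbase]
      rfl
    · grind
    · rintro z e m m' ⟨h, e⟩ ⟨h', e'⟩
      exact zun_injective hp sep (e.symm.trans e')
    · obtain ⟨V, f, hf, hfe, ht⟩ := mem_etale.1 hS t
      obtain ⟨z, i, e, he, hee, ⟨t', ht'⟩⟩ := exists_nbhd hp x f hfe ht
      have h : S (zbase ((zun p).map e)) := by
        rw [zbase_zun, he]
        exact S.downward_closed hf _
      obtain ⟨w, b, n, hb, hbt, hn⟩ := exists_local_rep hp (F _ h) t'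
      obtain ⟨h3, h4⟩ := exists_comp_nbhd e hee ht' b hb hbt
      grind
  obtain ⟨c, hc, hcPr⟩ := exists_zhom hp sep glue f Pr hPr
  refine ⟨c, ⟨hc, fun {z} A h => zhom_ext hp sep ?_ fun t => ?_⟩, fun c' ⟨h1, h2⟩ =>
    zhom_ext hp sep (h1.trans hc.symm) fun t => ?_⟩
  · rw [zbase_comp, hc]
    exact (Fbase A h).symm
  · obtain ⟨w, b, n, hb, ⟨t', ht'⟩, hn⟩ := exists_local_rep hp A t
    have h3 : S (zbase ((zun p).map n)) := by
      rw [← hn]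
      exact Scomp _ _ h
    obtain ⟨v, b', m, hb', hbt', hm⟩ := exists_local_rep hp (F _ h3) t'
    obtain ⟨h4, h5⟩ := exists_comp_nbhd b hb ht' b' hb' hbt'
    refine ⟨v, b' ≫ b, h4, h5, ?_⟩
    have h6 : Pr (b' ≫ n) m := by
      grind
    grind
  · obtain ⟨z, e, he, ht, m, hm⟩ := hPr.loc t
    grind

include hp sep glue in
theorem zprestack : IsPrestack etale (proj zariski p) := by
  refine ⟨zfibred hp sep glue, fun {X Y} Φ => ?_⟩
  exact zglue hp sep glue (x := X.obj) (y := Y.obj) Φ.base Φ.sieve Φ.mem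
    (fun {z} A h => Φ.map (z := (zun p).obj z) A h)
    (fun {z} A h => Φ.map_base (z := (zun p).obj z) A h)
    (fun {w z} B A h h' => Φ.map_comp (w := (zun p).obj w) (z := (zun p).obj z) B A h h') |>
    fun ⟨c, ⟨h1, h2⟩, h3⟩ => ⟨c, ⟨h1, fun {Z} A h => h2 (z := Z.obj) A h⟩, fun c' ⟨h4, h5⟩ =>
      h3 c' ⟨h4, fun {z} A h => h5 (z := (zun p).obj z) A h⟩⟩

end IsomSheafified

end Sheafified


section Sequences

/-! ### Sequences of line bundles with a section -/

section Vanishing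

variable {A B : Type} [CommRing A] [CommRing B]

lemma LineSec.vanishesAt_iff_dual (P : LineSec A) (x : PrimeSpectrum A) :
    P.VanishesAt x ↔ ∀ φ : Module.Dual A P.L, φ P.sec ∈ x.asIdeal := by
  refine ⟨fun h φ => ?_, mem_smul_top_of_dual P _ _⟩
  have aux : ∀ m ∈ x.asIdeal • (⊤ : Submodule A P.L), φ m ∈ x.asIdeal := by
    intro m hm
    induction hm using Submodule.smul_induction_on' with
    | smul r hr n _ => rw [map_smul]; exact Ideal.mul_mem_right _ _ hr
    | add a _ b _ ha hb => rw [map_add]; exact Ideal.add_mem _ ha hb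
  exact aux _ h

lemma LineSec.isClosed_vanishesAt (P : LineSec A) : IsClosed {x | P.VanishesAt x} := by
  have : {x | P.VanishesAt x} =
      PrimeSpectrum.zeroLocus (Set.range fun φ : Module.Dual A P.L => φ P.sec) := by
    ext x
    rw [Set.mem_ofPred_eq, P.vanishesAt_iff_dual, PrimeSpectrum.mem_zeroLocus]
    constructor
    · rintro h _ ⟨φ, rfl⟩
      exact h φ
    · exact fun h φ => h ⟨φ, rfl⟩
  rw [this]
  exact PrimeSpectrum.isClosed_zeroLocus _

lemma IsPullbackMap.eq_of_not_nonInvertible {f : A →+* B} {P : LineSec A} {Q : LineSec B}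
    {θ θ' : P.L →+ Q.L} (h : IsPullbackMap f P Q θ) (h' : IsPullbackMap f P Q θ')
    (hQ : ¬ Q.NonInvertible) : θ = θ' := by
  ext l
  rw [← sub_eq_zero]
  let I : Ideal B := LinearMap.ker (LinearMap.toSpanSingleton B Q.L (θ l - θ' l))
  have hI : ∀ b, b ∈ I ↔ b • (θ l - θ' l) = 0 := fun b => Iff.rfl
  have key : ∀ χ : Module.Dual A P.L, f (χ P.sec) ∈ I := by
    intro χ
    have e := P.smul_comm_dual χ P.sec l
    rw [hI, smul_sub, ← h.smul, ← h'.smul, e, h.smul, h'.smul, h.sec, h'.sec, sub_self]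
  have hI1 : I = ⊤ := by
    by_contra hI1
    obtain ⟨m, hm, hIm⟩ := Ideal.exists_le_maximal I hI1
    refine hQ ⟨⟨m, hm.isPrime⟩, (h.vanishesAt_iff _).2 ?_⟩
    exact (P.vanishesAt_iff_dual _).2 fun χ => hIm (key χ)
  have := (hI 1).1 (hI1 ▸ Submodule.mem_top)
  rwa [one_smul] at this

end Vanishing

namespace WPP

variable {X Y Z : WPP}

/-- A member of the sequence. -/
def at_ (X : WPP) (j : X.ι) : A1GmPow 1 := ⟨X.base, fun _ => X.pair j⟩

lemma hom_ext {φ ψ : X ⟶ Y} (h : WPP.Hom.base φ = WPP.Hom.base ψ)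
    (h' : ∀ j, WPP.Hom.map φ j = WPP.Hom.map ψ j) : φ = ψ := WPP.Hom.ext h (funext h')

lemma comp_map (φ : X ⟶ Y) (ψ : Y ⟶ Z) (j : X.ι) : WPP.Hom.map (φ ≫ ψ) j =
    ⟨(WPP.Hom.map ψ (WPP.Hom.map φ j).1).1,
      (WPP.Hom.map φ j).2.comp (WPP.Hom.map ψ (WPP.Hom.map φ j).1).2⟩ := rfl

lemma comp_map' {φ : X ⟶ Y} {ψ : Y ⟶ Z} {j : X.ι} {i : Y.ι} {k : Z.ι}
    {α : (Y.pair i).L →+ (X.pair j).L} {β : (Z.pair k).L →+ (Y.pair i).L}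
    (h : WPP.Hom.map φ j = ⟨i, α⟩) (h' : WPP.Hom.map ψ i = ⟨k, β⟩) :
    WPP.Hom.map (φ ≫ ψ) j = ⟨k, α.comp β⟩ := by
  have : ∀ s, WPP.Hom.map φ j = s → s = ⟨i, α⟩ → WPP.Hom.map (φ ≫ ψ) j = ⟨k, α.comp β⟩ := by
    rintro s hs rfl
    rw [comp_map, hs]
    grind
  exact this _ rfl h

lemma exists_map (φ : X ⟶ Y) (j : X.ι) : ∃ i α, WPP.Hom.map φ j = ⟨i, α⟩ := ⟨_, _, rfl⟩

lemma isPullback_of_map {φ : X ⟶ Y} {j : X.ι} {i : Y.ι} {α : (Y.pair i).L →+ (X.pair j).L}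
    (h : WPP.Hom.map φ j = ⟨i, α⟩) :
    IsPullbackMap (ringMap (WPP.Hom.base φ)) (Y.pair i) (X.pair j) α := by
  have := WPP.Hom.isPullback φ j
  rw [h] at this
  exact this

/-- The morphism between members of two sequences belonging to a morphism of the sequences. -/
def homAt {φ : X ⟶ Y} {j : X.ι} {i : Y.ι} {α : (Y.pair i).L →+ (X.pair j).L}
    (h : WPP.Hom.map φ j = ⟨i, α⟩) : X.at_ j ⟶ Y.at_ i :=
  ⟨WPP.Hom.base φ, fun _ => α, fun _ => isPullback_of_map h⟩

lemma index_injective (φ : X ⟶ Y) {j j' : X.ι}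
    (h : (WPP.Hom.map φ j).1 = (WPP.Hom.map φ j').1) : j = j' :=
  (WPP.Hom.strictMono φ).injective h

lemma index_eq {φ : X ⟶ Y} {j j' : X.ι} {i : Y.ι} {α : (Y.pair i).L →+ (X.pair j).L}
    {α' : (Y.pair i).L →+ (X.pair j').L} (h : WPP.Hom.map φ j = ⟨i, α⟩)
    (h' : WPP.Hom.map φ j' = ⟨i, α'⟩) : j = j' :=
  index_injective φ (by rw [h, h'])

lemma vanishesAt_iff {φ : X ⟶ Y} {j : X.ι} {i : Y.ι} {α : (Y.pair i).L →+ (X.pair j).L}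
    (h : WPP.Hom.map φ j = ⟨i, α⟩) (x : PrimeSpectrum X.base.unop) :
    (X.pair j).VanishesAt x ↔ (Y.pair i).VanishesAt (ptMap (WPP.Hom.base φ) x) :=
  (isPullback_of_map h).vanishesAt_iff x

lemma exists_index (φ : X ⟶ Y) {i : Y.ι} {x : PrimeSpectrum X.base.unop}
    (h : (Y.pair i).VanishesAt (ptMap (WPP.Hom.base φ) x)) :
    ∃ (j : X.ι) (α : (Y.pair i).L →+ (X.pair j).L), WPP.Hom.map φ j = ⟨i, α⟩ ∧
      (X.pair j).VanishesAt x := by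
  obtain ⟨j, hj⟩ := (WPP.Hom.mem_range φ i).2 ⟨x, h⟩
  obtain ⟨α, hα⟩ : ∃ α : (Y.pair i).L →+ (X.pair j).L, WPP.Hom.map φ j = ⟨i, α⟩ := by
    subst hj
    exact ⟨_, rfl⟩
  exact ⟨j, α, hα, (vanishesAt_iff hα x).2 h⟩

/-- The pull-back of a sequence. -/
def restrict (X : WPP) {V : Aff} (f : V ⟶ X.base) : WPP where
  base := V
  ι := {i : X.ι // ∃ x, (X.pair i).VanishesAt (ptMap f x)}
  pair i := (X.pair i.1).baseChange (ringMap f)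
  nonInv := fun ⟨_, x, hx⟩ => ⟨x, ((LineSec.isPullbackMap_baseChange _ _).vanishesAt_iff x).2 hx⟩

/-- The projection from the pull-back of a sequence. -/
def restrictHom (X : WPP) {V : Aff} (f : V ⟶ X.base) : X.restrict f ⟶ X where
  base := f
  map i := ⟨i.1, LineSec.baseChangeMap _ _⟩
  strictMono _ _ h := h
  mem_range i := ⟨by rintro ⟨j, rfl⟩; exact j.2, fun h => ⟨⟨i, h⟩, rfl⟩⟩
  isPullback i := LineSec.isPullbackMap_baseChange _ _

lemma fac_unique {a : Y ⟶ X} {c c' : Z ⟶ Y} (h : WPP.Hom.base c = WPP.Hom.base c')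
    (h' : c ≫ a = c' ≫ a) : c = c' := by
  refine hom_ext h fun j => ?_
  obtain ⟨k, η, hc⟩ := exists_map c j
  obtain ⟨k', η', hc'⟩ := exists_map c' j
  obtain ⟨i, α, ha⟩ := exists_map a k
  obtain ⟨i', α', ha'⟩ := exists_map a k'
  have e : WPP.Hom.map (c ≫ a) j = WPP.Hom.map (c' ≫ a) j := by rw [h']
  rw [comp_map' hc ha, comp_map' hc' ha'] at e
  obtain rfl : i = i' := congrArg Sigma.fst e
  obtain rfl := index_eq ha ha'
  obtain rfl : α = α' := by simpa using ha.symm.trans ha'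
  have e2 : η.comp α = η'.comp α := by simpa using e
  have := (isPullback_of_map ha).ext_semilinear (isPullback_of_map hc).smul
    (by rw [h]; exact (isPullback_of_map hc').smul) e2
  rw [hc, hc', this]

lemma exists_fac (a : Y ⟶ X) (b : Z ⟶ X) (g : Z.base ⟶ Y.base)
    (h : g ≫ WPP.Hom.base a = WPP.Hom.base b) :
    ∃ c : Z ⟶ Y, WPP.Hom.base c = g ∧ c ≫ a = b := by
  have key : ∀ j : Z.ι, ∃ s : Σ k, ((Y.pair k).L →+ (Z.pair j).L),
      IsPullbackMap (ringMap g) (Y.pair s.1) (Z.pair j) s.2 ∧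
      WPP.Hom.map b j = ⟨(WPP.Hom.map a s.1).1, s.2.comp (WPP.Hom.map a s.1).2⟩ := by
    intro j
    obtain ⟨i, β, hb⟩ := exists_map b j
    obtain ⟨x, hx⟩ := Z.nonInv j
    have hx' := (vanishesAt_iff hb x).1 hx
    rw [← h, ptMap_comp] at hx'
    obtain ⟨k, α, ha, -⟩ := exists_index a hx'
    obtain ⟨η, hη, e⟩ := (isPullback_of_map ha).exists_fac (ringMap g) (R := Z.pair j) (θ' := β) (by
      rw [← ringMap_comp, h]
      exact isPullback_of_map hb)
    have aux : ∀ s, WPP.Hom.map a k = s → s = ⟨i, α⟩ →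
        (⟨s.1, η.comp s.2⟩ : Σ i, ((X.pair i).L →+ (Z.pair j).L)) = ⟨i, β⟩ := by
      rintro _ - rfl
      rw [← e]
    exact ⟨⟨k, η⟩, hη, hb.trans (aux _ rfl ha).symm⟩
  choose s hs hs' using key
  refine ⟨⟨g, s, fun j j' hj => ?_, fun k => ⟨?_, fun ⟨x, hx⟩ => ?_⟩, hs⟩, rfl,
    hom_ext h fun j => (hs' j).symm⟩
  · have := WPP.Hom.strictMono b hj
    change (WPP.Hom.map b j).1 < (WPP.Hom.map b j').1 at this
    rw [hs', hs'] at this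
    exact (WPP.Hom.strictMono a).lt_iff_lt.1 this
  · rintro ⟨j, rfl⟩
    obtain ⟨x, hx⟩ := Z.nonInv j
    exact ⟨x, ((hs j).vanishesAt_iff x).1 hx⟩
  · have h1 := ((WPP.Hom.isPullback a k).vanishesAt_iff _).1 hx
    rw [← ptMap, ← ptMap_comp, h] at h1
    obtain ⟨j, hj⟩ := (WPP.Hom.mem_range b _).2 ⟨x, h1⟩
    rw [hs'] at hj
    exact ⟨j, index_injective a hj⟩

lemma fibred : IsFibredInGroupoids WPP.proj := by
  refine IsFibredInGroupoids.mk' (fun X V f => ⟨X.restrict f, rfl, X.restrictHom f,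
    (id_comp _).symm⟩) fun {X Y Z} a b g h => ?_
  obtain ⟨c, hc, hc'⟩ := exists_fac a b g h
  exact ⟨c, ⟨hc, hc'⟩, fun c' ⟨h1, h2⟩ => fac_unique (h1.trans hc.symm) (h2.trans hc'.symm)⟩

lemma etaleSeparated : EtaleSeparated WPP.proj := by
  intro X Y φ ψ h H
  refine hom_ext h fun j => ?_
  obtain ⟨i, η, hφ⟩ := exists_map φ j
  obtain ⟨i', η', hψ⟩ := exists_map ψ j
  obtain rfl : i = i' := by
    obtain ⟨x, hx⟩ := X.nonInv j
    obtain ⟨Z, a, -, ⟨z, rfl⟩, e⟩ := H x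
    obtain ⟨k, α, ha, -⟩ := exists_index a hx
    have := congrArg (fun m => (WPP.Hom.map m k).1) e
    dsimp only at this
    rw [comp_map' ha hφ, comp_map' ha hψ] at this
    exact this
  rw [hφ, hψ]
  refine congrArg (Sigma.mk i) (AddMonoidHom.ext fun l => A1GmPow.elem_ext (x := X.at_ j) (i := 0) fun p => ?_)
  obtain ⟨Z, a, ha, hp, e⟩ := H p
  have hb : WPP.Hom.base φ = WPP.Hom.base ψ := h
  by_cases hj : ∃ x, (X.pair j).VanishesAt (ptMap (WPP.Hom.base a) x)
  · obtain ⟨x, hx⟩ := hj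
    obtain ⟨k, α, hk, -⟩ := exists_index a hx
    refine ⟨_, homAt hk, ha, hp, ?_⟩
    have := congrArg (fun m => WPP.Hom.map m k) e
    dsimp only at this
    rw [comp_map' hk hφ, comp_map' hk hψ] at this
    have h2 : α.comp η = α.comp η' := by simpa using this
    exact DFunLike.congr_fun h2 l
  · have hbc := (X.pair j).isPullbackMap_baseChange (ringMap (WPP.Hom.base a))
    refine ⟨⟨Z.base, fun _ => (X.pair j).baseChange (ringMap (WPP.Hom.base a))⟩,
      ⟨WPP.Hom.base a, fun _ => _, fun _ => hbc⟩,
      ha, hp, ?_⟩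
    have h1 := (isPullback_of_map hφ).comp hbc
    have h2 := (isPullback_of_map hψ).comp hbc
    rw [← hb] at h2
    refine DFunLike.congr_fun (h1.eq_of_not_nonInvertible h2 ?_) l
    rintro ⟨x, hx⟩
    exact hj ⟨x, (hbc.vanishesAt_iff x).1 hx⟩

section Descend

variable {V : WPP} (c : V ⟶ Z) (m : V ⟶ Y)
  (compat : ∀ {W : WPP} (u v : W ⟶ V), u ≫ c = v ≫ c → u ≫ m = v ≫ m)

include compat in
lemma compat_at {k : V.ι} {j : Z.ι} {i : Y.ι} {α : (Z.pair j).L →+ (V.pair k).L}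
    {μ : (Y.pair i).L →+ (V.pair k).L} (hc : WPP.Hom.map c k = ⟨j, α⟩)
    (hm : WPP.Hom.map m k = ⟨i, μ⟩) {β : Z.base ⟶ Y.base}
    (hβ : WPP.Hom.base m = WPP.Hom.base c ≫ β) {w : A1GmPow 1} (u v : w ⟶ V.at_ k)
    (h : u ≫ homAt hc = v ≫ homAt hc) : u ≫ homAt hm = v ≫ homAt hm := by
  have hb : A1GmPow.Hom.base u ≫ WPP.Hom.base c = A1GmPow.Hom.base v ≫ WPP.Hom.base c :=
    congrArg A1GmPow.Hom.base h
  have hb' : A1GmPow.Hom.base u ≫ WPP.Hom.base m = A1GmPow.Hom.base v ≫ WPP.Hom.base m := by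
    refine (congrArg (A1GmPow.Hom.base u ≫ ·) hβ).trans ((assoc _ _ _).symm.trans ?_)
    exact ((congrArg (· ≫ β) hb).trans (assoc _ _ _)).trans
      (congrArg (A1GmPow.Hom.base v ≫ ·) hβ.symm)
  by_cases hw : (w.pair 0).NonInvertible
  · obtain ⟨x, hx⟩ := hw
    have hx' := ((A1GmPow.Hom.isPullback u 0).vanishesAt_iff x).1 hx
    let u' := V.restrictHom (A1GmPow.Hom.base u)
    obtain ⟨kw, ν, hν, -⟩ := exists_index u' (i := k) hx'
    obtain ⟨v', hv', e'⟩ := exists_fac c (u' ≫ c) (A1GmPow.Hom.base v) hb.symm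
    have e2 := congrArg (fun m => WPP.Hom.map m kw) e'
    obtain ⟨k', ν', hν'⟩ := exists_map v' kw
    obtain ⟨j', α', hc'⟩ := exists_map c k'
    dsimp only at e2
    rw [comp_map' hν hc, comp_map' hν' hc'] at e2
    obtain rfl : j' = j := congrArg Sigma.fst e2
    obtain rfl := index_eq hc' hc
    have e3 := congrArg (fun m => WPP.Hom.map m kw) (compat v' u' e')
    dsimp only at e3
    rw [comp_map' hν hm, comp_map' hν' hm] at e3
    have e3' : ν'.comp μ = ν.comp μ := by simpa using e3
    have e4 : homAt hν' ≫ homAt hm = homAt hν ≫ homAt hm :=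
      A1GmPow.hom_ext ((congrArg (· ≫ _) hv').trans hb'.symm) fun _ => e3'
    have e5 : homAt hν' ≫ homAt hc = homAt hν ≫ homAt hc := by
      obtain rfl : α = α' := by simpa using hc.symm.trans hc'
      have e2' : ν'.comp α = ν.comp α := by simpa using e2
      exact A1GmPow.hom_ext ((congrArg (· ≫ _) hv').trans hb.symm) fun _ => e2'
    obtain ⟨t, ht, hut⟩ := A1GmPow.fac (homAt hν) u (𝟙 _) (id_comp _)
    have hvt : t ≫ homAt hν' = v := by
      refine A1GmPow.fibred.cancel (homAt hc) ?_ ?_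
      · exact (congrArg₂ (· ≫ ·) ht hv').trans (id_comp _)
      · rw [assoc, e5, ← assoc, hut, h]
    rw [← hut, ← hvt, assoc, assoc, e4]
  · refine A1GmPow.hom_ext hb' (Fin.forall_fin_one.2 ?_)
    have h1 := A1GmPow.Hom.isPullback (u ≫ homAt hm) 0
    have h2 := A1GmPow.Hom.isPullback (v ≫ homAt hm) 0
    have e : A1GmPow.Hom.base (v ≫ homAt hm) = A1GmPow.Hom.base (u ≫ homAt hm) := hb'.symm
    rw [e] at h2
    exact h1.eq_of_not_nonInvertible h2 hw

include compat in
lemma exists_descend (hc : IsEt (WPP.Hom.base c)) (surj : Function.Surjective (ptMap (WPP.Hom.base c)))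
    (β : Z.base ⟶ Y.base) (hβ : WPP.Hom.base m = WPP.Hom.base c ≫ β)
    (t : PrimeSpectrum Z.base.unop) (h₁ : ∀ j, (Z.pair j).VanishesAt t)
    (h₂ : ∀ i x, (Y.pair i).VanishesAt (ptMap β x) → (Y.pair i).VanishesAt (ptMap β t)) :
    ∃ n : Z ⟶ Y, WPP.Hom.base n = β ∧ c ≫ n = m := by
  obtain ⟨s, rfl⟩ := surj t
  have key : ∀ j : Z.ι, ∃ r : Σ i, ((Y.pair i).L →+ (Z.pair j).L),
      IsPullbackMap (ringMap β) (Y.pair r.1) (Z.pair j) r.2 ∧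
      ∀ k α, WPP.Hom.map c k = ⟨j, α⟩ → WPP.Hom.map m k = ⟨r.1, α.comp r.2⟩ := by
    intro j
    obtain ⟨k, α, hk, -⟩ := exists_index c (h₁ j)
    obtain ⟨i, μ, hm⟩ := exists_map m k
    obtain ⟨n, hn, hn'⟩ := A1GmPow.isPrestack.exists_hom (y := Z.at_ j) (y' := Y.at_ i) β
      (fun {w} e n => ∃ u : w ⟶ V.at_ k, u ≫ homAt hk = e ∧ u ≫ homAt hm = n)
      (by
        rintro w _ _ ⟨u, rfl, rfl⟩
        exact (congrArg (A1GmPow.Hom.base u ≫ ·) hβ).trans (assoc _ _ _).symm)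
      (by
        rintro w w' b _ _ ⟨u, rfl, rfl⟩
        exact ⟨b ≫ u, assoc _ _ _, assoc _ _ _⟩)
      (by
        rintro w e _ _ ⟨u, hu, rfl⟩ ⟨v, hv, rfl⟩
        exact compat_at c m compat hk hm hβ u v (hu.trans hv.symm))
      (fun x => ⟨V.at_ k, homAt hk, hc, surj x, _, 𝟙 _, id_comp _, rfl⟩)
    have hnb : A1GmPow.Hom.base n = β := hn
    have hnp := A1GmPow.Hom.isPullback n 0
    rw [hnb] at hnp
    refine ⟨⟨i, A1GmPow.Hom.map n 0⟩, hnp, fun k' α' hk' => ?_⟩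
    obtain rfl := index_eq hk' hk
    obtain rfl : α' = α := by simpa using hk'.symm.trans hk
    rw [hm]
    have : μ = α'.comp (A1GmPow.Hom.map n 0) := congrArg (A1GmPow.Hom.map · 0) (hn' (homAt hk) (homAt hm) ⟨𝟙 _, id_comp _,
      id_comp _⟩).symm
    exact congrArg (Sigma.mk i) this
  choose r hr hr' using key
  have hr2 : ∀ k, WPP.Hom.map m k = ⟨(r (WPP.Hom.map c k).1).1,
      (WPP.Hom.map c k).2.comp (r (WPP.Hom.map c k).1).2⟩ := fun k => hr' _ k _ rfl
  refine ⟨⟨β, r, fun j j' hj => ?_, fun i => ⟨?_, fun ⟨x, hx⟩ => ?_⟩, hr⟩, rfl,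
    hom_ext hβ.symm fun k => (hr2 k).symm⟩
  · obtain ⟨k, α, hk, -⟩ := exists_index c (h₁ j)
    obtain ⟨k', α', hk', -⟩ := exists_index c (h₁ j')
    have h1 : k < k' := (WPP.Hom.strictMono c).lt_iff_lt.1 (by rwa [hk, hk'])
    have h2 := WPP.Hom.strictMono m h1
    grind
  · rintro ⟨j, rfl⟩
    exact ⟨_, ((hr j).vanishesAt_iff _).1 (h₁ j)⟩
  · have h3 := h₂ i x hx
    rw [← ptMap_comp, ← hβ] at h3
    obtain ⟨k, μ, hk, -⟩ := exists_index m h3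
    grind

end Descend

lemma exists_small_nbhd (X Y : WPP) (f : X.base ⟶ Y.base) (t : PrimeSpectrum X.base.unop)
    {O : Set (PrimeSpectrum X.base.unop)} (hO : IsOpen O) (ht : t ∈ O) :
    ∃ a : X.base.unop, t ∈ Set.range (ptMap (awayHom a)) ∧ Set.range (ptMap (awayHom a)) ⊆ O ∧
      (∀ j, ∀ x ∈ Set.range (ptMap (awayHom a)), (X.pair j).VanishesAt x →
        (X.pair j).VanishesAt t) ∧
      ∀ i, ∀ x ∈ Set.range (ptMap (awayHom a)), (Y.pair i).VanishesAt (ptMap f x) →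
        (Y.pair i).VanishesAt (ptMap f t) := by
  let O₁ : Set (PrimeSpectrum X.base.unop) :=
    ⋂ j, {x | (X.pair j).VanishesAt x → (X.pair j).VanishesAt t}
  let O₂ : Set (PrimeSpectrum X.base.unop) :=
    ⋂ i, {x | (Y.pair i).VanishesAt (ptMap f x) → (Y.pair i).VanishesAt (ptMap f t)}
  have h₁ : IsOpen O₁ := isOpen_iInter_of_finite fun j => by
    by_cases h : (X.pair j).VanishesAt t
    · simp [h]
    · have : {x | (X.pair j).VanishesAt x → (X.pair j).VanishesAt t} =
          {x | (X.pair j).VanishesAt x}ᶜ := by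
        ext x
        simp [h]
      rw [this]
      exact (X.pair j).isClosed_vanishesAt.isOpen_compl
  have h₂ : IsOpen O₂ := isOpen_iInter_of_finite fun i => by
    by_cases h : (Y.pair i).VanishesAt (ptMap f t)
    · simp [h]
    · have : {x | (Y.pair i).VanishesAt (ptMap f x) → (Y.pair i).VanishesAt (ptMap f t)} =
          ptMap f ⁻¹' {x | (Y.pair i).VanishesAt x}ᶜ := by
        ext x
        simp [h]
      rw [this]
      exact (Y.pair i).isClosed_vanishesAt.isOpen_compl.preimage (PrimeSpectrum.continuous_comap _)
  obtain ⟨_, ⟨a, rfl⟩, hta, hsub⟩ :=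
    PrimeSpectrum.isTopologicalBasis_basic_opens.exists_subset_of_mem_open
      (show t ∈ O ∩ (O₁ ∩ O₂) from ⟨ht, by simp [O₁], by simp [O₂]⟩) (hO.inter (h₁.inter h₂))
  refine ⟨a, ?_, ?_, ?_, ?_⟩ <;> rw [range_awayHom]
  · exact hta
  · exact fun x hx => (hsub hx).1
  · exact fun j x hx => Set.mem_iInter.1 (hsub hx).2.1 j
  · exact fun i x hx => Set.mem_iInter.1 (hsub hx).2.2 i

lemma zariskiGluing : ZariskiGluing WPP.proj := by
  intro X Y f Pr hPr t
  change X.base ⟶ Y.base at f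
  change PrimeSpectrum X.base.unop at t
  obtain ⟨z, e, he, hs, m, hm⟩ := hPr.loc t
  obtain ⟨a, ⟨t', rfl⟩, haO, h₁, h₂⟩ := exists_small_nbhd X Y f t he.isOpenMap.isOpen_range hs
  let Z := X.restrict (awayHom a)
  let eZ : Z ⟶ X := X.restrictHom (awayHom a)
  have hp := IsPullback.of_hasPullback (awayHom a) (WPP.proj.map e)
  obtain ⟨V, i, c, hc⟩ := fibred.lift_sieve (x := Z)
    (pullback.fst (awayHom a) (WPP.proj.map e))
  have hce : IsEt (WPP.proj.map c) := by
    rw [hc]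
    exact (isEt_of_isIso _).comp (IsEt.of_isPullback hp he)
  have hcs : Function.Surjective (ptMap (WPP.proj.map c)) := by
    intro x
    obtain ⟨y, hy⟩ := haO ⟨x, rfl⟩
    obtain ⟨w, hw, -⟩ := exists_point hp x y hy.symm
    obtain ⟨w', rfl⟩ := ptMap_surjective_of_isIso i.hom w
    exact ⟨w', by rw [hc]; exact hw⟩
  have e₀ : (i.hom ≫ pullback.snd (awayHom a) (WPP.proj.map e)) ≫ WPP.proj.map e =
      WPP.proj.map (c ≫ eZ) := by
    refine (assoc _ _ _).trans ((congrArg (i.hom ≫ ·) hp.w.symm).trans ?_)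
    refine (assoc _ _ _).symm.trans ?_
    exact congrArg (fun t => t ≫ awayHom a) hc.symm
  obtain ⟨d, hd, hde⟩ := fibred.fac e (c ≫ eZ) _ e₀
  have compat : ∀ {W : WPP} (u v : W ⟶ V), u ≫ c = v ≫ c → u ≫ d ≫ m = v ≫ d ≫ m := by
    intro W u v huv
    have h1 := hPr.stab (u ≫ d) e m hm
    have h2 := hPr.stab (v ≫ d) e m hm
    have h3 : (u ≫ d) ≫ e = (v ≫ d) ≫ e := by
      grind
    rw [h3] at h1
    have := hPr.uniq _ _ _ h1 h2
    rwa [assoc, assoc] at this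
  have e₁ : WPP.proj.map d ≫ WPP.proj.map e = WPP.proj.map c ≫ WPP.proj.map eZ := by
    grind
  have hbase : WPP.proj.map (d ≫ m) = WPP.proj.map c ≫ awayHom a ≫ f := by
    refine (Functor.map_comp _ _ _).trans ((congrArg (_ ≫ ·) (hPr.base e m hm)).trans ?_)
    refine (assoc _ _ _).symm.trans (Eq.trans ?_ (assoc _ _ _))
    exact congrArg (fun t => t ≫ f) e₁
  obtain ⟨n, hn, hcn⟩ := exists_descend c (d ≫ m) compat hce hcs (awayHom a ≫ f) hbase t'
    (fun ⟨j, x, hx⟩ => by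
      refine ((LineSec.isPullbackMap_baseChange _ _).vanishesAt_iff _).2 ?_
      exact h₁ j _ ⟨x, rfl⟩ hx)
    (fun i x hx => h₂ i _ ⟨x, rfl⟩ hx)
  refine ⟨Z, eZ, n, awayHom_isStandard a, ⟨t', rfl⟩, hn, fun {w} k n' hn' => ?_⟩
  refine etaleSeparated _ _ ?_ fun x => ?_
  · have h4 : WPP.proj.map n = WPP.proj.map eZ ≫ f := hn
    refine (Functor.map_comp _ _ _).trans ((congrArg (_ ≫ ·) h4).trans ?_)
    refine (assoc _ _ _).symm.trans (Eq.trans ?_ (hPr.base _ _ hn').symm)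
    rfl
  · obtain ⟨w', b, d', hb, hbx, hbk⟩ := fibred.exists_square hce k (t := x) (hcs _)
    refine ⟨w', b, hb, hbx, ?_⟩
    have h1 := hPr.stab b _ _ hn'
    have h2 := hPr.stab (d' ≫ d) e m hm
    have h3 : b ≫ k ≫ eZ = (d' ≫ d) ≫ e := by
      rw [assoc, hde, ← assoc, hbk, assoc]
    rw [h3] at h1
    rw [← assoc, hbk, assoc, hcn, ← assoc]
    exact hPr.uniq _ _ _ h2 h1

end WPP

lemma WP.isPrestack : IsPrestack etale WP.proj :=
  IsomSheafified.zprestack WPP.fibred WPP.etaleSeparated WPP.zariskiGluing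

end Sequences


section Matchings

/-! ### Isomorphisms between sequences of functions -/

lemma LineSec.exists_of_isPullbackMap_triv {A B : Type} [CommRing A] [CommRing B] {f : A →+* B}
    {a : A} {b : B} {θ : (LineSec.triv a).L →+ (LineSec.triv b).L}
    (h : IsPullbackMap f (LineSec.triv a) (LineSec.triv b) θ) :
    ∃ u : B, IsUnit u ∧ u * f a = b ∧ θ = (AddMonoidHom.mulLeft u).comp f.toAddMonoidHom := by
  let θ' : A →+ B := θ
  have hθ : ∀ x : A, θ' x = θ' 1 * f x := fun x => by
    have := h.smul x (1 : A)
    change θ' (x * 1) = f x * θ' 1 at this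
    rw [mul_one] at this
    rw [this, mul_comm]
  refine ⟨θ' 1, ?_, (hθ a).symm.trans h.sec, AddMonoidHom.ext hθ⟩
  have h1 : (Submodule.span B (Set.range θ') : Submodule B B) ≤ (Ideal.span {θ' 1} : Ideal B) := by
    refine Submodule.span_le.2 ?_
    rintro _ ⟨x, rfl⟩
    rw [hθ x]
    exact (Ideal.mem_span_singleton' (α := B)).2 ⟨f x, mul_comm _ _⟩
  have h2 : Ideal.span {θ' 1} = ⊤ := top_le_iff.1 (le_of_eq_of_le (Eq.symm h.span) h1)
  exact Ideal.span_singleton_eq_top.1 h2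

/-- A partial increasing bijection `s` between the indices of two families of functions, defined
where the functions are not units, and units `u` by which corresponding functions differ. -/
structure Matching {A ι κ : Type} [CommRing A] [LinearOrder ι] [LinearOrder κ] (s : ι → Option κ)
    (a : ι → A) (b : κ → A) (u : ι → A) : Prop where
  mono : ∀ {i i' j j'}, s i = some j → s i' = some j' → i < i' → j < j'
  unit : ∀ i, IsUnit (u i)
  eq : ∀ i, a i = u i * (s i).elim 1 b
  off : ∀ j, (∀ i, s i ≠ some j) → IsUnit (b j)

namespace Matching

variable {A B ι κ μ : Type} [CommRing A] [CommRing B] [LinearOrder ι] [LinearOrder κ] [LinearOrder μ]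
  {s s' : ι → Option κ} {a : ι → A} {b : κ → A} {u u' : ι → A}

lemma map (h : Matching s a b u) (f : A →+* B) :
    Matching s (fun i => f (a i)) (fun j => f (b j)) (fun i => f (u i)) where
  mono := h.mono
  unit i := (h.unit i).map f
  eq i := by
    rw [h.eq, map_mul]
    cases s i <;> simp
  off j hj := (h.off j hj).map f

lemma refl {a : ι → A} : Matching some a a fun _ => 1 where
  mono := by
    rintro i i' _ _ ⟨⟩ ⟨⟩ h
    exact h
  unit _ := isUnit_one
  eq i := by simp
  off j hj := (hj j rfl).elim

lemma eq_some (h : Matching s a b u) {i : ι} {j : κ} (e : s i = some j) : u i * b j = a i := by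
  rw [h.eq i, e, Option.elim_some]

lemma isUnit_of_none (h : Matching s a b u) {i : ι} (e : s i = none) : IsUnit (a i) := by
  rw [h.eq i, e, Option.elim_none, mul_one]
  exact h.unit i

lemma isUnit_iff (h : Matching s a b u) {i : ι} {j : κ} (e : s i = some j) :
    IsUnit (b j) ↔ IsUnit (a i) := by
  rw [← h.eq_some e]
  exact ⟨fun hb => (h.unit i).mul hb, fun hb => isUnit_of_mul_isUnit_right hb⟩

lemma mem_iff (h : Matching s a b u) {i : ι} {j : κ} (e : s i = some j) (p : PrimeSpectrum A) :
    b j ∈ p.asIdeal ↔ a i ∈ p.asIdeal := by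
  rw [← h.eq_some e, p.2.mul_mem_iff_mem_or_mem, or_iff_right]
  exact fun hp => p.2.ne_top (Ideal.eq_top_of_isUnit_mem _ hp (h.unit i))

lemma eq_of_agree (h : Matching s a b u) (h' : Matching s' a b u')
    (H : ∀ i, ¬ IsUnit (a i) → s i = s' i ∧ u i = u' i) {i : ι} (e : s i = s' i) : u i = u' i := by
  by_cases hi : IsUnit (a i)
  · have h1 := h.eq i
    have h2 := h'.eq i
    rw [← e] at h2
    have h3 : IsUnit ((s i).elim 1 b) := isUnit_of_mul_isUnit_right (h1 ▸ hi)
    exact h3.mul_right_cancel (h1.symm.trans h2)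
  · exact (H i hi).2

lemma extend {s₀ s : ι → Option κ} {u₀ : ι → A} (h : Matching s₀ a b u₀)
    (mono : ∀ {i i' j j'}, s i = some j → s i' = some j' → i < i' → j < j')
    (le : ∀ i j, s₀ i = some j → s i = some j) :
    ∃ u, Matching s a b u ∧ ∀ i, s₀ i ≠ none → u i = u₀ i := by
  have inj : ∀ {i i' j}, s i = some j → s i' = some j → i = i' := by
    grind
  have key : ∀ i, ∃ u, IsUnit u ∧ a i = u * (s i).elim 1 b ∧ (s₀ i ≠ none → u = u₀ i) := by
    intro i
    cases e₀ : s₀ i with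
    | some j => exact ⟨u₀ i, h.unit i, by rw [le i j e₀, h.eq i, e₀], fun _ => rfl⟩
    | none =>
      have ha := h.isUnit_of_none e₀
      cases e : s i with
      | none => exact ⟨a i, ha, by simp, fun h => (h rfl).elim⟩
      | some j =>
        have hb : IsUnit (b j) := h.off j fun i' e' => by
          grind
        obtain ⟨v, hv⟩ := hb
        refine ⟨a i * ↑v⁻¹, ha.mul v⁻¹.isUnit, ?_, fun h => (h rfl).elim⟩
        rw [Option.elim_some, ← hv, mul_assoc, Units.inv_mul, mul_one]
  choose u hu he h₀ using key
  exact ⟨u, ⟨mono, hu, he, fun j hj => h.off j fun i e => hj i (le i j e)⟩, h₀⟩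

lemma eq_of_vanish {a' : ι → A} (h : Matching s a b u) (h' : Matching s' a' b u')
    (p : PrimeSpectrum A) (hs : ∀ i, s i ≠ none → a i ∈ p.asIdeal)
    (hs' : ∀ i, s' i ≠ none → a' i ∈ p.asIdeal)
    (hfin : {i | s i ≠ none}.Finite) (e : ∀ i, a i ∈ p.asIdeal ↔ a' i ∈ p.asIdeal) : s = s' := by
  have nonunit : ∀ {x : A}, x ∈ p.asIdeal → ¬ IsUnit x := fun hx hu =>
    p.2.ne_top (Ideal.eq_top_of_isUnit_mem _ hx hu)
  have dom : ∀ i, s i = none ↔ s' i = none := fun i => by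
    constructor
    · intro hi
      by_contra hc
      exact nonunit ((e i).2 (hs' i hc)) (h.isUnit_of_none hi)
    · intro hi
      by_contra hc
      exact nonunit ((e i).1 (hs i hc)) (h'.isUnit_of_none hi)
  have cod : ∀ j, (∃ i, s i = some j) ↔ ∃ i, s' i = some j := fun j => by
    constructor
    · rintro ⟨i, hi⟩
      by_contra! hc
      exact nonunit ((h.mem_iff hi p).2 (hs i (by simp [hi]))) (h'.off j hc)
    · rintro ⟨i, hi⟩
      by_contra! hc
      exact nonunit ((h'.mem_iff hi p).2 (hs' i (by simp [hi]))) (h.off j hc)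
  have : Finite {i // s i ≠ none} := hfin
  have g : ∀ i : {i // s i ≠ none}, ∃ j, s i = some j := fun i => Option.ne_none_iff_exists'.1 i.2
  have g' : ∀ i : {i // s i ≠ none}, ∃ j, s' i = some j :=
    fun i => Option.ne_none_iff_exists'.1 fun hc => i.2 ((dom i).2 hc)
  choose f hf using g
  choose f' hf' using g'
  have hff : f = f' := by
    refine (StrictMono.range_inj (fun i i' hi => h.mono (hf i) (hf i') hi)
      (fun i i' hi => h'.mono (hf' i) (hf' i') hi)).1 (Set.ext fun j => ?_)
    constructor
    · rintro ⟨i, rfl⟩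
      obtain ⟨i', hi'⟩ := (cod (f i)).1 ⟨i, hf i⟩
      have hn : s i' ≠ none := fun hc => by
        rw [(dom i').1 hc] at hi'
        cases hi'
      exact ⟨⟨i', hn⟩, Option.some_injective _ ((hf' ⟨i', hn⟩).symm.trans hi')⟩
    · rintro ⟨i, rfl⟩
      obtain ⟨i', hi'⟩ := (cod (f' i)).2 ⟨i, hf' i⟩
      have hn : s i' ≠ none := by simp [hi']
      exact ⟨⟨i', hn⟩, Option.some_injective _ ((hf ⟨i', hn⟩).symm.trans hi')⟩
  funext i
  by_cases hi : s i = none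
  · rw [hi, (dom i).1 hi]
  · rw [hf ⟨i, hi⟩, hf' ⟨i, hi⟩, hff]

end Matching

/-- All but finitely many members of a family of functions are units. -/
def AlmostUnits {A ι : Type} [CommRing A] (a : ι → A) : Prop :=
  Finite {i // (LineSec.triv (a i)).NonInvertible}

lemma AlmostUnits.of_finite {A ι : Type} [CommRing A] [Finite ι] (a : ι → A) : AlmostUnits a :=
  inferInstanceAs (Finite {i // (LineSec.triv (a i)).NonInvertible})

lemma almostUnits_iff {A ι : Type} [CommRing A] (a : ι → A) :
    AlmostUnits a ↔ {i | ¬ IsUnit (a i)}.Finite := by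
  refine ((Set.finite_coe_iff (s := {i | (LineSec.triv (a i)).NonInvertible})).trans ?_)
  have : {i | (LineSec.triv (a i)).NonInvertible} = {i | ¬ IsUnit (a i)} :=
    Set.ext fun i => LineSec.nonInvertible_triv (a i)
  rw [this]

lemma AlmostUnits.map {A B ι : Type} [CommRing A] [CommRing B] {a : ι → A} (h : AlmostUnits a)
    (f : A →+* B) : AlmostUnits fun i => f (a i) := by
  rw [almostUnits_iff] at h ⊢
  exact h.subset fun i hi hc => hi (hc.map f)

variable {V T U : Aff} {ι κ μ : Type} [LinearOrder ι] [LinearOrder κ] [LinearOrder μ]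

/-- The sequence of those members of a family of functions which are not units. -/
def std (T : Aff) (a : ι → T.unop) (ha : AlmostUnits a) : WPP where
  base := T
  ι := {i // (LineSec.triv (a i)).NonInvertible}
  fin := ha
  pair i := LineSec.triv (a i.1)
  nonInv i := i.2

variable {a : ι → V.unop} {ha : AlmostUnits a} {b : κ → T.unop} {hb : AlmostUnits b}

lemma Matching.ne_none {f : V ⟶ T} {s : ι → Option κ} {u : ι → V.unop}
    (h : Matching s a (fun j => ringMap f (b j)) u) (i : (std V a ha).ι) : (s i.1).isSome := by
  rw [Option.isSome_iff_ne_none]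
  exact fun hc => (LineSec.nonInvertible_triv _).1 i.2 (h.isUnit_of_none hc)

lemma Matching.nonInvertible {f : V ⟶ T} {s : ι → Option κ} {u : ι → V.unop}
    (h : Matching s a (fun j => ringMap f (b j)) u) {i : ι} {j : κ}
    (hi : (LineSec.triv (a i)).NonInvertible) (e : s i = some j) :
    (LineSec.triv (b j)).NonInvertible := by
  rw [LineSec.nonInvertible_triv] at hi ⊢
  exact fun hj => hi ((h.isUnit_iff e).1 (hj.map (ringMap f)))

/-- The morphism of sequences given by a matching. -/
def matchHom (f : V ⟶ T) {s : ι → Option κ} {u : ι → V.unop}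
    (h : Matching s a (fun j => ringMap f (b j)) u) : std V a ha ⟶ std T b hb where
  base := f
  map i := ⟨⟨(s i.1).get (h.ne_none i), h.nonInvertible i.2 (Option.some_get _).symm⟩,
    (AddMonoidHom.mulLeft (u i.1)).comp (ringMap f).toAddMonoidHom⟩
  strictMono i i' hi := h.mono (Option.some_get _).symm (Option.some_get _).symm hi
  mem_range j := by
    constructor
    · rintro ⟨i, rfl⟩
      obtain ⟨x, hx⟩ := i.2
      refine ⟨x, (LineSec.vanishesAt_triv _ _).2 ?_⟩
      exact (h.mem_iff (Option.some_get _).symm x).2 ((LineSec.vanishesAt_triv _ _).1 hx)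
    · rintro ⟨x, hx⟩
      have hx' : b j.1 ∈ (ptMap f x).asIdeal := (LineSec.vanishesAt_triv _ _).1 hx
      replace hx' : ringMap f (b j.1) ∈ x.asIdeal := hx'
      obtain ⟨i, hi⟩ : ∃ i, s i = some j.1 := by
        by_contra! hc
        exact x.2.ne_top (Ideal.eq_top_of_isUnit_mem _ hx' (h.off _ hc))
      refine ⟨⟨i, x, (LineSec.vanishesAt_triv _ _).2 ((h.mem_iff hi x).1 hx')⟩, Subtype.ext ?_⟩
      grind
  isPullback i := LineSec.isPullbackMap_triv (h.unit i.1)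
    (h.eq_some (Option.some_get (h.ne_none i)).symm)

lemma matchHom_map (f : V ⟶ T) {s : ι → Option κ} {u : ι → V.unop}
    (h : Matching s a (fun j => ringMap f (b j)) u) (i : (std V a ha).ι) (j : (std T b hb).ι)
    (e : s i.1 = some j.1) : WPP.Hom.map (matchHom (ha := ha) (hb := hb) f h) i =
      ⟨j, (AddMonoidHom.mulLeft (u i.1)).comp (ringMap f).toAddMonoidHom⟩ := by
  have e' : (⟨(s i.1).get (h.ne_none i), h.nonInvertible i.2 (Option.some_get _).symm⟩ :
      (std T b hb).ι) = j := Subtype.ext (Option.some_injective _ ((Option.some_get _).trans e))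
  subst e'
  rfl

lemma exists_index_matchHom (f : V ⟶ T) {s : ι → Option κ} {u : ι → V.unop}
    (h : Matching s a (fun j => ringMap f (b j)) u) (i : (std V a ha).ι) :
    ∃ j : (std T b hb).ι, s i.1 = some j.1 :=
  ⟨⟨(s i.1).get (h.ne_none i), h.nonInvertible i.2 (Option.some_get _).symm⟩,
    (Option.some_get _).symm⟩

lemma matchHom_eq_iff (f : V ⟶ T) {s s' : ι → Option κ} {u u' : ι → V.unop}
    (h : Matching s a (fun j => ringMap f (b j)) u)
    (h' : Matching s' a (fun j => ringMap f (b j)) u') :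
    matchHom (ha := ha) (hb := hb) f h = matchHom f h' ↔
      ∀ i, ¬ IsUnit (a i) → s i = s' i ∧ u i = u' i := by
  constructor
  · intro e i hi
    let k : (std V a ha).ι := ⟨i, (LineSec.nonInvertible_triv _).2 hi⟩
    have e' := congrArg (fun m => WPP.Hom.map m k) e
    obtain ⟨j, hj⟩ := exists_index_matchHom (hb := hb) f h k
    obtain ⟨j', hj'⟩ := exists_index_matchHom (hb := hb) f h' k
    dsimp only at e'
    rw [matchHom_map f h k j hj, matchHom_map f h' k j' hj'] at e'
    obtain rfl : j = j' := congrArg Sigma.fst e'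
    refine ⟨hj.trans hj'.symm, ?_⟩
    have e2 := eq_of_heq (Sigma.mk.inj e').2
    have e3 : u i * ringMap f 1 = u' i * ringMap f 1 := DFunLike.congr_fun e2 (1 : T.unop)
    simpa using e3
  · intro H
    refine WPP.hom_ext rfl fun k => ?_
    obtain ⟨h1, h2⟩ := H k.1 ((LineSec.nonInvertible_triv _).1 k.2)
    obtain ⟨j, hj⟩ := exists_index_matchHom (hb := hb) f h k
    rw [matchHom_map f h k j hj, matchHom_map f h' k j (h1 ▸ hj), h2]

lemma matchHom_comp {c : μ → U.unop} {hc : AlmostUnits c} (f : V ⟶ T) (g : T ⟶ U)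
    {s : ι → Option κ} {u : ι → V.unop} {s' : κ → Option μ} {u' : κ → T.unop}
    {s'' : ι → Option μ} {u'' : ι → V.unop}
    (h : Matching s a (fun j => ringMap f (b j)) u)
    (h' : Matching s' b (fun j => ringMap g (c j)) u')
    (h'' : Matching s'' a (fun j => ringMap (f ≫ g) (c j)) u'')
    (hs : ∀ i j, s i = some j → s'' i = s' j)
    (hu : ∀ i j, s i = some j → u'' i = u i * ringMap f (u' j)) :
    matchHom (ha := ha) (hb := hb) f h ≫ matchHom (hb := hc) g h' = matchHom (f ≫ g) h'' := by
  refine WPP.hom_ext rfl fun i => ?_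
  obtain ⟨j, hj⟩ := exists_index_matchHom (hb := hb) f h i
  obtain ⟨k, hk⟩ := exists_index_matchHom (hb := hc) g h' j
  rw [matchHom_map (f ≫ g) h'' i k ((hs _ _ hj).trans hk),
    WPP.comp_map' (matchHom_map f h i j hj) (matchHom_map g h' j k hk)]
  refine congrArg (Sigma.mk k) (AddMonoidHom.ext fun x => ?_)
  change (show V.unop from u i.1) * ringMap f (u' j.1 * ringMap g x) =
    (show V.unop from u'' i.1) * ringMap f (ringMap g x)
  rw [hu _ _ hj, map_mul, mul_assoc]

lemma exists_matching (f : V ⟶ T) (c : std V a ha ⟶ std T b hb) (hf : WPP.Hom.base c = f) :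
    ∃ (s : ι → Option κ) (u : ι → V.unop) (h : Matching s a (fun j => ringMap f (b j)) u),
      c = matchHom f h ∧ ∀ i, s i ≠ none → ¬ IsUnit (a i) := by
  classical
  have hpb : ∀ {i j α}, WPP.Hom.map c i = ⟨j, α⟩ →
      IsPullbackMap (ringMap f) ((std T b hb).pair j) ((std V a ha).pair i) α := fun h => by
    have := WPP.isPullback_of_map h
    rwa [hf] at this
  have key : ∀ i : (std V a ha).ι, ∃ (j : (std T b hb).ι) (u : V.unop), IsUnit u ∧
      u * ringMap f (b j.1) = a i.1 ∧ WPP.Hom.map c i =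
        ⟨j, (AddMonoidHom.mulLeft u).comp (ringMap f).toAddMonoidHom⟩ := by
    intro i
    obtain ⟨j, α, h⟩ := WPP.exists_map c i
    obtain ⟨u, hu, e, rfl⟩ := LineSec.exists_of_isPullbackMap_triv (hpb h)
    exact ⟨j, u, hu, e, h⟩
  choose j u hu he hm using key
  let s : ι → Option κ := fun i =>
    if h : (LineSec.triv (a i)).NonInvertible then some (j ⟨i, h⟩).1 else none
  let u' : ι → V.unop := fun i =>
    if h : (LineSec.triv (a i)).NonInvertible then u ⟨i, h⟩ else a i
  have hs : ∀ i : (std V a ha).ι, s i.1 = some (j i).1 := fun i => dif_pos i.2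
  have hu' : ∀ i : (std V a ha).ι, u' i.1 = u i := fun i => dif_pos i.2
  have hs' : ∀ i, s i ≠ none → (LineSec.triv (a i)).NonInvertible := fun i hi => by
    by_contra hc
    exact hi (dif_neg hc)
  have hsj : ∀ {i k}, s i = some k → ∃ h : (LineSec.triv (a i)).NonInvertible,
      (j ⟨i, h⟩).1 = k := fun {i k} e => by
    grind
  have hmatch : Matching s a (fun k => ringMap f (b k)) u' := by
    refine ⟨?_, fun i => ?_, fun i => ?_, fun k hk => ?_⟩
    · rintro i i' k k' e e' hi
      obtain ⟨h, rfl⟩ := hsj e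
      obtain ⟨h', rfl⟩ := hsj e'
      have := WPP.Hom.strictMono c (show (⟨i, h⟩ : (std V a ha).ι) < ⟨i', h'⟩ from hi)
      have hm' : ∀ i, (WPP.Hom.map c i).1 = j i := fun i => congrArg Sigma.fst (hm i)
      have h3 : j ⟨i, h⟩ < j ⟨i', h'⟩ := by grind
      exact h3
    · by_cases h : (LineSec.triv (a i)).NonInvertible
      · rw [hu' ⟨i, h⟩]
        exact hu _
      · have : u' i = a i := dif_neg h
        rw [this]
        by_contra hc
        exact h ((LineSec.nonInvertible_triv _).2 hc)
    · by_cases h : (LineSec.triv (a i)).NonInvertible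
      · grind
      · grind
    · by_contra hc
      obtain ⟨x, hx⟩ := (LineSec.nonInvertible_triv _).2 hc
      have hx' := (LineSec.vanishesAt_triv _ _).1 hx
      have hbk : (LineSec.triv (b k)).VanishesAt (ptMap (WPP.Hom.base c) x) := by
        rw [hf]
        exact (LineSec.vanishesAt_triv _ _).2 hx'
      obtain ⟨i, α, hi, -⟩ := WPP.exists_index c (i := ⟨k, _, hbk⟩) hbk
      grind
  refine ⟨s, u', hmatch, WPP.hom_ext hf fun i => ?_, fun i hi =>
    (LineSec.nonInvertible_triv _).1 (hs' i hi)⟩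
  refine (hm i).trans (Eq.trans ?_ (matchHom_map f hmatch i (j i) (hs i)).symm)
  rw [hu']

end Matchings


section LocalStructure

/-! ### The local structure of `W` -/

/-- The functor from sequences to `W`. -/
abbrev toW : WPP ⥤ W := IsomSheafified.unit zariski WPP.proj ⋙ DescentDatum.unit etale WP.proj

lemma W.isStack : IsStack etale W.proj := DescentDatum.isStack WP.isPrestack

lemma toW_injective {X Y : WPP} {m m' : X ⟶ Y} (h : toW.map m = toW.map m') : m = m' :=
  IsomSheafified.zun_injective WPP.fibred WPP.etaleSeparated
    (DescentDatum.unit_faithful WP.isPrestack h)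

lemma exists_local_toW {X Y : WPP} (n : toW.obj X ⟶ toW.obj Y) (p : PrimeSpectrum X.base.unop) :
    ∃ (Z : WPP) (b : Z ⟶ X) (m : Z ⟶ Y), IsEt (WPP.Hom.base b) ∧
      p ∈ Set.range (ptMap (WPP.Hom.base b)) ∧ toW.map b ≫ n = toW.map m := by
  obtain ⟨n', rfl⟩ := DescentDatum.unit_full WP.isPrestack n
  obtain ⟨Z, b, m, h, hp, e⟩ := IsomSheafified.exists_local_rep WPP.fibred n' p
  exact ⟨Z, b, m, h, hp, ((DescentDatum.unit etale WP.proj).map_comp _ _).symm.trans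
    (congrArg (DescentDatum.unit etale WP.proj).map e)⟩

lemma WPP.length_le {X Y : WPP} (c : X ⟶ Y) : X.length ≤ Y.length :=
  Nat.card_le_card_of_injective _ (WPP.Hom.strictMono c).injective

lemma W.exists_cover (ξ : W) (x : PrimeSpectrum (W.proj.obj ξ).unop) :
    ∃ (X : WPP) (e : toW.obj X ⟶ ξ), IsEt (W.proj.map e) ∧
      x ∈ Set.range (ptMap (W.proj.map e)) ∧ ∀ l, lengthLE l ξ → X.length ≤ l := by
  obtain ⟨V, f, hf, he, hx⟩ := mem_etale.1 ξ.cover x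
  obtain ⟨k, c, rfl⟩ := DescentDatum.exists_mid ξ f hf
  exact ⟨(ξ.obj k).obj.restrict c, toW.map ((ξ.obj k).obj.restrictHom c) ≫ DescentDatum.can ξ k,
    he, hx, fun l hl => (WPP.length_le ((ξ.obj k).obj.restrictHom c)).trans (hl k)⟩

/-- An étale neighbourhood over which an object of `W` is given by a sequence of functions. -/
structure StdNbhd (ξ : W) where
  κ : Type
  [ord : LinearOrder κ]
  [fin : Finite κ]
  U : Aff
  b : κ → U.unop
  e : toW.obj (std U b (.of_finite b)) ⟶ ξ
  et : IsEt (W.proj.map e)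

attribute [instance] StdNbhd.ord StdNbhd.fin

/-- The morphism to the base. -/
def StdNbhd.base {ξ : W} (N : StdNbhd ξ) : N.U ⟶ W.proj.obj ξ := W.proj.map N.e

lemma WPP.exists_std (X : WPP) (x : PrimeSpectrum X.base.unop) :
    ∃ (U : Aff) (b : X.ι → U.unop) (e : std U b (.of_finite b) ⟶ X), IsEt (WPP.Hom.base e) ∧
      x ∈ Set.range (ptMap (WPP.Hom.base e)) := by
  have := Fintype.ofFinite X.ι
  choose φ l hφ using fun i => (X.pair i).exists_dual_notMem x
  let g : X.base.unop := ∏ i, φ i (l i)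
  have hg : ∀ i, IsUnit (ringMap (awayHom g) (φ i (l i))) := fun i => by
    have h := isUnit_awayHom g
    simp only [g, map_prod] at h
    exact isUnit_of_dvd_unit (Finset.dvd_prod_of_mem
      (fun i => ringMap (awayHom (∏ i, φ i (l i))) (φ i (l i))) (Finset.mem_univ i)) h
  have hpb := fun i => LineSec.isPullbackMap_dual (X.pair i) (φ i) (l i) (hg i)
  refine ⟨away g, fun i => ringMap (awayHom g) (φ i (X.pair i).sec),
    ⟨awayHom g, fun i => ⟨i.1, _⟩, fun _ _ h => h, fun i => ⟨?_, ?_⟩, fun i => hpb i.1⟩,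
    awayHom_isEt g, ?_⟩
  · rintro ⟨j, rfl⟩
    obtain ⟨y, hy⟩ := j.2
    exact ⟨y, ((hpb j.1).vanishesAt_iff y).1 hy⟩
  · rintro ⟨y, hy⟩
    exact ⟨⟨i, y, ((hpb i).vanishesAt_iff y).2 hy⟩, rfl⟩
  · change x ∈ Set.range (ptMap (awayHom g))
    rw [range_awayHom]
    change ∏ i, φ i (l i) ∉ x.asIdeal
    rw [x.2.prod_mem_iff]
    exact fun ⟨i, _, h⟩ => hφ i h

lemma W.exists_stdNbhd (ξ : W) (x : PrimeSpectrum (W.proj.obj ξ).unop) :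
    ∃ N : StdNbhd ξ, x ∈ Set.range (ptMap N.base) ∧ ∀ l, lengthLE l ξ → Nat.card N.κ ≤ l := by
  obtain ⟨X, e, he, ⟨y, rfl⟩, hl⟩ := W.exists_cover ξ x
  obtain ⟨U, b, e', he', z, hz⟩ := X.exists_std y
  refine ⟨⟨X.ι, U, b, toW.map e' ≫ e, ?_⟩, ⟨z, ?_⟩, hl⟩
  · exact (W.proj.map_comp _ _).symm ▸ IsEt.comp he' he
  · change ptMap (W.proj.map (toW.map e' ≫ e)) z = _
    rw [Functor.map_comp]
    exact congrArg (ptMap (W.proj.map e)) hz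

variable {V V' T U : Aff} {ι κ : Type} [LinearOrder ι] [LinearOrder κ]
  {a : ι → T.unop} {ha : AlmostUnits a} {b : κ → U.unop} {hb : AlmostUnits b}

/-- Pull-back of a sequence of functions. -/
def stdMap (h : V ⟶ T) (a : ι → T.unop) (ha : AlmostUnits a) :
    std V (fun i => ringMap h (a i)) (ha.map _) ⟶ std T a ha :=
  matchHom h Matching.refl

lemma stdMap_comp_matchHom (h : V ⟶ T) (f : T ⟶ U) {s : ι → Option κ} {u : ι → T.unop}
    (M : Matching s a (fun j => ringMap f (b j)) u) :
    stdMap h a ha ≫ matchHom (hb := hb) f M = matchHom (h ≫ f) (M.map (ringMap h)) :=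
  matchHom_comp h f _ M (M.map (ringMap h)) (by rintro i _ ⟨⟩; rfl)
    (by rintro i _ ⟨⟩; exact (one_mul _).symm)

lemma stdMap_comp_stdMap (d : V' ⟶ V) (h : V ⟶ T) :
    stdMap d _ (ha.map _) ≫ stdMap h a ha = stdMap (d ≫ h) a ha :=
  matchHom_comp d h _ _ _ (by rintro i _ ⟨⟩; rfl) (by rintro i _ ⟨⟩; simp)

lemma exists_local_matching (f : T ⟶ U) (m : toW.obj (std T a ha) ⟶ toW.obj (std U b hb))
    (hm : W.proj.map m = f) (p : PrimeSpectrum T.unop) :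
    ∃ (V : Aff) (h : V ⟶ T) (s : ι → Option κ) (u : ι → V.unop)
      (M : Matching s (fun i => ringMap h (a i)) (fun j => ringMap (h ≫ f) (b j)) u),
      IsEt h ∧ p ∈ Set.range (ptMap h) ∧
      toW.map (stdMap h a ha) ≫ m = toW.map (matchHom (h ≫ f) M) ∧
      ∀ i, s i ≠ none → a i ∈ p.asIdeal := by
  obtain ⟨Z, e, n, he, ⟨q, rfl⟩, hn⟩ := exists_local_toW m p
  have hbase : WPP.Hom.base n = WPP.Hom.base e ≫ f := by
    have := congrArg W.proj.map hn
    rw [Functor.map_comp, hm] at this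
    exact this.symm
  obtain ⟨(g : Z.base.unop), ⟨q', rfl⟩, -, hg, -⟩ := WPP.exists_small_nbhd
    (std Z.base (fun i => ringMap (WPP.Hom.base e) (a i)) (ha.map _))
    (std Z.base (fun i => ringMap (WPP.Hom.base e) (a i)) (ha.map _)) (𝟙 Z.base) q isOpen_univ
    (Set.mem_univ _)
  obtain ⟨c, hc, hce⟩ := WPP.exists_fac e (stdMap (awayHom g ≫ WPP.Hom.base e) a ha) (awayHom g) rfl
  obtain ⟨s, u, M, hM, hs⟩ := exists_matching ((awayHom g ≫ WPP.Hom.base e) ≫ f) (c ≫ n) (by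
    refine Eq.trans ?_ (assoc _ _ _).symm
    exact (congrArg (WPP.Hom.base c ≫ ·) hbase).trans (congrArg (· ≫ _) hc))
  refine ⟨away g, awayHom g ≫ WPP.Hom.base e, s, u, M, (awayHom_isEt g).comp he, ⟨q', rfl⟩, ?_,
    fun i hi => ?_⟩
  · refine (congrArg (· ≫ m) ((congrArg toW.map hce.symm).trans (toW.map_comp _ _))).trans ?_
    refine (assoc _ _ _).trans ((congrArg (_ ≫ ·) hn).trans ?_)
    exact (toW.map_comp _ _).symm.trans (congrArg toW.map hM)
  · obtain ⟨x, hx⟩ := (LineSec.nonInvertible_triv _).2 (hs i hi)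
    have hx1 : (LineSec.triv (ringMap (WPP.Hom.base e) (a i))).VanishesAt (ptMap (awayHom g) x) :=
      (LineSec.vanishesAt_triv _ _).2 ((LineSec.vanishesAt_triv _ _).1 hx :)
    have hx2 : (LineSec.triv (ringMap (WPP.Hom.base e) (a i))).VanishesAt (ptMap (awayHom g) q') :=
      hg ⟨i, _, hx1⟩ _ ⟨x, rfl⟩ hx1
    have hx3 : ringMap (WPP.Hom.base e) (a i) ∈ (ptMap (awayHom g) q').asIdeal :=
      (LineSec.vanishesAt_triv _ _).1 hx2
    exact hx3

variable {ξ : W} (m m' : toW.obj (std T a ha) ⟶ ξ) (N : StdNbhd ξ)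

/-- The pull-back of `m` along `h` is given by a matching. -/
def IsRep (h : V ⟶ T) (t : V ⟶ N.U) (s : ι → Option N.κ) (u : ι → V.unop) : Prop :=
  ∃ M : Matching s (fun i => ringMap h (a i)) (fun j => ringMap t (N.b j)) u,
    toW.map (stdMap h a ha) ≫ m = toW.map (matchHom t M) ≫ N.e

variable {m m' N}

lemma base_stdMap_comp (h : V ⟶ T) :
    W.proj.map (toW.map (stdMap h a ha) ≫ m) = h ≫ W.proj.map m :=
  W.proj.map_comp _ _

lemma IsRep.comp {h : V ⟶ T} {t : V ⟶ N.U} {s : ι → Option N.κ} {u : ι → V.unop}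
    (H : IsRep m N h t s u) (d : V' ⟶ V) :
    IsRep m N (d ≫ h) (d ≫ t) s fun i => ringMap d (u i) := by
  obtain ⟨M, e⟩ := H
  refine ⟨M.map (ringMap d), ?_⟩
  have h1 := stdMap_comp_stdMap (ha := ha) d h
  have h2 := stdMap_comp_matchHom (ha := ha.map (ringMap h)) (hb := .of_finite N.b) d t M
  refine (((congrArg toW.map h1.symm).trans (toW.map_comp _ _)) =≫ m).trans ?_
  refine (assoc _ _ _).trans ((_ ≫= e).trans ?_)
  refine (assoc _ _ _).symm.trans (?_ =≫ N.e)
  exact (toW.map_comp _ _).symm.trans (congrArg toW.map h2)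

lemma IsRep.base_eq {h : V ⟶ T} {t : V ⟶ N.U} {s : ι → Option N.κ} {u : ι → V.unop}
    (H : IsRep m N h t s u) : h ≫ W.proj.map m = t ≫ N.base := by
  obtain ⟨M, e⟩ := H
  have := congrArg W.proj.map e
  rw [Functor.map_comp, Functor.map_comp] at this
  exact this

lemma IsRep.eq_iff {h : V ⟶ T} {t : V ⟶ N.U} {s s' : ι → Option N.κ} {u u' : ι → V.unop}
    (H : IsRep m N h t s u) (H' : IsRep m' N h t s' u') :
    toW.map (stdMap h a ha) ≫ m = toW.map (stdMap h a ha) ≫ m' ↔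
      ∀ i, ¬ IsUnit (ringMap h (a i)) → s i = s' i ∧ u i = u' i := by
  obtain ⟨M, e⟩ := H
  obtain ⟨M', e'⟩ := H'
  rw [e, e', ← matchHom_eq_iff (ha := ha.map _) (hb := .of_finite N.b) t M M']
  exact ⟨fun h => toW_injective (W.isStack.fibred.cancel N.e rfl h), fun h => by rw [h]⟩

lemma IsRep.agree {h : V ⟶ T} {t : V ⟶ N.U} {s s' : ι → Option N.κ} {u u' : ι → V.unop}
    (H : IsRep m N h t s u) (H' : IsRep m N h t s' u') :
    ∀ i, ¬ IsUnit (ringMap h (a i)) → s i = s' i ∧ u i = u' i := (H.eq_iff H').1 rfl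

lemma IsRep.unit_eq {h : V ⟶ T} {t : V ⟶ N.U} {s : ι → Option N.κ} {u u' : ι → V.unop}
    (H : IsRep m N h t s u) (H' : IsRep m N h t s u') : u = u' :=
  funext fun _ => Matching.eq_of_agree H.choose H'.choose (H.agree H') rfl

lemma exists_isRep (m : toW.obj (std T a ha) ⟶ ξ) (t : T ⟶ N.U) (ht : t ≫ N.base = W.proj.map m)
    (p : PrimeSpectrum T.unop) : ∃ (V : Aff) (h : V ⟶ T) (s : ι → Option N.κ) (u : ι → V.unop),
      IsEt h ∧ p ∈ Set.range (ptMap h) ∧ IsRep m N h (h ≫ t) s u ∧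
      ∀ i, s i ≠ none → a i ∈ p.asIdeal := by
  obtain ⟨n, hn, rfl⟩ := W.isStack.fibred.fac N.e m t ht
  obtain ⟨V, h, s, u, M, he, hp, e, hs⟩ := exists_local_matching t n hn p
  exact ⟨V, h, s, u, he, hp, ⟨M, by rw [← assoc, e]⟩, hs⟩

lemma exists_isRep' (m : toW.obj (std T a ha) ⟶ ξ) (N : StdNbhd ξ) (p : PrimeSpectrum T.unop)
    (hp : ptMap (W.proj.map m) p ∈ Set.range (ptMap N.base)) :
    ∃ (V : Aff) (h : V ⟶ T) (t : V ⟶ N.U) (s : ι → Option N.κ) (u : ι → V.unop),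
      IsEt h ∧ p ∈ Set.range (ptMap h) ∧ IsRep m N h t s u := by
  obtain ⟨q, hq⟩ := hp
  obtain ⟨V, h, t, v, he, hc, rfl, -⟩ :=
    IsEt.exists_square (f := N.base) N.et (W.proj.map m) p q hq.symm
  obtain ⟨V', h', s, u, he', ⟨v', rfl⟩, ⟨M, e⟩, -⟩ := exists_isRep (N := N)
    (toW.map (stdMap h a ha) ≫ m) t (hc.symm.trans (base_stdMap_comp h).symm) v
  refine ⟨V', h' ≫ h, h' ≫ t, s, u, he'.comp he, ⟨v', rfl⟩, M, ?_⟩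
  refine (congrArg (· ≫ m) ((congrArg toW.map (stdMap_comp_stdMap (ha := ha) h' h).symm).trans
    (toW.map_comp _ _))).trans ?_
  exact (assoc _ _ _).trans e

lemma IsRep.exists_nbhd {t : T ⟶ N.U} (ht : t ≫ N.base = W.proj.map m) {k : V ⟶ T}
    {s : ι → Option N.κ} {u : ι → V.unop} (H : IsRep m N k (k ≫ t) s u) (q : PrimeSpectrum V.unop) :
    ∃ (V' : Aff) (h : V' ⟶ T) (u' : ι → V'.unop), IsEt h ∧ ptMap k q ∈ Set.range (ptMap h) ∧
      IsRep m N h (h ≫ t) s u' := by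
  obtain ⟨V', h, s₀, u₀, he, ⟨v, hv⟩, H₀, hs⟩ := exists_isRep m t ht (ptMap k q)
  obtain ⟨Y, c, d, y, -, hcd, rfl, rfl⟩ := he.exists_square k q v hv.symm
  have H1 := H.comp c
  have H2 := H₀.comp d
  rw [← assoc, ← hcd] at H2
  rw [← assoc] at H1
  have key := H1.agree H2
  obtain ⟨M₀, e₀⟩ := H₀
  obtain ⟨u', M', hu'⟩ := M₀.extend H.choose.mono fun i j hi => by
    refine ((key i fun hu => ?_).1).trans hi
    exact y.2.ne_top (Ideal.eq_top_of_isUnit_mem _ (hs i (by simp [hi])) hu)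
  refine ⟨V', h, u', he, ⟨_, hv⟩, M', e₀.trans (congrArg (· ≫ N.e) (congrArg toW.map ?_))⟩
  refine (matchHom_eq_iff _ M₀ M').2 fun i hi => ?_
  have hi0 : s₀ i ≠ none := fun hc => hi (M₀.isUnit_of_none hc)
  obtain ⟨j, hj⟩ := Option.ne_none_iff_exists'.1 hi0
  refine ⟨?_, (hu' i hi0).symm⟩
  refine ((key i fun hu => ?_).1).symm
  exact y.2.ne_top (Ideal.eq_top_of_isUnit_mem _ (hs i hi0) hu)

end LocalStructure


section MatchingSpaces

/-! ### Affine spaces and spaces of matchings -/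

instance (R σ : Type) [CommRing R] [Finite σ] :
    Algebra.IsStandardSmoothOfRelativeDimension (Nat.card σ) R (MvPolynomial σ R) := by
  let v : PEmpty.{1} → MvPolynomial σ R := PEmpty.elim
  let P : Algebra.SubmersivePresentation R (MvPolynomial σ R ⧸ Ideal.span (Set.range v)) σ PEmpty.{1} :=
    { Algebra.PreSubmersivePresentation.naive (v := v) PEmpty.elim (fun i => i.elim)
        (Function.surjInv Ideal.Quotient.mk_surjective) (Function.surjInv_eq _) with
      jacobian_isUnit := by
        rw [Algebra.PreSubmersivePresentation.jacobian_eq_jacobiMatrix_det, Matrix.det_isEmpty,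
          map_one]
        exact isUnit_one }
  have hv : Ideal.span (Set.range v) = ⊥ := by rw [Set.range_eq_empty, Ideal.span_empty]
  have : Algebra.IsStandardSmoothOfRelativeDimension (Nat.card σ) R
      (MvPolynomial σ R ⧸ Ideal.span (Set.range v)) :=
    P.isStandardSmoothOfRelativeDimension (by simp [Algebra.Presentation.dimension])
  exact .of_algEquiv (Nat.card σ)
    ((Ideal.quotientEquivAlgOfEq R hv).trans (AlgEquiv.quotientBot R (MvPolynomial σ R)))

/-- The affine space over an affine scheme. -/
def affineSpace (U : Aff) (σ : Type) : Aff := affOver U (MvPolynomial σ U.unop) MvPolynomial.C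

/-- The projection of affine space. -/
def affineHom (U : Aff) (σ : Type) : affineSpace U σ ⟶ U := affOverHom U _ _

/-- The coordinates of affine space. -/
def affineCoord (U : Aff) (σ : Type) (i : σ) : (affineSpace U σ).unop :=
  (MvPolynomial.X i : MvPolynomial σ U.unop)

lemma exists_affine_lift {U W : Aff} {σ : Type} (k : W ⟶ U) (v : σ → W.unop) :
    ∃ g : W ⟶ affineSpace U σ, g ≫ affineHom U σ = k ∧
      ∀ i, ringMap g (affineCoord U σ i) = v i :=
  ⟨affOverLift k (MvPolynomial.eval₂Hom (ringMap k) v) (MvPolynomial.eval₂Hom_comp_C _ _),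
    affOverLift_comp _ _ _, fun i => MvPolynomial.eval₂Hom_X' _ _ i⟩

lemma affine_hom_ext {U W : Aff} {σ : Type} {g g' : W ⟶ affineSpace U σ}
    (h : g ≫ affineHom U σ = g' ≫ affineHom U σ)
    (h' : ∀ i, ringMap g (affineCoord U σ i) = ringMap g' (affineCoord U σ i)) : g = g' :=
  ringMap_injective (MvPolynomial.ringHom_ext (f := ringMap g) (g := ringMap g')
    (fun c => congrArg (fun m => ringMap m c) h) h')

lemma smooth_affineHom (U : Aff) (σ : Type) [Finite σ] :
    SmoothOfRelativeDimension (Nat.card σ) (spec.map (affineHom U σ)).left := by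
  rw [spec_map_left]
  refine (HasRingHomProperty.Spec_iff (P := @SmoothOfRelativeDimension (Nat.card σ))).2
    (RingHom.locally_of RingHom.isStandardSmoothOfRelativeDimension_respectsIso _ ?_)
  change RingHom.IsStandardSmoothOfRelativeDimension (Nat.card σ)
    (algebraMap U.unop (MvPolynomial σ U.unop))
  rw [RingHom.isStandardSmoothOfRelativeDimension_algebraMap]
  infer_instance

lemma away_hom_ext {U W : Aff} {d : U.unop} {g g' : W ⟶ away d}
    (h : g ≫ awayHom d = g' ≫ awayHom d) : g = g' :=
  ringMap_injective (IsLocalization.ringHom_ext (S := Localization.Away d) (Submonoid.powers d)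
    (congrArg ringMap h))

lemma exists_units_space (U : Aff) (σ : Type) [Finite σ] (d : U.unop) :
    ∃ (Z : Aff) (π : Z ⟶ U) (w : σ → Z.unop), (∀ i, IsUnit (w i)) ∧ IsUnit (ringMap π d) ∧
      SmoothOfRelativeDimension (Nat.card σ) (spec.map π).left ∧
      (∀ {W : Aff} (k : W ⟶ U) (v : σ → W.unop), (∀ i, IsUnit (v i)) → IsUnit (ringMap k d) →
        ∃ g : W ⟶ Z, g ≫ π = k ∧ ∀ i, ringMap g (w i) = v i) ∧
      ∀ {W : Aff} (g g' : W ⟶ Z), g ≫ π = g' ≫ π →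
        (∀ i, ringMap g (w i) = ringMap g' (w i)) → g = g' := by
  have := Fintype.ofFinite σ
  let D : (affineSpace U σ).unop := ringMap (affineHom U σ) d * ∏ i, affineCoord U σ i
  have hD := isUnit_awayHom D
  simp only [D, map_mul, map_prod] at hD
  refine ⟨away D, awayHom D ≫ affineHom U σ, fun i => ringMap (awayHom D) (affineCoord U σ i),
    fun i => ?_, isUnit_of_mul_isUnit_left hD, ?_, fun {W} k v hv hd => ?_, fun {W} g g' h h' => ?_⟩
  · exact isUnit_of_dvd_unit (Finset.dvd_prod_of_mem
      (fun i => ringMap (awayHom D) (affineCoord U σ i)) (Finset.mem_univ i))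
      (isUnit_of_mul_isUnit_right hD)
  · have h1 : SmoothOfRelativeDimension 0 (spec.map (awayHom D)).left :=
      (Etale.iff_smoothOfRelativeDimension_zero _).1 ((isEt_iff _).1 (awayHom_isEt D))
    have h2 := smooth_affineHom U σ
    rw [spec_map_comp_left, ← zero_add (Nat.card σ)]
    infer_instance
  · obtain ⟨g, rfl, hg⟩ := exists_affine_lift k v
    obtain ⟨g', rfl⟩ := exists_lift_away (a := D) g (by
      simp only [D, map_mul, map_prod, hg]
      exact hd.mul (IsUnit.prod_iff.2 fun i _ => hv i))
    exact ⟨g', (assoc _ _ _).symm, hg⟩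
  · have : g ≫ awayHom D = g' ≫ awayHom D :=
      affine_hom_ext ((assoc _ _ _).trans (h.trans (assoc _ _ _).symm)) h'
    exact away_hom_ext this

lemma exists_matching_space (U : Aff) {ι κ : Type} [LinearOrder ι] [LinearOrder κ] [Finite ι]
    [Finite κ] (a : ι → U.unop) (b : κ → U.unop) (s : ι → Option κ)
    (mono : ∀ {i i' j j'}, s i = some j → s i' = some j' → i < i' → j < j') :
    ∃ (Z : Aff) (π : Z ⟶ U) (u : ι → Z.unop),
      Matching s (fun i => ringMap π (a i)) (fun j => ringMap π (b j)) u ∧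
      (∀ {W : Aff} (k : W ⟶ U) (v : ι → W.unop),
        Matching s (fun i => ringMap k (a i)) (fun j => ringMap k (b j)) v →
        ∃ g : W ⟶ Z, g ≫ π = k ∧ ∀ i, ringMap g (u i) = v i) ∧
      ∀ {W : Aff} (g g' : W ⟶ Z), g ≫ π = g' ≫ π →
        (∀ i, ringMap g (u i) = ringMap g' (u i)) → g = g' := by
  classical
  have := Fintype.ofFinite κ
  obtain ⟨Z, π, w, hw, hd, -, hl, he⟩ := exists_units_space U ι
    (∏ j, if ∀ i, s i ≠ some j then b j else 1)
  rw [map_prod, IsUnit.prod_univ_iff] at hd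
  let I : Ideal Z.unop := Ideal.span (Set.range fun i =>
    ringMap π (a i) - w i * (s i).elim 1 fun j => ringMap π (b j))
  have hI : ∀ i, ringMap (closedHom I) (ringMap π (a i)) =
      ringMap (closedHom I) (w i * (s i).elim 1 fun j => ringMap π (b j)) := fun i =>
    sub_eq_zero.1 ((map_sub _ _ _).symm.trans (Ideal.Quotient.eq_zero_iff_mem.2
      (Ideal.subset_span ⟨i, rfl⟩)))
  refine ⟨closedAff I, closedHom I ≫ π, fun i => ringMap (closedHom I) (w i),
    ⟨mono, fun i => (hw i).map _, fun i => ?_, fun j hj => ?_⟩, fun {W} k v M => ?_,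
    fun {W} g g' h h' => ?_⟩
  · refine (hI i).trans ((map_mul _ _ _).trans ?_)
    cases s i <;> simp [ringMap_comp]
  · have := hd j
    rw [if_pos hj] at this
    exact this.map (ringMap (closedHom I))
  · obtain ⟨g, rfl, hg⟩ := hl k v M.unit (by
      rw [map_prod, IsUnit.prod_univ_iff]
      intro j
      split_ifs with hj
      · exact M.off j hj
      · simp)
    obtain ⟨g', rfl⟩ := (exists_lift_closed (I := I) g).2 fun x hx => by
      refine Submodule.span_induction ?_ (map_zero _) (fun x y _ _ hx hy => ?_)
        (fun c x _ hx => ?_) hx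
      · rintro _ ⟨i, rfl⟩
        have h := M.eq i
        rw [map_sub, map_mul, hg, sub_eq_zero]
        refine h.trans (congrArg (v i * ·) ?_)
        cases s i <;> simp [ringMap_comp]
      · rw [map_add, hx, hy, add_zero]
      · rw [smul_eq_mul, map_mul, hx, mul_zero]
    exact ⟨g', (assoc _ _ _).symm, hg⟩
  · have h1 : g ≫ closedHom I = g' ≫ closedHom I :=
      he _ _ ((assoc _ _ _).trans (h.trans (assoc _ _ _).symm)) h'
    exact ringMap_injective (Ideal.Quotient.ringHom_ext (congrArg ringMap h1))

end MatchingSpaces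


section Diagonal

/-! ### Isomorphisms between objects of `W` -/

/-- A smaller neighbourhood. -/
def StdNbhd.restrict {ξ : W} (N : StdNbhd ξ) {V : Aff} (h : V ⟶ N.U) (hh : IsEt h) : StdNbhd ξ where
  κ := N.κ
  U := V
  b i := ringMap h (N.b i)
  e := toW.map (stdMap h N.b _) ≫ N.e
  et := by
    rw [Functor.map_comp]
    exact IsEt.comp hh N.et

lemma StdNbhd.base_restrict {ξ : W} (N : StdNbhd ξ) {V : Aff} (h : V ⟶ N.U) (hh : IsEt h) :
    (N.restrict h hh).base = h ≫ N.base := W.proj.map_comp _ _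

section Transport

variable {x x' ξ : W} (N : StdNbhd ξ) (f : x ⟶ ξ) {T T' : Aff} (t : T ⟶ N.U)
  (k : T ⟶ W.proj.obj x) (h : t ≫ N.base = k ≫ W.proj.map f)

include h in
lemma StdNbhd.existsUnique_tr :
    ∃! c : toW.obj (std T (fun i => ringMap t (N.b i)) (.of_finite _)) ⟶ x,
      W.proj.map c = k ∧ c ≫ f = toW.map (stdMap t N.b (.of_finite _)) ≫ N.e :=
  W.isStack.fibred.existsUnique_fac f (toW.map (stdMap t N.b (.of_finite _)) ≫ N.e)
    (show W.proj.obj (toW.obj (std T (fun i => ringMap t (N.b i)) (.of_finite _))) ⟶ _ from k)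
    (h.symm.trans (base_stdMap_comp t).symm)

/-- The sequence of functions as an object isomorphic to a pull-back of `x`. -/
def StdNbhd.tr : toW.obj (std T (fun i => ringMap t (N.b i)) (.of_finite _)) ⟶ x :=
  (N.existsUnique_tr f t k h).choose

lemma StdNbhd.tr_base : W.proj.map (N.tr f t k h) = k :=
  (N.existsUnique_tr f t k h).choose_spec.1.1

lemma StdNbhd.tr_comp : N.tr f t k h ≫ f = toW.map (stdMap t N.b (.of_finite _)) ≫ N.e :=
  (N.existsUnique_tr f t k h).choose_spec.1.2

lemma StdNbhd.restrict_tr (d : T' ⟶ T) (h') :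
    toW.map (stdMap d (fun i => ringMap t (N.b i)) (.of_finite _)) ≫ N.tr f t k h =
      N.tr f (d ≫ t) (d ≫ k) h' := by
  refine (N.existsUnique_tr f (d ≫ t) (d ≫ k) h').unique ⟨?_, ?_⟩
    ⟨N.tr_base _ _ _ _, N.tr_comp _ _ _ _⟩
  · exact (W.proj.map_comp _ _).trans (d ≫= (N.tr_base f t k h))
  · refine (assoc _ _ _).trans ((_ ≫= (N.tr_comp f t k h)).trans ?_)
    refine (assoc _ _ _).symm.trans (?_ =≫ N.e)
    exact (toW.map_comp _ _).symm.trans (congrArg toW.map (stdMap_comp_stdMap d t))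

lemma StdNbhd.tr_map (g : x' ⟶ x) {f' : x' ⟶ ξ} (hf : g ≫ f = f') (k' : T ⟶ W.proj.obj x')
    (hk : k' ≫ W.proj.map g = k) (h') : N.tr f' t k' h' ≫ g = N.tr f t k h := by
  refine (N.existsUnique_tr f t k h).unique ⟨?_, ?_⟩ ⟨N.tr_base _ _ _ _, N.tr_comp _ _ _ _⟩
  · exact (W.proj.map_comp _ _).trans (((N.tr_base _ _ _ _) =≫ _).trans hk)
  · rw [assoc, hf, N.tr_comp]

end Transport

variable {Y : Type 1} [Category.{1} Y] {Φ : Y ⥤ W} {ξ η : Y}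
  {e : (Φ ⋙ W.proj).obj ξ ⟶ (Φ ⋙ W.proj).obj η}

variable (Φ ξ η e) in
/-- Compatible neighbourhoods on which both objects are given by functions. -/
structure IsomNbhd where
  N : StdNbhd (Φ.obj ξ)
  N' : StdNbhd (Φ.obj η)
  tb : N.U ⟶ N'.U
  comm : N.base ≫ e = tb ≫ N'.base

lemma exists_isomNbhd (x : PrimeSpectrum ((Φ ⋙ W.proj).obj ξ).unop) :
    ∃ I : IsomNbhd Φ ξ η e, x ∈ Set.range (ptMap I.N.base) := by
  obtain ⟨N, ⟨y, rfl⟩, -⟩ := W.exists_stdNbhd (Φ.obj ξ) x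
  obtain ⟨N', ⟨z, hz⟩, -⟩ := W.exists_stdNbhd (Φ.obj η) (ptMap e (ptMap N.base y))
  obtain ⟨V, a, b, v, ha, hab, rfl, -⟩ :=
    IsEt.exists_square (f := N'.base) N'.et (N.base ≫ e) y z hz.symm
  refine ⟨⟨N.restrict a ha, N', b, ?_⟩, v, ?_⟩
  · rw [N.base_restrict]
    exact (assoc _ _ _).trans hab
  · exact congrArg (fun f => ptMap f v) (N.base_restrict a ha)

namespace IsomNbhd

variable (I : IsomNbhd Φ ξ η e) (y w : IsomObj (Φ ⋙ W.proj) ξ η e) {T T' : Aff} (t : T ⟶ I.N.U)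
  (k : T ⟶ (Φ ⋙ W.proj).obj y.z) (h : t ≫ I.N.base = k ≫ W.proj.map (Φ.map y.fst))

/-- The isomorphism, as a morphism from a sequence of functions. -/
def mor : toW.obj (std T (fun i => ringMap t (I.N.b i)) (.of_finite _)) ⟶ Φ.obj η :=
  I.N.tr (Φ.map y.fst) t k h ≫ Φ.map y.snd

lemma mor_base : (t ≫ I.tb) ≫ I.N'.base = W.proj.map (I.mor y t k h) := by
  have h1 : W.proj.map (I.mor y t k h) = k ≫ W.proj.map (Φ.map y.snd) :=
    (W.proj.map_comp _ _).trans ((I.N.tr_base _ _ _ _) =≫ _)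
  have h2 : W.proj.map (Φ.map y.fst) ≫ e = W.proj.map (Φ.map y.snd) := y.w
  rw [h1, ← h2, ← assoc, ← h, assoc, ← I.comm, assoc]

lemma restrict_mor (d : T' ⟶ T) (h') :
    toW.map (stdMap d (fun i => ringMap t (I.N.b i)) (.of_finite _)) ≫ I.mor y t k h =
      I.mor y (d ≫ t) (d ≫ k) h' :=
  (assoc _ _ _).symm.trans ((I.N.restrict_tr _ t k h d h') =≫ _)

/-- The isomorphism is given by a matching. -/
def Rep (s : I.N.κ → Option I.N'.κ) (u : I.N.κ → T.unop) : Prop :=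
  ∃ M : Matching s (fun i => ringMap t (I.N.b i)) (fun j => ringMap (t ≫ I.tb) (I.N'.b j)) u,
    I.mor y t k h = toW.map (matchHom (t ≫ I.tb) M) ≫ I.N'.e

variable {I y w t k h}

lemma mor_hom (g : w ⟶ y) {k' : T ⟶ (Φ ⋙ W.proj).obj w.z}
    (hk : k' ≫ W.proj.map (Φ.map (IsomObj.Hom.hom g)) = k) (h') :
    I.mor w t k' h' = I.mor y t k h := by
  have h1 := I.N.tr_map (Φ.map y.fst) t k h (Φ.map (IsomObj.Hom.hom g)) (f' := Φ.map w.fst)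
    (by rw [← Functor.map_comp, g.fst]) k' hk h'
  rw [mor, mor, ← h1, assoc, ← Functor.map_comp, g.snd]

lemma isRep_iff {d : T' ⟶ T} {s : I.N.κ → Option I.N'.κ} {u : I.N.κ → T'.unop} {t' : T' ⟶ I.N'.U}
    (ht : d ≫ t ≫ I.tb = t') (h') :
    IsRep (I.mor y t k h) I.N' d t' s u ↔ I.Rep y (d ≫ t) (d ≫ k) h' s u := by
  subst ht
  have h1 := I.restrict_mor y t k h d h'
  constructor
  · rintro ⟨M, hM⟩
    exact ⟨M, h1.symm.trans hM⟩
  · rintro ⟨M, hM⟩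
    exact ⟨M, h1.trans hM⟩

lemma Rep.comp {s : I.N.κ → Option I.N'.κ} {u : I.N.κ → T.unop} (H : I.Rep y t k h s u)
    (d : T' ⟶ T) (h') : I.Rep y (d ≫ t) (d ≫ k) h' s fun i => ringMap d (u i) := by
  obtain ⟨M, hM⟩ := H
  refine ⟨M.map (ringMap d), (I.restrict_mor y t k h d h').symm.trans ?_⟩
  refine (_ ≫= hM).trans ((assoc _ _ _).symm.trans (?_ =≫ _))
  exact (toW.map_comp _ _).symm.trans (congrArg toW.map (stdMap_comp_matchHom d (t ≫ I.tb) M))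

lemma Rep.congr {s : I.N.κ → Option I.N'.κ} {u : I.N.κ → T.unop} (H : I.Rep y t k h s u)
    {t' : T ⟶ I.N.U} {k' : T ⟶ (Φ ⋙ W.proj).obj w.z} (ht : t = t') (g : w ⟶ y)
    (hk : k' ≫ W.proj.map (Φ.map (IsomObj.Hom.hom g)) = k) (h') : I.Rep w t' k' h' s u := by
  subst ht
  obtain ⟨M, hM⟩ := H
  exact ⟨M, (mor_hom g hk h').trans hM⟩

lemma Rep.eq_iff {y' : IsomObj (Φ ⋙ W.proj) ξ η e} {k' : T ⟶ (Φ ⋙ W.proj).obj y'.z} {h'}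
    {s s' : I.N.κ → Option I.N'.κ} {u u' : I.N.κ → T.unop} (H : I.Rep y t k h s u)
    (H' : I.Rep y' t k' h' s' u') : I.mor y t k h = I.mor y' t k' h' ↔
      ∀ i, ¬ IsUnit (ringMap t (I.N.b i)) → s i = s' i ∧ u i = u' i := by
  obtain ⟨M, hM⟩ := H
  obtain ⟨M', hM'⟩ := H'
  rw [hM, hM', ← matchHom_eq_iff (ha := .of_finite _) (hb := .of_finite I.N'.b) (t ≫ I.tb) M M']
  exact ⟨fun h => toW_injective (W.isStack.fibred.cancel I.N'.e rfl h), fun h => by rw [h]⟩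

lemma Rep.unit_eq {s : I.N.κ → Option I.N'.κ} {u u' : I.N.κ → T.unop} (H : I.Rep y t k h s u)
    (H' : I.Rep y t k h s u') : u = u' :=
  funext fun _ => Matching.eq_of_agree H.choose H'.choose ((H.eq_iff H').1 rfl) rfl

lemma exists_hom [Φ.Full] [Φ.Faithful] {c : (Φ ⋙ W.proj).obj w.z ⟶ (Φ ⋙ W.proj).obj y.z}
    (hc : c ≫ W.proj.map (Φ.map y.fst) = W.proj.map (Φ.map w.fst))
    {t : (Φ ⋙ W.proj).obj w.z ⟶ I.N.U} {h h'}
    (e' : I.mor w t (𝟙 _) h = I.mor y t c h') :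
    ∃ g : w ⟶ y, (isomProj (Φ ⋙ W.proj) ξ η e).map g = c := by
  obtain ⟨g, hg, hgf⟩ := W.isStack.fibred.fac (Φ.map y.fst) (Φ.map w.fst) c hc
  have h1 := I.N.tr_map (Φ.map y.fst) t c h' g hgf (𝟙 _) ((id_comp _).trans hg) h
  have h2 : IsIso (I.N.tr (Φ.map w.fst) t (𝟙 _) h) := by
    have : IsIso (W.proj.map (I.N.tr (Φ.map w.fst) t (𝟙 _) h)) := by
      rw [I.N.tr_base]
      exact inferInstanceAs (IsIso (𝟙 _))
    exact W.isStack.fibred.isIso _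
  have h3 : g ≫ Φ.map y.snd = Φ.map w.snd := by
    rw [← cancel_epi (I.N.tr (Φ.map w.fst) t (𝟙 _) h), ← assoc, h1]
    exact e'.symm
  exact ⟨⟨Φ.preimage g,
    Φ.map_injective ((Φ.map_comp _ _).trans (((Φ.map_preimage g) =≫ _).trans hgf)),
    Φ.map_injective ((Φ.map_comp _ _).trans (((Φ.map_preimage g) =≫ _).trans h3))⟩,
    (congrArg W.proj.map (Φ.map_preimage g)).trans hg⟩

end IsomNbhd

end Diagonal


section IsomSpaces

lemma comp_square {C : Type*} [Category C] {A B B' D X : C} {a : A ⟶ B} {x : B ⟶ X} {b : A ⟶ B'}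
    {y : B' ⟶ X} (h : a ≫ x = b ≫ y) (d : D ⟶ A) : (d ≫ a) ≫ x = (d ≫ b) ≫ y := by
  rw [assoc, assoc, h]

lemma exists_isRep_pair {T : Aff} {ι ι' : Type} [LinearOrder ι] [LinearOrder ι'] {a : ι → T.unop}
    {ha : AlmostUnits a} {a' : ι' → T.unop} {ha' : AlmostUnits a'} {ξ : W} {N : StdNbhd ξ}
    (m : toW.obj (std T a ha) ⟶ ξ) (m' : toW.obj (std T a' ha') ⟶ ξ) (t : T ⟶ N.U)
    (ht : t ≫ N.base = W.proj.map m) (ht' : t ≫ N.base = W.proj.map m')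
    (p : PrimeSpectrum T.unop) : ∃ (V : Aff) (h : V ⟶ T) (s : ι → Option N.κ) (u : ι → V.unop)
      (s' : ι' → Option N.κ) (u' : ι' → V.unop) (x : PrimeSpectrum V.unop), IsEt h ∧ ptMap h x = p ∧
      IsRep m N h (h ≫ t) s u ∧ IsRep m' N h (h ≫ t) s' u' ∧
      (∀ i, s i ≠ none → a i ∈ p.asIdeal) ∧ ∀ i, s' i ≠ none → a' i ∈ p.asIdeal := by
  obtain ⟨V, h, s, u, hh, ⟨v, hv⟩, H, hs⟩ := exists_isRep m t ht p
  obtain ⟨V', h', s', u', hh', ⟨v', hv'⟩, H', hs'⟩ := exists_isRep m' t ht' p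
  obtain ⟨Z, c, c', z, hc, hcc, rfl, -⟩ := IsEt.exists_square hh' h v v' (hv.trans hv'.symm)
  refine ⟨Z, c ≫ h, s, fun i => ringMap c (u i), s', fun i => ringMap c' (u' i), z, hc.comp hh, hv, ?_, ?_, hs, hs'⟩
  · rw [assoc]
    exact H.comp c
  · rw [hcc, assoc]
    exact H'.comp c'

variable {Y : Type 1} [Category.{1} Y] {Φ : Y ⥤ W} {ξ η : Y}
  {e : (Φ ⋙ W.proj).obj ξ ⟶ (Φ ⋙ W.proj).obj η}

namespace IsomNbhd

variable (I : IsomNbhd Φ ξ η e)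

lemma exists_hom_iff [Φ.Full] [Φ.Faithful] {w y : IsomObj (Φ ⋙ W.proj) ξ η e}
    {c : (Φ ⋙ W.proj).obj w.z ⟶ (Φ ⋙ W.proj).obj y.z}
    (hc : c ≫ W.proj.map (Φ.map y.fst) = W.proj.map (Φ.map w.fst))
    {t : (Φ ⋙ W.proj).obj w.z ⟶ I.N.U} (h) (h') :
    (∃ g : w ⟶ y, (isomProj (Φ ⋙ W.proj) ξ η e).map g = c) ↔ I.mor w t (𝟙 _) h = I.mor y t c h' :=
  ⟨fun ⟨g, hg⟩ => mor_hom g ((id_comp _).trans hg) h, exists_hom hc⟩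

lemma exists_chart [Φ.Full] [Φ.Faithful] (hq : IsFibredInGroupoids (Φ ⋙ W.proj))
    (s : I.N.κ → Option I.N'.κ)
    (mono : ∀ {i i' j j'}, s i = some j → s i' = some j' → i < i' → j < j') :
    ∃ (ζ : IsomObj (Φ ⋙ W.proj) ξ η e) (π : (Φ ⋙ W.proj).obj ζ.z ⟶ I.N.U) (h : _)
      (u : I.N.κ → ((Φ ⋙ W.proj).obj ζ.z).unop), I.Rep ζ π (𝟙 _) h s u ∧
      (∀ {T : Aff} (k : T ⟶ I.N.U) (v : I.N.κ → T.unop),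
        Matching s (fun i => ringMap k (I.N.b i)) (fun j => ringMap (k ≫ I.tb) (I.N'.b j)) v →
        ∃ g : T ⟶ (Φ ⋙ W.proj).obj ζ.z, g ≫ π = k ∧ ∀ i, ringMap g (u i) = v i) ∧
      ∀ {T : Aff} (g g' : T ⟶ (Φ ⋙ W.proj).obj ζ.z), g ≫ π = g' ≫ π →
        (∀ i, ringMap g (u i) = ringMap g' (u i)) → g = g' := by
  obtain ⟨Z, π, u, M, univ, uniq⟩ :=
    exists_matching_space I.N.U I.N.b (fun j => ringMap I.tb (I.N'.b j)) s mono
  obtain ⟨z, j, a, ha⟩ := hq.lift ξ (π ≫ I.N.base)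
  have h : (j.hom ≫ π) ≫ I.N.base = 𝟙 _ ≫ W.proj.map (Φ.map a) := by grind
  let τ := I.N.tr (Φ.map a) (j.hom ≫ π) (𝟙 _) h
  have hτ : W.proj.map τ = 𝟙 _ := I.N.tr_base _ _ _ h
  have : IsIso τ := by
    have : IsIso (W.proj.map τ) := by
      rw [hτ]
      exact inferInstanceAs (IsIso (𝟙 _))
    exact W.isStack.fibred.isIso _
  let M' := M.map (ringMap j.hom)
  let n := toW.map (matchHom (ha := .of_finite _) (hb := .of_finite I.N'.b)
    ((j.hom ≫ π) ≫ I.tb) M') ≫ I.N'.e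
  have hn : W.proj.map n = ((j.hom ≫ π) ≫ I.tb) ≫ I.N'.base := W.proj.map_comp _ _
  have h1 : τ ≫ inv τ ≫ n = n := IsIso.hom_inv_id_assoc τ n
  have h2 : W.proj.map (inv τ ≫ n) = W.proj.map n := by
    have h3 := congrArg W.proj.map h1
    rw [W.proj.map_comp] at h3
    exact (id_comp _).symm.trans ((hτ =≫ _).symm.trans h3)
  let ζ : IsomObj (Φ ⋙ W.proj) ξ η e := ⟨z, a, Φ.preimage (inv τ ≫ n), by
    refine Eq.trans ?_ (congrArg W.proj.map (Φ.map_preimage _)).symm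
    refine Eq.trans ?_ (h2.trans hn).symm
    rw [ha, assoc, assoc, I.comm]
    simp only [assoc]⟩
  refine ⟨ζ, j.hom ≫ π, h, fun i => ringMap j.hom (u i), ⟨M', ?_⟩, ?_, ?_⟩
  · exact (τ ≫= (Φ.map_preimage (inv τ ≫ n))).trans h1
  · intro T k v hv
    obtain ⟨g, hg, hg'⟩ := univ k v hv
    refine ⟨g ≫ j.inv, by simp [hg], fun i => ?_⟩
    have h4 : (g ≫ j.inv) ≫ j.hom = g := by simp
    exact (congrArg (fun f => ringMap f (u i)) h4).trans (hg' i)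
  · intro T g g' hg hg'
    rw [← cancel_mono j.hom]
    exact uniq _ _ (by simpa using hg) hg'

lemma exists_hom_of_rep [Φ.Full] [Φ.Faithful] (hs : IsStack etale (Φ ⋙ W.proj))
    {s : I.N.κ → Option I.N'.κ} {ζ : IsomObj (Φ ⋙ W.proj) ξ η e}
    {π : (Φ ⋙ W.proj).obj ζ.z ⟶ I.N.U} {h} {u : I.N.κ → ((Φ ⋙ W.proj).obj ζ.z).unop}
    (R : I.Rep ζ π (𝟙 _) h s u)
    (univ : ∀ {T : Aff} (k : T ⟶ I.N.U) (v : I.N.κ → T.unop),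
      Matching s (fun i => ringMap k (I.N.b i)) (fun j => ringMap (k ≫ I.tb) (I.N'.b j)) v →
      ∃ g : T ⟶ (Φ ⋙ W.proj).obj ζ.z, g ≫ π = k ∧ ∀ i, ringMap g (u i) = v i)
    {y : IsomObj (Φ ⋙ W.proj) ξ η e} {V : Aff} {t : V ⟶ I.N.U} {k : V ⟶ (Φ ⋙ W.proj).obj y.z}
    (hk : IsEt k) {h'} {v : I.N.κ → V.unop} (R' : I.Rep y t k h' s v)
    {p : PrimeSpectrum ((Φ ⋙ W.proj).obj y.z).unop} (hp : p ∈ Set.range (ptMap k)) :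
    ∃ (w : IsomObj (Φ ⋙ W.proj) ξ η e) (e' : w ⟶ y) (g : w ⟶ ζ)
      (j : (isomProj (Φ ⋙ W.proj) ξ η e).obj w ⟶ V),
      (isomProj (Φ ⋙ W.proj) ξ η e).map e' = j ≫ k ∧
      IsEt ((isomProj (Φ ⋙ W.proj) ξ η e).map e') ∧
      p ∈ Set.range (ptMap ((isomProj (Φ ⋙ W.proj) ξ η e).map e')) ∧
      (isomProj (Φ ⋙ W.proj) ξ η e).map g ≫ π = j ≫ t := by
  obtain ⟨g₀, hg₀, hgu⟩ := univ t v R'.choose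
  obtain ⟨w, j, e', he', het, hp'⟩ := exists_nbhd (IsomObj.isStack hs).fibred y k hk hp
  have hw : (j.hom ≫ k) ≫ W.proj.map (Φ.map y.fst) = W.proj.map (Φ.map w.fst) :=
    (congrArg (· ≫ _) he'.symm).trans
      (Charts.base_app (q := isomProj (Φ ⋙ W.proj) ξ η e) (r := isomBase _ _ _ _) e')
  have h₀ : (j.hom ≫ t) ≫ I.N.base = 𝟙 _ ≫ W.proj.map (Φ.map w.fst) :=
    (comp_square h' j.hom).trans (hw.trans (id_comp _).symm)
  have h₁ : (j.hom ≫ t) ≫ I.N.base = (j.hom ≫ g₀) ≫ W.proj.map (Φ.map ζ.fst) := by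
    refine comp_square ?_ _
    rw [← hg₀, assoc, h]
    exact congrArg (g₀ ≫ ·) (id_comp _)
  have h₂ := IsomNbhd.mor_hom (y := y) (w := w) e' ((id_comp _).trans he') h₀
    (h := comp_square h' j.hom)
  have R₁ : I.Rep ζ (j.hom ≫ t) (j.hom ≫ g₀) h₁ s fun i => ringMap j.hom (v i) := by
    have R₂ := (R.comp g₀ (comp_square h g₀)).comp j.hom (comp_square (comp_square h g₀) j.hom)
    simp only [hgu] at R₂
    exact R₂.congr (by rw [hg₀]) (𝟙 ζ) ((congrArg (_ ≫ ·) (congrArg W.proj.map (Φ.map_id _))).trans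
      (by simp)) h₁
  have h₃ := (Rep.eq_iff (R'.comp j.hom (comp_square h' j.hom)) R₁).2 fun _ _ => ⟨rfl, rfl⟩
  obtain ⟨g, hg⟩ := (I.exists_hom_iff (w := w) (y := ζ) (c := j.hom ≫ g₀)
    (h₁.symm.trans (h₀.trans (id_comp _))) h₀ h₁).2 (h₂.trans h₃)
  exact ⟨w, e', g, j.hom, he', het, hp',
    (congrArg (· ≫ π) hg).trans ((assoc _ _ _).trans (congrArg (j.hom ≫ ·) hg₀))⟩

end IsomNbhd

variable [Φ.Full] [Φ.Faithful] (hs : IsStack etale (Φ ⋙ W.proj))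

include hs in
lemma isom_eqClosed : EqClosed (isomProj (Φ ⋙ W.proj) ξ η e) (isomBase (Φ ⋙ W.proj) ξ η e) := by
  intro y₁ y₂ i hi p
  obtain ⟨I, x, hx⟩ :=
    exists_isomNbhd (Φ := Φ) (η := η) (e := e) (ptMap ((Φ ⋙ W.proj).map y₁.fst) p)
  obtain ⟨T, a, b, t, ha, hab, hat, -⟩ := IsEt.exists_square (f := I.N.base) I.N.et
    (W.proj.map (Φ.map y₁.fst)) p x hx.symm
  have hab' : b ≫ I.N.base = (a ≫ i.hom) ≫ W.proj.map (Φ.map y₂.fst) :=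
    hab.symm.trans ((a ≫= hi.symm).trans (assoc _ _ _).symm)
  obtain ⟨V, h, s, u, s', u', x, hh, rfl, H, H', hv, hv'⟩ := exists_isRep_pair
    (I.mor y₁ b a hab.symm) (I.mor y₂ b (a ≫ i.hom) hab') (b ≫ I.tb) (I.mor_base _ _ _ _)
    (I.mor_base _ _ _ _) t
  obtain rfl : s = s' := Matching.eq_of_vanish H.choose H'.choose x hv hv' (Set.toFinite _)
    fun _ => Iff.rfl
  obtain ⟨v, j, e₁, he₁, het, hp⟩ :=
    exists_nbhd (IsomObj.isStack hs).fibred y₁ (h ≫ a) (hh.comp ha) ⟨x, hat⟩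
  have R := (IsomNbhd.isRep_iff rfl (comp_square hab.symm h)).1 H
  have R' := (IsomNbhd.isRep_iff rfl (comp_square hab' h)).1 H'
  refine ⟨v, e₁, Ideal.span (Set.range fun i => ringMap j.hom (u i - u' i)), het, hp,
    fun {w} d => ?_⟩
  let δ := (isomProj (Φ ⋙ W.proj) ξ η e).map d ≫ j.hom
  have hc : (isomProj (Φ ⋙ W.proj) ξ η e).map (d ≫ e₁) = δ ≫ h ≫ a :=
    (Functor.map_comp _ _ _).trans ((_ ≫= he₁).trans (assoc _ _ _).symm)
  have hci : (isomProj (Φ ⋙ W.proj) ξ η e).map (d ≫ e₁) ≫ i.hom = δ ≫ h ≫ a ≫ i.hom :=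
    (hc =≫ i.hom).trans
      ((assoc _ _ _).trans (δ ≫= (assoc _ _ _)))
  have R := R.comp δ (comp_square (comp_square hab.symm h) δ)
  have R' := R'.comp δ (comp_square (comp_square hab' h) δ)
  have hw : (δ ≫ h ≫ a) ≫ W.proj.map (Φ.map y₁.fst) = W.proj.map (Φ.map w.fst) :=
    (hc.symm =≫ _).trans
      (Charts.base_app (q := isomProj (Φ ⋙ W.proj) ξ η e) (r := isomBase _ _ _ _) (d ≫ e₁))
  have h₀ : (δ ≫ h ≫ b) ≫ I.N.base = 𝟙 _ ≫ W.proj.map (Φ.map w.fst) :=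
    (comp_square (comp_square hab.symm h) δ).trans (hw.trans (id_comp _).symm)
  have h₁ := I.exists_hom_iff (y := y₂) (((comp_square (comp_square hab' h) δ).symm.trans
    (comp_square (comp_square hab.symm h) δ)).trans hw) h₀ (comp_square (comp_square hab' h) δ)
  have h₂ := IsomNbhd.mor_hom (d ≫ e₁) ((id_comp _).trans hc) h₀
    (h := comp_square (comp_square hab.symm h) δ)
  have h₃ := (IsomNbhd.Rep.eq_iff R R')
  rw [hci]
  refine h₁.trans (Iff.trans ⟨h₂.symm.trans, h₂.trans⟩ (h₃.trans ⟨fun H z hz => ?_, fun H i _ => ⟨rfl, ?_⟩⟩))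
  · refine (Ideal.span_le (I := RingHom.ker (ringMap ((isomProj _ _ _ _).map d)))).2 ?_ hz
    rintro _ ⟨i, rfl⟩
    change ringMap δ (u i - u' i) = 0
    refine (map_sub (ringMap δ) _ _).trans (sub_eq_zero.2 ?_)
    exact Matching.eq_of_agree R.choose R'.choose H rfl
  · refine sub_eq_zero.1 (Eq.trans (map_sub (ringMap δ) _ _).symm ?_)
    exact H _ (Ideal.subset_span ⟨i, rfl⟩)

include hs in
theorem exists_isom_space (ξ η : Y) (e : (Φ ⋙ W.proj).obj ξ ⟶ (Φ ⋙ W.proj).obj η) :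
    ∃ (R : PSpace) (f : R ⟶ pts.obj (spec.obj ((Φ ⋙ W.proj).obj ξ))), IsAlgebraicSpace R ∧
      Nonempty (Represents (isomProj (Φ ⋙ W.proj) ξ η e) (isomBase (Φ ⋙ W.proj) ξ η e) R f) ∧
      IsSeparatedOver f ∧ HasAtlasWith @QuasiCompact f := by
  choose I hI using exists_isomNbhd (Φ := Φ) (ξ := ξ) (η := η) (e := e)
  obtain ⟨F, hF⟩ := exists_finite_cover (v := fun x => (I x).N.base) (fun x => (I x).N.et) hI
  let K : Type := Σ x : F, {s : (I x).N.κ → Option (I x).N'.κ //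
    ∀ {i i' j j'}, s i = some j → s i' = some j' → i < i' → j < j'}
  choose ζ π h u R univ uniq using fun k : K => (I k.1).exists_chart hs.fibred k.2.1 k.2.2
  let C : Charts (isomProj (Φ ⋙ W.proj) ξ η e) (isomBase (Φ ⋙ W.proj) ξ η e) K :=
    { U := fun k => (I k.1).N.U
      u := fun k => (I k.1).N.base
      et := fun k => (I k.1).N.et
      ζ := ζ
      zu := π
      comm := fun k => (h k).trans (id_comp _)
      uniq := by
        intro k w g g' hgg
        have hid : ∀ g : w ⟶ ζ k, 𝟙 _ ≫ (isomProj (Φ ⋙ W.proj) ξ η e).map g =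
          (isomProj (Φ ⋙ W.proj) ξ η e).map g ≫ 𝟙 _ := fun _ => by simp
        have hw : ((isomProj (Φ ⋙ W.proj) ξ η e).map g ≫ π k) ≫ (I k.1).N.base =
            𝟙 _ ≫ W.proj.map (Φ.map w.fst) :=
          (assoc _ _ _).trans ((congrArg (_ ≫ ·) ((h k).trans (id_comp _))).trans
            ((Charts.base_app (q := isomProj (Φ ⋙ W.proj) ξ η e) (r := isomBase _ _ _ _) g).trans
              (id_comp _).symm))
        have R₁ := ((R k).comp ((isomProj (Φ ⋙ W.proj) ξ η e).map g) (comp_square (h k) _)).congr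
          rfl g (hid g) hw
        have R₂ := ((R k).comp ((isomProj (Φ ⋙ W.proj) ξ η e).map g') (comp_square (h k) _)).congr
          hgg.symm g' (hid g') hw
        exact uniq k _ _ hgg (congrFun (R₁.unit_eq R₂))
      opn := by
        intro k y t ht w d g hg p
        have hb : t ≫ (I k.1).N.base = 𝟙 _ ≫ W.proj.map (Φ.map y.fst) :=
          ht.trans (id_comp _).symm
        have hid : ∀ {y' : IsomObj (Φ ⋙ W.proj) ξ η e} (g : w ⟶ y'),
          𝟙 _ ≫ (isomProj (Φ ⋙ W.proj) ξ η e).map g =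
          (isomProj (Φ ⋙ W.proj) ξ η e).map g ≫ 𝟙 _ := fun _ => by simp
        have hw : ((isomProj (Φ ⋙ W.proj) ξ η e).map d ≫ t) ≫ (I k.1).N.base =
            𝟙 _ ≫ W.proj.map (Φ.map w.fst) :=
          (assoc _ _ _).trans ((congrArg (_ ≫ ·) ht).trans
            ((Charts.base_app (q := isomProj (Φ ⋙ W.proj) ξ η e) (r := isomBase _ _ _ _) d).trans
              (id_comp _).symm))
        have R₁ := ((R k).comp ((isomProj (Φ ⋙ W.proj) ξ η e).map g) (comp_square (h k) _)).congr
          hg g (hid g) hw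
        have R₂ : (I k.1).Rep y ((isomProj (Φ ⋙ W.proj) ξ η e).map d ≫ t)
            ((isomProj (Φ ⋙ W.proj) ξ η e).map d ≫ 𝟙 _) (comp_square hb _) k.2.1 _ :=
          ⟨R₁.choose, (IsomNbhd.mor_hom d (hid d) hw).symm.trans R₁.choose_spec⟩
        obtain ⟨V, h', u', hh', hp', H'⟩ := IsRep.exists_nbhd ((I k.1).mor_base y t (𝟙 _) hb)
          ((IsomNbhd.isRep_iff rfl (comp_square hb _)).2 R₂) p
        obtain ⟨v, e', g', j, he', het, hpe, hg'⟩ := (I k.1).exists_hom_of_rep hs (R k) (univ k)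
          (hh'.comp (isEt_id _)) ((IsomNbhd.isRep_iff rfl (comp_square hb h')).1 H') hp'
        refine ⟨v, e', g', het, hpe, hg'.trans ((assoc _ _ _).symm.trans
          (congrArg (· ≫ t) ?_))⟩
        exact (he'.trans (congrArg (j ≫ ·) (comp_id h'))).symm
      cov := by
        intro y p
        obtain ⟨x, hx, z, hz⟩ := hF (ptMap ((Φ ⋙ W.proj).map y.fst) p)
        obtain ⟨T, a, b, t, ha, hab, hat, -⟩ := IsEt.exists_square (f := (I x).N.base) (I x).N.et
          (W.proj.map (Φ.map y.fst)) p z hz.symm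
        obtain ⟨V, c, s, v, hc, ⟨o, ho⟩, H, -⟩ := exists_isRep (N := (I x).N')
          ((I x).mor y b a hab.symm) (b ≫ (I x).tb) ((I x).mor_base _ _ _ _) t
        let k : K := ⟨⟨x, hx⟩, s, H.choose.mono⟩
        obtain ⟨w, e', g, j, -, het, hp, -⟩ := (I x).exists_hom_of_rep hs (R k) (univ k)
          (hc.comp ha) ((IsomNbhd.isRep_iff rfl (comp_square hab.symm c)).1 H) (p := p)
          ⟨o, (congrArg (ptMap a) ho).trans hat⟩
        exact ⟨k, w, e', g, het, hp⟩ }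
  have hfin : Finite K := by
    have : ∀ x, Finite (I x).N.κ := fun x => (I x).N.fin
    have : ∀ x, Finite (I x).N'.κ := fun x => (I x).N'.fin
    infer_instance
  exact exists_represents_of_eqClosed (IsomObj.isStack hs)
    (fun g g' hg => IsomObj.Hom.ext (hs.fibred.cancel _ hg
      ((IsomObj.Hom.fst g).trans (IsomObj.Hom.fst g').symm))) C
    (isom_eqClosed hs) _ (quasiCompact_copDesc _)

end IsomSpaces


section Substacks

lemma Wl.isStack (l : ℕ) : IsStack etale (Wl.proj l) := by
  refine DescentDatum.isStack_fullSubcategory WP.isPrestack (fun X => X.obj.length ≤ l)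
    (fun X hX V f => ?_) (lengthLE l) fun _ => Iff.rfl
  exact ⟨⟨X.obj.restrict f⟩, (WPP.length_le (X.obj.restrictHom f)).trans hX, Iso.refl _,
    (IsomSheafified.unit zariski WPP.proj).map (X.obj.restrictHom f), (id_comp f).symm⟩

/-- The projection of the fibre product with an affine scheme, for a functor to `W`. -/
def fibreMap {X : Type*} [Category X] (F : X ⥤ W) (ξ : W) :
    CostructuredArrow.proj F ξ ⋙ F ⋙ W.proj ⟶ (Functor.const _).obj (W.proj.obj ξ) where
  app t := W.proj.map t.hom
  naturality t t' k := by
    refine Eq.trans ?_ (comp_id _).symm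
    exact (W.proj.map_comp _ _).symm.trans (congrArg W.proj.map (CostructuredArrow.w k))

lemma map_map_op (R : PSpace) {A B C : Aff} (g : A ⟶ B) (h : B ⟶ C) {k : A ⟶ C} (e : g ≫ h = k)
    (x : R.obj (op C)) : R.map g.op (R.map h.op x) = R.map k.op x := by
  subst e
  rw [op_comp, Functor.map_comp_apply]

lemma map_id_op (R : PSpace) {A : Aff} (x : R.obj (op A)) : R.map (𝟙 A).op x = x := by simp

lemma Mor.representableWith_of_full {X Y : Type*} [Category X] [Category Y] {p : X ⥤ Aff}
    (Φ : Y ⥤ W) [Φ.Full] [Φ.Faithful] (G : Mor p (Φ ⋙ W.proj))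
    {Q : ∀ ⦃R : PSpace⦄ ⦃S : Sch⦄, (R ⟶ pts.obj S) → Prop}
    (h : ∀ ξ : Y, ∃ (R : PSpace) (f : R ⟶ pts.obj (spec.obj (W.proj.obj (Φ.obj ξ)))),
      IsAlgebraicSpace R ∧ Nonempty (Represents _ (fibreMap (G.functor ⋙ Φ) (Φ.obj ξ)) R f) ∧ Q f) :
    G.RepresentableWith Q := by
  intro ξ
  obtain ⟨R, f, hR, ⟨P⟩, hQ⟩ := h ξ
  let E (y : CostructuredArrow G.functor ξ) : CostructuredArrow (G.functor ⋙ Φ) (Φ.obj ξ) :=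
    CostructuredArrow.mk (Y := y.left) (Φ.map y.hom)
  have nat : ∀ {x x' : X} (g : x ⟶ x'), p.map g ≫ G.iso.inv.app x' =
      G.iso.inv.app x ≫ (Φ ⋙ W.proj).map (G.functor.map g) := fun g => G.iso.inv.naturality g
  refine ⟨R, f, hR, ⟨{
    pt := fun y => R.map (G.iso.inv.app y.left).op (P.pt (E y))
    pt_map := ?_
    pt_base := ?_
    fullyFaithful := ?_
    essSurj := ?_ }⟩, hQ⟩
  · intro y y' g
    let g' : E y ⟶ E y' := CostructuredArrow.homMk g.left
      ((Φ.map_comp _ _).symm.trans (congrArg Φ.map (CostructuredArrow.w g)))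
    have h1 := P.pt_map g'
    exact (map_map_op R _ _ (nat g.left) _).trans
      ((map_map_op R _ _ rfl _).symm.trans (congrArg (R.map _) h1))
  · intro y
    refine (NatTrans.naturality_apply f (G.iso.inv.app y.left).op (P.pt (E y))).trans ?_
    refine (congrArg ((pts.obj _).map _) (P.pt_base (E y))).trans ?_
    exact congrArg ULift.up (spec.map_comp _ _).symm
  · intro y y' k hk
    have hk' : R.map (G.iso.hom.app y.left ≫ k ≫ G.iso.inv.app y'.left).op (P.pt (E y')) =
        P.pt (E y) :=
      (map_map_op R _ _ rfl _).symm.trans ((congrArg (R.map _) ((map_map_op R _ _ rfl _).symm.trans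
        hk)).trans ((map_map_op R _ _ (G.iso.hom_inv_id_app _) _).trans (map_id_op R _)))
    obtain ⟨g, hg, hu⟩ := P.fullyFaithful (y := E y) (y' := E y') _ hk'
    refine ⟨CostructuredArrow.homMk g.left (Φ.map_injective ((Φ.map_comp _ _).trans
      (CostructuredArrow.w g))), ?_, fun g' hg' => ?_⟩
    · change p.map g.left = k
      refine (cancel_mono (G.iso.inv.app y'.left)).1
        ((cancel_epi (G.iso.hom.app y.left)).1 (Eq.trans ?_ hg))
      refine ((G.iso.hom.app y.left) ≫= (nat g.left)).trans ?_
      exact Iso.hom_inv_id_app_assoc _ _ _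
    · have h2 := hu (CostructuredArrow.homMk g'.left
        ((Φ.map_comp _ _).symm.trans (congrArg Φ.map (CostructuredArrow.w g')))) (by
          refine Eq.trans ?_ (congrArg (fun k => G.iso.hom.app y.left ≫ k ≫ _) hg')
          refine Eq.symm (((G.iso.hom.app y.left) ≫= (nat g'.left)).trans ?_)
          exact Iso.hom_inv_id_app_assoc _ _ _)
      ext
      exact congrArg (fun k => k.left) h2
  · intro T x
    obtain ⟨y, i, hx⟩ := P.essSurj x
    let y' : CostructuredArrow G.functor ξ := CostructuredArrow.mk (Y := y.left) (Φ.preimage y.hom)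
    let g : y ⟶ E y' := CostructuredArrow.homMk (𝟙 _) ((((G.functor ⋙ Φ).map_id _) =≫ _).trans ((id_comp _).trans (Φ.map_preimage _)))
    have h1 : P.pt (E y') = P.pt y := by
      refine Eq.trans ?_ (P.pt_map g)
      refine Eq.trans ?_ (congrArg (fun k => R.map (Quiver.Hom.op k) _)
        (((G.functor ⋙ Φ) ⋙ W.proj).map_id y.left)).symm
      exact (map_id_op R _).symm
    refine ⟨y', i ≪≫ G.iso.app y.left, ?_⟩
    refine (map_map_op R _ _ ((assoc _ _ _).trans ((i.hom ≫= (G.iso.hom_inv_id_app _)).trans (comp_id _))) _).trans ?_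
    exact (congrArg (R.map i.hom.op) h1).trans hx

end Substacks

section Presentations

/-- Coordinates on a disjoint union of affine spaces of dimensions `n ∈ S`: a point is a sequence of
functions whose first member `n + 1` tells the dimension, followed by `n` arbitrary functions and
completed by `1`. -/
structure Coords (V : Sch) (S : Set ℕ) where
  co : ∀ {T : Aff}, (spec.obj T ⟶ V) → ℕ → T.unop
  co_comp : ∀ {T T' : Aff} (h : T' ⟶ T) (t : spec.obj T ⟶ V) (i : ℕ),
    co (spec.map h ≫ t) i = ringMap h (co t i)
  ext : ∀ {T : Aff} (t t' : spec.obj T ⟶ V), (∀ i, co t i = co t' i) → t = t'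
  loc : ∀ {T : Aff} (t : spec.obj T ⟶ V) (p : PrimeSpectrum T.unop), ∃ (T' : Aff) (h : T' ⟶ T),
    IsEt h ∧ p ∈ Set.range (ptMap h) ∧ ∃ n ∈ S, co (spec.map h ≫ t) 0 = n + 1 ∧
      ∀ i, n < i → co (spec.map h ≫ t) i = 1
  exists_of : ∀ {T : Aff} (a : ℕ → T.unop), ∀ n ∈ S, a 0 = n + 1 → (∀ i, n < i → a i = 1) →
    ∃ t : spec.obj T ⟶ V, ∀ i, co t i = a i

lemma isUnit_of_forall_range {T : Aff} {F : Finset (PrimeSpectrum T.unop)}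
    {V : PrimeSpectrum T.unop → Aff} {v : ∀ p, V p ⟶ T}
    (hF : ∀ p, ∃ q ∈ F, p ∈ Set.range (ptMap (v q))) {a : T.unop}
    (h : ∀ q ∈ F, IsUnit (ringMap (v q) a)) : IsUnit a := by
  by_contra ha
  obtain ⟨m, hm, ham⟩ := exists_max_ideal_of_mem_nonunits ha
  obtain ⟨q, hq, z, hz⟩ := hF ⟨m, hm.isPrime⟩
  have h1 : ringMap (v q) a ∈ z.asIdeal := by
    change a ∈ (ptMap (v q) z).asIdeal
    rw [hz]
    exact ham
  exact z.2.ne_top (Ideal.eq_top_of_isUnit_mem _ h1 (h q hq))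

namespace Coords

variable {V : Sch} {S : Set ℕ} (D : Coords V S) {T T' : Aff}

lemma almostUnits (t : spec.obj T ⟶ V) : AlmostUnits (D.co t) := by
  rw [almostUnits_iff]
  choose T' h hh hp n _ _ hn using D.loc t
  obtain ⟨F, hF⟩ := exists_finite_cover h hh hp
  refine (F.finite_toSet.biUnion (t := fun q => Set.Iic (n q)) fun _ _ => Set.finite_Iic _).subset ?_
  intro i hi
  by_contra hi'
  refine hi (isUnit_of_forall_range hF fun q hq => ?_)
  rw [← D.co_comp, hn q i]
  · exact isUnit_one
  · by_contra hlt
    exact hi' (Set.mem_biUnion hq (not_lt.1 hlt))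

end Coords

/-- The pull-back map between sequences of functions. -/
def pullHom {ι : Type} [LinearOrder ι] {T T' : Aff} (c : T' ⟶ T) {a : ι → T.unop} {a' : ι → T'.unop}
    (ha : AlmostUnits a) (ha' : AlmostUnits a') (h : ∀ i, a' i = ringMap c (a i)) :
    std T' a' ha' ⟶ std T a ha :=
  matchHom (s := some) (u := fun _ => 1) c (by rw [← funext h]; exact .refl)

section

variable {ι : Type} [LinearOrder ι] {T T' U : Aff} {c : T' ⟶ T} {a : ι → T.unop} {a' : ι → T'.unop}
    {ha : AlmostUnits a} {ha' : AlmostUnits a'} (h : ∀ i, a' i = ringMap c (a i))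

lemma isRep_pull {ξ : W} {N : StdNbhd ξ} {m : toW.obj (std T a ha) ⟶ ξ} {d : U ⟶ T'} {d' : U ⟶ T}
    (hd : d ≫ c = d') {t : U ⟶ N.U} {s : ι → Option N.κ} {u : ι → U.unop} :
    IsRep (toW.map (pullHom c ha ha' h) ≫ m) N d t s u ↔ IsRep m N d' t s u := by
  obtain rfl : a' = fun i => ringMap c (a i) := funext h
  subst hd
  have h1 : toW.map (stdMap d _ ha') ≫ toW.map (pullHom c ha ha' h) ≫ m =
      toW.map (stdMap (d ≫ c) a ha) ≫ m :=
    (assoc _ _ _).symm.trans (((toW.map_comp _ _).symm.trans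
      (congrArg toW.map (stdMap_comp_stdMap d c))) =≫ m)
  exact ⟨fun ⟨M, hM⟩ => ⟨M, h1.symm.trans hM⟩, fun ⟨M, hM⟩ => ⟨M, h1.trans hM⟩⟩

lemma IsRep.eq_iff_id {ξ : W} {N : StdNbhd ξ} {m m' : toW.obj (std T a ha) ⟶ ξ} {t : T ⟶ N.U}
    {s s' : ι → Option N.κ} {u u' : ι → T.unop} (H : IsRep m N (𝟙 T) t s u)
    (H' : IsRep m' N (𝟙 T) t s' u') :
    m = m' ↔ ∀ i, ¬ IsUnit (a i) → s i = s' i ∧ u i = u' i := by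
  refine Iff.trans ⟨fun h => _ ≫= h, fun h => ?_⟩ (H.eq_iff H')
  have : IsIso (toW.map (stdMap (𝟙 T) a ha)) := by
    have : IsIso (W.proj.map (toW.map (stdMap (𝟙 T) a ha))) := inferInstanceAs (IsIso (𝟙 T))
    exact W.isStack.fibred.isIso _
  exact (cancel_epi (toW.map (stdMap (𝟙 T) a ha))).1 h

end

variable {V : Sch} {S : Set ℕ} (D : Coords V S)

/-- The object of `W` over a disjoint union of affine spaces given by the coordinates. -/
def Coords.functor : CostructuredArrow spec V ⥤ W :=
  { obj := fun t => std t.left (D.co t.hom) (D.almostUnits _)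
    map := fun {t t'} k => pullHom k.left (D.almostUnits _) (D.almostUnits _) (by
      rw [← CostructuredArrow.w k]
      exact D.co_comp _ _)
    map_id := fun t => WPP.hom_ext rfl fun j =>
      (matchHom_map _ _ j j rfl).trans (congrArg (Sigma.mk j) (AddMonoidHom.ext fun x => one_mul (M := t.left.unop) x))
    map_comp := fun f g => (matchHom_comp f.left g.left _ _ _ (fun _ _ e => e) (by simp)).symm : CostructuredArrow spec V ⥤ WPP } ⋙ toW

end Presentations


section PresentationFibres

variable {V : Sch} {S : Set ℕ} (D : Coords V S) {ξ : W}

lemma IsRep.of_eq {ι : Type} [LinearOrder ι] {T T' : Aff} {a : ι → T.unop} {ha : AlmostUnits a}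
    {m : toW.obj (std T a ha) ⟶ ξ} {N : StdNbhd ξ} {h h' : T' ⟶ T} {t t' : T' ⟶ N.U}
    {s : ι → Option N.κ} {u : ι → T'.unop} (H : IsRep m N h t s u) (e : h = h') (e' : t = t') :
    IsRep m N h' t' s u := by
  subst e e'
  exact H

namespace Coords

/-- The projection to affine schemes of the fibre product of `W` with the scheme and an affine
scheme. -/
abbrev fibProj (ξ : W) : CostructuredArrow D.functor ξ ⥤ Aff :=
  CostructuredArrow.proj D.functor ξ ⋙ D.functor ⋙ W.proj

/-- The coordinates of an object of the fibre product. -/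
def cofib (y : CostructuredArrow D.functor ξ) : ℕ → ((D.fibProj ξ).obj y).unop := D.co y.left.hom

/-- The given isomorphism of an object of the fibre product. -/
def hom (y : CostructuredArrow D.functor ξ) :
    toW.obj (std ((D.fibProj ξ).obj y) (D.cofib y) (D.almostUnits _)) ⟶ ξ := y.hom

/-- An object of the fibre product. -/
def mkFib {T : Aff} (t : spec.obj T ⟶ V) (m : toW.obj (std T (D.co t) (D.almostUnits t)) ⟶ ξ) :
    CostructuredArrow D.functor ξ := CostructuredArrow.mk (Y := CostructuredArrow.mk t) m

variable {D}

lemma cofib_map {w y : CostructuredArrow D.functor ξ} (g : w ⟶ y) (i : ℕ) :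
    D.cofib w i = ringMap ((D.fibProj ξ).map g) (D.cofib y i) := by
  refine Eq.trans ?_ (D.co_comp g.left.left y.left.hom i)
  exact congrArg (fun t => D.co t i) (CostructuredArrow.w g.left).symm

lemma hom_map {w y : CostructuredArrow D.functor ξ} (g : w ⟶ y) :
    toW.map (pullHom ((D.fibProj ξ).map g) (D.almostUnits _) (D.almostUnits _) (cofib_map g)) ≫
      D.hom y = D.hom w := CostructuredArrow.w g

lemma exists_fib_hom {w y : CostructuredArrow D.functor ξ}
    (c : (D.fibProj ξ).obj w ⟶ (D.fibProj ξ).obj y)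
    (h : ∀ i, D.cofib w i = ringMap c (D.cofib y i))
    (h' : toW.map (pullHom c (D.almostUnits _) (D.almostUnits _) h) ≫ D.hom y = D.hom w) :
    ∃ g : w ⟶ y, (D.fibProj ξ).map g = c :=
  ⟨CostructuredArrow.homMk (CostructuredArrow.homMk c (D.ext _ _ fun i =>
    (D.co_comp c y.left.hom i).trans (h i).symm)) h', rfl⟩

lemma fib_faithful {w y : CostructuredArrow D.functor ξ} (g g' : w ⟶ y)
    (h : (D.fibProj ξ).map g = (D.fibProj ξ).map g') : g = g' := by
  ext
  exact h

lemma isRep_map {w y : CostructuredArrow D.functor ξ} (g : w ⟶ y) {N : StdNbhd ξ} {T : Aff}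
    {d : T ⟶ (D.fibProj ξ).obj w} {d' : T ⟶ (D.fibProj ξ).obj y}
    (hd : d ≫ (D.fibProj ξ).map g = d') {t : T ⟶ N.U} {s : ℕ → Option N.κ} {u : ℕ → T.unop} :
    IsRep (D.hom w) N d t s u ↔ IsRep (D.hom y) N d' t s u := by
  rw [← hom_map g]
  exact isRep_pull _ hd

variable (D)

lemma fib_isStack (h : IsStack etale (schemeProj V)) : IsStack etale (D.fibProj ξ) :=
  IsStack.costructuredArrow (F := D.functor) (q := W.proj) h W.isStack.isPrestack ξ

/-- The coordinates are those of a point of an affine space of dimension `n`. -/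
def IsDim {A : Type} [CommRing A] (n : ℕ) (a : ℕ → A) : Prop := a 0 = n + 1 ∧ ∀ i, n < i → a i = 1

/-- The indices of a matching are those of coordinates. -/
def Adm {κ : Type} [LinearOrder κ] (n : ℕ) (s : ℕ → Option κ) : Prop :=
  (∀ {i i' j j'}, s i = some j → s i' = some j' → i < i' → j < j') ∧
    ∀ i, s i ≠ none → 1 ≤ i ∧ i ≤ n

end Coords

lemma isUnit_natCast_succ {T : Aff} (n : ℕ) : IsUnit (n + 1 : T.unop) := by
  have h : IsUnit ((n : ℂ) + 1) := (Nat.cast_add_one_ne_zero n).isUnit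
  have h1 := h.map (algebraMap (CommRingCat.of ℂ) T.unop)
  have h2 : algebraMap (CommRingCat.of ℂ) T.unop ((n : ℂ) + 1) = n + 1 :=
    (map_add _ _ _).trans (congrArg₂ _ (map_natCast (algebraMap (CommRingCat.of ℂ) T.unop) n) (map_one _))
  rwa [h2] at h1

lemma eq_of_natCast_eq {T : Aff} (p : PrimeSpectrum T.unop) {m n : ℕ}
    (h : (m + 1 : T.unop) = n + 1) : m = n := by
  by_contra hmn
  have h0 : ((m : ℂ) - n) ≠ 0 := sub_ne_zero.2 (Nat.cast_injective.ne hmn)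
  have h1 := h0.isUnit.map (algebraMap (CommRingCat.of ℂ) T.unop)
  have h2 : algebraMap (CommRingCat.of ℂ) T.unop ((m : ℂ) - n) = 0 := by
    refine (map_sub _ _ _).trans (sub_eq_zero.2 ?_)
    refine (map_natCast (algebraMap (CommRingCat.of ℂ) T.unop) m).trans (Eq.trans ?_
      (map_natCast (algebraMap (CommRingCat.of ℂ) T.unop) n).symm)
    exact add_right_cancel h
  rw [h2] at h1
  exact p.2.ne_top (Ideal.eq_top_of_isUnit_mem _ p.asIdeal.zero_mem h1)

lemma Coords.exists_chart (N : StdNbhd ξ) {n : ℕ} (hn : n ∈ S) {s : ℕ → Option N.κ}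
    (hs : Adm n s) :
    ∃ (ζ : CostructuredArrow D.functor ξ) (π : (D.fibProj ξ).obj ζ ⟶ N.U)
      (u : ℕ → ((D.fibProj ξ).obj ζ).unop), π ≫ N.base = (fibreMap D.functor ξ).app ζ ∧
      IsRep (D.hom ζ) N (𝟙 _) π s u ∧ SmoothOfRelativeDimension n (spec.map π).left ∧
      IsDim n (D.cofib ζ) ∧ (∀ {T : Aff} (k : T ⟶ N.U) (a v : ℕ → T.unop),
        Matching s a (fun j => ringMap k (N.b j)) v → IsDim n a →
        ∃ g : T ⟶ (D.fibProj ξ).obj ζ, g ≫ π = k ∧ ∀ i, ringMap g (u i) = v i ∧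
          ringMap g (D.cofib ζ i) = a i) ∧
      ∀ {T : Aff} (g g' : T ⟶ (D.fibProj ξ).obj ζ), g ≫ π = g' ≫ π →
        (∀ i, ringMap g (u i) = ringMap g' (u i)) → g = g' := by
  classical
  have := Fintype.ofFinite N.κ
  let d : N.U.unop := ∏ j : {j // ∀ i, s i ≠ some j}, N.b j
  have hd : ∀ {T : Aff} (k : T ⟶ N.U), IsUnit (ringMap k d) ↔
      ∀ j, (∀ i, s i ≠ some j) → IsUnit (ringMap k (N.b j)) := fun k => by
    rw [map_prod, IsUnit.prod_univ_iff]
    exact ⟨fun h j hj => h ⟨j, hj⟩, fun h j => h j.1 j.2⟩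
  obtain ⟨Z, π, w, hw, hπ, smooth, univ, uniq⟩ := exists_units_space N.U (Fin n) d
  let u : ℕ → Z.unop := fun i => if i = 0 then n + 1 else
    if h : i - 1 < n then w ⟨i - 1, h⟩ else 1
  have hu : ∀ i (h : i < n), u (i + 1) = w ⟨i, h⟩ := fun i h => by simp [u, h]
  have hu' : ∀ i, n < i → u i = 1 := fun i h => by
    grind
  have hs0 : ∀ i, (i = 0 ∨ n < i) → s i = none := fun i hi => by
    by_contra h
    have := hs.2 i h
    omega
  let a : ℕ → Z.unop := fun i => u i * (s i).elim 1 fun j => ringMap π (N.b j)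
  have ha0 : a 0 = n + 1 := by simp [a, hs0 0 (.inl rfl), u]
  have ha : ∀ i, n < i → a i = 1 := by grind
  obtain ⟨t, ht⟩ := D.exists_of a n hn ha0 ha
  have M : Matching s (D.co t) (fun j => ringMap π (N.b j)) u :=
    { mono := hs.1
      unit := fun i => by
        by_cases h0 : i = 0
        · simp only [u, if_pos h0]
          exact isUnit_natCast_succ n
        · by_cases h1 : i - 1 < n
          · grind
          · grind
      eq := ht
      off := (hd π).1 hπ }
  refine ⟨D.mkFib t (toW.map (matchHom π M) ≫ N.e), π, u, (W.proj.map_comp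
    (toW.map (matchHom (ha := D.almostUnits t) (hb := .of_finite N.b) π M)) N.e).symm, ⟨M, ?_⟩,
    by rwa [Nat.card_fin] at smooth, ⟨(ht 0).trans ha0, fun i hi => (ht i).trans (ha i hi)⟩, ?_, ?_⟩
  · exact (assoc _ _ _).symm.trans (((toW.map_comp _ _).symm.trans
      (congrArg toW.map (stdMap_comp_matchHom (𝟙 Z) π M))) =≫ N.e)
  · intro T k a' v M' hdim
    obtain ⟨g, rfl, hg'⟩ := univ k (fun i => v (i + 1)) (fun i => M'.unit _) ((hd k).2 M'.off)
    have hgu : ∀ i, ringMap g (u i) = v i := fun i => by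
      by_cases h0 : i = 0
      · subst h0
        have h1 := M'.eq 0
        rw [hs0 0 (.inl rfl), hdim.1] at h1
        simpa [u] using h1
      · by_cases h1 : n < i
        · have h2 := M'.eq i
          rw [hs0 i (.inr h1), hdim.2 i h1] at h2
          simpa [hu' i h1] using h2
        · grind
    refine ⟨g, rfl, fun i => ⟨hgu i, ?_⟩⟩
    refine (congrArg (ringMap g) (ht i)).trans ((map_mul _ _ _).trans ?_)
    rw [hgu, M'.eq i]
    congr 1
    cases s i
    · exact map_one _
    · rfl
  · intro T g g' hg hgu
    refine uniq g g' hg fun i => ?_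
    rw [← hu i i.2]
    exact hgu _

lemma Coords.exists_hom_of_rep (hV : IsStack etale (schemeProj V)) {N : StdNbhd ξ} {n : ℕ}
    {s : ℕ → Option N.κ} {ζ : CostructuredArrow D.functor ξ} {π : (D.fibProj ξ).obj ζ ⟶ N.U}
    {u : ℕ → ((D.fibProj ξ).obj ζ).unop} (R : IsRep (D.hom ζ) N (𝟙 _) π s u)
    (univ : ∀ {T : Aff} (k : T ⟶ N.U) (a v : ℕ → T.unop),
        Matching s a (fun j => ringMap k (N.b j)) v → IsDim n a →
        ∃ g : T ⟶ (D.fibProj ξ).obj ζ, g ≫ π = k ∧ ∀ i, ringMap g (u i) = v i ∧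
          ringMap g (D.cofib ζ i) = a i)
    {y : CostructuredArrow D.functor ξ} {T : Aff} {f : T ⟶ (D.fibProj ξ).obj y} (hf : IsEt f)
    {t : T ⟶ N.U} {v : ℕ → T.unop} (R' : IsRep (D.hom y) N f t s v)
    (hdim : IsDim n fun i => ringMap f (D.cofib y i)) {p : PrimeSpectrum ((D.fibProj ξ).obj y).unop}
    (hp : p ∈ Set.range (ptMap f)) :
    ∃ (w : CostructuredArrow D.functor ξ) (e : w ⟶ y) (g : w ⟶ ζ) (j : (D.fibProj ξ).obj w ⟶ T),
      (D.fibProj ξ).map e = j ≫ f ∧ IsEt ((D.fibProj ξ).map e) ∧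
      p ∈ Set.range (ptMap ((D.fibProj ξ).map e)) ∧ (D.fibProj ξ).map g ≫ π = j ≫ t := by
  obtain ⟨w, j, e, he, het, hpe⟩ := exists_nbhd (D.fib_isStack hV).fibred y f hf hp
  have M' : Matching s (fun i => ringMap f (D.cofib y i)) (fun j => ringMap t (N.b j)) v := R'.choose
  obtain ⟨g₀, hg₀, hgu⟩ := univ t _ v M' hdim
  have hco : ∀ i, D.cofib w i = ringMap (j.hom ≫ g₀) (D.cofib ζ i) := fun i => by
    refine (cofib_map e i).trans ((congrArg (fun k => ringMap k (D.cofib y i)) he).trans ?_)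
    exact congrArg (ringMap j.hom) (hgu i).2.symm
  have R₁ : IsRep (D.hom w) N (𝟙 _) (j.hom ≫ t) s fun i => ringMap j.hom (v i) :=
    (isRep_map e ((id_comp _).trans he)).2 (R'.comp j.hom)
  have R₃ := (isRep_pull (m := D.hom ζ) (ha' := D.almostUnits _) hco
    (id_comp (j.hom ≫ g₀))).2 ((R.comp (j.hom ≫ g₀)).of_eq (comp_id _)
      ((assoc _ _ _).trans (congrArg (j.hom ≫ ·) hg₀)))
  obtain ⟨g, hg⟩ := exists_fib_hom (w := w) (y := ζ) (j.hom ≫ g₀) hco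
    ((R₃.eq_iff_id R₁).2 fun i _ => ⟨rfl, congrArg (ringMap j.hom) (hgu i).1⟩)
  grind

lemma Coords.exists_isDim (y : CostructuredArrow D.functor ξ) {T : Aff}
    (f : T ⟶ (D.fibProj ξ).obj y) (x : PrimeSpectrum T.unop) :
    ∃ (T' : Aff) (h : T' ⟶ T) (x' : PrimeSpectrum T'.unop), IsEt h ∧ ptMap h x' = x ∧
      ∃ n ∈ S, IsDim n fun i => ringMap (h ≫ f) (D.cofib y i) := by
  obtain ⟨T', h, hh, ⟨x', hx'⟩, n, hn, h0, h1⟩ := D.loc (spec.map f ≫ y.left.hom) x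
  have h2 : ∀ i, D.co (spec.map h ≫ spec.map f ≫ y.left.hom) i =
      ringMap (h ≫ f) (D.cofib y i) := fun i =>
    (D.co_comp h _ i).trans (congrArg (ringMap h) (D.co_comp f y.left.hom i))
  exact ⟨T', h, x', hh, hx', n, hn, (h2 0).symm.trans h0, fun i hi => (h2 i).symm.trans (h1 i hi)⟩

end PresentationFibres


section SchemeStack

variable {V : Sch}

lemma scheme_hom_ext {T : Aff} {t t' : spec.obj T ⟶ V} (h : ∀ x : PrimeSpectrum T.unop,
    ∃ (T' : Aff) (f : T' ⟶ T), IsEt f ∧ x ∈ Set.range (ptMap f) ∧ spec.map f ≫ t = spec.map f ≫ t') :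
    t = t' := by
  have := section_ext (pts_isSheaf V) (s := ULift.up t) (s' := ULift.up t') fun x => by
    obtain ⟨T', f, hf, hx, e⟩ := h x
    exact ⟨T', f, hf, hx, congrArg ULift.up e⟩
  exact congrArg ULift.down this

lemma schemeProj_isStack (V : Sch) : IsStack etale (schemeProj V) where
  fibred := by
    refine IsFibredInGroupoids.mk' (fun x T f => ?_) fun {x y z} a b g h => ?_
    · exact ⟨CostructuredArrow.mk (spec.map f ≫ x.hom), rfl, CostructuredArrow.homMk f rfl,
        (id_comp _).symm⟩
    · refine ⟨CostructuredArrow.homMk g ?_, ⟨rfl, ?_⟩, fun c hc => ?_⟩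
      · exact ((spec.map g) ≫= (CostructuredArrow.w a).symm).trans
          ((assoc _ _ _).symm.trans (((spec.map_comp g a.left).symm =≫ x.hom).trans ((congrArg (fun k => spec.map k ≫ x.hom) h).trans
          (CostructuredArrow.w b))))
      · ext
        exact h
      · ext
        exact hc.1
  glueHom {x y} φ := by
    have h : spec.map φ.base ≫ y.hom = x.hom := scheme_hom_ext fun p => by
      obtain ⟨T, f, hf, he, hp⟩ := mem_etale.1 φ.mem p
      let a : CostructuredArrow.mk (spec.map f ≫ x.hom) ⟶ x := CostructuredArrow.homMk f rfl
      have h1 := CostructuredArrow.w (φ.map a hf)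
      have h2 : (φ.map a hf).left = f ≫ φ.base := φ.map_base a hf
      rw [h2] at h1
      exact ⟨T, f, he, hp, (assoc _ _ _).symm.trans
        (((spec.map_comp f φ.base).symm =≫ y.hom).trans h1)⟩
    refine ⟨CostructuredArrow.homMk φ.base h, ⟨rfl, fun a ha => ?_⟩, fun c hc => ?_⟩
    · ext
      exact (φ.map_base a ha).symm
    · ext
      exact hc.1
  effective D := by
    obtain ⟨s, hs⟩ := exists_section (pts_isSheaf V) (U := D.U)
      (fun {T} f s => ∃ (i : D.I) (k : T ⟶ (D.obj i).left), k ≫ D.map i = f ∧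
        s = ULift.up (spec.map k ≫ (D.obj i).hom))
      (fun g f s ⟨i, k, hk, e⟩ => ⟨i, g ≫ k, (assoc _ _ _).trans (g ≫= hk), by
        rw [e, pts_map_op, spec.map_comp, assoc]⟩)
      (fun {T} f s s' ⟨i, k, hk, e⟩ ⟨j, k', hk', e'⟩ => by
        let u : CostructuredArrow.mk (spec.map k ≫ (D.obj i).hom) ⟶ D.obj i :=
          CostructuredArrow.homMk k rfl
        have h1 := CostructuredArrow.w (D.glue u j k' (hk'.trans hk.symm))
        have h2 : (D.glue u j k' (hk'.trans hk.symm)).left = k' := D.glue_base u j k' _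
        rw [h2] at h1
        rw [e, e', h1]
        rfl)
      (fun p => by
        obtain ⟨T, f, hf, he, hp⟩ := mem_etale.1 D.cover p
        obtain ⟨i, k, hk⟩ := D.exists_mid f hf
        exact ⟨T, f, he, hp, _, i, k, hk, rfl⟩)
    refine ⟨CostructuredArrow.mk s.down, Iso.refl _, fun i => CostructuredArrow.homMk (D.map i)
      (congrArg ULift.down (hs (D.map i) (ULift.up (D.obj i).hom) ⟨i, 𝟙 _, id_comp _, ?_⟩)),
      fun i => comp_id _, fun u j b w => ?_⟩
    · exact congrArg ULift.up (((spec.map_id _) =≫ _).trans (id_comp _)).symm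
    · ext
      exact ((D.glue_base u j b w) =≫ (D.map j)).trans w

end SchemeStack

section Presentations

variable {V : Sch} {S : Set ℕ} (D : Coords V S) {ξ : W}

lemma base_pull {ι : Type} [LinearOrder ι] {T T' : Aff} {c : T' ⟶ T} {a : ι → T.unop}
    {a' : ι → T'.unop} {ha : AlmostUnits a} {ha' : AlmostUnits a'}
    (h : ∀ i, a' i = ringMap c (a i)) (m : toW.obj (std T a ha) ⟶ ξ) :
    c ≫ W.proj.map m = W.proj.map (toW.map (pullHom c ha ha' h) ≫ m) :=
  (W.proj.map_comp (toW.map (pullHom c ha ha' h)) m).symm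

namespace Coords

lemma fib_eqClosed (ξ : W) : EqClosed (D.fibProj ξ) (fibreMap D.functor ξ) := by
  intro y₁ y₂ i hi p
  obtain ⟨N, ⟨z, hz⟩, -⟩ := W.exists_stdNbhd ξ (ptMap ((fibreMap D.functor ξ).app y₁) p)
  obtain ⟨T, a, b, t, ha, hab, hat, -⟩ := IsEt.exists_square (f := N.base) N.et
    ((fibreMap D.functor ξ).app y₁) p z hz.symm
  have hab' : b ≫ N.base = (a ≫ i.hom) ≫ (fibreMap D.functor ξ).app y₂ := by
    rw [← hab, ← hi, assoc]
  obtain ⟨T', h, s, u, s', u', x, hh, rfl, H, H', hv, hv'⟩ := exists_isRep_pair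
    (toW.map (pullHom a (D.almostUnits _) ((D.almostUnits _).map _) fun _ => rfl) ≫ D.hom y₁)
    (toW.map (pullHom (a ≫ i.hom) (D.almostUnits _) ((D.almostUnits _).map _) fun _ => rfl) ≫
      D.hom y₂) b (hab.symm.trans (base_pull _ _))
    (hab'.trans (base_pull _ _)) t
  let A : ℕ → T'.unop := fun n => ringMap (h ≫ a) (D.cofib y₁ n)
  let A' : ℕ → T'.unop := fun n => ringMap (h ≫ a ≫ i.hom) (D.cofib y₂ n)
  have R : IsRep (D.hom y₁) N (h ≫ a) (h ≫ b) s u := (isRep_pull _ rfl).1 H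
  have R' : IsRep (D.hom y₂) N (h ≫ a ≫ i.hom) (h ≫ b) s' u' := (isRep_pull _ rfl).1 H'
  obtain ⟨δ, hδ, hδ'⟩ : ∃ δ : T'.unop, δ ∉ x.asIdeal ∧ (s = s' ∨ ∃ n, δ = A n - A' n) := by
    by_cases hA : ∀ n, A n ∈ x.asIdeal ↔ A' n ∈ x.asIdeal
    · refine ⟨1, (Ideal.ne_top_iff_one _).1 x.2.ne_top, .inl ?_⟩
      refine Matching.eq_of_vanish R.choose R'.choose x hv hv' ?_ hA
      refine ((almostUnits_iff _).1 (D.almostUnits y₁.left.hom |>.map (ringMap (h ≫ a)))).subset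
        fun n hn hu => x.2.ne_top (Ideal.eq_top_of_isUnit_mem _ (hv n hn) hu)
    · obtain ⟨n, hn⟩ := not_forall.1 hA
      exact ⟨A n - A' n, fun hm => hn ⟨fun h => by simpa using sub_mem h hm,
        fun h => by simpa using add_mem hm h⟩, .inr ⟨n, rfl⟩⟩
  obtain ⟨x', hx'⟩ : x ∈ ran (awayHom δ) := by
    rw [range_awayHom]
    exact hδ
  obtain ⟨v, j, e, he, het, hp⟩ := exists_nbhd (D.fib_isStack (schemeProj_isStack V)).fibred y₁
    (awayHom δ ≫ h ≫ a) ((awayHom_isEt δ).comp (hh.comp ha)) ⟨x', (congrArg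
      (fun z => ptMap a (ptMap h z)) hx').trans hat⟩
  let c := j.hom ≫ awayHom δ
  refine ⟨v, e, Ideal.span (Set.range fun n => ringMap c (A n - A' n)) ⊔
    Ideal.span (Set.range fun n => ringMap c (u n - u' n)), het, hp, fun {w} d => ?_⟩
  let g := (D.fibProj ξ).map d ≫ c
  have hδg : IsUnit (ringMap g δ) := (isUnit_awayHom δ).map (ringMap ((D.fibProj ξ).map d ≫ j.hom))
  have hc : (D.fibProj ξ).map (d ≫ e) = g ≫ h ≫ a :=
    (Functor.map_comp _ _ _).trans ((_ ≫= he).trans (by simp only [g, c, assoc]))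
  have hci : (D.fibProj ξ).map (d ≫ e) ≫ i.hom = g ≫ h ≫ a ≫ i.hom :=
    (hc =≫ i.hom).trans
      ((assoc _ _ _).trans (g ≫= (assoc _ _ _)))
  have R₁ : IsRep (D.hom w) N (𝟙 _) (g ≫ h ≫ b) s fun n => ringMap g (u n) :=
    (isRep_map (d ≫ e) ((id_comp _).trans hc)).2 (R.comp g)
  have hco : ∀ n, D.cofib w n = ringMap g (A n) := fun n =>
    (cofib_map (d ≫ e) n).trans (congrArg (fun k => ringMap k (D.cofib y₁ n)) hc)
  have key : (∃ m : w ⟶ y₂, (D.fibProj ξ).map m = g ≫ h ≫ a ≫ i.hom) ↔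
      (∀ n, ringMap g (A n) = ringMap g (A' n)) ∧ ∀ n, ringMap g (u n) = ringMap g (u' n) := by
    have triv : (∀ n, ringMap g (A n) = ringMap g (A' n)) → s = s' ∨ Subsingleton ((D.fibProj ξ).obj w).unop :=
      fun hA => hδ'.imp_right fun ⟨n, hn⟩ => by
        rw [hn, map_sub, sub_eq_zero.2 (hA n), isUnit_zero_iff] at hδg
        exact subsingleton_of_zero_eq_one hδg
    constructor
    · rintro ⟨m, hm⟩
      have hA : ∀ n, ringMap g (A n) = ringMap g (A' n) := fun n => (hco n).symm.trans
        ((cofib_map m n).trans (congrArg (fun k => ringMap k (D.cofib y₂ n)) hm))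
      refine ⟨hA, ?_⟩
      rcases triv hA with rfl | _
      · have R₂ : IsRep (D.hom w) N (𝟙 _) (g ≫ h ≫ b) s fun n => ringMap g (u' n) :=
          (isRep_map m ((id_comp _).trans hm)).2 (R'.comp g)
        exact congrFun (R₁.unit_eq R₂)
      · exact fun _ => Subsingleton.elim _ _
    · rintro ⟨hA, hu⟩
      have hco' : ∀ n, D.cofib w n = ringMap (g ≫ h ≫ a ≫ i.hom) (D.cofib y₂ n) := fun n =>
        (hco n).trans (hA n)
      refine exists_fib_hom _ hco' ?_
      have R₂ := (isRep_pull (m := D.hom y₂) (ha' := D.almostUnits _) hco'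
        (id_comp (g ≫ h ≫ a ≫ i.hom))).2 (R'.comp g)
      refine (R₂.eq_iff_id R₁).2 fun n hn => ?_
      rcases triv hA with rfl | _
      · exact ⟨rfl, (hu n).symm⟩
      · exact (hn (isUnit_of_subsingleton _)).elim
  rw [hci]
  refine key.trans ⟨fun ⟨hA, hu⟩ z hz => ?_, fun H => ⟨fun n => sub_eq_zero.1 ?_,
    fun n => sub_eq_zero.1 ?_⟩⟩
  · refine (sup_le (c := RingHom.ker (ringMap ((D.fibProj ξ).map d))) (Ideal.span_le.2 ?_)
      (Ideal.span_le.2 ?_)) hz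
    · rintro _ ⟨n, rfl⟩
      exact (map_sub (ringMap g) _ _).trans (sub_eq_zero.2 (hA n))
    · rintro _ ⟨n, rfl⟩
      exact (map_sub (ringMap g) _ _).trans (sub_eq_zero.2 (hu n))
  · exact (map_sub (ringMap g) _ _).symm.trans
      (H _ (Ideal.mem_sup_left (Ideal.subset_span ⟨n, rfl⟩)))
  · exact (map_sub (ringMap g) _ _).symm.trans
      (H _ (Ideal.mem_sup_right (Ideal.subset_span ⟨n, rfl⟩)))

end Coords

end Presentations


section PresentationSpaces

instance (n : ℕ) : IsZariskiLocalAtSource (@SmoothOfRelativeDimension.{0} n) :=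
  HasRingHomProperty.instIsZariskiLocalAtSource
    (Q := RingHom.Locally (RingHom.IsStandardSmoothOfRelativeDimension n))

variable {V : Sch} {S : Set ℕ} (D : Coords V S)

namespace Coords

theorem exists_represents (ξ : W) : ∃ (R : PSpace) (f : R ⟶ pts.obj (spec.obj (W.proj.obj ξ))),
    IsAlgebraicSpace R ∧ Nonempty (Represents _ (fibreMap D.functor ξ) R f) ∧
      HasAtlasWith (fun _ _ g => Smooth g ∧ (∀ n, S = {n} → SmoothOfRelativeDimension n g) ∧
        ((∀ c : ℕ, (∀ l, lengthLE l ξ → c ≤ l) → ∃ n ∈ S, c ≤ n) → Surjective g)) f := by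
  have hV := schemeProj_isStack V
  choose N hN hNl using W.exists_stdNbhd ξ
  let K : Type := Σ (x : PrimeSpectrum (W.proj.obj ξ).unop) (n : S),
    {s : ℕ → Option (N x).κ // Adm n.1 s}
  choose ζ π u h R smooth dim univ uniq using fun k : K => D.exists_chart (N k.1) k.2.1.2 k.2.2.2
  let C : Charts (D.fibProj ξ) (fibreMap D.functor ξ) K :=
    { U := fun k => (N k.1).U
      u := fun k => (N k.1).base
      et := fun k => (N k.1).et
      ζ := ζ
      zu := π
      comm := h
      uniq := fun {k w} g g' hgg => uniq k _ _ hgg (congrFun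
        (((isRep_map g (id_comp _)).2 (((R k).comp _).of_eq (comp_id _) rfl)).unit_eq
          ((isRep_map g' (id_comp _)).2
            (((R k).comp _).of_eq (comp_id _) hgg.symm))))
      opn := by
        intro k y t ht w d g hg p
        have R₁ : IsRep (D.hom y) (N k.1) ((D.fibProj ξ).map d) ((D.fibProj ξ).map d ≫ t) k.2.2.1 _ :=
          (isRep_map d (id_comp _)).1 ((isRep_map g (id_comp _)).2
            (((R k).comp _).of_eq (comp_id _) hg))
        obtain ⟨T, f, u', hf, ⟨x, hx⟩, R₂⟩ := IsRep.exists_nbhd ht R₁ p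
        obtain ⟨T', f', x', hf', hx', n, hn, hdim⟩ := D.exists_isDim y f x
        have hnk : k.2.1.1 = n := by
          obtain ⟨Z, c, c', z, -, hcc, -, -⟩ := IsEt.exists_square (hf'.comp hf)
            ((D.fibProj ξ).map d) p x' (hx.symm.trans (congrArg (ptMap f) hx').symm)
          have h1 := congrArg (ringMap c) ((cofib_map d 0).symm.trans ((cofib_map g 0).trans
            (congrArg (ringMap _) (dim k).1)))
          have h2 := congrArg (ringMap c') hdim.1
          have h3 : ringMap c (ringMap ((D.fibProj ξ).map d) (D.cofib y 0)) =
              ringMap c' (ringMap (f' ≫ f) (D.cofib y 0)) :=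
            congrArg (fun k => ringMap k (D.cofib y 0)) hcc
          refine eq_of_natCast_eq z ?_
          simpa using h1.symm.trans (h3.trans h2)
        obtain ⟨v, e, g', j, he, het, hp, hg'⟩ := D.exists_hom_of_rep hV (R k) (univ k)
          (hf'.comp hf) (R₂.comp f') (hnk ▸ hdim) ⟨x', (congrArg (ptMap f) hx').trans hx⟩
        refine ⟨v, e, g', het, hp, hg'.trans ?_⟩
        exact Eq.symm ((congrArg (· ≫ t) he).trans ((assoc _ _ _).trans
          (congrArg (j ≫ ·) (assoc _ _ _))))
      cov := by
        intro y p
        obtain ⟨z, hz⟩ := hN ((ptMap ((fibreMap D.functor ξ).app y)) p)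
        obtain ⟨T, a, b, t, ha, hab, hat, -⟩ := IsEt.exists_square (N _).et
          ((fibreMap D.functor ξ).app y) p z hz.symm
        obtain ⟨T₁, c, s, v, hc, ⟨o, ho⟩, H, hv⟩ := exists_isRep
          (toW.map (pullHom a (D.almostUnits _) ((D.almostUnits _).map _) fun _ => rfl) ≫ D.hom y) b
          (hab.symm.trans (base_pull _ _)) t
        have R₁ := (isRep_pull _ rfl).1 H
        obtain ⟨T₂, f, x, hf, hx, n, hn, hdim⟩ := D.exists_isDim y (c ≫ a) o
        have hu : ∀ i, s i ≠ none → ¬ IsUnit (ringMap (f ≫ c ≫ a) (D.cofib y i)) := fun i hi hu => by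
          refine x.2.ne_top (Ideal.eq_top_of_isUnit_mem _ ?_ hu)
          have h1 : ptMap (f ≫ c) x = t := (congrArg (ptMap c) hx).trans ho
          have h2 := hv i hi
          rw [← h1] at h2
          exact h2
        let k : K := ⟨_, ⟨n, hn⟩, s, R₁.choose.mono, fun i hi => by
          by_contra hlt
          refine hu i hi ?_
          have hlt : ¬ (1 ≤ i ∧ i ≤ n) := hlt
          rcases (by omega : i = 0 ∨ n < i) with rfl | h
          · exact (hdim.1.symm ▸ isUnit_natCast_succ n :)
          · rw [show ringMap (f ≫ c ≫ a) (D.cofib y i) = 1 from hdim.2 i h]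
            exact isUnit_one⟩
        obtain ⟨w, e, g, -, -, het, hp, -⟩ := D.exists_hom_of_rep hV (R k) (univ k)
          (hf.comp (hc.comp ha)) (R₁.comp f) hdim (p := p)
          ⟨x, (congrArg (fun z => ptMap a (ptMap c z)) hx).trans ((congrArg (ptMap a) ho).trans hat)⟩
        exact ⟨k, w, e, g, het, hp⟩ }
  let Q : MorphismProperty Scheme.{0} := fun _ _ g => Smooth g ∧
    (∀ n, S = {n} → SmoothOfRelativeDimension n g) ∧
      ((∀ c : ℕ, (∀ l, lengthLE l ξ → c ≤ l) → ∃ n ∈ S, c ≤ n) → Surjective g)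
  suffices hQ : Q (copDesc fun k => spec.map ((fibreMap D.functor ξ).app (C.ζ k))).left by
    obtain ⟨R, f, h1, h2, -, h3⟩ := exists_represents_of_eqClosed (D.fib_isStack hV) fib_faithful C
      (D.fib_eqClosed ξ) Q hQ
    exact ⟨R, f, h1, h2, h3⟩
  have hk : ∀ k, SmoothOfRelativeDimension k.2.1.1
      (spec.map ((fibreMap D.functor ξ).app (C.ζ k))).left := fun k => by
    have h1 := smooth k
    have h2 : Etale (spec.map (N k.1).base).left := (isEt_iff _).1 (N k.1).et
    have h3 := (Etale.iff_smoothOfRelativeDimension_zero _).1 h2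
    rw [← C.comm k, spec_map_comp_left]
    exact inferInstanceAs (SmoothOfRelativeDimension (k.2.1.1 + 0)
      ((spec.map (C.zu k)).left ≫ (spec.map (N k.1).base).left))
  refine ⟨copDesc_left_of_local _ _ fun k => ?_, fun n hn => copDesc_left_of_local _ _ fun k => ?_,
    fun hS => surjective_copDesc _ fun x => ?_⟩
  · exact @SmoothOfRelativeDimension.smooth k.2.1.1 _ _ _ (hk k)
  · have := hk k
    rwa [show k.2.1.1 = n from by simpa [hn] using k.2.1.2] at this
  · obtain ⟨n, hn, hle⟩ := hS (Nat.card (N x).κ) (hNl x)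
    have := Fintype.ofFinite (N x).κ
    rw [Nat.card_eq_fintype_card] at hle
    let o := Fintype.orderIsoFinOfCardEq (N x).κ rfl
    let s : ℕ → Option (N x).κ := fun i => if h : 1 ≤ i ∧ i - 1 < Fintype.card (N x).κ then
      some (o ⟨i - 1, h.2⟩) else none
    have hs : ∀ {i j}, s i = some j → ∃ h : 1 ≤ i ∧ i - 1 < Fintype.card (N x).κ,
        o ⟨i - 1, h.2⟩ = j := fun {i j} h => by
      by_cases h' : 1 ≤ i ∧ i - 1 < Fintype.card (N x).κ
      · simp only [s, dif_pos h', Option.some.injEq] at h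
        exact ⟨h', h⟩
      · rw [show s i = none from dif_neg h'] at h
        exact (Option.some_ne_none j h.symm).elim
    let k : K := ⟨x, ⟨n, hn⟩, s, fun {i i' j j'} h h' hlt => by
      obtain ⟨h1, rfl⟩ := hs h
      obtain ⟨h2, rfl⟩ := hs h'
      exact o.lt_iff_lt.2 (Fin.mk_lt_mk.2 (by omega)), fun i hi => by
      obtain ⟨j, hj⟩ := Option.ne_none_iff_exists'.1 hi
      obtain ⟨h, -⟩ := hs hj
      change 1 ≤ i ∧ i ≤ n
      omega⟩
    obtain ⟨z, hz⟩ := hN x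
    let v : ℕ → (N x).U.unop := fun i => if i = 0 then n + 1 else 1
    obtain ⟨g, hg, -⟩ := univ k (𝟙 _) (fun i => v i * (s i).elim 1 (N x).b) v
      { mono := k.2.2.2.1
        unit := fun i => by
          simp only [v]
          split_ifs
          exacts [isUnit_natCast_succ n, isUnit_one]
        eq := fun i => rfl
        off := fun j hj => by
          obtain ⟨i, rfl⟩ := o.surjective j
          exact (hj (i + 1) (dif_pos ⟨by omega, i.2⟩)).elim }
      ⟨by
        change v 0 * (s 0).elim 1 (N x).b = n + 1
        rw [show s 0 = none from dif_neg (by omega)]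
        simp [v], fun i hi => by
        have hi : n < i := hi
        change v i * (s i).elim 1 (N x).b = 1
        rw [show s i = none from dif_neg (by omega)]
        rw [show v i = 1 from if_neg (by omega)]
        exact mul_one _⟩
    refine ⟨k, ptMap g z, ?_⟩
    refine Eq.trans ?_ hz
    have h1 : g ≫ (fibreMap D.functor ξ).app (C.ζ k) = (N x).base := by
      rw [← C.comm k, ← assoc]
      exact (congrArg (· ≫ _) hg).trans (id_comp _)
    exact congrArg (fun f => ptMap f z) h1

end Coords

end PresentationSpaces


section Dimension

lemma card_le_ringKrullDim_away {σ : Type} [Finite σ] (f : MvPolynomial σ ℂ) (hf : f ≠ 0) :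
    (Nat.card σ : WithBot ℕ∞) ≤ ringKrullDim (Localization.Away f) := by
  have hdim : ringKrullDim (MvPolynomial σ ℂ) = Nat.card σ := by
    simp [*]
  have : FiniteRingKrullDim (MvPolynomial σ ℂ) := by
    rw [finiteRingKrullDim_iff_ne_bot_and_top, hdim]
    exact ⟨nofun, fun h => ENat.natCast_ne_top (Nat.card σ) (WithBot.coe_injective h)⟩
  obtain ⟨m, hm, hmd⟩ := Ideal.exists_isMaximal_height (R := MvPolynomial σ ℂ)
  obtain ⟨c, rfl⟩ := MvPolynomial.isMaximal_iff_eq_vanishingIdeal_singleton.1 hm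
  obtain ⟨d, hd⟩ : ∃ d, MvPolynomial.eval d f ≠ 0 := by
    by_contra! h
    exact hf (MvPolynomial.funext fun x => by rw [h x, map_zero])
  let τ (e : σ → ℂ) : MvPolynomial σ ℂ →ₐ[ℂ] MvPolynomial σ ℂ :=
    MvPolynomial.aeval fun i => MvPolynomial.X i + MvPolynomial.C (e i)
  have hτ : ∀ e, (τ e).comp (τ (-e)) = AlgHom.id ℂ _ := fun e => by
    ext i
    simp [τ]
  let E : MvPolynomial σ ℂ ≃ₐ[ℂ] MvPolynomial σ ℂ := AlgEquiv.ofAlgHom (τ (d - c)) (τ (-(d - c)))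
    (hτ _) (by simpa using hτ (-(d - c)))
  let P := MvPolynomial.vanishingIdeal ℂ {d}
  have hP : P = (MvPolynomial.vanishingIdeal ℂ {c}).comap E.toRingEquiv := by
    ext p
    rw [Ideal.mem_comap, MvPolynomial.mem_vanishingIdeal_singleton_iff,
      MvPolynomial.mem_vanishingIdeal_singleton_iff]
    have : (MvPolynomial.aeval c).comp (τ (d - c)) = (MvPolynomial.aeval d : _ →ₐ[ℂ] ℂ) := by
      ext i
      simp [τ]
    have := DFunLike.congr_fun this p
    exact this.symm ▸ Iff.rfl
  have hPh : (P.height : WithBot ℕ∞) = Nat.card σ := by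
    rw [hP, RingEquiv.height_comap, hmd, hdim]
  have hPp : P.IsPrime := inferInstance
  have hdisj : Disjoint (Submonoid.powers f : Set (MvPolynomial σ ℂ)) P :=
    (Ideal.disjoint_powers_iff_notMem _ hPp.isRadical).2 fun h =>
      hd ((MvPolynomial.mem_vanishingIdeal_singleton_iff d f).1 h)
  rw [← hPh, ← IsLocalization.height_map_of_disjoint (S := Localization.Away f) _ P hdisj]
  exact Ideal.height_le_ringKrullDim_of_ne_top
    (IsLocalization.isPrime_of_isPrime_disjoint _ _ P hPp hdisj).ne_top

lemma dimAt_of_openImmersion {X : Scheme.{0}} {σ : Type} [Finite σ]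
    (i : Spec (CommRingCat.of (MvPolynomial σ ℂ)) ⟶ X) [IsOpenImmersion i] (z) :
    dimAt X (i z) = Nat.card σ := by
  refine le_antisymm ?_ (le_iInf fun ⟨O, hO⟩ => ?_)
  · refine (iInf_le _ ⟨i.opensRange, z, rfl⟩).trans ?_
    refine (i.isOpenEmbedding.isEmbedding.toHomeomorph.symm.isInducing.topologicalKrullDim_le).trans ?_
    refine (PrimeSpectrum.topologicalKrullDim_eq_ringKrullDim (R := MvPolynomial σ ℂ)).le.trans ?_
    rw [MvPolynomial.ringKrullDim_of_isNoetherianRing, ringKrullDim_eq_zero_of_field, zero_add]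
  · obtain ⟨_, ⟨f, rfl⟩, hz, hf⟩ := PrimeSpectrum.isTopologicalBasis_basic_opens
      |>.exists_subset_of_mem_open (u := i ⁻¹' O) (a := z) hO (O.2.preimage i.continuous)
    have hf0 : f ≠ 0 := by
      rintro rfl
      exact hz (Ideal.zero_mem _)
    refine (card_le_ringKrullDim_away f hf0).trans ?_
    rw [← PrimeSpectrum.topologicalKrullDim_eq_ringKrullDim]
    have h1 : Topology.IsInducing (i ∘ PrimeSpectrum.comap (algebraMap _ (Localization.Away f))) :=
      i.isOpenEmbedding.isInducing.comp
        (PrimeSpectrum.localization_away_isOpenEmbedding (Localization.Away f) f).isInducing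
    exact (h1.codRestrict (s := (O : Set X)) fun x => hf (by
      change _ ∈ (↑(PrimeSpectrum.basicOpen f) : Set (PrimeSpectrum (MvPolynomial σ ℂ)))
      rw [← PrimeSpectrum.localization_away_comap_range (Localization.Away f) f]
      exact ⟨x, rfl⟩)).topologicalKrullDim_le

end Dimension

section AffineSpaces

/-- The point `Spec ℂ`. -/
def point : Aff := op (CommAlgCat.of (CommRingCat.of ℂ) (CommRingCat.of ℂ))

lemma point_hom_ext {T : Aff} (f g : T ⟶ point) : f = g :=
  Quiver.Hom.unop_inj (CommAlgCat.hom_ext (AlgHom.ext fun c =>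
    (f.unop.hom.commutes c).trans (g.unop.hom.commutes c).symm))

def toPoint (T : Aff) : T ⟶ point := (CommAlgCat.ofHom (Algebra.ofId (CommRingCat.of ℂ) T.unop)).op

/-- The affine space of dimension `n`. -/
def affN (n : ℕ) : Aff := affineSpace point (Fin n)

/-- The coordinates on the affine space. -/
def affCoord (n i : ℕ) : (affN n).unop :=
  if i = 0 then n + 1 else if h : i - 1 < n then affineCoord point (Fin n) ⟨i - 1, h⟩ else 1

/-- The disjoint union of the affine spaces of dimensions `n ∈ S`. -/
def affUnion (S : Set ℕ) : Sch := cop fun n : S => spec.obj (affN n)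

variable {S : Set ℕ} {T : Aff}

/-- The inclusion of an affine space. -/
def affIncl (n : S) : spec.obj (affN n) ⟶ affUnion S :=
  copι (fun n : S => spec.obj (affN n)) n

/-- The coordinates of a point. -/
def affCo (t : spec.obj T ⟶ affUnion S) (i : ℕ) : T.unop :=
  ringMap (spec.preimage (t ≫ copDesc fun n : S => spec.map (toLine (affCoord n i)))) coord

lemma affCo_comp {T' : Aff} (h : T' ⟶ T) (t : spec.obj T ⟶ affUnion S) (i : ℕ) :
    affCo (spec.map h ≫ t) i = ringMap h (affCo t i) := by
  have : spec.preimage ((spec.map h ≫ t) ≫ copDesc fun n : S => spec.map (toLine (affCoord n i))) =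
      h ≫ spec.preimage (t ≫ copDesc fun n : S => spec.map (toLine (affCoord n i))) :=
    spec.map_injective ((spec.map_preimage _).trans ((assoc _ _ _).trans
      (((spec.map h) ≫= (spec.map_preimage _).symm).trans (spec.map_comp _ _).symm)))
  exact congrArg (fun k => ringMap k coord) this

lemma affCo_incl (n : S) (g : T ⟶ affN n) (i : ℕ) :
    affCo (spec.map g ≫ affIncl n) i = ringMap g (affCoord n i) := by
  have : spec.preimage ((spec.map g ≫ affIncl n) ≫
      copDesc fun n : S => spec.map (toLine (affCoord n i))) = g ≫ toLine (affCoord n i) :=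
    spec.map_injective ((spec.map_preimage _).trans ((assoc _ _ _).trans
      (((spec.map g) ≫= (copι_desc _ n)).trans (spec.map_comp _ _).symm)))
  exact (congrArg (fun k => ringMap k coord) this).trans
    (congrArg (ringMap g) (ringMap_toLine (affCoord n i)))

lemma affCoord_zero (n : ℕ) : affCoord n 0 = n + 1 := if_pos rfl

lemma affCoord_succ {n i : ℕ} (h : i < n) : affCoord n (i + 1) = affineCoord point (Fin n) ⟨i, h⟩ :=
  (if_neg i.succ_ne_zero).trans (dif_pos h)

lemma affCoord_of_lt {n i : ℕ} (h : n < i) : affCoord n i = 1 :=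
  (if_neg (by omega)).trans (dif_neg (by omega))

lemma isDim_affCoord (n : ℕ) (g : T ⟶ affN n) : Coords.IsDim n fun i => ringMap g (affCoord n i) :=
  ⟨(congrArg (ringMap g) (affCoord_zero n)).trans (by simp), fun i hi =>
    (congrArg (ringMap g) (affCoord_of_lt hi)).trans (map_one _)⟩

lemma exists_local_affUnion (t : spec.obj T ⟶ affUnion S) (p : PrimeSpectrum T.unop) :
    ∃ (T' : Aff) (f : T' ⟶ T) (n : S) (g : T' ⟶ affN n), IsEt f ∧ p ∈ Set.range (ptMap f) ∧
      spec.map g ≫ affIncl n = spec.map f ≫ t := by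
  obtain ⟨T', f, n, l, hf, hp, h⟩ := exists_local_cop t p
  exact ⟨T', f, n, spec.preimage l, hf, hp, (congrArg (· ≫ affIncl n) (spec.map_preimage l)).trans h⟩

lemma affCo_ext {t t' : spec.obj T ⟶ affUnion S} (h : ∀ i, affCo t i = affCo t' i) : t = t' := by
  refine scheme_hom_ext fun x => ?_
  obtain ⟨T₁, f₁, n, g, hf₁, ⟨x₁, rfl⟩, e⟩ := exists_local_affUnion t x
  obtain ⟨T₂, f₂, m, g', hf₂, ⟨x₂, rfl⟩, e'⟩ := exists_local_affUnion (spec.map f₁ ≫ t') x₁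
  have h1 : ∀ i, ringMap (f₂ ≫ g) (affCoord n i) = ringMap g' (affCoord m i) := fun i => by
    rw [← affCo_incl, ← affCo_incl, e', spec.map_comp, assoc, e, affCo_comp, affCo_comp,
      affCo_comp, affCo_comp, h]
  obtain rfl : n = m := Subtype.ext (eq_of_natCast_eq x₂
    ((isDim_affCoord _ _).1.symm.trans ((h1 0).trans (isDim_affCoord _ _).1)))
  have h2 : f₂ ≫ g = g' := affine_hom_ext (point_hom_ext _ _) fun i => by
    have := h1 (i + 1)
    rwa [affCoord_succ i.2] at this
  refine ⟨T₂, f₂ ≫ f₁, hf₂.comp hf₁, ⟨x₂, rfl⟩, ?_⟩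
  grind

/-- A coordinate system on a scheme `V` over a union of affine spaces. -/
def coordsOver {V : Sch} (j : V ⟶ affUnion S) [Mono j] (S' : Set ℕ)
    (loc : ∀ {T : Aff} (t : spec.obj T ⟶ V) (p : PrimeSpectrum T.unop), ∃ (T' : Aff) (f : T' ⟶ T)
      (n : S) (g : T' ⟶ affN n), IsEt f ∧ p ∈ Set.range (ptMap f) ∧ n.1 ∈ S' ∧
      spec.map g ≫ affIncl n = (spec.map f ≫ t) ≫ j)
    (lift : ∀ {T : Aff}, ∀ n ∈ S', ∃ h : n ∈ S, ∀ g : T ⟶ affN n, ∃ t, t ≫ j =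
      spec.map g ≫ affIncl ⟨n, h⟩)
    (co : ∀ {T : Aff}, (spec.obj T ⟶ V) → ℕ → T.unop) (hco : @co = fun _ t => affCo (t ≫ j)) :
    Coords V S' where
  co := co
  co_comp h t i := by
    subst hco
    exact (congrArg (affCo · i) (assoc _ _ _)).trans (affCo_comp h (t ≫ j) i)
  ext t t' h := by
    subst hco
    exact (cancel_mono j).1 (affCo_ext h)
  loc t p := by
    subst hco
    obtain ⟨T', f, n, g, hf, hp, hn, e⟩ := loc t p
    have h1 : ∀ i, affCo ((spec.map f ≫ t) ≫ j) i = ringMap g (affCoord n i) := fun i => by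
      rw [← e, affCo_incl]
    exact ⟨T', f, hf, hp, n, hn, (h1 0).trans (isDim_affCoord n.1 g).1,
      fun i hi => (h1 i).trans ((isDim_affCoord n.1 g).2 i hi)⟩
  exists_of a n hn h0 h1 := by
    subst hco
    obtain ⟨hnS, hl⟩ := lift n hn
    obtain ⟨g, -, hg⟩ := exists_affine_lift (toPoint _) fun i : Fin n => a (i + 1)
    obtain ⟨t, ht⟩ := hl g
    refine ⟨t, fun i => ?_⟩
    refine (congrArg (affCo · i) ht).trans ((affCo_incl ⟨n, hnS⟩ g i).trans ?_)
    by_cases hi : n < i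
    · exact ((isDim_affCoord n g).2 i hi).trans (h1 i hi).symm
    · rcases i with _ | i
      · exact (isDim_affCoord n g).1.trans h0.symm
      · have := hg ⟨i, by omega⟩
        rwa [affCoord_succ (show i < n by omega)]

/-- The coordinates on a union of affine spaces. -/
def affCoords (S : Set ℕ) : Coords (affUnion S) S :=
  coordsOver (𝟙 _) S (fun t p => by
    obtain ⟨T', f, n, g, hf, hp, e⟩ := exists_local_affUnion t p
    exact ⟨T', f, n, g, hf, hp, n.2, e.trans (comp_id _).symm⟩)
    (fun n hn => ⟨hn, fun g => ⟨_, comp_id _⟩⟩) affCo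
    (by funext T t; exact congrArg affCo (comp_id t).symm)

/-- The coordinates on an open subscheme isomorphic to an affine space. -/
def affCoordsOpen (n : S) {V : Sch} (j : V ⟶ affUnion S) [Mono j] (k : spec.obj (affN n) ≅ V)
    (h : k.hom ≫ j = affIncl n) : Coords V {n.1} :=
  coordsOver j {n.1} (fun {T} t p => ⟨T, 𝟙 T, n, spec.preimage (t ≫ k.inv), RingHom.Etale.containsIdentities _, ⟨p, rfl⟩, rfl,
    ((spec.map_preimage _) =≫ (affIncl n)).trans (by simp [← h])⟩)
    (fun m hm => by
      obtain rfl : m = n.1 := hm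
      exact ⟨n.2, fun g => ⟨spec.map g ≫ k.hom, (assoc _ _ _).trans
        ((spec.map g) ≫= h)⟩⟩)
    (fun t => affCo (t ≫ j)) rfl

lemma Coords.length_le {V : Sch} {l : ℕ} (D : Coords V {l}) (t : spec.obj T ⟶ V) :
    (std T (D.co t) (D.almostUnits t)).length ≤ l := by
  have H : ∀ i, ¬ IsUnit (D.co t i) → i - 1 < l ∧ 0 < i := fun i hi => by
    obtain ⟨m, hm, hi⟩ := exists_max_ideal_of_mem_nonunits hi
    obtain ⟨T', f, -, ⟨x, hx⟩, n, hn, h0, h1⟩ := D.loc t ⟨m, hm.isPrime⟩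
    obtain rfl : n = l := hn
    have h2 : ¬ IsUnit (D.co (spec.map f ≫ t) i) := fun hu => x.2.ne_top
      (Ideal.eq_top_of_isUnit_mem _ (by
        have h3 : D.co t i ∈ (ptMap f x).asIdeal := hx ▸ hi
        exact (D.co_comp f t i).symm ▸ h3) hu)
    refine ⟨?_, Nat.pos_of_ne_zero fun h => h2 (h ▸ h0 ▸ isUnit_natCast_succ _)⟩
    by_contra! h
    have : 0 < i := Nat.pos_of_ne_zero fun h => h2 (h ▸ h0 ▸ isUnit_natCast_succ _)
    grind
  refine (Nat.card_le_card_of_injective (fun i => (⟨i.1 - 1, (H i.1 ?_).1⟩ : Fin l))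
    fun i j e => Subtype.ext ?_).trans (by simp)
  · exact (LineSec.nonInvertible_triv _).1 i.2
  · have h1 := (H i.1 ((LineSec.nonInvertible_triv _).1 i.2)).2
    have h2 := (H j.1 ((LineSec.nonInvertible_triv _).1 j.2)).2
    grind

end AffineSpaces


section Algebraicity

lemma HasAtlasWith.mono {Q Q' : MorphismProperty Scheme.{0}} {X : PSpace} {S : Sch}
    {f : X ⟶ pts.obj S} (h : HasAtlasWith Q f) (hQ : ∀ ⦃A B⦄ (g : A ⟶ B), Q g → Q' g) :
    HasAtlasWith Q' f :=
  let ⟨Z, π, g, h1, h2, h3⟩ := h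
  ⟨Z, π, g, h1, h2, hQ _ h3⟩

lemma Coords.representableWith {V : Sch} {S : Set ℕ} (D : Coords V S) {Y : Type*} [Category Y]
    (Φ : Y ⥤ W) [Φ.Full] [Φ.Faithful] (G : Mor (schemeProj V) (Φ ⋙ W.proj))
    (hG : G.functor ⋙ Φ = D.functor) (P : MorphismProperty Scheme.{0})
    (hP : ∀ ξ : Y, ∀ ⦃A B⦄ (g : A ⟶ B), (Smooth g ∧ (∀ n, S = {n} → SmoothOfRelativeDimension n g) ∧
      ((∀ c : ℕ, (∀ l, lengthLE l (Φ.obj ξ) → c ≤ l) → ∃ n ∈ S, c ≤ n) → Surjective g)) → P g) :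
    G.RepresentableWith fun _ _ f => HasAtlasWith P f :=
  Mor.representableWith_of_full Φ G (hG ▸ fun ξ =>
    let ⟨R, f, h1, h2, h3⟩ := D.exists_represents (Φ.obj ξ)
    ⟨R, f, h1, h2, h3.mono (hP ξ)⟩)

lemma affUnion_hom (S : Set ℕ) : (copDesc fun n : S => spec.map (affineHom point (Fin n))).left ≫
    (spec.obj point).hom = (affUnion S).hom := Over.w _

lemma affUnion_smooth (S : Set ℕ) : Smooth (affUnion S).hom := by
  have : Smooth (copDesc fun n : S => spec.map (affineHom point (Fin n))).left :=
    copDesc_left_of_local _ _ fun n => (smooth_affineHom point (Fin n)).smooth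
  have h : Smooth (Spec.map (𝟙 (CommRingCat.of ℂ))) := inferInstance
  exact affUnion_hom S ▸ MorphismProperty.comp_mem @Smooth.{0} _ _ this h

lemma affUnion_quasiCompact {S : Set ℕ} (hS : S.Finite) : QuasiCompact (affUnion S).hom := by
  have := hS.to_subtype
  have : QuasiCompact (copDesc fun n : S => spec.map (affineHom point (Fin n))).left :=
    quasiCompact_copDesc _
  have h : QuasiCompact (Spec.map (𝟙 (CommRingCat.of ℂ))) := inferInstance
  exact affUnion_hom S ▸ MorphismProperty.comp_mem @QuasiCompact.{0} _ _ this h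

theorem algebraicity {Y : Type 1} [Category.{1} Y] (Φ : Y ⥤ W) [Φ.Full] [Φ.Faithful]
    (hst : IsStack etale (Φ ⋙ W.proj)) {S : Set ℕ} (hS : S.Nonempty)
    (hΦ : ∀ ξ : Y, ∀ c : ℕ, (∀ l, lengthLE l (Φ.obj ξ) → c ≤ l) → ∃ n ∈ S, c ≤ n)
    (G : Mor (schemeProj (affUnion S)) (Φ ⋙ W.proj)) (hG : G.functor ⋙ Φ = (affCoords S).functor) :
    IsAlgebraicStack (Φ ⋙ W.proj) ∧ IsSmoothStack (Φ ⋙ W.proj) ∧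
      (S.Finite → IsFiniteTypeStack (Φ ⋙ W.proj)) ∧ HasDimension (Φ ⋙ W.proj) 0 := by
  have hp : IsPresentation G := (affCoords S).representableWith Φ G hG smoothSurjective
    fun ξ _ _ _ h => ⟨h.1, h.2.2 (hΦ ξ)⟩
  have hs := affUnion_smooth S
  have hft : LocallyOfFiniteType (affUnion S).hom := inferInstance
  refine ⟨⟨hst, fun ξ η e => exists_isom_space hst ξ η e, _, G, hp⟩, ⟨_, G, hp, hs⟩,
    fun hf => ⟨_, G, hp, hft, affUnion_quasiCompact hf⟩, _, G, hp, hft, ?_, fun v => ?_⟩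
  · obtain ⟨n, hn⟩ := hS
    have : Nonempty (spec.obj (affN n)).left :=
      inferInstanceAs (Nonempty (PrimeSpectrum (MvPolynomial (Fin n) ℂ)))
    exact this.map (affIncl (⟨n, hn⟩ : S)).left
  · obtain ⟨n, z, rfl⟩ := cop_cover v
    have hi : IsOpenImmersion (affIncl n).left :=
      inferInstanceAs (IsOpenImmersion (copι (fun n : S => spec.obj (affN n)) n).left)
    let O := (affIncl n).left.opensRange
    let k : spec.obj (affN n) ≅ openSub (affUnion S) O := Over.isoMk (affIncl n).left.isoOpensRange 
      ((assoc _ _ _).symm.trans (((affIncl n).left.isoOpensRange_hom_ι =≫ ((affUnion S).hom)).trans (Over.w (affIncl n))))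
    have hk : k.hom ≫ openIncl _ O = affIncl n := by
      ext1
      exact (affIncl n).left.isoOpensRange_hom_ι
    have : Mono (openIncl (affUnion S) O) := Over.mono_of_mono_left _
    refine ⟨O, n, n, ⟨z, rfl⟩, ?_, (affCoordsOpen n (openIncl _ O) k hk).representableWith Φ _ ?_ _
      fun ξ _ _ g h => h.2.1 n rfl, sub_self _⟩
    · have := @dimAt_of_openImmersion _ (Fin n) _ (affIncl n).left hi z
      rw [Nat.card_fin] at this
      exact this
    · exact congrArg (CostructuredArrow.map (openIncl (affUnion S) O) ⋙ ·) hG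

theorem W.algebraicity : IsAlgebraicStack W.proj ∧ IsSmoothStack W.proj ∧ HasDimension W.proj 0 :=
  have h := ModStack.algebraicity (𝟭 W) W.isStack (S := Set.univ) ⟨0, trivial⟩
    (fun ξ c h => ⟨c, trivial, le_rfl⟩) ⟨(affCoords _).functor, Iso.refl _⟩ rfl
  ⟨h.1, h.2.1, h.2.2.2⟩

theorem Wl.algebraicity (l : ℕ) : IsAlgebraicStack (Wl.proj l) ∧ IsSmoothStack (Wl.proj l) ∧
    IsFiniteTypeStack (Wl.proj l) ∧ HasDimension (Wl.proj l) 0 :=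
  have h := ModStack.algebraicity (lengthLE l).ι (Wl.isStack l) (S := {l}) ⟨l, rfl⟩
    (fun ξ c h => ⟨l, rfl, h l ξ.2⟩) ⟨(lengthLE l).lift (affCoords {l}).functor
      fun t _ => (affCoords {l}).length_le t.hom, Iso.refl _⟩ rfl
  ⟨h.1, h.2.1, h.2.2.1 (Set.finite_singleton l), h.2.2.2⟩

end Algebraicity


section Tuples

variable {l : ℕ} {T T' U V : Aff} {ξ : W} {N : StdNbhd ξ}

/-- The functor from tuples to `W`. -/
abbrev powToW (l : ℕ) : A1GmPow l ⥤ W := keepNonInvertible l ⋙ toW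

/-- A tuple of trivial line bundles. -/
def trivPow (T : Aff) (a : Fin l → T.unop) : A1GmPow l := ⟨T, fun i => LineSec.triv (a i)⟩

/-- A morphism between tuples of trivial line bundles. -/
def powHom (c : T' ⟶ T) {a : Fin l → T'.unop} {b : Fin l → T.unop} {u : Fin l → T'.unop}
    (hu : ∀ i, IsUnit (u i)) (e : ∀ i, u i * ringMap c (b i) = a i) : trivPow T' a ⟶ trivPow T b :=
  ⟨c, fun i => (AddMonoidHom.mulLeft (u i)).comp (ringMap c).toAddMonoidHom,
    fun i => LineSec.isPullbackMap_triv (hu i) (e i)⟩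

lemma matching_some (c : T' ⟶ T) {a : Fin l → T'.unop} {b : Fin l → T.unop} {u : Fin l → T'.unop}
    (hu : ∀ i, IsUnit (u i)) (e : ∀ i, u i * ringMap c (b i) = a i) :
    Matching some a (fun i => ringMap c (b i)) u where
  mono h h' hlt := by
    cases h; cases h'; exact hlt
  unit := hu
  eq i := (e i).symm
  off j hj := (hj j rfl).elim

lemma A1GmPow.exists_triv (X : A1GmPow l) (x : PrimeSpectrum X.base.unop) :
    ∃ (U : Aff) (b : Fin l → U.unop) (e : trivPow U b ⟶ X), IsEt (A1GmPow.Hom.base e) ∧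
      x ∈ Set.range (ptMap (A1GmPow.Hom.base e)) := by
  choose φ l hφ using fun i => (X.pair i).exists_dual_notMem x
  let g : X.base.unop := ∏ i, φ i (l i)
  have hg : ∀ i, IsUnit (ringMap (awayHom g) (φ i (l i))) := fun i => by
    have h := isUnit_awayHom g
    simp only [g, map_prod] at h
    exact isUnit_of_dvd_unit (Finset.dvd_prod_of_mem
      (fun i => ringMap (awayHom (∏ i, φ i (l i))) (φ i (l i))) (Finset.mem_univ i)) h
  refine ⟨away g, fun i => ringMap (awayHom g) (φ i (X.pair i).sec),
    ⟨awayHom g, fun i => _, fun i => LineSec.isPullbackMap_dual (X.pair i) (φ i) (l i) (hg i)⟩,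
    awayHom_isEt g, ?_⟩
  change x ∈ Set.range (ptMap (awayHom g))
  rw [range_awayHom]
  change ∏ i, φ i (l i) ∉ x.asIdeal
  rw [x.2.prod_mem_iff]
  exact fun ⟨i, _, h⟩ => hφ i h

/-- The sections of a standard neighbourhood picked by `s`. -/
def pick (k : T ⟶ N.U) (s : Fin l → Option N.κ) (i : Fin l) : T.unop :=
  (s i).elim 1 fun j => ringMap k (N.b j)

lemma ringMap_pick (c : T' ⟶ T) (k : T ⟶ N.U) (s : Fin l → Option N.κ) (i : Fin l) :
    ringMap c (pick k s i) = pick (c ≫ k) s i := by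
  unfold pick
  cases s i
  exacts [map_one _, rfl]

/-- `s` picks all the sections which are not invertible, in order. -/
abbrev Picks (k : T ⟶ N.U) (s : Fin l → Option N.κ) : Prop :=
  Matching s (pick k s) (fun j => ringMap k (N.b j)) fun _ => 1

lemma Picks.comp {k : T ⟶ N.U} {s : Fin l → Option N.κ} (M : Picks k s) {k' : T' ⟶ N.U} (c : T' ⟶ T)
    (h : c ≫ k = k') : Picks k' s where
  mono := M.mono
  unit _ := isUnit_one
  eq _ := (one_mul _).symm
  off j hj := h ▸ (M.off j hj).map (ringMap c)

/-- The tuple picked by `s`. -/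
def pickObj (k : T ⟶ N.U) {s : Fin l → Option N.κ} (M : Picks k s) : CostructuredArrow (powToW l) ξ :=
  CostructuredArrow.mk (Y := trivPow T (pick k s))
    (toW.map (matchHom (ha := .of_finite _) (hb := .of_finite _) k M) ≫ N.e)

/-- The projection of the fibre product. -/
abbrev powProj (l : ℕ) (ξ : W) : CostructuredArrow (powToW l) ξ ⥤ Aff :=
  CostructuredArrow.proj (powToW l) ξ ⋙ powToW l ⋙ W.proj

lemma pickObj_base (k : T ⟶ N.U) {s : Fin l → Option N.κ} (M : Picks k s) :
    (fibreMap (powToW l) ξ).app (pickObj k M) = k ≫ N.base := W.proj.map_comp _ _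

lemma exists_pickHom {c : T' ⟶ T} {k : T ⟶ N.U} {k' : T' ⟶ N.U} (hk : c ≫ k = k')
    {s s' : Fin l → Option N.κ} (M : Picks k s) (M' : Picks k' s')
    (h : ∀ i, s i ≠ s' i → IsUnit (pick k' s i) ∧ IsUnit (pick k' s' i)) :
    ∃ g : pickObj k' M' ⟶ pickObj k M, (powProj l ξ).map g = c := by
  classical
  have H : ∀ i, ∃ v, IsUnit v ∧ v * pick k' s i = pick k' s' i ∧ (s i = s' i → v = 1) := fun i => by
    by_cases hi : s i = s' i
    · exact ⟨1, isUnit_one, by rw [pick, pick, hi, one_mul], fun _ => rfl⟩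
    · obtain ⟨⟨v, hv⟩, hv'⟩ := h i hi
      exact ⟨pick k' s' i * ↑v⁻¹, hv'.mul (Units.isUnit _), by rw [← hv]; simp, fun h => (hi h).elim⟩
  choose v hv e hv1 using H
  have e' : ∀ i, v i * ringMap c (pick k s i) = pick k' s' i := fun i => by
    rw [ringMap_pick, hk, e]
  refine ⟨CostructuredArrow.homMk (powHom c hv e') ?_, rfl⟩
  change toW.map (matchHom (ha := .of_finite _) (hb := .of_finite _) c (matching_some c hv e')) ≫
    toW.map (matchHom (hb := .of_finite _) k M) ≫ N.e = toW.map (matchHom k' M') ≫ N.e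
  have M'' : Matching s (pick k' s') (fun j => ringMap (c ≫ k) (N.b j)) v :=
    { mono := M.mono
      unit := hv
      eq := fun i => by rw [← e, ← hk]; rfl
      off := (M.comp c rfl).off }
  rw [← assoc, ← toW.map_comp, matchHom_comp c k _ M M'' (fun i j h => by cases h; rfl)
    (fun i j h => by cases h; simp)]
  subst hk
  congr 2
  refine (matchHom_eq_iff _ _ _).2 fun i hi => ?_
  by_contra hc
  by_cases his : s i = s' i
  · exact hc ⟨his, hv1 i his⟩
  · exact hi (h i his).2

lemma isUnit_pick_of_ne {w : CostructuredArrow (powToW l) ξ} {k : T ⟶ N.U} {k' : T' ⟶ N.U}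
    {s s' : Fin l → Option N.κ} {M : Picks k s} {M' : Picks k' s'} (g : w ⟶ pickObj k M)
    (g' : w ⟶ pickObj k' M') {k₀ : (powProj l ξ).obj w ⟶ N.U} (h : (powProj l ξ).map g ≫ k = k₀)
    (h' : (powProj l ξ).map g' ≫ k' = k₀) (i : Fin l) (hi : s i ≠ s' i) :
    IsUnit (pick k₀ s i) ∧ IsUnit (pick k₀ s' i) := by
  have key : (keepNonInvertible l).map g.left ≫ matchHom (ha := .of_finite _) (hb := .of_finite N.b) k M =
      (keepNonInvertible l).map g'.left ≫ matchHom (ha := .of_finite _) k' M' := by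
    refine toW_injective (W.isStack.fibred.cancel N.e (h.trans h'.symm) ?_)
    refine (((toW.map_comp _ _) =≫ N.e).trans (assoc _ _ _)).trans
      (Eq.trans ?_ (((toW.map_comp _ _) =≫ N.e).trans (assoc _ _ _)).symm)
    exact (CostructuredArrow.w g).trans (CostructuredArrow.w g').symm
  have hn : ¬ (w.left.pair i).NonInvertible := fun hn => by
    let i₀ : ((keepNonInvertible l).obj w.left).ι := ⟨i, hn⟩
    have := congrArg (fun m => Sigma.fst (WPP.Hom.map m i₀)) key
    have h1 : s i = some _ := (Option.some_get (M.ne_none (ha := .of_finite _)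
      (WPP.Hom.map ((keepNonInvertible l).map g.left) i₀).1)).symm
    have h2 : s' i = some _ := (Option.some_get (M'.ne_none (ha := .of_finite _)
      (WPP.Hom.map ((keepNonInvertible l).map g'.left) i₀).1)).symm
    exact hi (h1.trans ((congrArg (fun z => some z.1) this).trans h2.symm))
  have aux : ∀ {T : Aff} {k : T ⟶ N.U} {s : Fin l → Option N.κ} {M : Picks k s} (g : w ⟶ pickObj k M),
      IsUnit (ringMap ((powProj l ξ).map g) (pick k s i)) := fun {T k s M} g => by
    by_contra hu
    obtain ⟨m, hm, hmem⟩ := exists_max_ideal_of_mem_nonunits hu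
    exact hn ⟨⟨m, hm.isPrime⟩, ((A1GmPow.Hom.isPullback g.left i).vanishesAt_iff _).2
      ((LineSec.vanishesAt_triv _ _).2 hmem)⟩
  exact ⟨Eq.mp (congrArg IsUnit ((ringMap_pick (T := T) ((powProj l ξ).map g) k s i).trans
      (congrArg (pick · s i) h))) (aux g),
    Eq.mp (congrArg IsUnit ((ringMap_pick (T := T') ((powProj l ξ).map g') k' s' i).trans
      (congrArg (pick · s' i) h'))) (aux g')⟩

lemma exists_local_pick (y : CostructuredArrow (powToW l) ξ) {a : T ⟶ (powProj l ξ).obj y}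
    {t : T ⟶ N.U} (ht : a ≫ (fibreMap (powToW l) ξ).app y = t ≫ N.base) (q : PrimeSpectrum T.unop) :
    ∃ (T' : Aff) (f : T' ⟶ T) (s : Fin l → Option N.κ) (M : Picks (f ≫ t) s)
      (e : pickObj (f ≫ t) M ⟶ y), (powProj l ξ).map e = f ≫ a ∧ IsEt f ∧ q ∈ Set.range (ptMap f) ∧
      ∀ i j, s i = some j → N.b j ∈ (ptMap t q).asIdeal := by
  obtain ⟨U, b, e₀, he, ⟨x, hx⟩⟩ := y.left.exists_triv (ptMap a q)
  obtain ⟨T₁, c, d, o, hc, hcd, rfl, rfl⟩ := he.exists_square a q x hx.symm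
  let m : toW.obj (std T₁ (fun i => ringMap d (b i)) (.of_finite _)) ⟶ ξ :=
    toW.map (stdMap d b (.of_finite _)) ≫ toW.map ((keepNonInvertible l).map e₀) ≫ y.hom
  have e1 : A1GmPow.Hom.base e₀ ≫ (fibreMap (powToW l) ξ).app y =
      W.proj.map (toW.map ((keepNonInvertible l).map e₀) ≫ y.hom) :=
    (W.proj.map_comp (toW.map ((keepNonInvertible l).map e₀)) y.hom).symm
  have e2 : d ≫ W.proj.map (toW.map ((keepNonInvertible l).map e₀) ≫ y.hom) = W.proj.map m :=
    (W.proj.map_comp (toW.map (stdMap d b (.of_finite _))) _).symm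
  have hm : (c ≫ t) ≫ N.base = W.proj.map m :=
    (assoc c t N.base).trans ((congrArg (c ≫ ·) ht.symm).trans
      ((assoc _ _ _).symm.trans ((congrArg (· ≫ _) hcd).trans ((assoc _ _ _).trans
        ((congrArg (d ≫ ·) e1).trans e2)))))
  obtain ⟨T₂, h, s, u, hh, ⟨o', rfl⟩, H, hmin⟩ := exists_isRep m (c ≫ t) hm o
  obtain ⟨M, R⟩ := H.of_eq rfl (assoc _ _ _).symm
  have M' : Picks ((h ≫ c) ≫ t) s := ⟨M.mono, fun _ => isUnit_one, fun _ => (one_mul _).symm, M.off⟩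
  choose v hv using fun i => (M.unit i).exists_left_inv
  have hvu : ∀ i, IsUnit (v i) := fun i => .of_mul_eq_one _ (hv i)
  have hvb : ∀ i, v i * ringMap (h ≫ d) (b i) = pick ((h ≫ c) ≫ t) s i := fun i =>
    (congrArg (v i * ·) (M.eq i)).trans ((mul_assoc _ _ _).symm.trans
      ((congrArg (· * _) (hv i)).trans (one_mul _)))
  refine ⟨T₂, h ≫ c, s, M', CostructuredArrow.homMk (powHom (h ≫ d) hvu hvb ≫ e₀) ?_, ?_, hh.comp hc,
    ⟨o', rfl⟩, ?_⟩
  · have Mv : Matching some (pick ((h ≫ c) ≫ t) s)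
        (fun i => ringMap (𝟙 T₂) (ringMap h (ringMap d (b i)))) v := matching_some (𝟙 T₂) hvu hvb
    have h1 : matchHom (ha := .of_finite _) (hb := .of_finite b) (h ≫ d) (matching_some (h ≫ d) hvu hvb) =
        matchHom (ha := .of_finite _) (𝟙 T₂) Mv ≫
          stdMap h _ (.of_finite _) ≫ stdMap d b (.of_finite _) := by
      refine Eq.trans ?_ (congrArg (matchHom (ha := .of_finite _) (𝟙 T₂) Mv ≫ ·)
        (stdMap_comp_stdMap h d)).symm
      refine Eq.trans ?_ (matchHom_comp (𝟙 T₂) (h ≫ d) Mv Matching.refl (matching_some (h ≫ d) hvu hvb)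
        (fun i j h => h) fun i j h => by simp).symm
      rfl
    have h2 : matchHom (ha := .of_finite _) (hb := .of_finite N.b) ((h ≫ c) ≫ t) M' =
        matchHom (ha := .of_finite _) (hb := .of_finite _) (𝟙 T₂) Mv ≫ matchHom ((h ≫ c) ≫ t) M := by
      refine Eq.trans ?_ (matchHom_comp (𝟙 T₂) ((h ≫ c) ≫ t) Mv M M'
        (fun i j h => by cases h; rfl) fun i j e => by cases e; exact (hv i).symm).symm
      rfl
    have h3 : (powToW l).map (powHom (h ≫ d) hvu hvb ≫ e₀) =
        (toW.map (matchHom (ha := .of_finite _) (𝟙 T₂) Mv) ≫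
          toW.map (stdMap h _ (.of_finite _)) ≫ toW.map (stdMap d b (.of_finite _))) ≫
            (powToW l).map e₀ :=
      ((powToW l).map_comp _ _).trans (congrArg (· ≫ (powToW l).map e₀)
        ((congrArg toW.map h1).trans ((toW.map_comp _ _).trans (congrArg (_ ≫ ·) (toW.map_comp _ _)))))
    refine (congrArg (· ≫ y.hom) h3).trans ?_
    refine Eq.trans ?_ ((congrArg (· ≫ N.e) ((congrArg toW.map h2).trans (toW.map_comp _ _))).trans
      (assoc _ _ _)).symm
    exact (assoc _ _ _).trans ((assoc _ _ _).trans
      (congrArg (toW.map (matchHom (𝟙 T₂) Mv) ≫ ·) ((assoc _ _ _).trans R)))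
  · exact (assoc h d _).trans ((congrArg (h ≫ ·) hcd.symm).trans (assoc _ _ _).symm)
  · intro i j hij
    exact (M.mem_iff hij o').2 (hmin i (hij ▸ Option.some_ne_none j))

lemma pow_faithful {y y' : CostructuredArrow (powToW l) ξ} (g g' : y ⟶ y')
    (h : (powProj l ξ).map g = (powProj l ξ).map g') : g = g' := by
  have h0 : A1GmPow.Hom.base g.left = A1GmPow.Hom.base g'.left := h
  have key : (keepNonInvertible l).map g.left = (keepNonInvertible l).map g'.left :=
    toW_injective (W.isStack.fibred.cancel y'.hom h
      ((CostructuredArrow.w g).trans (CostructuredArrow.w g').symm))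
  refine CostructuredArrow.hom_ext _ _ (A1GmPow.hom_ext h0 fun i => ?_)
  by_cases hn : (y.left.pair i).NonInvertible
  · let i₀ : ((keepNonInvertible l).obj y.left).ι := ⟨i, hn⟩
    have h1 : WPP.Hom.map ((keepNonInvertible l).map g.left) i₀ =
      WPP.Hom.map ((keepNonInvertible l).map g'.left) i₀ := congrArg (fun m => WPP.Hom.map m i₀) key
    exact eq_of_heq (Sigma.mk.inj h1).2
  · have h2 := A1GmPow.Hom.isPullback g'.left i
    rw [← h0] at h2
    exact (A1GmPow.Hom.isPullback g.left i).eq_of_not_nonInvertible h2 hn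

lemma pow_isStack (hl : IsStack etale (A1GmPow.proj l)) (ξ : W) : IsStack etale (powProj l ξ) :=
  IsStack.costructuredArrow (F := powToW l) (q := W.proj) hl W.isStack.isPrestack ξ

lemma isUnit_prod_pick [DecidableEq (Option N.κ)] (h : T' ⟶ T) (k : T ⟶ N.U)
    (s s' : Fin l → Option N.κ) :
    IsUnit (ringMap h (∏ i, if s i = s' i then 1 else pick k s i * pick k s' i)) ↔
      ∀ i, s i ≠ s' i → IsUnit (pick (h ≫ k) s i) ∧ IsUnit (pick (h ≫ k) s' i) := by
  rw [map_prod, IsUnit.prod_univ_iff]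
  refine forall_congr' fun i => ?_
  split_ifs with hi
  · simp [hi]
  · rw [map_mul, IsUnit.mul_iff, ringMap_pick, ringMap_pick]
    exact ⟨fun h _ => h, fun h => h hi⟩

lemma pow_eqOpen (hl : IsStack etale (A1GmPow.proj l)) (ξ : W) :
    EqOpen (powProj l ξ) (fibreMap (powToW l) ξ) := by
  classical
  intro y₁ y₂ i hi p
  have hf := (pow_isStack hl ξ).fibred
  obtain ⟨N, ⟨z, hz⟩, -⟩ := W.exists_stdNbhd ξ (ptMap ((fibreMap (powToW l) ξ).app y₁) p)
  obtain ⟨T, a, t, o, ha, hat, rfl, -⟩ := N.et.exists_square ((fibreMap (powToW l) ξ).app y₁) p z hz.symm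
  obtain ⟨T₁, f₁, s₁, M₁, e₁, he₁, hf₁, ⟨o₁, rfl⟩, -⟩ := exists_local_pick y₁ hat o
  obtain ⟨T₂, f₂, s₂, M₂, e₂, he₂, hf₂, ⟨o₂, rfl⟩, -⟩ := exists_local_pick y₂
    (a := f₁ ≫ a ≫ i.hom) (t := f₁ ≫ t) ((assoc _ _ _).trans ((f₁ ≫= ((assoc _ _ _).trans ((a ≫= hi).trans hat))).trans
        (assoc _ _ _).symm)) o₁
  let k := f₂ ≫ f₁ ≫ t
  obtain ⟨c, hc⟩ := exists_pickHom (ξ := ξ) (c := f₂) (k' := k) rfl M₁ (M₁.comp f₂ rfl)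
    fun i h => (h rfl).elim
  have hce : (powProj l ξ).map (c ≫ e₁) = f₂ ≫ f₁ ≫ a :=
    ((powProj l ξ).map_comp c e₁).trans ((hc =≫ _).trans (f₂ ≫= he₁))
  refine ⟨_, c ≫ e₁, ∏ i, if s₁ i = s₂ i then 1 else pick k s₁ i * pick k s₂ i,
    hce ▸ hf₂.comp (hf₁.comp ha), hce ▸ ⟨o₂, rfl⟩, fun {w} h => ?_⟩
  have hce₂ : (f₂ ≫ f₁ ≫ a) ≫ i.hom = (powProj l ξ).map e₂ := (assoc _ _ _).trans
    ((f₂ ≫= (assoc _ _ _)).trans he₂.symm)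
  let h₀ : (powProj l ξ).obj w ⟶ T₂ := (powProj l ξ).map h
  have hhe : (powProj l ξ).map (h ≫ c ≫ e₁) ≫ i.hom =
      h₀ ≫ (show T₂ ⟶ (powProj l ξ).obj y₂ from (powProj l ξ).map e₂) :=
    ((((powProj l ξ).map_comp h (c ≫ e₁)).trans (h₀ ≫= hce)) =≫ i.hom).trans
      ((assoc _ _ _).trans (h₀ ≫= hce₂))
  refine Iff.trans ⟨?_, fun H => ?_⟩ (isUnit_prod_pick h₀ k s₁ s₂).symm
  · rintro ⟨m, hm⟩ i hi
    obtain ⟨m', hm', -⟩ := hf.fac e₂ m h₀ (hhe.symm.trans hm.symm)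
    exact isUnit_pick_of_ne (k := k) (k' := k) (s' := s₂) h m' rfl (hm' =≫ k) i hi
  · obtain ⟨g₂, hg₂⟩ := exists_pickHom (ξ := ξ) (c := h₀) rfl M₂
      (M₁.comp (h₀ ≫ f₂) (assoc _ _ _)) (s' := s₁) fun i hi =>
        (H i (Ne.symm hi)).symm
    obtain ⟨g₁, hg₁⟩ := exists_pickHom (ξ := ξ) (c := h₀) rfl (M₁.comp f₂ rfl)
      (M₁.comp (h₀ ≫ f₂) (assoc _ _ _)) fun i hi => (hi rfl).elim
    obtain ⟨g, hg, -⟩ := hf.fac g₁ h (𝟙 _) ((id_comp _).trans hg₁)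
    refine ⟨g ≫ g₂ ≫ e₂, ?_⟩
    exact ((powProj l ξ).map_comp g (g₂ ≫ e₂)).trans ((congrArg₂ (· ≫ ·) hg
      (((powProj l ξ).map_comp g₂ e₂).trans (hg₂ =≫ _))).trans
        ((id_comp _).trans hhe.symm))

lemma exists_pickChart (N : StdNbhd ξ) (s : Fin l → Option N.κ)
    (mono : ∀ {i i' j j'}, s i = some j → s i' = some j' → i < i' → j < j') :
    ∃ (U : Aff) (π : U ⟶ N.U) (_ : Picks π s), IsEt π ∧ (∀ {T : Aff} (g g' : T ⟶ U),
      g ≫ π = g' ≫ π → g = g') ∧ ∀ {T : Aff} (k : T ⟶ N.U), Picks k s → ∃ g, g ≫ π = k := by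
  classical
  have := Fintype.ofFinite N.κ
  let d : N.U.unop := ∏ j, if ∃ i, s i = some j then 1 else N.b j
  have hd : ∀ {T : Aff} (k : T ⟶ N.U), IsUnit (ringMap k d) ↔
      ∀ j, (∀ i, s i ≠ some j) → IsUnit (ringMap k (N.b j)) := fun k => by
    rw [map_prod, IsUnit.prod_univ_iff]
    refine forall_congr' fun j => ?_
    split_ifs with hj
    · simpa using fun h => (hj.elim h).elim
    · grind
  exact ⟨away d, awayHom d, ⟨mono, fun _ => isUnit_one, fun _ => (one_mul _).symm,
    (hd _).1 (isUnit_awayHom d)⟩, awayHom_isEt d, fun _ _ => away_hom_ext,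
    fun k M => exists_lift_away k ((hd k).2 M.off)⟩

lemma exists_pick_nbhd (hf : IsFibredInGroupoids (powProj l ξ)) {y : CostructuredArrow (powToW l) ξ}
    {t : (powProj l ξ).obj y ⟶ N.U} (ht : t ≫ N.base = (fibreMap (powToW l) ξ).app y)
    {w : CostructuredArrow (powToW l) ξ} (h : w ⟶ y) {k : T ⟶ N.U} {s₀ : Fin l → Option N.κ}
    {M₀ : Picks k s₀} (g : w ⟶ pickObj k M₀) (hg : (powProj l ξ).map g ≫ k = (powProj l ξ).map h ≫ t)
    (p : PrimeSpectrum ((powProj l ξ).obj w).unop) :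
    ∃ (T' : Aff) (k' : T' ⟶ N.U) (s : Fin l → Option N.κ) (M : Picks k' s) (e : pickObj k' M ⟶ y),
      IsEt ((powProj l ξ).map e) ∧
      ptMap ((powProj l ξ).map h) p ∈ Set.range (ptMap ((powProj l ξ).map e)) ∧
      (powProj l ξ).map e ≫ t = k' ∧ Picks k' s₀ ∧
      ∀ i, s₀ i ≠ s i → IsUnit (pick k' s₀ i) ∧ IsUnit (pick k' s i) := by
  classical
  obtain ⟨T₁, f, s, M, e, he, het, ⟨q, hq⟩, hmin⟩ := exists_local_pick y (a := 𝟙 _) (t := t)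
    ((id_comp _).trans ht.symm) (ptMap ((powProj l ξ).map h) p)
  replace he : (powProj l ξ).map e = f := he.trans (comp_id f)
  obtain ⟨Z, c, c', z, -, hcc, -, rfl⟩ := het.exists_square ((powProj l ξ).map h) p q hq.symm
  obtain ⟨w', i₁, a, ha⟩ := hf.lift w c
  obtain ⟨a', ha', -⟩ := hf.fac e (a ≫ h) (i₁.hom ≫ c') ((congrArg ((i₁.hom ≫ c') ≫ ·) he).trans
    ((assoc _ _ _).trans ((congrArg (i₁.hom ≫ ·) hcc.symm).trans
      ((assoc _ _ _).symm.trans ((congrArg (· ≫ _) ha.symm).trans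
        ((powProj l ξ).map_comp a h).symm)))))
  have hk₀ : (powProj l ξ).map (a ≫ g) ≫ k = i₁.hom ≫ c' ≫ f ≫ t :=
    ((congrArg (· ≫ k) ((powProj l ξ).map_comp a g)).trans (assoc _ _ _)).trans
      ((congrArg ((powProj l ξ).map a ≫ ·) hg).trans ((assoc _ _ _).symm.trans
        ((congrArg (· ≫ t) ((congrArg (· ≫ _) ha).trans ((assoc _ _ _).trans
          (congrArg (i₁.hom ≫ ·) hcc)))).trans ((assoc _ _ _).trans
            (congrArg (i₁.hom ≫ ·) (assoc _ _ _))))))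
  have hne : ∀ i, s₀ i ≠ s i → s i = none ∧ pick (f ≫ t) s₀ i ∉ (ptMap c' z).asIdeal := fun i hi => by
    obtain ⟨h1, h2⟩ := isUnit_pick_of_ne (a ≫ g) a' hk₀ ((congrArg (· ≫ f ≫ t) ha').trans
      (assoc _ _ _)) i hi
    have h3 : ∀ {s' : Fin l → Option N.κ}, IsUnit (pick (i₁.hom ≫ c' ≫ f ≫ t) s' i) →
        pick (f ≫ t) s' i ∉ (ptMap c' z).asIdeal := fun {s'} hu hz => z.2.ne_top
      (Ideal.eq_top_of_isUnit_mem _ (x := pick (c' ≫ f ≫ t) s' i) (ringMap_pick c' _ _ _ ▸ hz) (by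
        have := hu.map (ringMap i₁.inv)
        rwa [ringMap_pick, Iso.inv_hom_id_assoc] at this))
    refine ⟨?_, h3 h1⟩
    by_contra hs
    obtain ⟨j, hj⟩ := Option.ne_none_iff_exists'.1 hs
    refine h3 h2 ?_
    have h4 := hmin i j hj
    rw [← hq] at h4
    rw [pick, hj]
    exact h4
  let D : T₁.unop := ∏ i, if s₀ i = s i then 1 else pick (f ≫ t) s₀ i
  have hD : ∀ i, s₀ i ≠ s i → IsUnit (pick (awayHom D ≫ f ≫ t) s₀ i) := fun i hi => by
    have := isUnit_awayHom D
    rw [show D = _ from rfl, map_prod, IsUnit.prod_univ_iff] at this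
    have := this i
    rwa [if_neg hi, ringMap_pick] at this
  have hM := M.comp (awayHom D) rfl
  obtain ⟨e', he'⟩ := exists_pickHom (ξ := ξ) (c := awayHom D) rfl M hM fun i h => (h rfl).elim
  have hee : (powProj l ξ).map (e' ≫ e) = awayHom D ≫ f :=
    ((powProj l ξ).map_comp e' e).trans (congrArg₂ (· ≫ ·) he' he)
  refine ⟨_, _, s, hM, e' ≫ e, hee ▸ (awayHom_isEt D).comp het, hee ▸ ?_,
    (congrArg (· ≫ t) hee).trans (assoc _ _ _), ⟨M₀.mono, fun _ => isUnit_one,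
      fun _ => (one_mul _).symm, fun j hj => ?_⟩, fun i hi => ⟨hD i hi, ?_⟩⟩
  · obtain ⟨x, hx⟩ : ptMap c' z ∈ Set.range (ptMap (awayHom D)) := by
      rw [range_awayHom]
      change D ∉ (ptMap c' z).asIdeal
      rw [(ptMap c' z).2.prod_mem_iff]
      rintro ⟨i, -, hi⟩
      split_ifs at hi with h
      · exact (ptMap c' z).2.one_notMem hi
      · exact (hne i h).2 hi
    exact ⟨x, (congrArg (ptMap f) hx).trans hq⟩
  · refine hM.off j fun i hi => ?_
    exact Option.some_ne_none j (hi.symm.trans (hne i fun h => hj i (h.trans hi)).1)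
  · rw [pick, (hne i hi).1]
    exact isUnit_one

theorem pow_exists_represents (hl : IsStack etale (A1GmPow.proj l)) (ξ : W) (hξ : lengthLE l ξ) :
    ∃ (R : PSpace) (f : R ⟶ pts.obj (spec.obj (W.proj.obj ξ))), IsAlgebraicSpace R ∧
      Nonempty (Represents _ (fibreMap (powToW l) ξ) R f) ∧ HasAtlasWith etaleSurjective f := by
  have hst := pow_isStack hl ξ
  choose N hN hNl using W.exists_stdNbhd ξ
  let K : Type := Σ (x : PrimeSpectrum (W.proj.obj ξ).unop), {s : Fin l → Option (N x).κ //
    ∀ {i i' j j'}, s i = some j → s i' = some j' → i < i' → j < j'}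
  choose U π M et uniq univ using fun k : K => exists_pickChart (N k.1) k.2.1 k.2.2
  let C : Charts (powProj l ξ) (fibreMap (powToW l) ξ) K :=
    { U := fun k => (N k.1).U
      u := fun k => (N k.1).base
      et := fun k => (N k.1).et
      ζ := fun k => pickObj (π k) (M k)
      zu := π
      comm := fun k => (pickObj_base _ _).symm
      uniq := fun {k w} g g' h => uniq k _ _ h
      opn := by
        intro k y t ht w h g hg p
        obtain ⟨T, k', s, M', e, he, hp, het, M₀, hu⟩ := exists_pick_nbhd hst.fibred ht h g hg p
        obtain ⟨c, hc⟩ := univ k k' M₀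
        obtain ⟨g', hg'⟩ := exists_pickHom (ξ := ξ) hc (M k) M' hu
        exact ⟨_, e, g', he, hp, (congrArg (· ≫ π k) hg').trans (hc.trans het.symm)⟩
      cov := by
        intro y p
        obtain ⟨z, hz⟩ := hN ((ptMap ((fibreMap (powToW l) ξ).app y)) p)
        obtain ⟨T, a, b, o, ha, hab, rfl, -⟩ := (N _).et.exists_square
          ((fibreMap (powToW l) ξ).app y) p z hz.symm
        obtain ⟨T', f, s, M', e, he, hf, ⟨q, rfl⟩, -⟩ := exists_local_pick y hab o
        let k : K := ⟨_, s, M'.mono⟩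
        obtain ⟨c, hc⟩ := univ k _ M'
        obtain ⟨g, -⟩ := exists_pickHom (ξ := ξ) hc (M k) M' fun i h => (h rfl).elim
        exact ⟨k, _, e, g, he ▸ hf.comp ha, he ▸ ⟨q, rfl⟩⟩ }
  refine exists_represents_of_eqOpen hst pow_faithful C (pow_eqOpen hl ξ) etaleSurjective
    ⟨copDesc_left_of_local _ _ fun k => (isEt_iff _).1 ?_, surjective_copDesc _ fun x => ?_⟩
  · rw [← C.comm k]
    exact (et k).comp (N k.1).et
  · have hle := hNl x l hξ
    have := Fintype.ofFinite (N x).κ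
    rw [Nat.card_eq_fintype_card] at hle
    let o := Fintype.orderIsoFinOfCardEq (N x).κ rfl
    let s : Fin l → Option (N x).κ := fun i => if h : i.1 < Fintype.card (N x).κ then
      some (o ⟨i, h⟩) else none
    have hs : ∀ {i j}, s i = some j → ∃ h : i.1 < Fintype.card (N x).κ, o ⟨i, h⟩ = j :=
      fun {i j} h => by
        by_cases h' : i.1 < Fintype.card (N x).κ
        · grind
        · grind
    have mono : ∀ {i i' j j'}, s i = some j → s i' = some j' → i < i' → j < j' :=
      fun {i i' j j'} h h' hlt => by
        obtain ⟨h1, rfl⟩ := hs h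
        obtain ⟨h2, rfl⟩ := hs h'
        exact o.lt_iff_lt.2 hlt
    let k : K := ⟨x, s, mono⟩
    obtain ⟨g, hg⟩ := univ k (𝟙 _) ⟨mono, fun _ => isUnit_one, fun _ => (one_mul _).symm,
      fun j hj => by
        obtain ⟨i, rfl⟩ := o.surjective j
        exact (hj ⟨i, i.2.trans_le hle⟩ (dif_pos i.2)).elim⟩
    obtain ⟨z, hz⟩ := hN x
    refine ⟨k, ptMap g z, Eq.trans ?_ hz⟩
    have h1 : g ≫ (fibreMap (powToW l) ξ).app (C.ζ k) = (N x).base :=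
      (congrArg (g ≫ ·) (pickObj_base (π k) (M k))).trans ((assoc _ _ _).symm.trans
        ((congrArg (· ≫ (N x).base) hg).trans (id_comp _)))
    exact congrArg (fun f => ptMap f z) h1

theorem toWl_representableWith (hl : IsStack etale (A1GmPow.proj l)) :
    (toWl l).RepresentableWith fun _ _ f => HasAtlasWith etaleSurjective f :=
  Mor.representableWith_of_full (lengthLE l).ι (toWl l) fun ξ => pow_exists_represents hl ξ.1 ξ.2

end Tuples


section FlatDescent

open TensorProduct

variable {A B : Type} [CommRing A] [CommRing B] [Algebra A B]

variable (A B) in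
/-- The pull-back of functions along the first two of three factors. -/
abbrev pull₁₂ : B ⊗[A] B →ₐ[A] B ⊗[A] (B ⊗[A] B) :=
  Algebra.TensorProduct.map (.id A B) (Algebra.TensorProduct.includeLeft (R := A) (S := A))

variable (A B) in
/-- The pull-back of functions along the first and the third factor. -/
abbrev pull₁₃ : B ⊗[A] B →ₐ[A] B ⊗[A] (B ⊗[A] B) :=
  Algebra.TensorProduct.map (.id A B) Algebra.TensorProduct.includeRight

variable (A B) in
/-- The pull-back of functions along the last two of three factors. -/
abbrev pull₂₃ : B ⊗[A] B →ₐ[A] B ⊗[A] (B ⊗[A] B) := Algebra.TensorProduct.includeRight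

/-- The cocycle condition for a function on `V ×_U V`. -/
def IsCocycle (g : B ⊗[A] B) : Prop := pull₁₂ A B g * pull₂₃ A B g = pull₁₃ A B g

lemma IsCocycle.inv {g g' : B ⊗[A] B} (h : IsCocycle g) (hg : g * g' = 1) : IsCocycle g' := by
  have h1 := fun F : B ⊗[A] B →ₐ[A] B ⊗[A] (B ⊗[A] B) => (map_mul F g g').symm.trans
    ((congrArg F hg).trans (map_one F))
  unfold IsCocycle at h ⊢
  linear_combination -(pull₁₂ A B g' * pull₂₃ A B g') * h1 (pull₁₃ A B) -
    (pull₁₂ A B g' * pull₂₃ A B g' * pull₁₃ A B g') * h +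
    (pull₁₃ A B g' * pull₂₃ A B g * pull₂₃ A B g') * h1 (pull₁₂ A B) +
    pull₁₃ A B g' * h1 (pull₂₃ A B)

/-- The map with kernel the descended module. -/
def twist (g : B ⊗[A] B) : B →ₗ[A] B ⊗[A] B :=
  (LinearMap.mulLeft A g : B ⊗[A] B →ₗ[A] B ⊗[A] B) ∘ₗ (Algebra.TensorProduct.includeRight : B →ₐ[A] B ⊗[A] B).toLinearMap -
    (Algebra.TensorProduct.includeLeft (R := A) (S := A) : B →ₐ[A] B ⊗[A] B).toLinearMap

lemma mem_ker_twist {g : B ⊗[A] B} {b : B} :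
    b ∈ LinearMap.ker (twist g) ↔ g * (1 ⊗ₜ b) = b ⊗ₜ 1 := sub_eq_zero

/-- The base change of the descended module. -/
def untwist (g : B ⊗[A] B) : B ⊗[A] LinearMap.ker (twist g) →ₗ[A] B :=
  LinearMap.mul' A B ∘ₗ LinearMap.lTensor B (LinearMap.ker (twist g)).subtype

lemma untwist_tmul (g : B ⊗[A] B) (b : B) (m : LinearMap.ker (twist g)) :
    untwist g (b ⊗ₜ m) = b * m := rfl

lemma untwist_bijective [Module.Flat A B] {g g' : B ⊗[A] B} (hg : g * g' = 1) (h : IsCocycle g) :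
    Function.Bijective (untwist g) := by
  constructor
  · rw [← LinearMap.ker_eq_bot, LinearMap.ker_eq_bot']
    intro w hw
    refine Module.Flat.lTensor_preserves_injective_linearMap (M := B) _
      (LinearMap.ker (twist g)).injective_subtype ?_
    have key : ∀ w, LinearMap.lTensor B (LinearMap.ker (twist g)).subtype w =
        g' * (untwist g w ⊗ₜ 1) := fun w => by
      induction w with
      | zero => simp
      | add x y hx hy => rw [map_add, map_add, hx, hy, TensorProduct.add_tmul, mul_add]
      | tmul b m =>
        have hm := mem_ker_twist.1 m.2
        have e : (b * (m : B)) ⊗ₜ[A] (1 : B) = (b ⊗ₜ 1) * ((m : B) ⊗ₜ 1) := by simp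
        rw [untwist_tmul, e, ← hm, mul_left_comm, ← mul_assoc g', mul_comm g', hg, one_mul]
        simp
    rw [key, hw, TensorProduct.zero_tmul, mul_zero, map_zero]
  · intro y
    let μ : B ⊗[A] B →ₐ[A] B := Algebra.TensorProduct.lmul' A
    let c := g' * ((μ g * y) ⊗ₜ 1)
    have hc : ∀ c, LinearMap.lTensor B (twist g) c =
        pull₂₃ A B g * pull₁₃ A B c - pull₁₂ A B c := fun c => by
      induction c with
      | zero => simp
      | add x y hx hy => rw [map_add, map_add, map_add, hx, hy]; ring
      | tmul x m => simp [twist]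
    have h' := h.inv hg
    have hb : pull₂₃ A B g * pull₂₃ A B g' = 1 := by rw [← map_mul, hg, map_one]
    have h0 : LinearMap.lTensor B (twist g) c = 0 := by
      rw [hc, map_mul, map_mul, ← h']
      simp only [Algebra.TensorProduct.map_tmul, map_one, AlgHom.id_apply]
      linear_combination (pull₁₂ A B g' * ((μ g * y) ⊗ₜ 1)) * hb
    obtain ⟨w, hw⟩ := ((Module.Flat.lTensor_exact B
      (LinearMap.exact_subtype_ker_map (twist g))) c).1 h0
    refine ⟨w, (congrArg (LinearMap.mul' A B) hw).trans ?_⟩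
    change μ (g' * ((μ g * y) ⊗ₜ 1)) = y
    have e : μ g * μ g' = 1 := by rw [← map_mul, hg, map_one]
    rw [map_mul, Algebra.TensorProduct.lmul'_apply_tmul]
    linear_combination y * e

lemma invertible_of_lTensor [Module.FaithfullyFlat A B] {M N : Type} [AddCommGroup M]
    [AddCommGroup N] [Module A M] [Module A N] (ψ : M ⊗[A] N →ₗ[A] A) (e : B ⊗[A] M ≃ₗ[A] B)
    (e' : B ⊗[A] N ≃ₗ[A] B) (h : ∀ b m n, e' (e (b ⊗ₜ m) ⊗ₜ n) = ψ (m ⊗ₜ n) • b) :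
    Module.Invertible A M := by
  let E : B ⊗[A] (M ⊗[A] N) ≃ₗ[A] B ⊗[A] A := (TensorProduct.assoc A B M N).symm ≪≫ₗ
    TensorProduct.congr e (LinearEquiv.refl A N) ≪≫ₗ e' ≪≫ₗ (TensorProduct.rid A B).symm
  have hE : E.toLinearMap = LinearMap.lTensor B ψ := by
    refine TensorProduct.ext (LinearMap.ext fun b => TensorProduct.ext' fun m n => ?_)
    refine (TensorProduct.rid A B).injective ?_
    change (TensorProduct.rid A B) ((TensorProduct.rid A B).symm (e' (e (b ⊗ₜ m) ⊗ₜ n))) =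
      ψ (m ⊗ₜ n) • b
    rw [LinearEquiv.apply_symm_apply, h]
  have hB : Function.Bijective (LinearMap.lTensor B ψ) := by
    rw [← hE]
    exact E.bijective
  exact .left (LinearEquiv.ofBijective ψ
    ((Module.FaithfullyFlat.lTensor_bijective_iff_bijective A B ψ).1 hB))

lemma one_isCocycle : IsCocycle (1 : B ⊗[A] B) := by
  unfold IsCocycle
  rw [map_one, map_one, map_one, mul_one]

lemma ker_twist_one [Module.FaithfullyFlat A B] {b : B}
    (hb : b ∈ LinearMap.ker (twist (1 : B ⊗[A] B))) : ∃ a, algebraMap A B a = b := by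
  let ψ : A →ₗ[A] LinearMap.ker (twist (1 : B ⊗[A] B)) :=
    (Algebra.linearMap A B).codRestrict _ fun a => mem_ker_twist.2 (by
      rw [one_mul, Algebra.linearMap_apply, ← mul_one (algebraMap A B a), ← Algebra.smul_def,
        TensorProduct.tmul_smul, TensorProduct.smul_tmul'])
  have h1 : Function.Bijective (LinearMap.lTensor B ψ) := by
    refine (Function.Bijective.of_comp_iff' (untwist_bijective (mul_one 1) one_isCocycle) _).1 ?_
    have : untwist (1 : B ⊗[A] B) ∘ₗ LinearMap.lTensor B ψ =
        (TensorProduct.rid A B).toLinearMap := by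
      ext b
      simp [untwist_tmul, ψ]
    exact (congrArg (fun f : B ⊗[A] A →ₗ[A] B => Function.Bijective f) this).mpr
      (TensorProduct.rid A B).bijective
  obtain ⟨a, ha⟩ := ((Module.FaithfullyFlat.lTensor_bijective_iff_bijective A B ψ).1 h1).2 ⟨b, hb⟩
  exact ⟨a, congrArg Subtype.val ha⟩

lemma twist_invertible [Module.FaithfullyFlat A B] {g g' : B ⊗[A] B} (hg : g * g' = 1)
    (h : IsCocycle g) : Module.Invertible A (LinearMap.ker (twist g)) := by
  have hg' : g' * g = 1 := (mul_comm _ _).trans hg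
  have hm : ∀ (m : LinearMap.ker (twist g)) (n : LinearMap.ker (twist g')),
      ∃ a, algebraMap A B a = m * n := fun m n => ker_twist_one (mem_ker_twist.2 (by
    have e1 := mem_ker_twist.1 m.2
    have e2 := mem_ker_twist.1 n.2
    have e3 : ((m : B) * n) ⊗ₜ[A] (1 : B) = ((m : B) ⊗ₜ 1) * ((n : B) ⊗ₜ 1) := by simp
    have e4 : (1 : B) ⊗ₜ[A] ((m : B) * n) = (1 ⊗ₜ (m : B)) * (1 ⊗ₜ (n : B)) := by simp
    rw [e3, e4, ← e1, ← e2]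
    linear_combination -((1 : B) ⊗ₜ[A] (m : B)) * ((1 : B) ⊗ₜ[A] (n : B)) * hg))
  have inj : Function.Injective (algebraMap A B) := FaithfulSMul.algebraMap_injective A B
  choose β hβ using hm
  let ψ : LinearMap.ker (twist g) ⊗[A] LinearMap.ker (twist g') →ₗ[A] A :=
    TensorProduct.lift (LinearMap.mk₂ A β
      (fun m m' n => inj (by rw [map_add, hβ, hβ, hβ, Submodule.coe_add, add_mul]))
      (fun c m n => inj (by simp [hβ, Algebra.smul_def, mul_assoc]))
      (fun m n n' => inj (by rw [map_add, hβ, hβ, hβ, Submodule.coe_add, mul_add]))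
      (fun c m n => inj (by simp [hβ, Algebra.smul_def, mul_left_comm])))
  let e := LinearEquiv.ofBijective _ (untwist_bijective hg h)
  let e' := LinearEquiv.ofBijective _ (untwist_bijective hg' (h.inv hg))
  refine invertible_of_lTensor ψ e e' fun b m n => ?_
  change b * m * n = β m n • b
  rw [Algebra.smul_def, hβ, mul_assoc, mul_comm]

theorem LineSec.exists_descent [Module.FaithfullyFlat A B] {g g' : B ⊗[A] B} (hg : g * g' = 1)
    (h : IsCocycle g) {a : B} (ha : g * (1 ⊗ₜ a) = a ⊗ₜ 1) :
    ∃ (P : LineSec A) (θ : P.L →+ B), IsPullbackMap (algebraMap A B) P (.triv a) θ ∧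
      ∀ x, g * (1 ⊗ₜ θ x) = θ x ⊗ₜ 1 := by
  have := twist_invertible hg h
  refine ⟨⟨LinearMap.ker (twist g), ⟨a, mem_ker_twist.2 ha⟩⟩,
    (LinearMap.ker (twist g)).subtype.toAddMonoidHom, ⟨fun c x => ?_, ?_, rfl⟩,
    fun x => mem_ker_twist.1 x.2⟩
  · exact Algebra.smul_def c (x : B)
  · refine eq_top_iff.2 fun (y : B) _ => ?_
    obtain ⟨w, rfl⟩ := (untwist_bijective hg h).2 y
    induction w with
    | zero => rw [map_zero]; exact Submodule.zero_mem _
    | add x y hx hy => rw [map_add]; exact Submodule.add_mem _ (hx trivial) (hy trivial)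
    | tmul b m => exact Submodule.smul_mem _ b (Submodule.subset_span ⟨m, rfl⟩)

end FlatDescent


section Coproduct

variable {s : Type} (V : s → Aff) {T U : Aff}

/-- The disjoint union of affine schemes. -/
def prodAff : Aff := op (CommAlgCat.of (CommRingCat.of ℂ) (∀ k, (V k).unop))

/-- The inclusion of a member of a disjoint union. -/
def prodIncl (k : s) : V k ⟶ prodAff V :=
  (CommAlgCat.ofHom (Pi.evalAlgHom (CommRingCat.of ℂ) (fun k => (V k).unop) k)).op

variable {V}

/-- The morphism from a disjoint union. -/
def prodDesc (v : ∀ k, V k ⟶ U) : prodAff V ⟶ U :=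
  (CommAlgCat.ofHom (AlgHom.pi fun k => (v k).unop.hom)).op

lemma prodIncl_cancel {k : s} {g g' : T ⟶ V k} (h : g ≫ prodIncl V k = g' ≫ prodIncl V k) :
    g = g' := by
  classical
  refine ringMap_injective (RingHom.ext fun x => ?_)
  have := RingHom.congr_fun (congrArg ringMap h) (Pi.single k x : ∀ k, (V k).unop)
  change ringMap g ((Pi.single k x : ∀ k, (V k).unop) k) =
    ringMap g' ((Pi.single k x : ∀ k, (V k).unop) k) at this
  rwa [Pi.single_eq_same] at this

lemma subsingleton_of_prodIncl {k k' : s} (hk : k ≠ k') {g : T ⟶ V k} {g' : T ⟶ V k'}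
    (h : g ≫ prodIncl V k = g' ≫ prodIncl V k') : Subsingleton T.unop := by
  classical
  have := RingHom.congr_fun (congrArg ringMap h) (Pi.single k 1 : ∀ k, (V k).unop)
  change ringMap g ((Pi.single k 1 : ∀ k, (V k).unop) k) =
    ringMap g' ((Pi.single k 1 : ∀ k, (V k).unop) k') at this
  rw [Pi.single_eq_same, Pi.single_eq_of_ne hk.symm, map_one, map_zero] at this
  exact subsingleton_of_zero_eq_one this.symm

lemma prodIncl_isEt (k : s) : IsEt (prodIncl V k) := by
  classical
  let R : s → Type := fun k => (V k).unop
  let _ : Algebra (∀ k, R k) (R k) := (Pi.evalRingHom R k).toAlgebra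
  have : IsLocalization.Away (Pi.single k 1 : ∀ k, R k) (R k) :=
    IsLocalization.away_of_isIdempotentElem (by simp [IsIdempotentElem, ← Pi.single_mul_left])
      (RingHom.ker_evalRingHom _ _) (Pi.evalRingHom R k).surjective
  have := Algebra.Etale.of_isLocalizationAway (R := ∀ k, R k) (A := R k) (Pi.single k 1)
  exact (RingHom.etale_algebraMap (R := ∀ k, R k) (S := R k)).2 this

lemma exists_prodIncl [Finite s] (p : PrimeSpectrum (prodAff V).unop) :
    ∃ k, p ∈ Set.range (ptMap (prodIncl V k)) :=
  PrimeSpectrum.exists_comap_evalRingHom_eq (R := fun k => (V k).unop) p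

lemma prodDesc_isEt [Finite s] {v : ∀ k, V k ⟶ U} (hv : ∀ k, IsEt (v k)) : IsEt (prodDesc v) := by
  let _ : ∀ k, Algebra U.unop (V k).unop := fun k => (ringMap (v k)).toAlgebra
  have : ∀ k, Algebra.Etale U.unop (V k).unop := fun k => RingHom.etale_algebraMap.1 (hv k)
  exact (RingHom.etale_algebraMap (R := U.unop) (S := ∀ k, (V k).unop)).2 inferInstance

end Coproduct

namespace A1GmPow

variable {l : ℕ} {T T' U V : Aff}

/-- The stack associated to the stack of tuples. -/
abbrev Desc (l : ℕ) := DescentDatum etale (proj l)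

variable (l) in
/-- The tautological functor. -/
abbrev toDesc : A1GmPow l ⥤ Desc l := DescentDatum.unit etale (proj l)

variable (l) in
/-- The projection. -/
abbrev descProj : Desc l ⥤ Aff := DescentDatum.proj etale (proj l)

lemma exists_trivD (D : Desc l) (x : PrimeSpectrum D.U.unop) :
    ∃ (T : Aff) (b : Fin l → T.unop) (e : (toDesc l).obj (trivPow T b) ⟶ D),
      IsEt ((descProj l).map e) ∧ x ∈ Set.range (ptMap ((descProj l).map e)) := by
  obtain ⟨V, f, hf, he, ⟨y, rfl⟩⟩ := mem_etale.1 D.cover x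
  obtain ⟨k, c, rfl⟩ := DescentDatum.exists_mid D f hf
  let X : A1GmPow l := ⟨V, fun i => ((D.obj k).pair i).baseChange (ringMap c)⟩
  let r : X ⟶ D.obj k := ⟨c, fun _ => _, fun i => ((D.obj k).pair i).isPullbackMap_baseChange _⟩
  obtain ⟨T, b, e, het, ⟨z, hz⟩⟩ := exists_triv X y
  have h : (descProj l).map ((toDesc l).map (e ≫ r) ≫ DescentDatum.can D k) =
      Hom.base e ≫ c ≫ D.map k := assoc (Hom.base e) c (D.map k)
  refine ⟨T, b, (toDesc l).map (e ≫ r) ≫ DescentDatum.can D k, h ▸ IsEt.comp het he, z, ?_⟩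
  rw [h, ← hz, ptMap_comp]
  rfl

/-- The projection from the pull-back of a tuple of trivial line bundles. -/
abbrev pullTriv (t : T ⟶ V) (a : Fin l → V.unop) :
    trivPow T (fun i => ringMap t (a i)) ⟶ trivPow V a :=
  powHom t (u := 1) (fun _ => isUnit_one) fun _ => one_mul _

lemma exists_surjective (D : Desc l) : ∃ (V : Aff) (a : Fin l → V.unop)
    (n : (toDesc l).obj (trivPow V a) ⟶ D), IsEt ((descProj l).map n) ∧
      Function.Surjective (ptMap ((descProj l).map n)) := by
  choose T' b' e' he' hp using exists_trivD D
  obtain ⟨s, hs⟩ := exists_finite_cover (fun p => (descProj l).map (e' p)) he' hp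
  let V := fun k : s => T' k.1
  let b : ∀ k, Fin l → (V k).unop := fun k => b' k.1
  let e : ∀ k, (toDesc l).obj (trivPow (V k) (b k)) ⟶ D := fun k => e' k.1
  let a : Fin l → (prodAff V).unop := fun i k => b k i
  let v : ∀ k : s, V k ⟶ D.U := fun k => (descProj l).map (e k)
  let j : ∀ k : s, (toDesc l).obj (trivPow (V k) (b k)) ⟶ (toDesc l).obj (trivPow (prodAff V) a) :=
    fun k => (toDesc l).map (pullTriv (prodIncl V k) a)
  have hq := DescentDatum.isPrestack (isPrestack (r := l))
  obtain ⟨n, hn, -⟩ := hq.exists_hom (y := (toDesc l).obj (trivPow (prodAff V) a)) (y' := D)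
    (prodDesc v) (fun {z} f m => ∃ (k : s) (u : z ⟶ (toDesc l).obj (trivPow (V k) (b k))),
      u ≫ j k = f ∧ u ≫ e k = m)
    (by
      rintro z _ _ ⟨k, u, rfl, rfl⟩
      exact ((descProj l).map_comp u (e k)).trans (((congrArg (· ≫ prodDesc v)
        ((descProj l).map_comp u (j k))).trans (assoc _ _ _)).symm))
    (by
      rintro z w c _ _ ⟨k, u, rfl, rfl⟩
      exact ⟨k, c ≫ u, assoc _ _ _, assoc _ _ _⟩)
    (by
      rintro z f _ _ ⟨k, u, rfl, rfl⟩ ⟨k', u', h, rfl⟩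
      have h' : (descProj l).map u' ≫ prodIncl V k' = (descProj l).map u ≫ prodIncl V k :=
        ((descProj l).map_comp u' (j k')).symm.trans ((congrArg (descProj l).map h).trans
          ((descProj l).map_comp u (j k)))
      by_cases hk : k = k'
      · subst hk
        rw [DescentDatum.comp_right_cancel isPrestack (j k) (prodIncl_cancel (V := V) h' :) h]
      · have : Subsingleton z.U.unop := subsingleton_of_prodIncl (Ne.symm hk) h'
        exact hq.hom_ext_local fun x => by
          have : Subsingleton z.U.unop := this
          exact ((PrimeSpectrum.isEmpty_iff_subsingleton (R := z.U.unop)).2 this).elim x)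
    (fun p => by
      obtain ⟨k, hk⟩ := exists_prodIncl (V := V) p
      exact ⟨_, j k, prodIncl_isEt k, hk, _, k, 𝟙 _, id_comp _, id_comp _⟩)
  refine ⟨prodAff V, a, n, hn ▸ prodDesc_isEt fun k => he' k.1, fun p => ?_⟩
  obtain ⟨q, hq, y, hy⟩ := hs p
  exact ⟨ptMap (prodIncl V ⟨q, hq⟩) y, (congrArg (fun m => ptMap m _) hn).trans hy⟩

section Transition

variable {D : Desc l} {a : Fin l → V.unop} (n : (toDesc l).obj (trivPow V a) ⟶ D)

/-- The units `u` describe the isomorphism of the pull-backs of `trivPow V a` along `t₁` and `t₂`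
which is given by `n`. -/
def Trans (t₁ t₂ : T ⟶ V) (u : Fin l → T.unop) : Prop :=
  ∃ (hu : ∀ i, IsUnit (u i)) (e : ∀ i, u i * ringMap t₂ (a i) = ringMap t₁ (a i)),
    (toDesc l).map (powHom t₂ hu e) ≫ n = (toDesc l).map (pullTriv t₁ a) ≫ n

variable {n} {t₁ t₂ t₃ : T ⟶ V} {u v : Fin l → T.unop}

lemma map_comp_congr {X Y : A1GmPow l} (σ : Y ⟶ X) {α β : X ⟶ trivPow V a} {α' β' : Y ⟶ trivPow V a}
    (h : (toDesc l).map α ≫ n = (toDesc l).map β ≫ n) (hα : σ ≫ α = α') (hβ : σ ≫ β = β') :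
    (toDesc l).map α' ≫ n = (toDesc l).map β' ≫ n := by
  subst hα hβ
  rw [Functor.map_comp, Functor.map_comp, assoc, assoc, h]

lemma Trans.uniq (h : Trans n t₁ t₂ u) (h' : Trans n t₁ t₂ v) : u = v := by
  obtain ⟨hu, e, h⟩ := h
  obtain ⟨hv, e', h'⟩ := h'
  have := DescentDatum.unit_faithful isPrestack
    (DescentDatum.comp_right_cancel isPrestack n (by rfl) (h.trans h'.symm))
  funext i
  have h1 : u i * ringMap t₂ 1 = v i * ringMap t₂ 1 :=
    DFunLike.congr_fun (congrFun (congrArg (fun m => Hom.map m) this) i) (1 : V.unop)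
  rwa [map_one, mul_one, mul_one] at h1

lemma Trans.comp (h : Trans n t₁ t₂ u) (c : T' ⟶ T) :
    Trans n (c ≫ t₁) (c ≫ t₂) fun i => ringMap c (u i) := by
  obtain ⟨hu, e, h⟩ := h
  refine ⟨fun i => (hu i).map _, fun i => ((ringMap c).map_mul _ _).symm.trans (congrArg _ (e i)), ?_⟩
  refine map_comp_congr (pullTriv c fun i => ringMap t₁ (a i)) h (hom_ext rfl fun i => ?_)
    (hom_ext rfl fun i => ?_)
  · refine AddMonoidHom.ext fun x : V.unop => ?_
    change 1 * ringMap c (u i * ringMap t₂ x) = ringMap c (u i) * ringMap c (ringMap t₂ x)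
    rw [one_mul, map_mul]
  · refine AddMonoidHom.ext fun x : V.unop => ?_
    change 1 * ringMap c (1 * ringMap t₁ x) = 1 * ringMap c (ringMap t₁ x)
    rw [one_mul (ringMap t₁ x)]

lemma trans_of_powHom {b : Fin l → T.unop} (hu : ∀ i, IsUnit (u i)) (hv : ∀ i, IsUnit (v i))
    (e : ∀ i, u i * ringMap t₁ (a i) = b i) (e' : ∀ i, v i * ringMap t₂ (a i) = b i)
    (h : (toDesc l).map (powHom t₁ hu e) ≫ n = (toDesc l).map (powHom t₂ hv e') ≫ n) :
    ∃ w, Trans n t₁ t₂ w ∧ ∀ i, u i * w i = v i := by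
  choose u' hu' using fun i => (hu i).exists_right_inv
  have hu1 : ∀ i, IsUnit (u' i) := fun i => .of_mul_eq_one_right _ (hu' i)
  have hb : ∀ i, u' i * ringMap (𝟙 T) (b i) = ringMap t₁ (a i) := fun i => by
    change u' i * b i = _
    rw [← e, ← mul_assoc, mul_comm (u' i), hu', one_mul]
  refine ⟨fun i => u' i * v i, ⟨fun i => (hu1 i).mul (hv i), fun i => ?_, ?_⟩, fun i => by
    rw [← mul_assoc, hu', one_mul]⟩
  · rw [mul_assoc, e']
    exact hb i
  · refine map_comp_congr (powHom (𝟙 T) hu1 hb) h.symm (hom_ext (id_comp _) fun i =>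
      AddMonoidHom.ext fun x : V.unop => (mul_assoc (u' i) (v i) (ringMap t₂ x)).symm)
        (hom_ext (id_comp _) fun i => AddMonoidHom.ext fun x : V.unop => ?_)
    change u' i * (u i * ringMap t₁ x) = 1 * ringMap t₁ x
    rw [← mul_assoc, mul_comm (u' i), hu']

lemma exists_trans (h : t₁ ≫ (descProj l).map n = t₂ ≫ (descProj l).map n) :
    ∃ u, Trans n t₁ t₂ u := by
  have h' : (descProj l).map ((toDesc l).map (pullTriv t₁ a) ≫ n) = t₁ ≫ (descProj l).map n :=
    (descProj l).map_comp ((toDesc l).map (pullTriv t₁ a)) n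
  obtain ⟨c, hc, hc'⟩ := (DescentDatum.fibred isPrestack).fac n
    ((toDesc l).map (pullTriv t₁ a) ≫ n) t₂ (h.symm.trans h'.symm)
  obtain ⟨c, rfl⟩ := DescentDatum.unit_full isPrestack c
  have hb : Hom.base c = t₂ := hc
  have := fun i => Hom.isPullback c i
  rw [hb] at this
  choose u hu e hm using fun i => LineSec.exists_of_isPullbackMap_triv (this i)
  refine ⟨u, hu, e, Eq.trans (congrArg (fun m => (toDesc l).map m ≫ n) ?_) hc'⟩
  exact hom_ext hb.symm fun i => (hm i).symm

lemma Trans.mul (h : Trans n t₁ t₂ u) (h' : Trans n t₂ t₃ v) :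
    Trans n t₁ t₃ fun i => u i * v i := by
  obtain ⟨hu, e, h⟩ := h
  obtain ⟨hv, e', h'⟩ := h'
  have hb : ∀ i, u i * ringMap (𝟙 T) (ringMap t₂ (a i)) = ringMap t₁ (a i) := e
  refine ⟨fun i => (hu i).mul (hv i), fun i => by rw [mul_assoc, e', e], ?_⟩
  refine Eq.trans (map_comp_congr (powHom (𝟙 T) hu hb) h' (hom_ext (id_comp _) fun i =>
      AddMonoidHom.ext fun x : V.unop => (mul_assoc (u i) (v i) (ringMap t₃ x)).symm) rfl)
    (Eq.trans (congrArg (fun m => (toDesc l).map m ≫ n) (hom_ext (id_comp _) fun i =>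
      AddMonoidHom.ext fun x : V.unop => ?_)) h)
  change u i * (1 * ringMap t₂ x) = u i * ringMap t₂ x
  rw [one_mul]

end Transition

end A1GmPow


namespace A1GmPow

open TensorProduct

variable {l : ℕ} {T U V : Aff} {D : Desc l} {a : Fin l → V.unop}
  (n : (toDesc l).obj (trivPow V a) ⟶ D)

lemma exists_descent (he : IsEt ((descProj l).map n))
    (hs : Function.Surjective (ptMap ((descProj l).map n))) :
    ∃ (P : Fin l → LineSec D.U.unop) (m : trivPow V a ⟶ ⟨D.U, P⟩),
      Hom.base m = (descProj l).map n ∧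
      ∀ {T : Aff} {t₁ t₂ : T ⟶ V} {u : Fin l → T.unop}, t₁ ≫ (descProj l).map n =
        t₂ ≫ (descProj l).map n → Trans n t₁ t₂ u → ∀ i y,
          u i * ringMap t₂ (Hom.map m i y : V.unop) = ringMap t₁ (Hom.map m i y : V.unop) := by
  let f : V ⟶ D.U := (descProj l).map n
  let _ : Algebra D.U.unop V.unop := (ringMap f).toAlgebra
  have : Algebra.Etale D.U.unop V.unop := RingHom.etale_algebraMap.1 he
  have : Module.FaithfullyFlat D.U.unop V.unop := .of_comap_surjective hs
  let w₁ := affOverHom D.U (V.unop ⊗[D.U.unop] V.unop) (algebraMap _ _)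
  let w₂ := affOverHom D.U (V.unop ⊗[D.U.unop] (V.unop ⊗[D.U.unop] V.unop)) (algebraMap _ _)
  let φ₁ : V.unop →ₐ[D.U.unop] V.unop ⊗[D.U.unop] V.unop :=
    Algebra.TensorProduct.includeLeft (R := D.U.unop) (S := D.U.unop)
  let φ₂ : V.unop →ₐ[D.U.unop] V.unop ⊗[D.U.unop] V.unop := Algebra.TensorProduct.includeRight
  let p₁ := homOver f w₁ φ₁.toRingHom φ₁.comp_algebraMap
  let p₂ := homOver f w₁ φ₂.toRingHom φ₂.comp_algebraMap
  let q := fun φ : V.unop ⊗[D.U.unop] V.unop →ₐ[D.U.unop]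
    V.unop ⊗[D.U.unop] (V.unop ⊗[D.U.unop] V.unop) => homOver w₁ w₂ φ.toRingHom φ.comp_algebraMap
  let q₁₂ := q (pull₁₂ _ _)
  let q₁₃ := q (pull₁₃ _ _)
  let q₂₃ := q (pull₂₃ _ _)
  obtain ⟨g, hg⟩ := exists_trans (n := n) (t₁ := p₁) (t₂ := p₂)
    ((homOver_comp f w₁ φ₁.toRingHom _).trans (homOver_comp f w₁ φ₂.toRingHom _).symm)
  have e₁ : q₁₂ ≫ p₁ = q₁₃ ≫ p₁ := ringMap_injective (RingHom.ext fun b => rfl)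
  have e₂ : q₁₂ ≫ p₂ = q₂₃ ≫ p₁ := ringMap_injective (RingHom.ext fun b => rfl)
  have e₃ : q₁₃ ≫ p₂ = q₂₃ ≫ p₂ := ringMap_injective (RingHom.ext fun b => rfl)
  have coc : ∀ i, IsCocycle (A := D.U.unop) (B := V.unop) (g i) := by
    have h₁ := hg.comp q₁₂
    have h₂ := hg.comp q₂₃
    have h₃ := hg.comp q₁₃
    rw [e₁, e₂] at h₁
    rw [e₃] at h₃
    exact congrFun ((h₁.mul h₂).uniq h₃)
  choose g' hg' using fun i => (hg.choose i).exists_right_inv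
  choose P θ hθ hθ' using fun i => LineSec.exists_descent (A := D.U.unop) (B := V.unop) (hg' i)
    (coc i) (hg.choose_spec.choose i)
  refine ⟨P, ⟨f, θ, hθ⟩, rfl, fun {T t₁ t₂ u} h hu i y => ?_⟩
  let _ : Algebra D.U.unop T.unop := (ringMap (t₁ ≫ f)).toAlgebra
  let ψ₁ : V.unop →ₐ[D.U.unop] T.unop := { ringMap t₁ with commutes' := fun _ => rfl }
  let ψ₂ : V.unop →ₐ[D.U.unop] T.unop := { ringMap t₂ with
    commutes' := fun c => (RingHom.congr_fun (congrArg ringMap h) c).symm }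
  let ψ := Algebra.TensorProduct.productMap ψ₁ ψ₂
  let r := homOver w₁ (t₁ ≫ f) ψ.toRingHom ψ.comp_algebraMap
  have r₁ : r ≫ p₁ = t₁ := ringMap_injective (RingHom.ext fun b =>
    Algebra.TensorProduct.productMap_left_apply ψ₁ ψ₂ b)
  have r₂ : r ≫ p₂ = t₂ := ringMap_injective (RingHom.ext fun b =>
    Algebra.TensorProduct.productMap_right_apply ψ₁ ψ₂ b)
  have h₁ := hg.comp r
  rw [r₁, r₂] at h₁
  have h₂ := (ψ.map_mul _ _).symm.trans (congrArg ψ (hθ' i y))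
  rw [hu.uniq h₁]
  exact (congrArg (ψ (g i) * ·) (Algebra.TensorProduct.productMap_right_apply ψ₁ ψ₂ _).symm).trans
    (h₂.trans (Algebra.TensorProduct.productMap_left_apply ψ₁ ψ₂ _))

theorem exists_effective (D : Desc l) : ∃ (P : Fin l → LineSec D.U.unop)
    (F : D ⟶ (toDesc l).obj ⟨D.U, P⟩), (descProj l).map F = 𝟙 D.U := by
  obtain ⟨V, a, n, he, hs⟩ := exists_surjective D
  obtain ⟨P, m, hm, H⟩ := exists_descent n he hs
  have hq := DescentDatum.isPrestack (isPrestack (r := l))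
  have key : ∀ {X : A1GmPow l} {T : Aff} {b : Fin l → T.unop} (_ : X = trivPow T b)
      (v w : X ⟶ trivPow V a), (toDesc l).map v ≫ n = (toDesc l).map w ≫ n → v ≫ m = w ≫ m := by
    rintro _ T b rfl ⟨t₁, η₁, h₁⟩ ⟨t₂, η₂, h₂⟩ h
    choose u hu e hη using fun i => LineSec.exists_of_isPullbackMap_triv (h₁ i)
    choose v hv e' hη' using fun i => LineSec.exists_of_isPullbackMap_triv (h₂ i)
    obtain rfl : η₁ = _ := funext hη
    obtain rfl : η₂ = _ := funext hη'
    have ht : t₁ ≫ (descProj l).map n = t₂ ≫ (descProj l).map n :=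
      ((descProj l).map_comp _ n).symm.trans ((congrArg (descProj l).map h).trans
        ((descProj l).map_comp _ n))
    obtain ⟨w, hw, huw⟩ := trans_of_powHom hu hv e e' h
    have hb : t₁ ≫ Hom.base m = t₂ ≫ Hom.base m  :=
      (t₁ ≫= hm).trans (ht.trans (t₂ ≫= hm.symm))
    refine hom_ext hb fun i => AddMonoidHom.ext fun y => ?_
    change u i * ringMap t₁ (Hom.map m i y : V.unop) = v i * ringMap t₂ (Hom.map m i y : V.unop)
    exact (congrArg (u i * ·) (H ht hw i y).symm).trans ((mul_assoc _ _ _).symm.trans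
      (congrArg (· * _) (huw i)))
  obtain ⟨F, hF, -⟩ := hq.exists_hom (y := D) (y' := (toDesc l).obj ⟨D.U, P⟩) (𝟙 D.U)
    (fun {z} e k => ∃ w : z ⟶ (toDesc l).obj (trivPow V a), w ≫ n = e ∧ w ≫ (toDesc l).map m = k)
    (by
      rintro z _ _ ⟨w, rfl, rfl⟩
      exact ((descProj l).map_comp w ((toDesc l).map m)).trans ((((descProj l).map w) ≫= hm).trans (((descProj l).map_comp w n).symm.trans (comp_id _).symm)))
    (by
      rintro z z' c _ _ ⟨w, rfl, rfl⟩
      exact ⟨c ≫ w, assoc _ _ _, assoc _ _ _⟩)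
    (by
      rintro z _ _ _ ⟨w, rfl, rfl⟩ ⟨w', h, rfl⟩
      refine hq.hom_ext_local fun p => ?_
      obtain ⟨T, b, e, het, hp⟩ := exists_trivD z p
      refine ⟨_, e, het, hp, ?_⟩
      obtain ⟨v, hv⟩ := DescentDatum.unit_full isPrestack (e ≫ w)
      obtain ⟨v', hv'⟩ := DescentDatum.unit_full isPrestack (e ≫ w')
      have h1 : (toDesc l).map v ≫ n = (toDesc l).map v' ≫ n := by
        rw [hv, hv', assoc, assoc, h]
      have h2 := congrArg (toDesc l).map (key rfl v v' h1)
      rw [Functor.map_comp, Functor.map_comp, hv, hv', assoc, assoc] at h2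
      exact h2)
    (fun p => ⟨_, n, he, hs p, _, 𝟙 _, id_comp _, rfl⟩)
  exact ⟨P, F, hF⟩

theorem isStack : IsStack etale (proj l) where
  fibred := fibred
  glueHom := isPrestack.glueHom
  effective D := by
    obtain ⟨P, F, hF⟩ := exists_effective D
    choose c hc using fun i => DescentDatum.unit_full isPrestack (DescentDatum.can D i ≫ F)
    refine ⟨⟨D.U, P⟩, Iso.refl _, c, fun i => ?_, fun {z i} u j b w => ?_⟩
    · have h : Hom.base (c i) = D.map i ≫ 𝟙 D.U := (congrArg (descProj l).map (hc i)).trans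
        (((descProj l).map_comp (DescentDatum.can D i) F).trans ((D.map i) ≫= hF))
      exact (comp_id _).trans (h.trans (comp_id _))
    · refine DescentDatum.unit_faithful isPrestack ?_
      rw [Functor.map_comp, Functor.map_comp, hc, hc, ← assoc, DescentDatum.glue_can,
        assoc]

end A1GmPow


section LengthLoci

variable {ξ ζ : W} {l : ℕ}

lemma W.ptMap_comp {x y z : W} (a : x ⟶ y) (b : y ⟶ z) (p : PrimeSpectrum (W.proj.obj x).unop) :
    ptMap (W.proj.map b) (ptMap (W.proj.map a) p) = ptMap (W.proj.map (a ≫ b)) p :=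
  (congrArg (ptMap · p) (W.proj.map_comp a b)).symm

lemma exists_length_nbhd {X : WPP} (e : toW.obj X ⟶ ξ) (p : PrimeSpectrum X.base.unop) :
    ∃ (Y : WPP) (f : toW.obj Y ⟶ ξ), Y.length ≤ X.length ∧ IsEt (W.proj.map f) ∧
      ptMap (W.proj.map e) p ∈ Set.range (ptMap (W.proj.map f)) := by
  classical
  obtain ⟨N, hN, -⟩ := W.exists_stdNbhd ξ (ptMap (W.proj.map e) p)
  obtain ⟨U, b, e', he', p', rfl⟩ := X.exists_std p
  obtain ⟨V, h, t, s, u, hh, ⟨q, rfl⟩, H⟩ := exists_isRep' (toW.map e' ≫ e) N p'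
    ((W.ptMap_comp (toW.map e') e p').symm ▸ hN)
  have hb := H.base_eq
  obtain ⟨M, -⟩ := H
  have := Fintype.ofFinite N.κ
  let d : N.U.unop := ∏ j, if ∃ i, s i = some j then 1 else N.b j
  have hd : ∀ {T : Aff} (k : T ⟶ N.U), IsUnit (ringMap k d) ↔
      ∀ j, (∀ i, s i ≠ some j) → IsUnit (ringMap k (N.b j)) := fun k => by
    rw [map_prod, IsUnit.prod_univ_iff]
    refine forall_congr' fun j => ?_
    split_ifs with hj
    · simpa using fun h => (hj.elim h).elim
    · exact ⟨fun h _ => h, fun h => h (not_exists.1 hj)⟩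
  obtain ⟨t', ht'⟩ := exists_lift_away t ((hd t).2 M.off)
  let b' : N.κ → (away d).unop := fun j => ringMap (awayHom d) (N.b j)
  have hb' : ∀ j : {j // (LineSec.triv (b' j)).NonInvertible}, ∃ i, s i = some j.1 := fun j => by
    by_contra hj
    exact (LineSec.nonInvertible_triv _).1 j.2 ((hd _).1 (isUnit_awayHom d) _ (not_exists.1 hj))
  choose g hg using hb'
  refine ⟨std (away d) b' (.of_finite _), toW.map (stdMap (awayHom d) N.b (.of_finite _)) ≫ N.e,
    Nat.card_le_card_of_injective g fun j j' h =>
      Subtype.ext (Option.some_injective _ ((hg j).symm.trans ((congrArg s h).trans (hg j')))),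
    (W.proj.map_comp (toW.map (stdMap (awayHom d) N.b (.of_finite _))) N.e).symm ▸
      (awayHom_isEt d).comp N.et, ptMap t' q, ?_⟩
  refine (congrArg (fun k => ptMap k (ptMap t' q)) (W.proj.map_comp _ _)).trans (Eq.trans ?_
    (W.ptMap_comp (toW.map e') e (ptMap h q)).symm)
  exact (congrArg (fun k => ptMap (k ≫ N.base) q) ht').trans (congrArg (ptMap · q) hb).symm

/-- The open locus where an object of `W` is given by a sequence of length at most `l`. -/
def lengthLocus (l : ℕ) (ξ : W) : (spec.obj (W.proj.obj ξ)).left.Opens where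
  carrier := {x : PrimeSpectrum (W.proj.obj ξ).unop | ∃ (X : WPP) (e : toW.obj X ⟶ ξ),
    X.length ≤ l ∧ IsEt (W.proj.map e) ∧ x ∈ Set.range (ptMap (W.proj.map e))}
  is_open' := isOpen_iff_forall_mem_open.2 fun _ ⟨X, e, hl, he, hx⟩ =>
    ⟨_, fun _ hy => ⟨X, e, hl, he, hy⟩, he.isOpenMap.isOpen_range, hx⟩

lemma mem_lengthLocus {X : WPP} (e : toW.obj X ⟶ ξ) (hl : X.length ≤ l)
    (p : PrimeSpectrum X.base.unop) : ptMap (W.proj.map e) p ∈ lengthLocus l ξ :=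
  let ⟨Y, f, h, hf, hp⟩ := exists_length_nbhd e p
  ⟨Y, f, h.trans hl, hf, hp⟩

lemma mem_lengthLocus_of_lengthLE (h : lengthLE l ζ) (g : ζ ⟶ ξ)
    (p : PrimeSpectrum (W.proj.obj ζ).unop) : ptMap (W.proj.map g) p ∈ lengthLocus l ξ := by
  obtain ⟨X, e, -, ⟨q, rfl⟩, hX⟩ := W.exists_cover ζ p
  exact (W.ptMap_comp e g q).symm ▸ mem_lengthLocus (e ≫ g) (hX l h) q

lemma mem_lengthLocus_of_map (a : ζ ⟶ ξ) {p : PrimeSpectrum (W.proj.obj ζ).unop}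
    (h : ptMap (W.proj.map a) p ∈ lengthLocus l ξ) : p ∈ lengthLocus l ζ := by
  obtain ⟨X, e, hX, he, hp⟩ := h
  obtain ⟨w, c, d, -, ⟨q, rfl⟩, -⟩ := W.isStack.fibred.exists_square he a hp
  obtain ⟨X', e', -, ⟨q', rfl⟩, -⟩ := W.exists_cover w q
  obtain ⟨Z, b, m, -, ⟨z, rfl⟩, -⟩ := exists_local_toW (e' ≫ d) q'
  refine Eq.mp (congrArg (· ∈ lengthLocus l ζ) ?_) (mem_lengthLocus (toW.map b ≫ e' ≫ c) ((WPP.length_le m).trans hX) z)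
  exact (W.ptMap_comp (toW.map b) (e' ≫ c) z).symm.trans (W.ptMap_comp e' c _).symm

lemma exists_lengthLE (h : ∀ x : PrimeSpectrum (W.proj.obj ζ).unop, x ∈ lengthLocus l ζ) :
    ∃ ζ' : W, lengthLE l ζ' ∧ ∃ (e : W.proj.obj ζ' = W.proj.obj ζ) (H : ζ' ⟶ ζ),
      W.proj.map H = eqToHom e := by
  choose X e hl he hx using h
  obtain ⟨ζ', H, hζ⟩ := DescentDatum.exists_of_cover WP.isPrestack ζ (fun x => toW.obj (X x)) e
    (mem_etale.2 fun x => ⟨_, _, (Sieve.mem_ofArrows_iff _ _ _).2 ⟨x, 𝟙 _, (id_comp _).symm⟩,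
      he x, hx x⟩)
  refine ⟨ζ', fun k => ?_, H⟩
  obtain ⟨i, j, h⟩ := hζ k
  rw [h]
  exact hl i

lemma isAlgebraicSpace_of_mono {S : Aff} {P : Sch} (a : P ⟶ spec.obj S) [Mono a] :
    IsAlgebraicSpace (pts.obj P) where
  isSheaf := pts_isSheaf P
  diagonal := schematicWith_diag (hasEqualizer_of_over
    (fun f hf => inferInstanceAs (QuasiCompact f)) (pts.map a) fun {T} s s' h => by
      have h' : s = s' := ULift.ext _ _ ((cancel_mono a).1 (congrArg ULift.down h))
      exact ⟨spec.obj T, 𝟙 _, inferInstance, inferInstanceAs (QuasiCompact (𝟙 _)),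
        fun k => ⟨fun _ => ⟨spec.map k, comp_id _⟩, fun _ => by rw [h']⟩⟩)
  atlas := ⟨P, 𝟙 _, fun T t => ⟨spec.obj T, 𝟙 _, t, .of_vert_isIso ⟨by simp⟩,
    inferInstanceAs (Etale (𝟙 _)), inferInstanceAs (Surjective (𝟙 _))⟩⟩

lemma exists_represents_lengthLE (l : ℕ) (ξ : W) :
    ∃ (R : PSpace) (f : R ⟶ pts.obj (spec.obj (W.proj.obj ξ))), IsAlgebraicSpace R ∧
      Nonempty (Represents _ (fibreMap (lengthLE l).ι ξ) R f) ∧ IsOpenImm f := by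
  let i := openIncl _ (lengthLocus l ξ)
  have hpt : ∀ y : CostructuredArrow (lengthLE l).ι ξ, ∃ t, t ≫ i =
      spec.map ((fibreMap (lengthLE l).ι ξ).app y) := fun y =>
    exists_lift_openSub _ _ fun p => mem_lengthLocus_of_lengthLE y.left.property y.hom p
  choose pt hpt using hpt
  refine ⟨_, pts.map i, isAlgebraicSpace_of_mono i, ⟨{
    pt := fun y => ULift.up (pt y)
    pt_map := fun {y y'} g => congrArg ULift.up ((cancel_mono i).1 ?_)
    pt_base := fun y => congrArg ULift.up (hpt y)
    fullyFaithful := fun {y y'} k hk => ?_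
    essSurj := fun {T} x => ?_ }⟩, ⟨_, i, Iso.refl _, id_comp _, inferInstance⟩⟩
  · refine (assoc _ _ _).trans ((congrArg (_ ≫ ·) (hpt y')).trans (Eq.trans ?_ (hpt y).symm))
    exact (spec.map_comp _ _).symm.trans (congrArg spec.map (((fibreMap _ ξ).naturality g).trans
      (comp_id _)))
  · have h1 : k ≫ W.proj.map y'.hom = W.proj.map y.hom := spec.map_injective
      ((spec.map_comp _ _).trans ((congrArg (_ ≫ ·) (hpt y').symm).trans
        ((assoc _ _ _).symm.trans ((congrArg (· ≫ i) (congrArg ULift.down hk)).trans (hpt y)))))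
    obtain ⟨c, ⟨hc, hc'⟩, hu⟩ := W.isStack.fibred.existsUnique_fac y'.hom y.hom k h1
    refine ⟨CostructuredArrow.homMk ((lengthLE l).ι.preimage c)
      ((congrArg (· ≫ _) ((lengthLE l).ι.map_preimage c)).trans hc'),
      (congrArg W.proj.map ((lengthLE l).ι.map_preimage c)).trans hc, fun g hg => ?_⟩
    exact CostructuredArrow.hom_ext _ _ ((lengthLE l).ι.map_injective
      ((hu _ ⟨hg, CostructuredArrow.w g⟩).trans ((lengthLE l).ι.map_preimage c).symm))
  · obtain ⟨x⟩ := x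
    obtain ⟨k, hk⟩ : ∃ k : T ⟶ W.proj.obj ξ, spec.map k = x ≫ i := spec.map_surjective _
    obtain ⟨ζ, rfl, a, ha⟩ := W.isStack.fibred.exists_eq ξ k
    replace ha : W.proj.map a = k := ha.trans (id_comp k)
    obtain ⟨ζ', hζ, e, H, hH⟩ := exists_lengthLE (ζ := ζ) (l := l) fun p =>
      mem_lengthLocus_of_map a (by
        have h1 : ptMap (W.proj.map a) p = i.left (x.left p) := by
          rw [ha]
          exact congrArg (fun m : spec.obj _ ⟶ _ => m.left p) hk
        rw [h1]
        exact (x.left p).2)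
    let y : CostructuredArrow (lengthLE l).ι ξ := CostructuredArrow.mk (Y := ⟨ζ', hζ⟩) (H ≫ a)
    refine ⟨y, eqToIso (Y := W.proj.obj ζ') e.symm,
      congrArg ULift.up ((cancel_mono i).1 ?_)⟩
    refine (assoc _ _ _).trans ((congrArg (_ ≫ ·) (hpt y)).trans
      ((spec.map_comp _ _).symm.trans (Eq.trans (congrArg spec.map ?_) hk)))
    refine (congrArg (_ ≫ ·) ((W.proj.map_comp H a).trans (congrArg₂ (· ≫ ·) hH ha))).trans ?_
    exact ((assoc _ _ _).symm.trans (congrArg (· ≫ k) (eqToHom_trans e.symm e))).trans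
      (id_comp k)

lemma Wl.incl_representableWith {l m : ℕ} (h : l ≤ m) :
    (Wl.incl h).RepresentableWith fun _ _ f => IsOpenImm f :=
  Mor.representableWith_of_full (lengthLE m).ι _ fun ξ => exists_represents_lengthLE l ξ.obj

lemma Wl.inclW_representableWith (l : ℕ) :
    (Wl.inclW l).RepresentableWith fun _ _ f => IsOpenImm f :=
  Mor.representableWith_of_full (𝟭 W) (Wl.inclW l) fun ξ => exists_represents_lengthLE l ξ

lemma W.exists_mem_range (ξ : W) (x : PrimeSpectrum (W.proj.obj ξ).unop) :
    ∃ (l : ℕ) (η : Wl l) (a : η.obj ⟶ ξ), x ∈ Set.range (ptMap (W.proj.map a)) :=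
  let ⟨X, e, _, hx, _⟩ := W.exists_cover ξ x
  ⟨X.length, ⟨toW.obj X, fun _ => le_rfl⟩, e, hx⟩

end LengthLoci

end ModStack

end

open CategoryTheory ModStack in
theorem mainTheorem4 :
    (∀ l : ℕ,
      IsStack etale (A1GmPow.proj l) ∧
      (toWl l).RepresentableWith (fun _ _ f => HasAtlasWith etaleSurjective f) ∧
      IsAlgebraicStack (Wl.proj l) ∧ IsSmoothStack (Wl.proj l) ∧
      IsFiniteTypeStack (Wl.proj l) ∧ HasDimension (Wl.proj l) 0) ∧
    (IsAlgebraicStack W.proj ∧ IsSmoothStack W.proj ∧ HasDimension W.proj 0) ∧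
    (∀ l m : ℕ, ∀ h : l ≤ m, (Wl.incl h).RepresentableWith (fun _ _ f => IsOpenImm f)) ∧
    (∀ l : ℕ, (Wl.inclW l).RepresentableWith (fun _ _ f => IsOpenImm f)) ∧
    (∀ (ξ : W) (x : PrimeSpectrum (W.proj.obj ξ).unop), ∃ (l : ℕ) (η : Wl l) (a : η.obj ⟶ ξ),
      x ∈ Set.range (ptMap (W.proj.map a))) :=
  ⟨fun l => ⟨A1GmPow.isStack, toWl_representableWith A1GmPow.isStack, Wl.algebraicity l⟩,
    W.algebraicity, fun _ _ => Wl.incl_representableWith, Wl.inclW_representableWith,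
    W.exists_mem_range⟩
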